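/- Let $k$ be a field of characteristic $0$ and let $1\to N\to G\xrightarrow{\pi} H\to 1$ be an exact sequence of finite groups. **Notation.** All modules and algebras below are unital, and algebras are associative. Let $Y$ be a locally Noetherian scheme with an action of $H$. An $H$-equivariant coherent $\mathcal O_Y$-algebra $\mathcal B$ has a category $\mathrm{coh}^H(\mathcal B)$ of $H$-equivariant coherent left $\mathcal B$-modules; $\mathrm{coh}^H(Y)=\mathrm{coh}^H(\mathcal O_Y)$; without the action we write $\mathrm{coh}(\mathcal B)$. An *$H$-equivariant Azumaya algebra* on $Y$ is an $H$-equivariant coherent $\mathcal O_Y$-algebra that is Azumaya after forgetting the action. Two of them, $\mathcal B,\mathcal B'$, are $H$-equivariantly Morita equivalent if there is an $H$-equivariant coherent $\mathcal B'\otimes_{\mathcal O_Y}\mathcal B^{op}$-module $\mathcal P$ such that $\mathcal P\otimes_{\mathcal B}-:\mathrm{coh}^H(\mathcal B)\to\mathrm{coh}^H(\mathcal B')$ is an equivalence. $\mathrm{Br}^H(Y)$ is the set of classes of $H$-equivariant Azumaya algebras for this relation. For a commutative Noetherian ring $R$ with an action of $H$, $\mathrm{Br}^H(R)$ is defined in the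 same way by $H$-equivariant Azumaya $R$-algebras and finitely generated $H$-equivariant modules; its element $0$ is the class of $R$. Let $Z=Z(k[N])$ be the centre of the group algebra, on which $H$ acts by conjugation by lifts to $G$, and let $\mathrm{Irr}(N)=\mathrm{Spec}(Z)$. A finite-dimensional $k$-linear representation $V$ of $G$ is called an *$N$-generator* if its restriction to $N$ contains every irreducible $k$-representation of $N$ as a direct summand. For such $V$ let $A_V=\mathrm{End}_N(V)^{op}$, with $H$ acting by conjugation; it is a $Z$-algebra through the action of $Z$ on $V$. **Theorem.** (1) *Canonical class.* $N$-generators exist. For every $N$-generator $V$, $A_V$ is an $H$-equivariant Azumaya $Z$-algebra, and its class $\theta\in\mathrm{Br}^H(Z)$ does not depend on the choice of $V$. Now let $X$ be a scheme of finite type over $k$ (for example a variety) with an action of $H$ over $k$, and let $G$ act on $X$ through $\pi$, so that $N$ acts trivially. (2) *Equivalence given by an $N$-generator.* Let $V$ be an $N$-generator, $\mathcal V=V\otimes_k\mathcal O_X$ and $\mathcal A=A_V\otimes_k\mathcal O_X$. Then the functors $\mathcal V\otimes_{\mathcal A}-$ and $\mathcal Hom_N(\mathcal V,-)$ are mutually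 quasi-inverse equivalences $$\mathrm{coh}(\mathcal A)\simeq\mathrm{coh}^N(X),\qquad \mathrm{coh}^H(\mathcal A)\simeq\mathrm{coh}^G(X),$$ and these are compatible with the functors $\mathrm{coh}^H(\mathcal A)\to\mathrm{coh}(\mathcal A)$ and $\mathrm{coh}^G(X)\to\mathrm{coh}^N(X)$ that forget the $H$-action and restrict to $N$. In particular $\mathrm{coh}^G(X)\simeq\mathrm{coh}^H(\mathrm{End}_N(V)^{op}\otimes_k\mathcal O_X)$. (3) *Brauer class.* Let $H$ act diagonally on $\mathrm{Irr}(N)\times X$ (product over $k$) and let $f:\mathrm{Irr}(N)\times X\to\mathrm{Irr}(N)$ be the projection. For every $H$-equivariant Azumaya $Z$-algebra $A$ of class $\theta$, the pull-back $f^*A$ is an $H$-equivariant Azumaya algebra, and its class $f^*\theta\in\mathrm{Br}^H(\mathrm{Irr}(N)\times X)$ does not depend on $A$. For every $H$-equivariant Azumaya algebra $\mathcal B$ on $\mathrm{Irr}(N)\times X$ of class $f^*\theta$ there is an equivalence of categories $\mathrm{coh}^G(X)\simeq\mathrm{coh}^H(\mathcal B)$, that is, $\mathrm{coh}^G(X)\simeq\mathrm{coh}^H(f^*\theta)$.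 (4) If $\theta=0$, then $\mathrm{coh}^G(X)\simeq\mathrm{coh}^H(\mathrm{Irr}(N)\times X)$. -/

import Mathlib

open CategoryTheory AlgebraicGeometry
open scoped TensorProduct

universe u

noncomputable section

namespace EquivSheaf

/-! ### Equivariant coherent sheaves -/

section Sheaves

variable {X : Scheme.{u}}

/-- Restriction of sections of a sheaf of modules. -/
def res (M : X.Modules) {U V : X.Opens} (i : V ≤ U) : Γ(M, U) →+ Γ(M, V) :=
  (M.presheaf.map (homOfLE i).op).hom

/-- Restriction of functions. -/
def resO {U V : X.Opens} (i : V ≤ U) : Γ(X, U) →+* Γ(X, V) :=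
  (X.presheaf.map (homOfLE i).op).hom

/-- A coherent sheaf on a locally Noetherian scheme: a quasi-coherent sheaf whose sections over
every affine open form a finitely generated module. -/
def IsCoherent (M : X.Modules) : Prop :=
  M.IsQuasicoherent ∧ ∀ U : X.Opens, IsAffineOpen U → Module.Finite Γ(X, U) Γ(M, U)

variable {H : Type u} [Group H] (ρ : H →* Aut X)

/-- The translate `h(U)` of an open subset, i.e. its preimage under `h⁻¹`. -/
def translate (h : H) (U : X.Opens) : X.Opens := (ρ h).inv ⁻¹ᵁ U

lemma translate_one (U : X.Opens) : translate ρ 1 U = U := by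
  simp only [translate, map_one]; rfl

lemma translate_mul (g h : H) (U : X.Opens) :
    translate ρ (g * h) U = translate ρ g (translate ρ h U) := by
  simp only [translate, map_mul]; rfl

lemma translate_mono (h : H) {U V : X.Opens} (i : V ≤ U) : translate ρ h V ≤ translate ρ h U :=
  fun _ hx => i hx

/-- The left action of `h` on functions, `φ ↦ (h⁻¹)^* φ`, from functions on `U` to functions
on `h(U)`. -/
def actO (h : H) (U : X.Opens) : Γ(X, U) →+* Γ(X, translate ρ h U) := ((ρ h).inv.app U).hom

/-- An `H`-equivariant sheaf of `𝒪_X`-modules: every `h` carries sections over `U` to sections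
over `h(U)`, semilinearly, compatibly with restriction and with the group law. Equivalently
this is a family of morphisms `M ⟶ (h⁻¹)_* M` satisfying the cocycle condition. -/
structure EqMod where
  mod : X.Modules
  act : ∀ (h : H) (U : X.Opens), Γ(mod, U) →+ Γ(mod, translate ρ h U)
  act_osmul : ∀ h U (r : Γ(X, U)) (s : Γ(mod, U)), act h U (r • s) = actO ρ h U r • act h U s
  act_res : ∀ h {U V : X.Opens} (i : V ≤ U) (s : Γ(mod, U)),
    act h V (res mod i s) = res mod (translate_mono ρ h i) (act h U s)
  act_one : ∀ U (s : Γ(mod, U)), act 1 U s = res mod (translate_one ρ U).le s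
  act_comp : ∀ g h U (s : Γ(mod, U)),
    act (g * h) U s = res mod (translate_mul ρ g h U).le (act g (translate ρ h U) (act h U s))

/-- Objects of the category `coh^H(X)` of `H`-equivariant coherent sheaves on `X`. -/
structure EqCoh extends EqMod ρ where
  coherent : IsCoherent mod

variable {ρ}

/-- Morphisms in `coh^H(X)`. -/
@[ext]
structure EqCoh.Hom (M N : EqCoh ρ) where
  hom : M.mod ⟶ N.mod
  map_act : ∀ h U (s : Γ(M.mod, U)),
    hom.app (translate ρ h U) (M.act h U s) = N.act h U (hom.app U s)

instance : Category (EqCoh ρ) where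
  Hom := EqCoh.Hom
  id M := ⟨𝟙 M.mod, fun _ _ _ => rfl⟩
  comp f g := ⟨f.hom ≫ g.hom, fun h U s => by
    change g.hom.app _ (f.hom.app _ _) = _
    rw [f.map_act, g.map_act]; rfl⟩
  id_comp f := EqCoh.Hom.ext (Category.id_comp f.hom)
  comp_id f := EqCoh.Hom.ext (Category.comp_id f.hom)
  assoc f g h := EqCoh.Hom.ext (Category.assoc f.hom g.hom h.hom)

/-- Restriction of the acting group along a homomorphism. -/
def EqCoh.restrictGroup {K : Type u} [Group K] (α : K →* H) :
    EqCoh ρ ⥤ EqCoh (ρ.comp α) where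
  obj M :=
    { mod := M.mod
      act := fun k U => M.act (α k) U
      act_osmul := fun k U r s => M.act_osmul (α k) U r s
      act_res := fun k _ _ i s => M.act_res (α k) i s
      act_one := fun U s => by
        have key : ∀ (a : H) (ha : a = 1) (e : translate ρ a U ≤ U),
            M.act a U s = res M.mod e s := by
          rintro a rfl e; exact M.act_one U s
        exact key (α 1) (map_one α) _
      act_comp := fun g h U s => by
        have key : ∀ (a : H) (ha : a = α g * α h)
            (e : translate ρ a U ≤ translate ρ (α g) (translate ρ (α h) U)),
            M.act a U s = res M.mod e (M.act (α g) _ (M.act (α h) U s)) := by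
          rintro a rfl e; exact M.act_comp _ _ U s
        exact key (α (g * h)) (map_mul α g h) _
      coherent := M.coherent }
  map f := ⟨f.hom, fun k U s => f.map_act (α k) U s⟩

/-! ### Sheaves of algebras and their modules -/

variable (X) in
/-- A sheaf of associative unital `𝒪_X`-algebras. -/
structure SheafAlg where
  mod : X.Modules
  mul : ∀ U : X.Opens, Γ(mod, U) →ₗ[Γ(X, U)] Γ(mod, U) →ₗ[Γ(X, U)] Γ(mod, U)
  one : ∀ U : X.Opens, Γ(mod, U)
  mul_assoc : ∀ U a b c, mul U (mul U a b) c = mul U a (mul U b c)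
  one_mul : ∀ U a, mul U (one U) a = a
  mul_one : ∀ U a, mul U a (one U) = a
  res_mul : ∀ {U V : X.Opens} (i : V ≤ U) a b,
    res mod i (mul U a b) = mul V (res mod i a) (res mod i b)
  res_one : ∀ {U V : X.Opens} (i : V ≤ U), res mod i (one U) = one V

namespace SheafAlg

/-- The sections of a sheaf of algebras over an open subset, as an algebra. -/
def Sec (B : SheafAlg X) (U : X.Opens) : Type u := Γ(B.mod, U)

instance (B : SheafAlg X) (U : X.Opens) : AddCommGroup (B.Sec U) :=
  inferInstanceAs (AddCommGroup Γ(B.mod, U))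

instance (B : SheafAlg X) (U : X.Opens) : Module Γ(X, U) (B.Sec U) :=
  inferInstanceAs (Module Γ(X, U) Γ(B.mod, U))

instance (B : SheafAlg X) (U : X.Opens) : Ring (B.Sec U) :=
  { (inferInstance : AddCommGroup (B.Sec U)) with
    mul := fun a b => B.mul U a b
    one := B.one U
    mul_assoc := B.mul_assoc U
    one_mul := B.one_mul U
    mul_one := B.mul_one U
    left_distrib := fun a b c => map_add (B.mul U a) b c
    right_distrib := fun a b c => LinearMap.map_add₂ (B.mul U) a b c
    zero_mul := fun a => LinearMap.map_zero₂ (B.mul U) a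
    mul_zero := fun a => map_zero (B.mul U a) }

instance (B : SheafAlg X) (U : X.Opens) : Algebra Γ(X, U) (B.Sec U) :=
  Algebra.ofModule (fun r a b => LinearMap.map_smul₂ (B.mul U) r a b)
    (fun r a b => map_smul (B.mul U a) r b)

/-- A sheaf of Azumaya algebras: a coherent sheaf of algebras whose sections over every affine
open form an Azumaya algebra over the functions. -/
def IsAzumaya (B : SheafAlg X) : Prop :=
  IsCoherent B.mod ∧ ∀ U : X.Opens, IsAffineOpen U → _root_.IsAzumaya Γ(X, U) (B.Sec U)

end SheafAlg

/-- A sheaf of left modules over a sheaf of algebras. -/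
structure AlgMod (B : SheafAlg X) where
  mod : X.Modules
  smul : ∀ U : X.Opens, Γ(B.mod, U) →ₗ[Γ(X, U)] Γ(mod, U) →ₗ[Γ(X, U)] Γ(mod, U)
  one_smul : ∀ U m, smul U (B.one U) m = m
  mul_smul : ∀ U a b m, smul U (B.mul U a b) m = smul U a (smul U b m)
  res_smul : ∀ {U V : X.Opens} (i : V ≤ U) b m,
    res mod i (smul U b m) = smul V (res B.mod i b) (res mod i m)

/-- Objects of the category `coh(B)` of coherent `B`-modules. -/
structure CohAlg (B : SheafAlg X) extends AlgMod B where
  coherent : IsCoherent mod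

/-- Morphisms in `coh(B)`. -/
@[ext]
structure CohAlg.Hom {B : SheafAlg X} (M N : CohAlg B) where
  hom : M.mod ⟶ N.mod
  map_bsmul : ∀ U (b : Γ(B.mod, U)) (m : Γ(M.mod, U)),
    hom.app U (M.smul U b m) = N.smul U b (hom.app U m)

instance (B : SheafAlg X) : Category (CohAlg B) where
  Hom := CohAlg.Hom
  id M := ⟨𝟙 M.mod, fun _ _ _ => rfl⟩
  comp f g := ⟨f.hom ≫ g.hom, fun U b m => by
    change g.hom.app _ (f.hom.app _ _) = _
    rw [f.map_bsmul, g.map_bsmul]; rfl⟩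
  id_comp f := CohAlg.Hom.ext (Category.id_comp f.hom)
  comp_id f := CohAlg.Hom.ext (Category.comp_id f.hom)
  assoc f g h := CohAlg.Hom.ext (Category.assoc f.hom g.hom h.hom)

variable (ρ) in
/-- An `H`-equivariant sheaf of `𝒪_X`-algebras. -/
structure EqAlg extends SheafAlg X, EqMod ρ where
  act_prod : ∀ h U (a b : Γ(mod, U)),
    act h U (mul U a b) = mul (translate ρ h U) (act h U a) (act h U b)
  act_unit : ∀ h U, act h U (one U) = one (translate ρ h U)

/-- Objects of the category `coh^H(B)` of `H`-equivariant coherent `B`-modules. -/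
structure EqCohAlg (B : EqAlg ρ) extends CohAlg B.toSheafAlg, EqMod ρ where
  act_bsmul : ∀ h U (b : Γ(B.mod, U)) (m : Γ(mod, U)),
    act h U (smul U b m) = smul (translate ρ h U) (B.act h U b) (act h U m)

/-- Morphisms in `coh^H(B)`. -/
@[ext]
structure EqCohAlg.Hom {B : EqAlg ρ} (M N : EqCohAlg B) where
  hom : M.mod ⟶ N.mod
  map_bsmul : ∀ U (b : Γ(B.mod, U)) (m : Γ(M.mod, U)),
    hom.app U (M.smul U b m) = N.smul U b (hom.app U m)
  map_act : ∀ h U (s : Γ(M.mod, U)),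
    hom.app (translate ρ h U) (M.act h U s) = N.act h U (hom.app U s)

instance (B : EqAlg ρ) : Category (EqCohAlg B) where
  Hom := EqCohAlg.Hom
  id M := ⟨𝟙 M.mod, fun _ _ _ => rfl, fun _ _ _ => rfl⟩
  comp f g := ⟨f.hom ≫ g.hom, fun U b m => by
      change g.hom.app _ (f.hom.app _ _) = _
      rw [f.map_bsmul, g.map_bsmul]; rfl, fun h U s => by
      change g.hom.app _ (f.hom.app _ _) = _
      rw [f.map_act, g.map_act]; rfl⟩
  id_comp f := EqCohAlg.Hom.ext (Category.id_comp f.hom)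
  comp_id f := EqCohAlg.Hom.ext (Category.comp_id f.hom)
  assoc f g h := EqCohAlg.Hom.ext (Category.assoc f.hom g.hom h.hom)

/-- The functor `coh^H(B) ⥤ coh(B)` forgetting the action of `H`. -/
def EqCohAlg.forgetAct (B : EqAlg ρ) : EqCohAlg B ⥤ CohAlg B.toSheafAlg where
  obj M := M.toCohAlg
  map f := ⟨f.hom, f.map_bsmul⟩

/-! ### The equivariant Brauer group of a scheme -/

/-- An `H`-equivariant coherent `B' ⊗ Bᵒᵖ`-module, i.e. a `(B', B)`-bimodule on which the two
actions of `𝒪_X` agree. -/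
structure EqBimod (B' B : EqAlg ρ) extends EqCoh ρ where
  lsmul : ∀ U : X.Opens, Γ(B'.mod, U) →ₗ[Γ(X, U)] Γ(mod, U) →ₗ[Γ(X, U)] Γ(mod, U)
  rsmul : ∀ U : X.Opens, Γ(mod, U) →ₗ[Γ(X, U)] Γ(B.mod, U) →ₗ[Γ(X, U)] Γ(mod, U)
  one_lsmul : ∀ U p, lsmul U (B'.one U) p = p
  mul_lsmul : ∀ U a b p, lsmul U (B'.mul U a b) p = lsmul U a (lsmul U b p)
  rsmul_one : ∀ U p, rsmul U p (B.one U) = p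
  rsmul_mul : ∀ U p a b, rsmul U p (B.mul U a b) = rsmul U (rsmul U p a) b
  lsmul_rsmul : ∀ U a p b, rsmul U (lsmul U a p) b = lsmul U a (rsmul U p b)
  res_lsmul : ∀ {U V : X.Opens} (i : V ≤ U) a p,
    res mod i (lsmul U a p) = lsmul V (res B'.mod i a) (res mod i p)
  res_rsmul : ∀ {U V : X.Opens} (i : V ≤ U) p b,
    res mod i (rsmul U p b) = rsmul V (res mod i p) (res B.mod i b)
  act_lsmul : ∀ h U a p,
    act h U (lsmul U a p) = lsmul (translate ρ h U) (B'.act h U a) (act h U p)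
  act_rsmul : ∀ h U p b,
    act h U (rsmul U p b) = rsmul (translate ρ h U) (act h U p) (B.act h U b)

/-- An `H`-equivariant, `B'`-linear, `B`-balanced pairing `P × M → N`. -/
structure BalancedMap {B' B : EqAlg ρ} (P : EqBimod B' B) (M : EqCohAlg B)
    (N : EqCohAlg B') where
  toFun : ∀ U : X.Opens, Γ(P.mod, U) →ₗ[Γ(X, U)] Γ(M.mod, U) →ₗ[Γ(X, U)] Γ(N.mod, U)
  map_lsmul : ∀ U a p m, toFun U (P.lsmul U a p) m = N.smul U a (toFun U p m)
  balanced : ∀ U p b m, toFun U (P.rsmul U p b) m = toFun U p (M.smul U b m)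
  map_res : ∀ {U V : X.Opens} (i : V ≤ U) p m,
    res N.mod i (toFun U p m) = toFun V (res P.mod i p) (res M.mod i m)
  map_act : ∀ h U p m,
    N.act h U (toFun U p m) = toFun (translate ρ h U) (P.act h U p) (M.act h U m)

/-- The functor `F` is `P ⊗_B -`: it comes with natural universal balanced pairings
`P × M → F(M)`. -/
structure TensorFunctor {B' B : EqAlg ρ} (P : EqBimod B' B)
    (F : EqCohAlg B ⥤ EqCohAlg B') where
  pair : ∀ M, BalancedMap P M (F.obj M)
  natural : ∀ {M M' : EqCohAlg B} (f : M ⟶ M') U p m,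
    (F.map f).hom.app U ((pair M).toFun U p m) = (pair M').toFun U p (f.hom.app U m)
  universal : ∀ M (N : EqCohAlg B') (γ : BalancedMap P M N),
    ∃! g : F.obj M ⟶ N, ∀ U p m, g.hom.app U ((pair M).toFun U p m) = γ.toFun U p m

/-- `H`-equivariant Morita equivalence over `X`: some `H`-equivariant coherent
`B' ⊗ Bᵒᵖ`-module `P` makes `P ⊗_B - : coh^H(B) ⥤ coh^H(B')` an equivalence. -/
def Morita (B B' : EqAlg ρ) : Prop :=
  ∃ (P : EqBimod B' B) (F : EqCohAlg B ⥤ EqCohAlg B'),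
    Nonempty (TensorFunctor P F) ∧ F.IsEquivalence

variable (ρ) in
/-- `H`-equivariant sheaves of Azumaya algebras on `X`. -/
def AzAlg : Type (u + 1) := {B : EqAlg ρ // B.toSheafAlg.IsAzumaya}

variable (ρ) in
/-- The underlying set of the `H`-equivariant Brauer group `Br^H(X)`: `H`-equivariant sheaves of
Azumaya algebras modulo `H`-equivariant Morita equivalence. -/
def BrH : Type (u + 1) := Quot fun B B' : AzAlg ρ => Morita B.1 B'.1

/-- The Brauer class of an equivariant sheaf of Azumaya algebras. -/
def BrH.mk (B : AzAlg ρ) : BrH ρ := Quot.mk _ B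

end Sheaves
end EquivSheaf

namespace EquivSheaf

/-! ### Equivariant algebras over a ring and the equivariant Brauer group of a ring -/

section Rings

variable {H : Type u} [Group H] {R : Type u} [CommRing R]

/-- An `H`-equivariant associative unital algebra over a commutative ring `R` with an action
`τ` of `H`. -/
structure RAlg (τ : H →* RingAut R) where
  carrier : Type u
  [ring : Ring carrier]
  [algebra : Algebra R carrier]
  act : H →* RingAut carrier
  act_smul : ∀ h (r : R) (a : carrier), act h (r • a) = τ h r • act h a

attribute [instance] RAlg.ring RAlg.algebra

variable {τ : H →* RingAut R}

/-- Objects of the category `mods^H(A)`: `H`-equivariant left `A`-modules which are finitely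
generated over `R`. -/
structure RMod (A : RAlg τ) where
  carrier : Type u
  [addCommGroup : AddCommGroup carrier]
  [moduleBase : Module R carrier]
  [module : Module A.carrier carrier]
  [tower : IsScalarTower R A.carrier carrier]
  [finite : Module.Finite R carrier]
  act : H →* AddMonoid.End carrier
  act_smul : ∀ h (a : A.carrier) (m : carrier), act h (a • m) = A.act h a • act h m

attribute [instance] RMod.addCommGroup RMod.moduleBase RMod.module RMod.tower RMod.finite

/-- Morphisms in `mods^H(A)`. -/
@[ext]
structure RMod.Hom {A : RAlg τ} (M N : RMod A) where
  hom : M.carrier →ₗ[A.carrier] N.carrier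
  map_act : ∀ h m, hom (M.act h m) = N.act h (hom m)

instance (A : RAlg τ) : Category (RMod A) where
  Hom := RMod.Hom
  id M := ⟨LinearMap.id, fun _ _ => rfl⟩
  comp f g := ⟨g.hom.comp f.hom, fun h m => by simp [f.map_act, g.map_act]⟩

/-- An `H`-equivariant `A' ⊗_R Aᵒᵖ`-module, finitely generated over `R`, i.e. an
`(A', A)`-bimodule on which the two actions of `R` agree. The right action of `A` is written as
an action of `Aᵐᵒᵖ`. -/
structure RBimod (A' A : RAlg τ) where
  carrier : Type u
  [addCommGroup : AddCommGroup carrier]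
  [moduleBase : Module R carrier]
  [moduleLeft : Module A'.carrier carrier]
  [moduleRight : Module A.carrierᵐᵒᵖ carrier]
  [towerLeft : IsScalarTower R A'.carrier carrier]
  [towerRight : IsScalarTower R A.carrierᵐᵒᵖ carrier]
  [comm : SMulCommClass A'.carrier A.carrierᵐᵒᵖ carrier]
  [finite : Module.Finite R carrier]
  act : H →* AddMonoid.End carrier
  act_lsmul : ∀ h (a : A'.carrier) (p : carrier), act h (a • p) = A'.act h a • act h p
  act_rsmul : ∀ h (p : carrier) (a : A.carrier),
    act h (MulOpposite.op a • p) = MulOpposite.op (A.act h a) • act h p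

attribute [instance] RBimod.addCommGroup RBimod.moduleBase RBimod.moduleLeft
  RBimod.moduleRight RBimod.towerLeft RBimod.towerRight RBimod.comm RBimod.finite

/-- An `H`-equivariant, `A'`-linear, `A`-balanced pairing `P × M → N`. -/
structure RBalancedMap {A' A : RAlg τ} (P : RBimod A' A) (M : RMod A) (N : RMod A') where
  toFun : P.carrier →+ M.carrier →+ N.carrier
  map_lsmul : ∀ (a : A'.carrier) p m, toFun (a • p) m = a • toFun p m
  balanced : ∀ (a : A.carrier) p m, toFun (MulOpposite.op a • p) m = toFun p (a • m)
  map_act : ∀ h p m, N.act h (toFun p m) = toFun (P.act h p) (M.act h m)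

/-- The functor `F` is `P ⊗_A -`: it comes with natural universal balanced pairings
`P × M → F(M)`. -/
structure RTensorFunctor {A' A : RAlg τ} (P : RBimod A' A) (F : RMod A ⥤ RMod A') where
  pair : ∀ M, RBalancedMap P M (F.obj M)
  natural : ∀ {M M' : RMod A} (f : M ⟶ M') p m,
    (F.map f).hom ((pair M).toFun p m) = (pair M').toFun p (f.hom m)
  universal : ∀ M (N : RMod A') (γ : RBalancedMap P M N),
    ∃! g : F.obj M ⟶ N, ∀ p m, g.hom ((pair M).toFun p m) = γ.toFun p m

/-- `H`-equivariant Morita equivalence over `R`: some `H`-equivariant `A' ⊗_R Aᵒᵖ`-module `P`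
makes `P ⊗_A - : mods^H(A) ⥤ mods^H(A')` an equivalence. -/
def RMorita (A A' : RAlg τ) : Prop :=
  ∃ (P : RBimod A' A) (F : RMod A ⥤ RMod A'),
    Nonempty (RTensorFunctor P F) ∧ F.IsEquivalence

variable (τ) in
/-- `H`-equivariant Azumaya algebras over `R`. -/
def RAz : Type (u + 1) := {A : RAlg τ // IsAzumaya R A.carrier}

variable (τ) in
/-- The underlying set of the `H`-equivariant Brauer group `Br^H(R)`: `H`-equivariant Azumaya
algebras over `R` modulo `H`-equivariant Morita equivalence. -/
def RBr : Type (u + 1) := Quot fun A A' : RAz τ => RMorita A.1 A'.1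

/-- The Brauer class of an equivariant Azumaya algebra over `R`. -/
def RBr.mk (A : RAz τ) : RBr τ := Quot.mk _ A

variable (τ) in
/-- `R` as an `H`-equivariant algebra over itself. -/
def RAlg.unit : RAlg τ where
  carrier := R
  act := τ
  act_smul h r a := map_mul (τ h) r a

/-- The zero element of `Br^H(R)` is the class of `R`. -/
instance : Zero (RBr τ) := ⟨RBr.mk ⟨RAlg.unit τ, IsAzumaya.id R⟩⟩

end Rings

/-! ### Pulling back an algebra to a scheme -/

section Pullback

variable {R : Type u} [CommRing R] {X : Scheme.{u}}

/-- The ring homomorphism `R → Γ(X, U)` given by a morphism `f : X ⟶ Spec R`. -/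
def baseHom (f : X ⟶ Spec (.of R)) (U : X.Opens) : R →+* Γ(X, U) :=
  (resO (le_top : U ≤ ⊤)).comp
    ((f.appTop.hom).comp (Scheme.ΓSpecIso (.of R)).inv.hom)

lemma resO_baseHom (f : X ⟶ Spec (.of R)) {U V : X.Opens} (i : V ≤ U) (r : R) :
    resO i (baseHom f U r) = baseHom f V r := by
  simp only [baseHom, resO, RingHom.comp_apply]
  rw [← CommRingCat.comp_apply, ← X.presheaf.map_comp]
  rfl

lemma resO_self {U : X.Opens} (i : U ≤ U) (r : Γ(X, U)) : resO i r = r := by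
  change (X.presheaf.map (𝟙 _)).hom r = r
  simp

lemma resO_resO {U V W : X.Opens} (i : V ≤ U) (j : W ≤ V) (r : Γ(X, U)) :
    resO j (resO i r) = resO (j.trans i) r := by
  simp only [resO]
  rw [← CommRingCat.comp_apply, ← X.presheaf.map_comp]
  rfl

/-- `Γ(X, U)` as an `R`-algebra through `f : X ⟶ Spec R`. -/
def FunSec (_f : X ⟶ Spec (.of R)) (U : X.Opens) : Type u := Γ(X, U)

instance (f : X ⟶ Spec (.of R)) (U : X.Opens) : CommRing (FunSec f U) :=
  inferInstanceAs (CommRing Γ(X, U))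

instance (f : X ⟶ Spec (.of R)) (U : X.Opens) : Algebra R (FunSec f U) :=
  (baseHom f U).toAlgebra

/-- Restriction of functions is a homomorphism of `R`-algebras. -/
def FunSec.res (f : X ⟶ Spec (.of R)) {U V : X.Opens} (i : V ≤ U) :
    FunSec f U →ₐ[R] FunSec f V :=
  { (resO i : Γ(X, U) →+* Γ(X, V)) with
    commutes' := fun r => resO_baseHom f i r }

variable (f : X ⟶ Spec (.of R)) (A : Type u) [Ring A] [Algebra R A]

/-- Sections over `U` of the pullback of `A` along `f : X ⟶ Spec R`. -/
abbrev PullSec (U : X.Opens) : Type u := FunSec f U ⊗[R] A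

/-- Restriction of sections of the pullback of `A`. -/
def PullSec.res {U V : X.Opens} (i : V ≤ U) : PullSec f A U →ₐ[R] PullSec f A V :=
  Algebra.TensorProduct.map (FunSec.res f i) (AlgHom.id R A)

lemma PullSec.res_self {U : X.Opens} (i : U ≤ U) (x : PullSec f A U) :
    PullSec.res f A i x = x := by
  induction x using TensorProduct.induction_on with
  | zero => simp
  | add x y hx hy => rw [map_add, hx, hy]
  | tmul r a =>
    simp only [PullSec.res, Algebra.TensorProduct.map_tmul, AlgHom.id_apply]
    exact congrArg (· ⊗ₜ[R] a) (resO_self i r)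

lemma PullSec.res_res {U V W : X.Opens} (i : V ≤ U) (j : W ≤ V) (x : PullSec f A U) :
    PullSec.res f A j (PullSec.res f A i x) = PullSec.res f A (j.trans i) x := by
  induction x using TensorProduct.induction_on with
  | zero => simp
  | add x y hx hy => rw [map_add, map_add, hx, hy, map_add]
  | tmul r a =>
    simp only [PullSec.res, Algebra.TensorProduct.map_tmul, AlgHom.id_apply]
    exact congrArg (· ⊗ₜ[R] a) (resO_resO i j r)

lemma PullSec.res_smul {U V : X.Opens} (i : V ≤ U) (r : FunSec f U) (x : PullSec f A U) :
    PullSec.res f A i (r • x) = FunSec.res f i r • PullSec.res f A i x := by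
  rw [Algebra.smul_def, map_mul, Algebra.smul_def]
  simp [PullSec.res, Algebra.TensorProduct.algebraMap_apply]

/-- The presheaf of abelian groups `U ↦ Γ(X, U) ⊗_R A`. -/
def pullAb : TopCat.Presheaf Ab X where
  obj U := AddCommGrpCat.of (PullSec f A U.unop)
  map j := AddCommGrpCat.ofHom (PullSec.res f A j.unop.le).toRingHom.toAddMonoidHom
  map_id U := by
    ext x
    exact PullSec.res_self f A _ x
  map_comp i j := by
    ext x
    exact (PullSec.res_res f A i.unop.le j.unop.le x).symm

instance (U : X.Opensᵒᵖ) : Module (X.ringCatSheaf.obj.obj U) ((pullAb f A).obj U) :=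
  inferInstanceAs (Module (FunSec f U.unop) (PullSec f A U.unop))

/-- The presheaf of modules `U ↦ Γ(X, U) ⊗_R A`. -/
def pullPresheaf : X.PresheafOfModules :=
  PresheafOfModules.ofPresheaf (pullAb f A) fun _ _ j r x => PullSec.res_smul f A j.unop.le r x

variable {A} in
/-- Evaluation of sections of the pullback of `A` at a linear form on `A`. -/
def PullSec.coord (l : A →ₗ[R] R) (U : X.Opens) : PullSec f A U →ₗ[R] FunSec f U :=
  (TensorProduct.rid R (FunSec f U)).toLinearMap ∘ₗ l.lTensor (FunSec f U)

lemma PullSec.coord_res (l : A →ₗ[R] R) {U V : X.Opens} (i : V ≤ U) (x : PullSec f A U) :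
    PullSec.coord f l V (PullSec.res f A i x) = FunSec.res f i (PullSec.coord f l U x) := by
  induction x using TensorProduct.induction_on with
  | zero => simp
  | add x y hx hy => simp only [map_add, hx, hy]
  | tmul r a => simp [PullSec.coord, PullSec.res]

lemma PullSec.eq_sum {n : ℕ} (l : Fin n → A →ₗ[R] R) (e : Fin n → A)
    (h : ∀ a, ∑ c, l c a • e c = a) {U : X.Opens} (x : PullSec f A U) :
    ∑ c, (PullSec.coord f (l c) U x) ⊗ₜ[R] e c = x := by
  induction x using TensorProduct.induction_on with
  | zero => simp
  | add x y hx hy => simp only [map_add, TensorProduct.add_tmul, Finset.sum_add_distrib, hx, hy]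
  | tmul r a =>
    simp only [PullSec.coord, LinearMap.coe_comp, LinearEquiv.coe_coe, Function.comp_apply,
      LinearMap.lTensor_tmul, TensorProduct.rid_tmul, TensorProduct.smul_tmul]
    rw [← TensorProduct.tmul_sum, h]

lemma pullAb_isSheaf [Module.Finite R A] [Module.Projective R A] : (pullAb f A).IsSheaf := by
  rw [TopCat.Presheaf.isSheaf_iff_isSheafUniqueGluing]
  obtain ⟨n, p, hp⟩ := Module.Finite.exists_fin' R A
  obtain ⟨j, hj⟩ := Module.projective_lifting_property p LinearMap.id hp
  let l : Fin n → A →ₗ[R] R := fun c => LinearMap.proj c ∘ₗ j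
  let e : Fin n → A := fun c => p (Pi.single c 1)
  have hle : ∀ a, ∑ c, l c a • e c = a := by
    intro a
    have h1 : p (j a) = a := LinearMap.congr_fun hj a
    conv_rhs => rw [← h1, pi_eq_sum_univ' (j a), map_sum]
    simp only [l, e, LinearMap.comp_apply, LinearMap.proj_apply, map_smul]
  intro ι U sf₀ hsf
  let sf : ∀ a, PullSec f A (U a) := sf₀
  have hcomp : ∀ a b (i : U a ⊓ U b ≤ U a) (i' : U a ⊓ U b ≤ U b),
      PullSec.res f A i (sf a) = PullSec.res f A i' (sf b) := fun a b _ _ => hsf a b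
  have glue : ∀ c : Fin n, ∃ s : Γ(X, iSup U), ∀ a (i : U a ≤ iSup U),
      resO i s = PullSec.coord f (l c) (U a) (sf a) := by
    intro c
    obtain ⟨s, hs, -⟩ := X.sheaf.existsUnique_gluing U
      (fun a => (PullSec.coord f (l c) (U a) (sf a) : Γ(X, U a))) (by
        intro a b
        change FunSec.res f inf_le_left (PullSec.coord f (l c) (U a) (sf a)) =
          FunSec.res f inf_le_right (PullSec.coord f (l c) (U b) (sf b))
        rw [← PullSec.coord_res, ← PullSec.coord_res, hcomp a b])
    exact ⟨s, fun a i => hs a⟩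
  choose s hs using glue
  refine ⟨∑ c, (s c : FunSec f (iSup U)) ⊗ₜ[R] e c, ?_, ?_⟩
  · intro a
    change PullSec.res f A (le_iSup U a) (∑ c, (s c : FunSec f (iSup U)) ⊗ₜ[R] e c) = sf a
    rw [map_sum]
    conv_rhs => rw [← PullSec.eq_sum f A l e hle (sf a)]
    refine Finset.sum_congr rfl fun c _ => ?_
    exact congrArg (· ⊗ₜ[R] e c) (hs c a (le_iSup U a))
  · intro y₀ hy₀
    let y : PullSec f A (iSup U) := y₀
    have hy : ∀ a (i : U a ≤ iSup U), PullSec.res f A i y = sf a := fun a _ => hy₀ a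
    change y = _
    rw [← PullSec.eq_sum f A l e hle y]
    refine Finset.sum_congr rfl fun c _ => ?_
    congr 1
    refine X.sheaf.eq_of_locally_eq U _ _ fun a => ?_
    change FunSec.res f (le_iSup U a) (PullSec.coord f (l c) (iSup U) y) =
      resO (le_iSup U a) (s c)
    rw [← PullSec.coord_res, hy, hs]

/-- The sheaf of modules `U ↦ Γ(X, U) ⊗_R A`. -/
def pullModule [Module.Finite R A] [Module.Projective R A] : X.Modules where
  val := pullPresheaf f A
  isSheaf := pullAb_isSheaf f A

end Pullback

section PullbackAlg

variable {R : Type u} [CommRing R] {X : Scheme.{u}}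

/-- The pullback `f^* A` along `f : X ⟶ Spec R` of (the sheaf on `Spec R` defined by) a finite
projective `R`-algebra `A`: the sheaf of algebras `U ↦ Γ(X, U) ⊗_R A`. -/
def pullAlg (f : X ⟶ Spec (.of R)) (A : Type u) [Ring A] [Algebra R A] [Module.Finite R A]
    [Module.Projective R A] : SheafAlg X where
  mod := pullModule f A
  mul U := LinearMap.mul (FunSec f U) (PullSec f A U)
  one U := (1 : PullSec f A U)
  mul_assoc U a b c := _root_.mul_assoc (G := PullSec f A U) a b c
  one_mul U a := _root_.one_mul (M := PullSec f A U) a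
  mul_one U a := _root_.mul_one (M := PullSec f A U) a
  res_mul {U V} i a b := map_mul (M := PullSec f A U) (N := PullSec f A V) (PullSec.res f A i) a b
  res_one i := map_one (PullSec.res f A i)

variable {H : Type u} [Group H] {τ : H →* RingAut R} {ρ : H →* Aut X}

/-- The morphism `f : X ⟶ Spec R` is `H`-equivariant, where `h` acts on `Spec R` through
`Spec (τ h⁻¹)`. -/
def IsEquivariant (τ : H →* RingAut R) (ρ : H →* Aut X) (f : X ⟶ Spec (.of R)) : Prop :=
  ∀ h, (ρ h).hom ≫ f = f ≫ Spec.map (CommRingCat.ofHom (τ h⁻¹ : R →+* R))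

lemma actO_baseHom {f : X ⟶ Spec (.of R)} (hf : IsEquivariant τ ρ f) (h : H) (U : X.Opens)
    (r : R) : actO ρ h U (baseHom f U r) = baseHom f (translate ρ h U) (τ h r) := by
  have h1 : (ρ h).inv ≫ f = f ≫ Spec.map (CommRingCat.ofHom (τ h : R →+* R)) := by
    have := hf h⁻¹
    rw [inv_inv, map_inv] at this
    exact this
  have h2 : ∀ g : X ⟶ Spec (.of R), (ρ h).inv ≫ f = g →
      actO ρ h U (baseHom f U r) = baseHom g (translate ρ h U) r := by
    rintro g rfl
    have nat := (ρ h).inv.naturality (homOfLE (le_top : U ≤ ⊤)).op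
    have nat' := ConcreteCategory.congr_hom nat (f.appTop.hom ((Scheme.ΓSpecIso (.of R)).inv.hom r))
    simp only [baseHom, RingHom.comp_apply, Scheme.Hom.comp_appTop]
    exact nat'
  rw [h2 _ h1]
  have h3 := ConcreteCategory.congr_hom
    (Scheme.ΓSpecIso_inv_naturality (CommRingCat.ofHom (τ h : R →+* R))) r
  simp only [baseHom, RingHom.comp_apply, Scheme.Hom.comp_appTop]
  exact congrArg (fun z => resO _ (f.appTop.hom z)) h3.symm

lemma resO_actO (h : H) {U V : X.Opens} (i : V ≤ U) (r : Γ(X, U)) :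
    actO ρ h V (resO i r) = resO (translate_mono ρ h i) (actO ρ h U r) :=
  ConcreteCategory.congr_hom ((ρ h).inv.naturality (homOfLE i).op) r

lemma actO_one (U : X.Opens) (r : Γ(X, U)) :
    actO ρ 1 U r = resO (translate_one ρ U).le r := by
  have key : ∀ (a : Aut X) (ha : a = 1) (e : a.inv ⁻¹ᵁ U ≤ U),
      (a.inv.app U).hom r = resO e r := by
    rintro a rfl e
    exact (resO_self e r).symm
  exact key (ρ 1) (map_one ρ) _

lemma actO_mul (g h : H) (U : X.Opens) (r : Γ(X, U)) :
    actO ρ (g * h) U r =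
      resO (translate_mul ρ g h U).le (actO ρ g (translate ρ h U) (actO ρ h U r)) := by
  have key : ∀ (a : Aut X) (ha : a = ρ g * ρ h)
      (e : a.inv ⁻¹ᵁ U ≤ (ρ g).inv ⁻¹ᵁ ((ρ h).inv ⁻¹ᵁ U)),
      (a.inv.app U).hom r = resO e (((ρ g).inv.app _).hom (((ρ h).inv.app U).hom r)) := by
    rintro a rfl e
    refine Eq.trans ?_ (resO_self e _).symm
    change (((ρ g).inv ≫ (ρ h).inv).app U).hom r = _
    rw [Scheme.Hom.comp_app]
    rfl
  exact key (ρ (g * h)) (map_mul ρ g h) _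

/-- The action of `h` on functions, for `Γ(X, U)` regarded as an `R`-algebra. -/
def FunSec.act (f : X ⟶ Spec (.of R)) (ρ : H →* Aut X) (h : H) (U : X.Opens) :
    FunSec f U →+* FunSec f (translate ρ h U) :=
  actO ρ h U

lemma FunSec.act_smul {f : X ⟶ Spec (.of R)} (hf : IsEquivariant τ ρ f) (h : H) (U : X.Opens)
    (r : R) (φ : FunSec f U) : FunSec.act f ρ h U (r • φ) = τ h r • FunSec.act f ρ h U φ := by
  rw [Algebra.smul_def, map_mul, Algebra.smul_def]
  exact congrArg (· * FunSec.act f ρ h U φ) (actO_baseHom hf h U r)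

/-- The action of `h` on sections of `f^* A`, namely `φ ⊗ a ↦ h(φ) ⊗ h(a)`. -/
def pullAct {f : X ⟶ Spec (.of R)} (hf : IsEquivariant τ ρ f) (A : RAlg τ) (h : H)
    (U : X.Opens) : PullSec f A.carrier U →+ PullSec f A.carrier (translate ρ h U) :=
  TensorProduct.liftAddHom
    { toFun := fun φ =>
        { toFun := fun a => FunSec.act f ρ h U φ ⊗ₜ[R] A.act h a
          map_zero' := by rw [map_zero, TensorProduct.tmul_zero]
          map_add' := fun a b => by rw [map_add, TensorProduct.tmul_add] }
      map_zero' := by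
        ext a
        change FunSec.act f ρ h U 0 ⊗ₜ[R] A.act h a = 0
        rw [map_zero, TensorProduct.zero_tmul]
      map_add' := fun φ ψ => by
        ext a
        change FunSec.act f ρ h U (φ + ψ) ⊗ₜ[R] A.act h a =
          FunSec.act f ρ h U φ ⊗ₜ[R] A.act h a + FunSec.act f ρ h U ψ ⊗ₜ[R] A.act h a
        rw [map_add, TensorProduct.add_tmul] }
    (fun r φ a => by
      change FunSec.act f ρ h U (r • φ) ⊗ₜ[R] A.act h a =
        FunSec.act f ρ h U φ ⊗ₜ[R] A.act h (r • a)
      rw [FunSec.act_smul hf, A.act_smul, TensorProduct.smul_tmul])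

lemma pullAct_tmul {f : X ⟶ Spec (.of R)} (hf : IsEquivariant τ ρ f) (A : RAlg τ) (h : H)
    (U : X.Opens) (φ : FunSec f U) (a : A.carrier) :
    pullAct hf A h U (φ ⊗ₜ a) = FunSec.act f ρ h U φ ⊗ₜ[R] A.act h a :=
  rfl

/-- The pullback `f^* A` along an `H`-equivariant morphism `f : X ⟶ Spec R` of an
`H`-equivariant finite projective `R`-algebra `A`. -/
def pullEqAlg {f : X ⟶ Spec (.of R)} (hf : IsEquivariant τ ρ f) (A : RAlg τ)
    [Module.Finite R A.carrier] [Module.Projective R A.carrier] : EqAlg ρ where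
  __ := pullAlg f A.carrier
  act h U := pullAct hf A h U
  act_osmul h U r s := by
    suffices key : ∀ (φ : FunSec f U) (x : PullSec f A.carrier U), pullAct hf A h U (φ • x) =
        FunSec.act f ρ h U φ • pullAct hf A h U x from key r s
    intro r x
    induction x using TensorProduct.induction_on with
    | zero => simp
    | add x y hx hy => rw [smul_add, map_add, map_add, hx, hy, smul_add]
    | tmul φ a =>
      rw [TensorProduct.smul_tmul', pullAct_tmul, pullAct_tmul, TensorProduct.smul_tmul']
      exact congrArg (· ⊗ₜ[R] A.act h a) (map_mul (FunSec.act f ρ h U) r φ)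
  act_res h U V i s := by
    suffices key : ∀ x : PullSec f A.carrier U, pullAct hf A h V (PullSec.res f A.carrier i x) =
        PullSec.res f A.carrier (translate_mono ρ h i) (pullAct hf A h U x) from key s
    intro x
    induction x using TensorProduct.induction_on with
    | zero => simp
    | add x y hx hy => simp only [map_add, hx, hy]
    | tmul φ a => exact congrArg (· ⊗ₜ[R] A.act h a) (resO_actO h i φ)
  act_one U s := by
    suffices key : ∀ x : PullSec f A.carrier U, pullAct hf A 1 U x =
        PullSec.res f A.carrier (translate_one ρ U).le x from key s
    intro x
    induction x using TensorProduct.induction_on with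
    | zero => simp
    | add x y hx hy => simp only [map_add, hx, hy]
    | tmul φ a =>
      rw [pullAct_tmul, map_one]
      exact congrArg (· ⊗ₜ[R] a) (actO_one U φ)
  act_comp g h U s := by
    suffices key : ∀ x : PullSec f A.carrier U, pullAct hf A (g * h) U x =
        PullSec.res f A.carrier (translate_mul ρ g h U).le
          (pullAct hf A g _ (pullAct hf A h U x)) from key s
    intro x
    induction x using TensorProduct.induction_on with
    | zero => simp
    | add x y hx hy => simp only [map_add, hx, hy]
    | tmul φ a =>
      rw [pullAct_tmul, map_mul]
      exact congrArg (· ⊗ₜ[R] A.act g (A.act h a)) (actO_mul g h U φ)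
  act_prod h U a b := by
    suffices key : ∀ x y : PullSec f A.carrier U, pullAct hf A h U (x * y) =
        pullAct hf A h U x * pullAct hf A h U y from key a b
    intro x y
    induction x using TensorProduct.induction_on with
    | zero => simp
    | add x x' hx hx' => simp only [map_add, add_mul, hx, hx']
    | tmul φ a =>
      induction y using TensorProduct.induction_on with
      | zero => simp
      | add y y' hy hy' => simp only [map_add, mul_add, hy, hy']
      | tmul ψ b =>
        rw [Algebra.TensorProduct.tmul_mul_tmul, pullAct_tmul, pullAct_tmul, pullAct_tmul,
          Algebra.TensorProduct.tmul_mul_tmul, map_mul (A.act h)]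
        rw [map_mul (FunSec.act f ρ h U)]
  act_unit h U := by
    change pullAct hf A h U ((1 : FunSec f U) ⊗ₜ[R] (1 : A.carrier)) =
      (1 : FunSec f (translate ρ h U)) ⊗ₜ[R] (1 : A.carrier)
    rw [pullAct_tmul, map_one (A.act h), map_one (FunSec.act f ρ h U)]

end PullbackAlg
end EquivSheaf

namespace EquivSheaf

/-! ### The algebras attached to an extension `1 → N → G → H → 1`

Here `π : G →* H` is surjective and `N = π.ker`. -/

section Extension

variable {k : Type u} [Field k] {G H : Type u} [Group G] [Group H] (π : G →* H)

variable (k) in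
/-- The center `Z = Z(k[N])` of the group algebra of `N = ker π`. -/
def ZN : Type u := Subalgebra.center k (MonoidAlgebra k π.ker)

instance : CommRing (ZN k π) :=
  inferInstanceAs (CommRing (Subalgebra.center k (MonoidAlgebra k π.ker)))

instance : Algebra k (ZN k π) :=
  inferInstanceAs (Algebra k (Subalgebra.center k (MonoidAlgebra k π.ker)))

/-- The inclusion `Z ⊆ k[N]`. -/
def ZN.incl : ZN k π →ₐ[k] MonoidAlgebra k π.ker :=
  (Subalgebra.center k (MonoidAlgebra k π.ker)).val

lemma ZN.incl_injective : Function.Injective (ZN.incl (k := k) π) := Subtype.val_injective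

lemma ZN.incl_comm (z : ZN k π) (x : MonoidAlgebra k π.ker) :
    x * ZN.incl π z = ZN.incl π z * x :=
  Subalgebra.mem_center_iff.mp (Subtype.prop z) x

variable (k) in
/-- Conjugation by `g ∈ G` on the group algebra `k[N]`. -/
def conjAlg : G →* (MonoidAlgebra k π.ker ≃ₐ[k] MonoidAlgebra k π.ker) :=
  (MonoidAlgebra.domCongrAut (R := k) (A := k)).comp MulAut.conjNormal

lemma conjAlg_single (g : G) (n : π.ker) (c : k) :
    conjAlg k π g (MonoidAlgebra.single n c) = MonoidAlgebra.single (MulAut.conjNormal g n) c := by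
  simp [conjAlg, MonoidAlgebra.domCongrAut]

lemma conjAlg_mem (n : π.ker) (z : MonoidAlgebra k π.ker) :
    conjAlg k π (n : G) z * MonoidAlgebra.single n 1 = MonoidAlgebra.single n 1 * z := by
  induction z using MonoidAlgebra.induction_linear with
  | zero => simp
  | add x y hx hy => rw [map_add, add_mul, mul_add, hx, hy]
  | single m c =>
    rw [conjAlg_single, MonoidAlgebra.single_mul_single, MonoidAlgebra.single_mul_single,
      mul_one, one_mul]
    congr 1
    ext
    simp

lemma conjAlg_center (g : G) {z : MonoidAlgebra k π.ker}
    (hz : z ∈ Subalgebra.center k (MonoidAlgebra k π.ker)) :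
    conjAlg k π g z ∈ Subalgebra.center k (MonoidAlgebra k π.ker) := by
  rw [Subalgebra.mem_center_iff] at hz ⊢
  intro b
  obtain ⟨b, rfl⟩ := (conjAlg k π g).surjective b
  rw [← map_mul, hz, map_mul]

/-- Conjugation by `g` on `Z`. -/
def conjCenter (g : G) (z : ZN k π) : ZN k π :=
  ⟨conjAlg k π g (ZN.incl π z), conjAlg_center π g (Subtype.prop z)⟩

lemma incl_conjCenter (g : G) (z : ZN k π) :
    ZN.incl π (conjCenter π g z) = conjAlg k π g (ZN.incl π z) := rfl

lemma conjCenter_one (z : ZN k π) : conjCenter π 1 z = z := by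
  apply ZN.incl_injective
  rw [incl_conjCenter, map_one]; rfl

lemma conjCenter_mul (g h : G) (z : ZN k π) :
    conjCenter π (g * h) z = conjCenter π g (conjCenter π h z) := by
  apply ZN.incl_injective
  rw [incl_conjCenter, map_mul]; rfl

variable (k) in
/-- The action of `G` on `Z` by conjugation. -/
def centerActG : G →* RingAut (ZN k π) where
  toFun g :=
    { toFun := conjCenter π g
      invFun := conjCenter π g⁻¹
      left_inv := fun z => by rw [← conjCenter_mul, inv_mul_cancel, conjCenter_one]
      right_inv := fun z => by rw [← conjCenter_mul, mul_inv_cancel, conjCenter_one]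
      map_mul' := fun a b => by
        apply ZN.incl_injective
        simp only [incl_conjCenter, map_mul]
      map_add' := fun a b => by
        apply ZN.incl_injective
        simp only [incl_conjCenter, map_add] }
  map_one' := RingEquiv.ext (conjCenter_one π)
  map_mul' g h := RingEquiv.ext (conjCenter_mul π g h)

lemma centerActG_apply (g : G) (z : ZN k π) : centerActG k π g z = conjCenter π g z := rfl

lemma centerActG_ker : π.ker ≤ (centerActG k π).ker := by
  intro n hn
  rw [MonoidHom.mem_ker]
  refine RingEquiv.ext fun z => ?_
  rw [centerActG_apply]
  apply ZN.incl_injective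
  rw [incl_conjCenter]
  change conjAlg k π n (ZN.incl π z) = ZN.incl π z
  have h1 := conjAlg_mem π (k := k) ⟨n, hn⟩ (ZN.incl π z)
  rw [ZN.incl_comm] at h1
  have h3 := congrArg (· * MonoidAlgebra.single (⟨n, hn⟩ : π.ker)⁻¹ (1 : k)) h1
  simpa only [mul_assoc, MonoidAlgebra.single_mul_single, mul_inv_cancel, mul_one,
    ← MonoidAlgebra.one_def] using h3

variable {π} (hπ : Function.Surjective π)

variable (k) in
/-- The action of `H` on `Z` by conjugation: `h` acts as conjugation by any lift of `h` to `G`. -/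
def centerAct : H →* RingAut (ZN k π) :=
  π.liftOfSurjective hπ ⟨centerActG k π, centerActG_ker π⟩

lemma centerAct_apply (g : G) : centerAct k hπ (π g) = centerActG k π g :=
  MonoidHom.liftOfRightInverse_comp_apply _ _ _ _ _

variable {V : Type u} [AddCommGroup V] [Module k V] (σ : Representation k G V)

variable (π) in
/-- The algebra `End_N(V)` of `N`-equivariant endomorphisms of a representation `V` of `G`. -/
abbrev EndN : Subalgebra k (Module.End k V) :=
  Subalgebra.centralizer k (Set.range fun n : π.ker => (σ (n : G) : Module.End k V))

lemma conj_mem_EndN (g : G) {φ : Module.End k V}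
    (hφ : φ ∈ EndN π σ) : σ g * φ * σ g⁻¹ ∈ EndN π σ := by
  rw [Subalgebra.mem_centralizer_iff] at hφ ⊢
  rintro _ ⟨n, rfl⟩
  have h1 := hφ _ ⟨⟨g⁻¹ * n * g, by simpa using π.normal_ker.conj_mem n n.2 g⁻¹⟩, rfl⟩
  simp only at h1 ⊢
  have e1 : σ (n : G) * σ g = σ g * σ (g⁻¹ * n * g) := by
    rw [← map_mul, ← map_mul]; congr 1; group
  have e2 : σ (g⁻¹ * n * g) * σ g⁻¹ = σ g⁻¹ * σ (n : G) := by
    rw [← map_mul, ← map_mul]; congr 1; group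
  calc σ (n : G) * (σ g * φ * σ g⁻¹) = (σ (n : G) * σ g) * φ * σ g⁻¹ := by noncomm_ring
    _ = σ g * (σ (g⁻¹ * n * g) * φ) * σ g⁻¹ := by rw [e1]; noncomm_ring
    _ = σ g * φ * (σ (g⁻¹ * n * g) * σ g⁻¹) := by rw [h1]; noncomm_ring
    _ = _ := by rw [e2]; noncomm_ring

lemma rep_mul_inv (g : G) : σ g * σ g⁻¹ = 1 := by rw [← map_mul, mul_inv_cancel, map_one]

lemma rep_inv_mul (g : G) : σ g⁻¹ * σ g = 1 := by rw [← map_mul, inv_mul_cancel, map_one]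

variable (π) in
/-- The action of `G` on `End_N(V)ᵒᵖ` by conjugation, `φ ↦ g φ g⁻¹`. -/
def endActG : G →* RingAut (EndN π σ)ᵐᵒᵖ where
  toFun g :=
    { toFun := fun a => .op ⟨σ g * a.unop * σ g⁻¹, conj_mem_EndN σ g a.unop.2⟩
      invFun := fun a => .op ⟨σ g⁻¹ * a.unop * σ g, by
        simpa using conj_mem_EndN σ g⁻¹ a.unop.2⟩
      left_inv := fun a => MulOpposite.unop_injective (Subtype.ext (by
        change σ g⁻¹ * (σ g * (a.unop : Module.End k V) * σ g⁻¹) * σ g = a.unop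
        calc _ = (σ g⁻¹ * σ g) * (a.unop : Module.End k V) * (σ g⁻¹ * σ g) := by noncomm_ring
          _ = _ := by rw [rep_inv_mul, one_mul, mul_one]))
      right_inv := fun a => MulOpposite.unop_injective (Subtype.ext (by
        change σ g * (σ g⁻¹ * (a.unop : Module.End k V) * σ g) * σ g⁻¹ = a.unop
        calc _ = (σ g * σ g⁻¹) * (a.unop : Module.End k V) * (σ g * σ g⁻¹) := by noncomm_ring
          _ = _ := by rw [rep_mul_inv, one_mul, mul_one]))
      map_mul' := fun a b => MulOpposite.unop_injective (Subtype.ext (by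
        change σ g * ((b.unop : Module.End k V) * a.unop) * σ g⁻¹ =
          (σ g * b.unop * σ g⁻¹) * (σ g * a.unop * σ g⁻¹)
        calc _ = σ g * (b.unop : Module.End k V) * 1 * a.unop * σ g⁻¹ := by noncomm_ring
          _ = _ := by rw [← rep_inv_mul σ g]; noncomm_ring))
      map_add' := fun a b => MulOpposite.unop_injective (Subtype.ext (by
        change σ g * ((a.unop : Module.End k V) + b.unop) * σ g⁻¹ =
          σ g * a.unop * σ g⁻¹ + σ g * b.unop * σ g⁻¹
        noncomm_ring)) }
  map_one' := by
    ext a : 1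
    refine MulOpposite.unop_injective (Subtype.ext ?_)
    change σ 1 * (a.unop : Module.End k V) * σ 1⁻¹ = a.unop
    simp
  map_mul' g h := by
    ext a : 1
    refine MulOpposite.unop_injective (Subtype.ext ?_)
    change σ (g * h) * (a.unop : Module.End k V) * σ (g * h)⁻¹ =
      σ g * (σ h * a.unop * σ h⁻¹) * σ g⁻¹
    rw [mul_inv_rev, map_mul, map_mul]
    noncomm_ring

lemma endActG_ker : π.ker ≤ (endActG π σ).ker := by
  intro n hn
  rw [MonoidHom.mem_ker]
  ext a : 1
  refine MulOpposite.unop_injective (Subtype.ext ?_)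
  change σ n * (a.unop : Module.End k V) * σ n⁻¹ = a.unop
  have h1 := Subalgebra.mem_centralizer_iff k |>.mp a.unop.2 _ ⟨⟨n, hn⟩, rfl⟩
  simp only at h1
  rw [h1, mul_assoc, rep_mul_inv, mul_one]

/-- The action of `H` on `End_N(V)ᵒᵖ`: `h` acts as conjugation by any lift of `h` to `G`. -/
def endAct : H →* RingAut (EndN π σ)ᵐᵒᵖ :=
  π.liftOfSurjective hπ ⟨endActG π σ, endActG_ker σ⟩

lemma endAct_apply (g : G) : endAct hπ σ (π g) = endActG π σ g :=
  MonoidHom.liftOfRightInverse_comp_apply _ _ _ _ _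

/-- The `H`-equivariant `k`-algebra `A = End_N(V)ᵒᵖ`. -/
def endAlg : RAlg (1 : H →* RingAut k) where
  carrier := (EndN π σ)ᵐᵒᵖ
  act := endAct hπ σ
  act_smul h c a := by
    obtain ⟨g, rfl⟩ := hπ h
    rw [endAct_apply]
    refine MulOpposite.unop_injective (Subtype.ext ?_)
    change σ g * (c • (a.unop : Module.End k V)) * σ g⁻¹ = c • (σ g * a.unop * σ g⁻¹)
    rw [mul_smul_comm, smul_mul_assoc]

variable (π) in
/-- The restriction of a representation of `G` to `N`. -/
abbrev resN : Representation k π.ker V := σ.comp π.ker.subtype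

variable (π) in
/-- The canonical homomorphism `Z → End_N(V)`. -/
def centerToEndN : ZN k π →+* EndN π σ :=
  ((resN π σ).asAlgebraHom.toRingHom.comp (ZN.incl π).toRingHom).codRestrict (EndN π σ)
    (fun z => by
      change (resN π σ).asAlgebraHom (ZN.incl π z) ∈ Subalgebra.centralizer k _
      rw [Subalgebra.mem_centralizer_iff]
      rintro _ ⟨n, rfl⟩
      have h1 := congrArg (resN π σ).asAlgebraHom (ZN.incl_comm π z (MonoidAlgebra.single n 1))
      rw [map_mul, map_mul, Representation.asAlgebraHom_single_one] at h1
      exact h1)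

lemma centerToEndN_comm (z : ZN k π) (φ : EndN π σ) :
    centerToEndN π σ z * φ = φ * centerToEndN π σ z := by
  refine Subtype.ext ?_
  change (resN π σ).asAlgebraHom (ZN.incl π z) * (φ : Module.End k V) =
    φ * (resN π σ).asAlgebraHom (ZN.incl π z)
  generalize ZN.incl π z = x
  induction x using MonoidAlgebra.induction_linear with
  | zero => simp
  | add x y hx hy => rw [map_add, add_mul, mul_add, hx, hy]
  | single n c =>
    rw [Representation.asAlgebraHom_single, smul_mul_assoc, mul_smul_comm]
    exact congrArg (c • ·) (Subalgebra.mem_centralizer_iff k |>.mp φ.2 _ ⟨n, rfl⟩)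

variable (π) in
/-- The `Z`-algebra structure on `End_N(V)ᵒᵖ`. -/
@[reducible] def centerAlgebra : Algebra (ZN k π) (EndN π σ)ᵐᵒᵖ :=
  RingHom.toAlgebra'
    { toFun := fun z => .op (centerToEndN π σ z)
      map_one' := by rw [map_one]; rfl
      map_mul' := fun a b => by rw [mul_comm, map_mul]; rfl
      map_zero' := by rw [map_zero]; rfl
      map_add' := fun a b => by rw [map_add]; rfl }
    (fun z a => MulOpposite.unop_injective (centerToEndN_comm σ z a.unop).symm)

lemma asAlgebraHom_conj (g : G) (x : MonoidAlgebra k π.ker) :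
    (resN π σ).asAlgebraHom (conjAlg k π g x) = σ g * (resN π σ).asAlgebraHom x * σ g⁻¹ := by
  induction x using MonoidAlgebra.induction_linear with
  | zero => simp
  | add x y hx hy => rw [map_add, map_add, hx, hy, map_add, mul_add, add_mul]
  | single n c =>
    rw [conjAlg_single, Representation.asAlgebraHom_single, Representation.asAlgebraHom_single,
      mul_smul_comm, smul_mul_assoc]
    congr 1
    change σ (g * n * g⁻¹) = σ g * σ (n : G) * σ g⁻¹
    rw [map_mul, map_mul]

lemma endAct_center (h : H) (z : ZN k π) :
    endAct hπ σ h (.op (centerToEndN π σ z)) =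
      .op (centerToEndN π σ (centerAct k hπ h z)) := by
  obtain ⟨g, rfl⟩ := hπ h
  rw [endAct_apply, centerAct_apply, centerActG_apply]
  refine MulOpposite.unop_injective (Subtype.ext ?_)
  exact (asAlgebraHom_conj σ g (ZN.incl π z)).symm

/-- The `H`-equivariant `Z`-algebra `End_N(V)ᵒᵖ`. -/
def endAlgZ : RAlg (centerAct k hπ) where
  carrier := (EndN π σ)ᵐᵒᵖ
  algebra := centerAlgebra π σ
  act := endAct hπ σ
  act_smul h z a := by
    change endAct hπ σ h (.op (centerToEndN π σ z) * a) =
      .op (centerToEndN π σ (centerAct k hπ h z)) * endAct hπ σ h a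
    rw [map_mul, endAct_center]

variable (π) in
/-- `V` is an `N`-generator: its restriction to `N` contains every irreducible representation of
`N` over `k` as a direct summand. -/
def IsNGenerator : Prop :=
  ∀ (W : Type u) [AddCommGroup W] [Module k W] (ω : Representation k π.ker W),
    ω.IsIrreducible →
      ∃ (i : ω.IntertwiningMap (resN π σ)) (p : (resN π σ).IntertwiningMap ω), ∀ w, p (i w) = w

/-- `θ ∈ Br^H(Z)` is the canonical class of the extension: `N`-generators exist, and for every
`N`-generator `V` the algebra `End_N(V)ᵒᵖ` is Azumaya over `Z` with class `θ`. -/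
def IsCanonicalClass (θ : RBr (centerAct k hπ)) : Prop :=
  (∃ (V : Type u) (_ : AddCommGroup V) (_ : Module k V) (_ : FiniteDimensional k V)
    (σ : Representation k G V), IsNGenerator π σ) ∧
  ∀ (V : Type u) [AddCommGroup V] [Module k V] [FiniteDimensional k V]
    (σ : Representation k G V), IsNGenerator π σ →
      ∃ hA : IsAzumaya (ZN k π) (endAlgZ hπ σ).carrier, RBr.mk ⟨endAlgZ hπ σ, hA⟩ = θ

end Extension

/-! ### Equivariant structures on products -/

section Products

variable {H : Type u} [Group H]

/-- The action of `H` on `Spec R` induced by an action `τ` on `R`: `h` acts as `Spec (τ h⁻¹)`. -/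
def specAct {R : Type u} [CommRing R] (τ : H →* RingAut R) : H →* Aut (Spec (.of R)) where
  toFun h :=
    { hom := Spec.map (CommRingCat.ofHom (τ h⁻¹ : R →+* R))
      inv := Spec.map (CommRingCat.ofHom (τ h : R →+* R))
      hom_inv_id := by
        rw [← Spec.map_comp, ← CommRingCat.ofHom_comp, ← Spec.map_id]
        congr 1
        ext r
        change (τ h⁻¹ * τ h) r = r
        rw [← map_mul, inv_mul_cancel, map_one]; rfl
      inv_hom_id := by
        rw [← Spec.map_comp, ← CommRingCat.ofHom_comp, ← Spec.map_id]
        congr 1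
        ext r
        change (τ h * τ h⁻¹) r = r
        rw [← map_mul, mul_inv_cancel, map_one]; rfl }
  map_one' := by
    refine Iso.ext ?_
    change Spec.map (CommRingCat.ofHom (τ 1⁻¹ : R →+* R)) = 𝟙 _
    rw [inv_one, map_one]
    exact Spec.map_id _
  map_mul' g h := by
    refine Iso.ext ?_
    change Spec.map (CommRingCat.ofHom (τ (g * h)⁻¹ : R →+* R)) =
      Spec.map (CommRingCat.ofHom (τ h⁻¹ : R →+* R)) ≫
        Spec.map (CommRingCat.ofHom (τ g⁻¹ : R →+* R))
    rw [← Spec.map_comp, mul_inv_rev, map_mul]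
    rfl

/-- `H` acts on `X` by automorphisms over `S`. -/
def IsOver {X S : Scheme.{u}} (ρ : H →* Aut X) (s : X ⟶ S) : Prop := ∀ h, (ρ h).hom ≫ s = s

lemma IsOver.inv {X S : Scheme.{u}} {ρ : H →* Aut X} {s : X ⟶ S} (hs : IsOver ρ s) (h : H) :
    (ρ h).inv ≫ s = s := by
  have := hs h⁻¹
  rwa [map_inv] at this

lemma IsOver.isEquivariant {k : Type u} [CommRing k] {X : Scheme.{u}} {ρ : H →* Aut X}
    {s : X ⟶ Spec (.of k)} (hs : IsOver ρ s) : IsEquivariant (1 : H →* RingAut k) ρ s := by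
  intro h
  rw [hs h]
  exact (Category.comp_id s).symm.trans (congrArg (s ≫ ·) (Spec.map_id _).symm)

variable {X Y S : Scheme.{u}} {ρ : H →* Aut X} {ρ' : H →* Aut Y} {s : X ⟶ S} {t : Y ⟶ S}

/-- The endomorphism of `Y ×_S X` induced by endomorphisms of `Y` and `X` over `S`. -/
def prodMap (a : Y ⟶ Y) (b : X ⟶ X) (ha : a ≫ t = t) (hb : b ≫ s = s) :
    Limits.pullback t s ⟶ Limits.pullback t s :=
  Limits.pullback.lift (Limits.pullback.fst t s ≫ a) (Limits.pullback.snd t s ≫ b)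
    (by rw [Category.assoc, Category.assoc, ha, hb, Limits.pullback.condition])

lemma prodMap_fst (a : Y ⟶ Y) (b : X ⟶ X) (ha : a ≫ t = t) (hb : b ≫ s = s) :
    prodMap a b ha hb ≫ Limits.pullback.fst t s = Limits.pullback.fst t s ≫ a :=
  Limits.pullback.lift_fst _ _ _

lemma prodMap_snd (a : Y ⟶ Y) (b : X ⟶ X) (ha : a ≫ t = t) (hb : b ≫ s = s) :
    prodMap a b ha hb ≫ Limits.pullback.snd t s = Limits.pullback.snd t s ≫ b :=
  Limits.pullback.lift_snd _ _ _

lemma prodMap_id (a : Y ⟶ Y) (b : X ⟶ X) (ha : a ≫ t = t) (hb : b ≫ s = s) (ha' : a = 𝟙 Y)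
    (hb' : b = 𝟙 X) : prodMap a b ha hb = 𝟙 (Limits.pullback t s) := by
  subst ha' hb'
  apply Limits.pullback.hom_ext
  · rw [prodMap_fst, Category.comp_id, Category.id_comp]
  · rw [prodMap_snd, Category.comp_id, Category.id_comp]

lemma prodMap_comp (a a' c : Y ⟶ Y) (b b' d : X ⟶ X) (ha : a ≫ t = t) (hb : b ≫ s = s)
    (ha' : a' ≫ t = t) (hb' : b' ≫ s = s) (hc : c ≫ t = t) (hd : d ≫ s = s) (e : c = a ≫ a')
    (e' : d = b ≫ b') : prodMap a b ha hb ≫ prodMap a' b' ha' hb' = prodMap c d hc hd := by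
  subst e e'
  apply Limits.pullback.hom_ext
  · rw [Category.assoc, prodMap_fst, ← Category.assoc, prodMap_fst, prodMap_fst, Category.assoc]
  · rw [Category.assoc, prodMap_snd, ← Category.assoc, prodMap_snd, prodMap_snd, Category.assoc]

/-- The diagonal action of `H` on the fibre product `Y ×_S X`. -/
def prodAct (ht : IsOver ρ' t) (hs : IsOver ρ s) : H →* Aut (Limits.pullback t s) where
  toFun h :=
    { hom := prodMap (ρ' h).hom (ρ h).hom (ht h) (hs h)
      inv := prodMap (ρ' h).inv (ρ h).inv (ht.inv h) (hs.inv h)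
      hom_inv_id := (prodMap_comp _ _ _ _ _ _ _ _ _ _ (Category.id_comp t)
        (Category.id_comp s) (ρ' h).hom_inv_id.symm (ρ h).hom_inv_id.symm).trans
          (prodMap_id _ _ _ _ rfl rfl)
      inv_hom_id := (prodMap_comp _ _ _ _ _ _ _ _ _ _ (Category.id_comp t)
        (Category.id_comp s) (ρ' h).inv_hom_id.symm (ρ h).inv_hom_id.symm).trans
          (prodMap_id _ _ _ _ rfl rfl) }
  map_one' := Iso.ext (prodMap_id _ _ (ht 1) (hs 1) (congrArg Iso.hom (map_one ρ'))
    (congrArg Iso.hom (map_one ρ)))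
  map_mul' g h := Iso.ext (prodMap_comp _ _ _ _ _ _ (ht h) (hs h) (ht g) (hs g)
    (ht (g * h)) (hs (g * h)) (congrArg Iso.hom (map_mul ρ' g h))
    (congrArg Iso.hom (map_mul ρ g h))).symm

end Products

end EquivSheaf

namespace EquivSheaf

/-! ### The schemes and functors in the theorem -/

section Main

variable {k : Type u} [Field k] {G H : Type u} [Group G] [Group H] {π : G →* H}
  (hπ : Function.Surjective π)

/-- The pullback `f^* A` of an `H`-equivariant Azumaya `R`-algebra along an `H`-equivariant
morphism `f : X ⟶ Spec R`. -/
def RAz.pull {R : Type u} [CommRing R] {τ : H →* RingAut R} {X : Scheme.{u}} {ρ : H →* Aut X}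
    {f : X ⟶ Spec (.of R)} (hf : IsEquivariant τ ρ f) (A : RAz τ) : EqAlg ρ :=
  haveI := A.2
  pullEqAlg hf A.1

variable (k π) in
/-- The structure morphism of the finite `k`-scheme `Irr(N) = Spec Z`. -/
def irrStr : Spec (.of (ZN k π)) ⟶ Spec (.of k) :=
  Spec.map (CommRingCat.ofHom (algebraMap k (ZN k π)))

lemma centerAct_algebraMap (h : H) (c : k) :
    centerAct k hπ h (algebraMap k (ZN k π) c) = algebraMap k (ZN k π) c := by
  obtain ⟨g, rfl⟩ := hπ h
  rw [centerAct_apply, centerActG_apply]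
  apply ZN.incl_injective
  rw [incl_conjCenter, AlgHom.commutes, AlgEquiv.commutes]

lemma irr_isOver : IsOver (specAct (centerAct k hπ)) (irrStr k π) := by
  intro h
  change Spec.map (CommRingCat.ofHom (centerAct k hπ h⁻¹ : ZN k π →+* ZN k π)) ≫
    Spec.map (CommRingCat.ofHom (algebraMap k (ZN k π))) = _
  rw [← Spec.map_comp, ← CommRingCat.ofHom_comp]
  congr 2
  ext c
  exact centerAct_algebraMap hπ h⁻¹ c

variable {X : Scheme.{u}} {s : X ⟶ Spec (.of k)} {ρ : H →* Aut X} (hs : IsOver ρ s)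

variable (π s) in
/-- The scheme `Irr(N) × X`, the product being over `k`. -/
def irrProd : Scheme.{u} := Limits.pullback (irrStr k π) s

/-- The diagonal action of `H` on `Irr(N) × X`. -/
def irrProdAct : H →* Aut (irrProd π s) := prodAct (irr_isOver hπ) hs

variable (π s) in
/-- The projection `f : Irr(N) × X ⟶ Irr(N)`. -/
def irrProj : irrProd π s ⟶ Spec (.of (ZN k π)) := Limits.pullback.fst (irrStr k π) s

lemma irrProj_equivariant : IsEquivariant (centerAct k hπ) (irrProdAct hπ hs) (irrProj π s) :=
  fun h => prodMap_fst _ _ (irr_isOver hπ h) (hs h)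

variable {V : Type u} [AddCommGroup V] [Module k V] [FiniteDimensional k V]
  (σ : Representation k G V)

instance : Module.Finite k (endAlg hπ σ).carrier :=
  inferInstanceAs (Module.Finite k (EndN π σ)ᵐᵒᵖ)

/-- The `H`-equivariant sheaf of algebras `𝒜 = End_N(V)ᵒᵖ ⊗_k 𝒪_X`. -/
def calA : EqAlg ρ := pullEqAlg hs.isEquivariant (endAlg hπ σ)

/-- The section `1 ⊗ φ` of `𝒜`, for `φ ∈ End_N(V)`. -/
def constSec (φ : EndN π σ) (U : X.Opens) : Γ((calA hπ hs σ).mod, U) :=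
  (1 ⊗ₜ[k] MulOpposite.op φ : PullSec s (EndN π σ)ᵐᵒᵖ U)

/-- A pairing between the right `𝒜`-module `𝒱 = V ⊗_k 𝒪_X` and a left `𝒜`-module `M`, with values
in a sheaf of `𝒪_X`-modules `F`, which is `𝒪_X`-bilinear and `𝒜`-balanced. It is determined by
its values `⟨v, m⟩` on elements `v` of `V`. -/
structure VPairing (M : AlgMod (calA hπ hs σ).toSheafAlg) (F : X.Modules) where
  toFun : ∀ U : X.Opens, V →+ Γ(M.mod, U) →ₗ[Γ(X, U)] Γ(F, U)
  map_ksmul : ∀ U (c : k) v m, toFun U (c • v) m = baseHom s U c • toFun U v m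
  balanced : ∀ U (φ : EndN π σ) v m,
    toFun U ((φ : Module.End k V) v) m = toFun U v (M.smul U (constSec hπ hs σ φ U) m)
  map_res : ∀ {U W : X.Opens} (i : W ≤ U) v m,
    res F i (toFun U v m) = toFun W v (res M.mod i m)

/-- `coh^G(X)`, where `G` acts on `X` through `π : G →* H`. -/
abbrev CohG (π : G →* H) (ρ : H →* Aut X) := EqCoh (ρ.comp π)

/-- `coh^N(X)`, where `N = ker π` acts (trivially) on `X` through `G`. -/
abbrev CohN (π : G →* H) (ρ : H →* Aut X) := EqCoh ((ρ.comp π).comp π.ker.subtype)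

/-- The functor `coh^G(X) ⥤ coh^N(X)` restricting the equivariant structure to `N`. -/
abbrev forgetGN (π : G →* H) (ρ : H →* Aut X) : CohG π ρ ⥤ CohN π ρ :=
  EqCoh.restrictGroup π.ker.subtype

variable {hπ hs σ} in
/-- A map `φ` from `V` to the sections over `U` of an `N`-equivariant sheaf `F` is `k`-linear and
`N`-equivariant. As `n(U) = U` for `n ∈ N`, sections over `U` and over `n(U)` are compared on
all open subsets of both. -/
def IsNHom (σ : Representation k G V) (s : X ⟶ Spec (.of k)) (F : CohN π ρ) (U : X.Opens)
    (φ : V →+ Γ(F.mod, U)) : Prop :=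
  (∀ (c : k) v, φ (c • v) = baseHom s U c • φ v) ∧
  ∀ (n : π.ker) v (W : X.Opens) (i : W ≤ U)
    (j : W ≤ translate ((ρ.comp π).comp π.ker.subtype) n U),
    res F.mod i (φ (σ n v)) = res F.mod j (F.act n U (φ v))

variable {hπ hs σ}

/-- The map `⟨-, m⟩ : V → Γ(F, U)` defined by a pairing and a section `m`. -/
def VPairing.curry {M : AlgMod (calA hπ hs σ).toSheafAlg} {F : X.Modules}
    (β : VPairing hπ hs σ M F) (U : X.Opens) (m : Γ(M.mod, U)) : V →+ Γ(F, U) where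
  toFun v := β.toFun U v m
  map_zero' := by rw [map_zero]; rfl
  map_add' v w := by rw [map_add]; rfl

/-- The pairing is `N`-equivariant (`N` acting trivially on `M`). -/
def VPairing.IsNEquiv {M : AlgMod (calA hπ hs σ).toSheafAlg} {F : CohN π ρ}
    (β : VPairing hπ hs σ M F.mod) : Prop :=
  ∀ U m, IsNHom σ s F U (β.curry U m)

/-- The pairing identifies `M` with the sheaf `ℋom_N(𝒱, F)`, whose sections over `U` are the
`N`-equivariant `k`-linear maps `V → Γ(F, U)`. -/
def VPairing.IsPerfect {M : AlgMod (calA hπ hs σ).toSheafAlg} {F : CohN π ρ}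
    (β : VPairing hπ hs σ M F.mod) : Prop :=
  ∀ U φ, IsNHom σ s F U φ → ∃! m, β.curry U m = φ

/-- The pairing is `G`-equivariant, `G` acting on `M` through `H`. -/
def VPairing.IsGEquiv {M : EqCohAlg (calA hπ hs σ)} {F : CohG π ρ}
    (β : VPairing hπ hs σ M.toAlgMod F.mod) : Prop :=
  ∀ (g : G) U v m, F.act g U (β.toFun U v m) =
    β.toFun (translate ρ (π g) U) (σ g v) (M.act (π g) U m)

variable (hπ hs σ)

/-- The functor `Φ : coh(𝒜) ⥤ coh^N(X)` is `𝒱 ⊗_𝒜 -`, through natural universal `N`-equivariant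
pairings, and these pairings identify `M` with `ℋom_N(𝒱, Φ M)`. -/
structure IsTensorN (Φ : CohAlg (calA hπ hs σ).toSheafAlg ⥤ CohN π ρ) where
  pair : ∀ M, VPairing hπ hs σ M.toAlgMod (Φ.obj M).mod
  equivariant : ∀ M, (pair M).IsNEquiv
  natural : ∀ {M M' : CohAlg (calA hπ hs σ).toSheafAlg} (f : M ⟶ M') U v m,
    (Φ.map f).hom.app U ((pair M).toFun U v m) = (pair M').toFun U v (f.hom.app U m)
  universal : ∀ M (F : CohN π ρ) (γ : VPairing hπ hs σ M.toAlgMod F.mod), γ.IsNEquiv →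
    ∃! g : Φ.obj M ⟶ F, ∀ U v m, g.hom.app U ((pair M).toFun U v m) = γ.toFun U v m
  perfect : ∀ M, (pair M).IsPerfect

/-- The functor `Φ : coh^H(𝒜) ⥤ coh^G(X)` is `𝒱 ⊗_𝒜 -`, through natural universal
`G`-equivariant pairings, and these pairings identify `M` with `ℋom_N(𝒱, Φ M)`. -/
structure IsTensorG (Φ : EqCohAlg (calA hπ hs σ) ⥤ CohG π ρ) where
  pair : ∀ M, VPairing hπ hs σ M.toAlgMod (Φ.obj M).mod
  equivariant : ∀ M, (pair M).IsGEquiv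
  natural : ∀ {M M' : EqCohAlg (calA hπ hs σ)} (f : M ⟶ M') U v m,
    (Φ.map f).hom.app U ((pair M).toFun U v m) = (pair M').toFun U v (f.hom.app U m)
  universal : ∀ M (F : CohG π ρ) (γ : VPairing hπ hs σ M.toAlgMod F.mod), γ.IsGEquiv →
    ∃! g : Φ.obj M ⟶ F, ∀ U v m, g.hom.app U ((pair M).toFun U v m) = γ.toFun U v m
  perfect : ∀ M,
    VPairing.IsPerfect (F := (forgetGN π ρ).obj (Φ.obj M)) (pair M)

end Main

end EquivSheaf

end

open EquivSheaf

noncomputable section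
namespace EquivSheaf

section Basic
variable {X : Scheme.{u}}

lemma res_self (M : X.Modules) {U : X.Opens} (i : U ≤ U) (s : Γ(M, U)) : res M i s = s := by
  change (M.presheaf.map (𝟙 _)).hom s = s
  simp

lemma res_res (M : X.Modules) {U V W : X.Opens} (i : V ≤ U) (j : W ≤ V) (s : Γ(M, U)) :
    res M j (res M i s) = res M (j.trans i) s := by
  simp only [res]
  rw [← AddCommGrpCat.comp_apply, ← M.presheaf.map_comp]
  rfl

lemma res_osmul (M : X.Modules) {U V : X.Opens} (i : V ≤ U) (r : Γ(X, U)) (s : Γ(M, U)) :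
    res M i (r • s) = resO i r • res M i s :=
  M.map_smul (homOfLE i) r s

lemma hom_res {M N : X.Modules} (f : M ⟶ N) {U V : X.Opens} (i : V ≤ U) (s : Γ(M, U)) :
    f.app V (res M i s) = res N i (f.app U s) :=
  (ConcreteCategory.congr_hom (f.mapPresheaf.naturality (homOfLE i).op) s)

/-- A family of linear maps compatible with restriction is a morphism of sheaves of modules. -/
def mkHom {M N : X.Modules} (φ : ∀ U : X.Opens, Γ(M, U) →ₗ[Γ(X, U)] Γ(N, U))
    (h : ∀ {U V : X.Opens} (i : V ≤ U) s, φ V (res M i s) = res N i (φ U s)) : M ⟶ N :=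
  ⟨{ app := fun U => ModuleCat.ofHom (φ U.unop)
     naturality := fun {U V} i => by
      ext s
      exact h i.unop.le s }⟩

lemma hom_ext' {M N : X.Modules} {f g : M ⟶ N} (h : ∀ U s, f.app U s = g.app U s) : f = g := by
  apply Scheme.Modules.hom_ext
  intro U
  ext s
  exact h U s

/-- The linear map on sections given by a morphism. -/
def homL {M N : X.Modules} (f : M ⟶ N) (U : X.Opens) : Γ(M, U) →ₗ[Γ(X, U)] Γ(N, U) where
  toFun := f.app U
  map_add' := map_add _
  map_smul' r s := f.app_smul r s

lemma isIso_of_bijective {M N : X.Modules} (f : M ⟶ N)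
    (h : ∀ U, Function.Bijective (f.app U)) : IsIso f := by
  rw [Scheme.Modules.Hom.isIso_iff_isIso_app]
  intro U
  exact (ConcreteCategory.isIso_iff_bijective _).mpr (h U)

lemma bijective_of_isIso {M N : X.Modules} (f : M ⟶ N) [IsIso f] (U : X.Opens) :
    Function.Bijective (f.app U) :=
  ConcreteCategory.bijective_of_isIso _

/-- Sections of a sheaf of modules agreeing on a cover are equal. -/
lemma section_ext (M : X.Modules) {U : X.Opens} {s t : Γ(M, U)}
    (h : ∀ x ∈ U, ∃ (V : X.Opens) (i : V ≤ U), x ∈ V ∧ res M i s = res M i t) : s = t := by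
  apply TopCat.Presheaf.IsSheaf.section_ext M.isSheaf
  intro x hx
  obtain ⟨V, i, hV, e⟩ := h x hx
  exact ⟨V, i, hV, e⟩

/-- Gluing of sections of a sheaf of modules. -/
lemma exists_glue (M : X.Modules) {ι : Type*} (V : ι → X.Opens) (U : X.Opens)
    (hV : ∀ a, V a ≤ U) (hU : ∀ x ∈ U, ∃ a, x ∈ V a) (sf : ∀ a, Γ(M, V a))
    (h : ∀ a b (W : X.Opens) (i : W ≤ V a) (j : W ≤ V b), res M i (sf a) = res M j (sf b)) :
    ∃! s : Γ(M, U), ∀ a, res M (hV a) s = sf a := by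
  obtain rfl : U = iSup V := le_antisymm (fun x hx => by
    obtain ⟨a, ha⟩ := hU x hx
    exact TopologicalSpace.Opens.mem_iSup.mpr ⟨a, ha⟩) (iSup_le hV)
  exact TopCat.Sheaf.existsUnique_gluing ⟨M.presheaf, M.isSheaf⟩ V sf
    (fun a b => h a b _ _ _)

end Basic

section QC
variable {X : Scheme.{u}}

/-- Sections of `M` over basic open subsets of `U` are localizations of the sections over `U`. -/
def IsLocAt (M : X.Modules) (U : X.Opens) : Prop :=
  ∀ f : Γ(X, U),
    (∀ s : Γ(M, U), res M (X.basicOpen_le f) s = 0 → ∃ n : ℕ, f ^ n • s = 0) ∧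
    ∀ t : Γ(M, X.basicOpen f), ∃ (n : ℕ) (s : Γ(M, U)),
      res M (X.basicOpen_le f) s = resO (X.basicOpen_le f) f ^ n • t

lemma appIso_fromSpec_inv {U : X.Opens} (hU : IsAffineOpen U) (W : (Spec Γ(X, U)).Opens)
    (h : hU.fromSpec ''ᵁ W ≤ U) (r : Γ(X, U)) :
    (hU.fromSpec.appIso W).inv ((Spec Γ(X, U)).presheaf.map W.leTop.op
      ((Scheme.ΓSpecIso Γ(X, U)).inv r)) = resO h r := by
  apply (ConcreteCategory.bijective_of_isIso (hU.fromSpec.appIso W).hom).1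
  rw [← CommRingCat.comp_apply, Iso.inv_hom_id]
  have h2 := IsAffineOpen.fromSpec_app_self hU
  have h3 : (hU.fromSpec.app U) r = (Spec Γ(X, U)).presheaf.map (eqToHom hU.fromSpec_preimage_self).op
    ((Scheme.ΓSpecIso Γ(X, U)).inv r) := by rw [h2]; rfl
  rw [Scheme.Hom.appIso_hom']
  change _ = (hU.fromSpec.appLE _ W _) ((X.presheaf.map (homOfLE h).op) r)
  have h4 : (hU.fromSpec.appLE (hU.fromSpec ''ᵁ W) W (hU.fromSpec.preimage_image_eq W).ge)
      ((X.presheaf.map (homOfLE h).op) r) = (Spec Γ(X, U)).presheaf.map W.leTop.op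
      ((Scheme.ΓSpecIso Γ(X, U)).inv r) := by
    rw [← CommRingCat.comp_apply, Scheme.Hom.map_appLE, Scheme.Hom.appLE, CommRingCat.comp_apply,
      h3, ← CommRingCat.comp_apply, ← Functor.map_comp]
    rfl
  exact h4.symm

lemma restrict_fromSpec_smul (M : X.Modules) {U : X.Opens} (hU : IsAffineOpen U)
    (W : (Spec Γ(X, U)).Opens) (h : hU.fromSpec ''ᵁ W ≤ U) (r : Γ(X, U))
    (x : Γ(M, hU.fromSpec ''ᵁ W)) :
    (show Γ(M, hU.fromSpec ''ᵁ W) from (r • (show Γ(M.restrict hU.fromSpec, W) from x))) =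
      resO h r • x := by
  rw [Scheme.Modules.smul_Spec_def, ← appIso_fromSpec_inv hU W h r]
  rfl

lemma isLocAt_iff_of_eq (M : X.Modules) {U U' : X.Opens} (hU : U' = U) (f : Γ(X, U))
    {V : X.Opens} (hV : V = X.basicOpen f) (i : V ≤ U') :
    ((∀ s : Γ(M, U), res M (X.basicOpen_le f) s = 0 → ∃ n : ℕ, f ^ n • s = 0) ∧
    ∀ t : Γ(M, X.basicOpen f), ∃ (n : ℕ) (s : Γ(M, U)),
      res M (X.basicOpen_le f) s = resO (X.basicOpen_le f) f ^ n • t) ↔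
    ((∀ s : Γ(M, U'), res M i s = 0 → ∃ n : ℕ, (resO hU.le f) ^ n • s = 0) ∧
    ∀ t : Γ(M, V), ∃ (n : ℕ) (s : Γ(M, U')),
      res M i s = (resO (i.trans hU.le) f) ^ n • t) := by
  subst hU hV
  simp only [resO_self]

lemma isUnit_resO_basicOpen {U V : X.Opens} (f : Γ(X, U)) (h : V ≤ X.basicOpen f) (i : V ≤ U) :
    IsUnit (resO i f) := by
  have := X.toRingedSpace.isUnit_res_basicOpen f
  have h2 : IsUnit (resO (X.basicOpen_le f) f) := this
  have := h2.map (resO h)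
  rwa [resO_resO] at this

lemma isIso_fromTildeΓ_restrict_iff (M : X.Modules) {U : X.Opens} (hU : IsAffineOpen U) :
    IsIso (M.restrict hU.fromSpec).fromTildeΓ ↔ IsLocAt M U := by
  rw [isIso_fromTildeΓ_iff_isLocalizing]
  refine forall_congr' fun f => ?_
  have eU : hU.fromSpec ''ᵁ ⊤ = U := by
    rw [Scheme.Hom.image_top_eq_opensRange, hU.opensRange_fromSpec]
  have eV := hU.fromSpec_image_basicOpen f
  have i : hU.fromSpec ''ᵁ (PrimeSpectrum.basicOpen f) ≤ hU.fromSpec ''ᵁ ⊤ :=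
    Scheme.Hom.image_mono _ le_top
  rw [isLocAt_iff_of_eq M eU f eV i]
  have hs : ∀ (n : ℕ) (x : Γ(M.restrict hU.fromSpec, ⊤)),
      (show Γ(M, hU.fromSpec ''ᵁ ⊤) from (f ^ n • x : Γ(M.restrict hU.fromSpec, ⊤))) =
        (resO eU.le f) ^ n • (show Γ(M, hU.fromSpec ''ᵁ ⊤) from x) := by
    intro n x
    rw [← map_pow]
    exact restrict_fromSpec_smul M hU ⊤ _ _ x
  let D : (Spec Γ(X, U)).Opens := PrimeSpectrum.basicOpen f
  change IsLocalizedModule (.powers f) ((modulesSpecToSheaf.obj (M.restrict hU.fromSpec)).obj.map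
    D.leTop.op).hom ↔ _
  have ht : ∀ (n : ℕ) (x : Γ(M.restrict hU.fromSpec, D)),
      (show Γ(M, hU.fromSpec ''ᵁ D) from (f ^ n • x : Γ(M.restrict hU.fromSpec, D))) =
        (resO (i.trans eU.le) f) ^ n • (show Γ(M, hU.fromSpec ''ᵁ D) from x) := by
    intro n x
    rw [← map_pow]
    exact restrict_fromSpec_smul M hU _ _ _ x
  constructor
  · intro h
    constructor
    · intro s hs0
      obtain ⟨⟨_, n, rfl⟩, hc⟩ := h.exists_of_eq (x₁ := (show Γ(M.restrict hU.fromSpec, ⊤) from s))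
        (x₂ := 0) (by rw [map_zero]; exact hs0)
      refine ⟨n, (hs n s).symm.trans ?_⟩
      rw [smul_zero] at hc
      exact hc
    · intro t
      obtain ⟨⟨s, ⟨_, n, rfl⟩⟩, hc⟩ := h.surj (show Γ(M.restrict hU.fromSpec, D) from t)
      exact ⟨n, s, ((ht n t).symm.trans hc).symm⟩
  · rintro ⟨h1, h2⟩
    refine ⟨?_, ?_, ?_⟩
    · rintro ⟨_, n, rfl⟩
      rw [map_pow]
      exact ((M.restrict hU.fromSpec).isUnit_algebraMap_end_of_le_basicOpen f le_rfl).pow n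
    · intro t
      obtain ⟨n, s, hc⟩ := h2 t
      exact ⟨⟨s, ⟨_, n, rfl⟩⟩, (ht n t).trans hc.symm⟩
    · intro s s' e
      obtain ⟨n, hn⟩ := h1 (show Γ(M, hU.fromSpec ''ᵁ ⊤) from (s - s' : Γ(M.restrict hU.fromSpec, ⊤)))
        ((map_sub (res M i) _ _).trans (sub_eq_zero.mpr e))
      refine ⟨⟨_, n, rfl⟩, sub_eq_zero.mp ((smul_sub (f ^ n)
        (s : Γ(M.restrict hU.fromSpec, ⊤)) s').symm.trans ?_)⟩
      exact (hs n (s - s' : Γ(M.restrict hU.fromSpec, ⊤))).trans hn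

end QC

section QC2
variable {X : Scheme.{u}}

lemma isLocAt_of_isQuasicoherent (M : X.Modules) (h : M.IsQuasicoherent) {U : X.Opens}
    (hU : IsAffineOpen U) : IsLocAt M U := by
  rw [← isIso_fromTildeΓ_restrict_iff M hU]
  infer_instance

lemma nonempty_presentation_of_isIso {R : CommRingCat.{u}} (M : (Spec R).Modules)
    [IsIso M.fromTildeΓ] : Nonempty M.Presentation := by
  exact ⟨@SheafOfModules.Presentation.ofIsIso.{u, u, u} _ _ _ _ _ _ _ _
    M.fromTildeΓ (inferInstance : IsIso M.fromTildeΓ)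
    (presentationTilde.{u} _ .univ (by simp) _ (Submodule.span_eq _))⟩

lemma nonempty_presentation_over (M : X.Modules) (U : X.Opens)
    (P : (M.restrict U.ι).Presentation) :
    Nonempty (SheafOfModules.Presentation (SheafOfModules.over M U)) := by
  let e := Scheme.Modules.overEquiv U
  let η : e.functor.obj (SheafOfModules.unit.{u} (X.ringCatSheaf.over U)) ≅
      SheafOfModules.unit.{u} (Scheme.ringCatSheaf U) :=
    (Scheme.Modules.overFunctorEquiv U).app (SheafOfModules.unit.{u} X.ringCatSheaf) ≪≫
      Scheme.Modules.restrictUnitIso U.ι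
  let P' : (e.functor.obj (SheafOfModules.over M U)).Presentation :=
    @SheafOfModules.Presentation.ofIsIso.{u, u, u} _ _ _ _ _ _ _ _
      ((Scheme.Modules.overFunctorEquiv U).app M).inv
      (Iso.isIso_inv ((Scheme.Modules.overFunctorEquiv U).app M)) P
  have hc : Limits.PreservesColimitsOfSize.{u, u} e.inverse := inferInstance
  exact ⟨@SheafOfModules.Presentation.ofIsIso.{u, u, u} _ _ _ _ _ _ _ _
    (e.unitIso.app (SheafOfModules.over M U)).inv (Iso.isIso_inv _)
    (@SheafOfModules.Presentation.map _ _ _ _ _ _ _ _ _ _ _ _ _ P' e.inverse hc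
      (e.inverse.mapIso η.symm ≪≫ (e.unitIso.app _).symm).symm)⟩

lemma nonempty_presentation_over_of_isLocAt (M : X.Modules) {U : X.Opens} (hU : IsAffineOpen U)
    (h : IsLocAt M U) : Nonempty (SheafOfModules.Presentation (SheafOfModules.over M U)) := by
  have := (isIso_fromTildeΓ_restrict_iff M hU).mpr h
  obtain ⟨P⟩ := nonempty_presentation_of_isIso (M.restrict hU.fromSpec)
  refine nonempty_presentation_over M U ?_
  let e : Scheme.Modules.restrictFunctor hU.fromSpec ⋙
      Scheme.Modules.restrictFunctor hU.isoSpec.hom ≅ Scheme.Modules.restrictFunctor U.ι :=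
    (Scheme.Modules.restrictFunctorComp _ _).symm ≪≫
      Scheme.Modules.restrictFunctorCongr hU.isoSpec_hom_fromSpec
  exact @SheafOfModules.Presentation.ofIsIso.{u, u, u} _ _ _ _ _ _ _ _ (e.app M).hom
    (Iso.isIso_hom (e.app M))
    (Scheme.Modules.presentationRestrict hU.isoSpec.hom P)

lemma isQuasicoherent_of_isLocAt (M : X.Modules) {ι : Type u} (U : ι → X.Opens)
    (hU : ∀ a, IsAffineOpen (U a)) (hc : ⨆ a, U a = ⊤) (h : ∀ a, IsLocAt M (U a)) :
    M.IsQuasicoherent := by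
  have P := fun a => nonempty_presentation_over_of_isLocAt M (hU a) (h a)
  let q : SheafOfModules.QuasicoherentData.{u, u, u, u} (R := X.ringCatSheaf) M :=
    { I := ι
      X := U
      coversTop := (Opens.coversTop_iff _ U).mpr hc
      presentation := fun a => (P a).some }
  exact q.isQuasicoherent

lemma isQuasicoherent_of_forall_isLocAt (M : X.Modules)
    (h : ∀ U : X.Opens, IsAffineOpen U → IsLocAt M U) : M.IsQuasicoherent :=
  isQuasicoherent_of_isLocAt M (fun U : X.affineOpens => U.1) (fun U => U.2)
    (iSup_affineOpens_eq_top X) (fun U => h U.1 U.2)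

/-- Coherence only depends on the sections over affine open subsets. -/
lemma isCoherent_of_forall (M : X.Modules) (h : ∀ U : X.Opens, IsAffineOpen U →
    IsLocAt M U ∧ Module.Finite Γ(X, U) Γ(M, U)) : IsCoherent M :=
  ⟨isQuasicoherent_of_forall_isLocAt M fun U hU => (h U hU).1, fun U hU => (h U hU).2⟩

lemma IsCoherent.isLocAt {M : X.Modules} (h : IsCoherent M) {U : X.Opens} (hU : IsAffineOpen U) :
    IsLocAt M U :=
  isLocAt_of_isQuasicoherent M h.1 hU

/-- A module that is a direct summand of a finite power of a coherent one is coherent. -/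
lemma IsCoherent.of_retract {M N : X.Modules} (h : IsCoherent M) {ι : Type*} [Finite ι]
    (i : ι → (N ⟶ M)) (r : ι → (M ⟶ N))
    (hir : ∀ U s, ∑ᶠ a, (r a).app U ((i a).app U s) = s) : IsCoherent N := by
  classical
  have := Fintype.ofFinite ι
  simp only [finsum_eq_sum_of_fintype] at hir
  refine isCoherent_of_forall N fun U hU => ⟨fun f => ⟨fun s hs => ?_, fun t => ?_⟩, ?_⟩
  · have h1 : ∀ a, ∃ n : ℕ, f ^ n • (i a).app U s = 0 := fun a =>
      (h.isLocAt hU f).1 _ (by rw [← hom_res, hs, map_zero])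
    choose n hn using h1
    refine ⟨∑ a, n a, ?_⟩
    rw [← hir U (f ^ _ • s)]
    refine Finset.sum_eq_zero fun a _ => ?_
    rw [Scheme.Modules.Hom.app_smul,
      ← Finset.sum_erase_add _ _ (Finset.mem_univ a), pow_add, mul_smul, hn, smul_zero, map_zero]
  · have h1 := fun a => (h.isLocAt hU f).2 ((i a).app _ t)
    choose n s hs using h1
    refine ⟨∑ a, n a, ∑ a, (r a).app U (f ^ (∑ b ∈ Finset.univ.erase a, n b) • s a), ?_⟩
    rw [map_sum]
    conv_rhs => rw [← hir _ t, Finset.smul_sum]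
    refine Finset.sum_congr rfl fun a _ => ?_
    rw [← hom_res, res_osmul, hs, smul_smul, map_pow, ← pow_add, Scheme.Modules.Hom.app_smul,
      Finset.sum_erase_add _ _ (Finset.mem_univ a)]
  · have := h.2 U hU
    let R : (ι → Γ(M, U)) →ₗ[Γ(X, U)] Γ(N, U) := LinearMap.lsum _ _ ℕ fun a => homL (r a) U
    refine Module.Finite.of_surjective R fun s => ⟨fun a => (i a).app U s, ?_⟩
    simp only [R, LinearMap.lsum_apply, LinearMap.sum_apply, LinearMap.comp_apply,
      LinearMap.proj_apply]
    exact hir U s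

end QC2

section QC3
variable {X : Scheme.{u}}

lemma exists_pow_mul_eq_resO {U : X.Opens} (hU : IsAffineOpen U) (f : Γ(X, U))
    (c : Γ(X, X.basicOpen f)) : ∃ (n : ℕ) (b : Γ(X, U)),
      resO (X.basicOpen_le f) b = resO (X.basicOpen_le f) f ^ n * c := by
  have := hU.isLocalization_basicOpen f
  obtain ⟨⟨b, ⟨_, n, rfl⟩⟩, h⟩ := IsLocalization.surj (Submonoid.powers f) c
  refine ⟨n, b, ?_⟩
  rw [mul_comm, ← map_pow]
  exact h.symm

lemma exists_pow_mul_eq_zero {U : X.Opens} (hU : IsAffineOpen U) (f : Γ(X, U))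
    (c : Γ(X, U)) (hc : resO (X.basicOpen_le f) c = 0) : ∃ n : ℕ, f ^ n * c = 0 := by
  have := hU.isLocalization_basicOpen f
  have h0 : algebraMap Γ(X, U) Γ(X, X.basicOpen f) c = 0 := hc
  obtain ⟨⟨_, n, rfl⟩, h⟩ := (IsLocalization.map_eq_zero_iff (Submonoid.powers f) _ c).mp h0
  exact ⟨n, h⟩

lemma eq_of_resO_basicOpen_smul {M : X.Modules} {U V : X.Opens} (f : Γ(X, U))
    (h : V ≤ X.basicOpen f) (i : V ≤ U) (n : ℕ) {s t : Γ(M, V)}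
    (e : resO i f ^ n • s = resO i f ^ n • t) : s = t :=
  ((isUnit_resO_basicOpen f h i).pow n).smul_left_cancel.mp e

lemma finite_basicOpen {M : X.Modules} {U : X.Opens} (hM : IsLocAt M U) (f : Γ(X, U))
    [h : Module.Finite Γ(X, U) Γ(M, U)] :
    Module.Finite Γ(X, X.basicOpen f) Γ(M, X.basicOpen f) := by
  classical
  obtain ⟨S, hS⟩ := h
  refine ⟨⟨S.image (res M (X.basicOpen_le f)), ?_⟩⟩
  rw [eq_top_iff]
  rintro t -
  obtain ⟨n, s, hs⟩ := (hM f).2 t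
  have key : ∀ s : Γ(M, U), res M (X.basicOpen_le f) s ∈ Submodule.span Γ(X, X.basicOpen f)
      (S.image (res M (X.basicOpen_le f)) : Set Γ(M, X.basicOpen f)) := by
    intro s
    have : s ∈ Submodule.span Γ(X, U) (S : Set Γ(M, U)) := hS ▸ Submodule.mem_top
    induction this using Submodule.span_induction with
    | mem x hx => exact Submodule.subset_span (by simpa using ⟨x, hx, rfl⟩)
    | zero => rw [map_zero]; exact zero_mem _
    | add x y _ _ hx hy => rw [map_add]; exact add_mem hx hy
    | smul a x _ hx => rw [res_osmul]; exact Submodule.smul_mem _ _ hx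
  obtain ⟨w, hw⟩ := (isUnit_resO_basicOpen f le_rfl (X.basicOpen_le f)).pow n
  have : t = (↑w⁻¹ : Γ(X, X.basicOpen f)) • res M (X.basicOpen_le f) s := by
    rw [hs, ← hw, smul_smul, Units.inv_mul, one_smul]
  rw [this]
  exact Submodule.smul_mem _ _ (key s)

lemma finite_of_span_eq_top {M : X.Modules} {U : X.Opens} (hU : IsAffineOpen U)
    (hM : IsLocAt M U) (s : Finset Γ(X, U)) (hs : Ideal.span (s : Set Γ(X, U)) = ⊤)
    (h : ∀ f : s, Module.Finite Γ(X, X.basicOpen f.1) Γ(M, X.basicOpen f.1)) :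
    Module.Finite Γ(X, U) Γ(M, U) := by
  classical
  have h1 : ∀ f : s, ∃ S : Finset Γ(M, U), Submodule.span Γ(X, X.basicOpen f.1)
      (S.image (res M (X.basicOpen_le f.1)) : Set Γ(M, X.basicOpen f.1)) = ⊤ := by
    intro f
    obtain ⟨T, hT⟩ := h f
    choose n m hm using (hM f.1).2
    refine ⟨T.image m, ?_⟩
    rw [eq_top_iff, ← hT, Submodule.span_le]
    intro t ht
    obtain ⟨w, hw⟩ := (isUnit_resO_basicOpen f.1 le_rfl (X.basicOpen_le f.1)).pow (n t)
    have : t = (↑w⁻¹ : Γ(X, X.basicOpen f.1)) • res M (X.basicOpen_le f.1) (m t) := by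
      rw [hm, ← hw, smul_smul, Units.inv_mul, one_smul]
    rw [this]
    exact Submodule.smul_mem _ _ (Submodule.subset_span (by
      simpa using ⟨t, ht, rfl⟩))
  choose S hS using h1
  refine ⟨⟨s.attach.biUnion S, ?_⟩⟩
  rw [eq_top_iff]
  rintro x -
  refine Submodule.mem_of_span_eq_top_of_smul_pow_mem _ (s : Set Γ(X, U)) hs x fun f => ?_
  have hx : res M (X.basicOpen_le f.1) x ∈ Submodule.span Γ(X, X.basicOpen f.1)
      ((S f).image (res M (X.basicOpen_le f.1)) : Set Γ(M, X.basicOpen f.1)) :=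
    hS f ▸ Submodule.mem_top
  have hle : Submodule.span Γ(X, U) (S f : Set Γ(M, U)) ≤
      Submodule.span Γ(X, U) (s.attach.biUnion S : Set Γ(M, U)) :=
    Submodule.span_mono (by
      intro y hy
      simp only [Finset.coe_biUnion, Set.mem_iUnion]
      exact ⟨f, Finset.mem_coe.mpr (Finset.mem_attach _ f), hy⟩)
  have key : ∀ y ∈ Submodule.span Γ(X, X.basicOpen f.1)
      ((S f).image (res M (X.basicOpen_le f.1)) : Set Γ(M, X.basicOpen f.1)),
      ∃ (n : ℕ), ∃ m ∈ Submodule.span Γ(X, U) (S f : Set Γ(M, U)),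
        res M (X.basicOpen_le f.1) m = resO (X.basicOpen_le f.1) f.1 ^ n • y := by
    intro y hy
    induction hy using Submodule.span_induction with
    | mem y hy =>
      simp only [Finset.coe_image, Set.mem_image, Finset.mem_coe] at hy
      obtain ⟨m, hm, rfl⟩ := hy
      exact ⟨0, m, Submodule.subset_span hm, by rw [pow_zero, one_smul]⟩
    | zero => exact ⟨0, 0, zero_mem _, by rw [map_zero, smul_zero]⟩
    | add y z _ _ hy hz =>
      obtain ⟨n, m, hm, e⟩ := hy
      obtain ⟨n', m', hm', e'⟩ := hz
      refine ⟨n + n', f.1 ^ n' • m + f.1 ^ n • m',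
        add_mem (Submodule.smul_mem _ _ hm) (Submodule.smul_mem _ _ hm'), ?_⟩
      rw [map_add, res_osmul, res_osmul, e, e', map_pow, map_pow, smul_smul, smul_smul, smul_add,
        ← pow_add, ← pow_add, add_comm n' n]
    | smul c y _ hy =>
      obtain ⟨n, m, hm, e⟩ := hy
      obtain ⟨n', b, hb⟩ := exists_pow_mul_eq_resO hU f.1 c
      refine ⟨n' + n, b • m, Submodule.smul_mem _ _ hm, ?_⟩
      rw [res_osmul, hb, e, pow_add, smul_smul, smul_smul]
      congr 1
      ring
  obtain ⟨n, m, hm, e⟩ := key _ hx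
  obtain ⟨l, hl⟩ := (hM f.1).1 (f.1 ^ n • x - m) (by
    rw [map_sub, res_osmul, e, map_pow, sub_self])
  refine ⟨l + n, ?_⟩
  rw [smul_sub, sub_eq_zero, smul_smul, ← pow_add] at hl
  rw [hl]
  exact Submodule.smul_mem _ _ (hle hm)

/-- Coherence can be checked on an affine open cover. -/
lemma isCoherent_of_cover (M : X.Modules) {ι : Type u} (U : ι → X.Opens)
    (hU : ∀ a, IsAffineOpen (U a)) (hc : ⨆ a, U a = ⊤)
    (h : ∀ a, IsLocAt M (U a) ∧ Module.Finite Γ(X, U a) Γ(M, U a)) : IsCoherent M := by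
  have hq := isQuasicoherent_of_isLocAt M U hU hc fun a => (h a).1
  refine ⟨hq, fun V hV => ?_⟩
  refine of_affine_open_cover (P := fun W : X.affineOpens => Module.Finite Γ(X, W.1) Γ(M, W.1))
    (fun a => ⟨U a, hU a⟩) hc ⟨V, hV⟩ (fun W f hW => ?_) (fun W s hs hW => ?_) fun a => (h a).2
  · exact finite_basicOpen (isLocAt_of_isQuasicoherent M hq W.2) f
  · exact finite_of_span_eq_top W.2 (isLocAt_of_isQuasicoherent M hq W.2) s hs hW

end QC3

section Structure
variable (X : Scheme.{u})

/-- The structure sheaf as a sheaf of modules. -/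
def structureModule : X.Modules := SheafOfModules.unit X.ringCatSheaf

lemma isCoherent_structureModule : IsCoherent (structureModule X) := by
  refine isCoherent_of_forall _ fun U hU => ⟨fun f => ⟨fun s hs => ?_, fun t => ?_⟩, ?_⟩
  · exact exists_pow_mul_eq_zero hU f s hs
  · exact exists_pow_mul_eq_resO hU f t
  · exact inferInstanceAs (Module.Finite Γ(X, U) Γ(X, U))

end Structure

section PullCoherent
variable {R : Type u} [CommRing R] {X : Scheme.{u}} (f : X ⟶ Spec (.of R))
  (A : Type u) [Ring A] [Algebra R A]

variable {A} in
lemma PullSec.coord_smul (l : A →ₗ[R] R) (U : X.Opens) (r : FunSec f U) (x : PullSec f A U) :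
    PullSec.coord f l U (r • x) = r • PullSec.coord f l U x := by
  induction x using TensorProduct.induction_on with
  | zero => simp
  | add x y hx hy => rw [smul_add, map_add, map_add, hx, hy, smul_add]
  | tmul s a => simp [PullSec.coord, TensorProduct.smul_tmul']

lemma isCoherent_pullModule [Module.Finite R A] [Module.Projective R A] :
    IsCoherent (pullModule f A) := by
  obtain ⟨n, p, hp⟩ := Module.Finite.exists_fin' R A
  obtain ⟨j, hj⟩ := Module.projective_lifting_property p LinearMap.id hp
  let l : Fin n → A →ₗ[R] R := fun c => LinearMap.proj c ∘ₗ j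
  let e : Fin n → A := fun c => p (Pi.single c 1)
  have hle : ∀ a, ∑ c, l c a • e c = a := by
    intro a
    have h1 : p (j a) = a := LinearMap.congr_fun hj a
    conv_rhs => rw [← h1, pi_eq_sum_univ' (j a), map_sum]
    simp only [l, e, LinearMap.comp_apply, LinearMap.proj_apply, map_smul]
  let i : Fin n → (pullModule f A ⟶ structureModule X) := fun c =>
    mkHom (M := pullModule f A) (N := structureModule X)
      (fun U => show PullSec f A U →ₗ[FunSec f U] FunSec f U from
        { toFun := PullSec.coord f (l c) U
          map_add' := map_add _
          map_smul' := PullSec.coord_smul f (l c) U })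
      (fun i s => PullSec.coord_res f A (l c) i s)
  let r : Fin n → (structureModule X ⟶ pullModule f A) := fun c =>
    mkHom (M := structureModule X) (N := pullModule f A)
      (fun U => show FunSec f U →ₗ[FunSec f U] PullSec f A U from
        { toFun := fun s => s ⊗ₜ[R] e c
          map_add' := fun s t => TensorProduct.add_tmul s t _
          map_smul' := fun s t => (TensorProduct.smul_tmul' s t (e c)).symm })
      (fun _ _ => rfl)
  refine (isCoherent_structureModule X).of_retract i r fun U s => ?_
  rw [finsum_eq_sum_of_fintype]
  exact PullSec.eq_sum f A l e hle s

end PullCoherent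

section SubPow
variable {X : Scheme.{u}}

/-- A family of submodules of the sections of the power `F^I` which is given by local
conditions. -/
structure LocalCond (F : X.Modules) (I : Type u) where
  carrier : ∀ U : X.Opens, Submodule Γ(X, U) (I → Γ(F, U))
  res_mem : ∀ {U V : X.Opens} (i : V ≤ U) (s : I → Γ(F, U)), s ∈ carrier U →
    (fun a => res F i (s a)) ∈ carrier V
  local_mem : ∀ (U : X.Opens) (s : I → Γ(F, U)),
    (∀ x ∈ U, ∃ (V : X.Opens) (i : V ≤ U), x ∈ V ∧ (fun a => res F i (s a)) ∈ carrier V) →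
      s ∈ carrier U

variable {F : X.Modules} {I : Type u} (C : LocalCond F I)

/-- Restriction of families of sections. -/
def LocalCond.resC {U V : X.Opens} (i : V ≤ U) : C.carrier U →+ C.carrier V where
  toFun s := ⟨fun a => res F i (s.1 a), C.res_mem i s.1 s.2⟩
  map_zero' := Subtype.ext (funext fun _ => map_zero _)
  map_add' _ _ := Subtype.ext (funext fun _ => map_add _ _ _)

lemma LocalCond.resC_self {U : X.Opens} (i : U ≤ U) (s : C.carrier U) : C.resC i s = s :=
  Subtype.ext (funext fun _ => res_self F i _)

lemma LocalCond.resC_resC {U V W : X.Opens} (i : V ≤ U) (j : W ≤ V) (s : C.carrier U) :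
    C.resC j (C.resC i s) = C.resC (j.trans i) s :=
  Subtype.ext (funext fun _ => res_res F i j _)

/-- The presheaf of abelian groups given by a local condition. -/
def LocalCond.ab : TopCat.Presheaf Ab X where
  obj U := AddCommGrpCat.of (C.carrier U.unop)
  map j := AddCommGrpCat.ofHom (C.resC j.unop.le)
  map_id U := by
    ext x
    exact congrFun (congrArg Subtype.val (C.resC_self _ x)) _
  map_comp i j := by
    ext x
    exact (congrFun (congrArg Subtype.val (C.resC_resC i.unop.le j.unop.le x)) _).symm

instance (U : X.Opensᵒᵖ) : Module (X.ringCatSheaf.obj.obj U) (C.ab.obj U) :=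
  inferInstanceAs (Module Γ(X, U.unop) (C.carrier U.unop))

lemma LocalCond.isSheaf_ab : C.ab.IsSheaf := by
  rw [TopCat.Presheaf.isSheaf_iff_isSheafUniqueGluing]
  intro ι U sf hsf
  let sf' : ∀ a, C.carrier (U a) := sf
  have hcomp : ∀ a b (W : X.Opens) (i : W ≤ U a) (j : W ≤ U b),
      C.resC i (sf' a) = C.resC j (sf' b) := by
    intro a b W i j
    have h : C.resC (inf_le_left : U a ⊓ U b ≤ U a) (sf' a) =
      C.resC (inf_le_right : U a ⊓ U b ≤ U b) (sf' b) := hsf a b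
    have h2 := congrArg (C.resC (le_inf i j)) h
    refine Subtype.ext (funext fun c => ?_)
    have h3 := congrFun (congrArg Subtype.val h2) c
    change res F _ (res F _ _) = res F _ (res F _ _) at h3
    rw [res_res, res_res] at h3
    exact h3
  have hglue : ∀ c : I, ∃! s : Γ(F, iSup U), ∀ a, res F (le_iSup U a) s = (sf' a).1 c := fun c =>
    exists_glue F U (iSup U) (le_iSup U) (fun _ hx => TopologicalSpace.Opens.mem_iSup.mp hx)
      (fun a => (sf' a).1 c) fun a b W i j => congrFun (congrArg Subtype.val (hcomp a b W i j)) c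
  choose s hs hu using hglue
  have hres : ∀ a, (fun c => res F (le_iSup U a) (s c)) = (sf' a).1 := fun a =>
    funext fun c => hs c a
  refine ⟨(⟨s, C.local_mem _ s fun x hx => ?_⟩ : C.carrier (iSup U)), ?_, ?_⟩
  · obtain ⟨a, ha⟩ := TopologicalSpace.Opens.mem_iSup.mp hx
    exact ⟨U a, le_iSup U a, ha, by rw [hres a]; exact (sf' a).2⟩
  · intro a
    exact Subtype.ext (hres a)
  · intro y hy
    refine Subtype.ext (funext fun c => hu c _ fun a => ?_)
    exact congrFun (congrArg Subtype.val (show C.resC (le_iSup U a) y = sf' a from hy a)) c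

/-- The sheaf of modules given by a local condition. -/
def LocalCond.sheaf : X.Modules where
  val := PresheafOfModules.ofPresheaf C.ab fun _ _ j r _ =>
    Subtype.ext (funext fun _ => res_osmul F j.unop.le r _)
  isSheaf := C.isSheaf_ab

end SubPow
end EquivSheaf

end

noncomputable section
namespace EquivSheaf

section QCHom
variable {X : Scheme.{u}}

/-- Morphisms from a quasi-coherent sheaf on an affine scheme are determined by global sections. -/
lemma exists_hom_top {R : CommRingCat.{u}} (M K : (Spec R).Modules) [IsIso M.fromTildeΓ]
    (θ₀ : Γ(M, ⊤) →ₗ[R] Γ(K, ⊤)) : ∃ α : M ⟶ K, ∀ m, α.app ⊤ m = θ₀ m := by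
  let θ : moduleSpecΓFunctor.obj M ⟶ moduleSpecΓFunctor.obj K :=
    ModuleCat.ofHom (X := Γ(M, ⊤)) (Y := Γ(K, ⊤)) θ₀
  suffices h : ∃ α : M ⟶ K, moduleSpecΓFunctor.map α = θ by
    obtain ⟨α, hα⟩ := h
    exact ⟨α, fun m => LinearMap.congr_fun (congrArg ModuleCat.Hom.hom hα) m⟩
  refine ⟨inv M.fromTildeΓ ≫ ((tilde.adjunction (R := R)).homEquiv _ _).symm θ, ?_⟩
  have h1 := (tilde.adjunction (R := R)).right_triangle_components M
  have h2 := ((tilde.adjunction (R := R)).homEquiv _ K).apply_symm_apply θ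
  rw [Adjunction.homEquiv_unit] at h2
  have h3 : moduleSpecΓFunctor.map M.fromTildeΓ ≫ moduleSpecΓFunctor.map (inv M.fromTildeΓ) =
      𝟙 _ := by
    rw [← Functor.map_comp, IsIso.hom_inv_id]
    exact CategoryTheory.Functor.map_id _ _
  have h4 : (tilde.adjunction (R := R)).unit.app (moduleSpecΓFunctor.obj M) =
      moduleSpecΓFunctor.map (inv M.fromTildeΓ) := by
    refine (Category.comp_id _).symm.trans ((congrArg _ h3.symm).trans ?_)
    exact (Category.assoc _ _ _).symm.trans
      ((congrArg (· ≫ moduleSpecΓFunctor.map (inv M.fromTildeΓ)) h1).trans (Category.id_comp _))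
  exact (Functor.map_comp moduleSpecΓFunctor _ _).trans
    ((congrArg (· ≫ moduleSpecΓFunctor.map _) h4.symm).trans h2)

lemma image_preimage_fromSpec {U : X.Opens} (hU : IsAffineOpen U) (V : X.Opens) :
    hU.fromSpec ''ᵁ (hU.fromSpec ⁻¹ᵁ V) = V ⊓ U := by
  rw [Scheme.Hom.image_preimage_eq_opensRange_inf, hU.opensRange_fromSpec, inf_comm]

lemma res_bijective_of_eq (M : X.Modules) {U V : X.Opens} (e : V = U) (i : V ≤ U) :
    Function.Bijective (res M i) := by
  subst e
  rw [show (res M i : Γ(M, V) → Γ(M, V)) = id from funext (res_self M i)]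
  exact Function.bijective_id

/-- Every linear map from the sections of a quasi-coherent sheaf over an affine open subset `U`
to the sections of a sheaf extended from `U` comes from a morphism of sheaves. -/
lemma exists_hom_of_isLocAt {U : X.Opens} (hU : IsAffineOpen U) {M K : X.Modules}
    (hM : IsLocAt M U)
    (hK : ∀ V : X.Opens, Function.Bijective (res K (inf_le_left : V ⊓ U ≤ V)))
    (θ : Γ(M, U) →ₗ[Γ(X, U)] Γ(K, U)) : ∃ φ : M ⟶ K, ∀ m, φ.app U m = θ m := by
  have hiso := (isIso_fromTildeΓ_restrict_iff M hU).mpr hM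
  let i := hU.fromSpec
  have eU : i ''ᵁ ⊤ = U := by
    rw [Scheme.Hom.image_top_eq_opensRange, hU.opensRange_fromSpec]
  let θ' : Γ(M.restrict i, ⊤) →ₗ[Γ(X, U)] Γ(K.restrict i, ⊤) :=
    { toFun := fun m => res K eU.le (θ (res M eU.ge m))
      map_add' := fun m m' => (congrArg (fun x => res K eU.le (θ x)) (map_add (res M eU.ge) m m')).trans
        ((congrArg (res K eU.le) (map_add θ _ _)).trans (map_add (res K eU.le) _ _))
      map_smul' := fun r m => by
        have h1 := restrict_fromSpec_smul M hU ⊤ eU.le r m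
        have h2 := restrict_fromSpec_smul K hU ⊤ eU.le r (res K eU.le (θ (res M eU.ge m)))
        refine Eq.trans ?_ h2.symm
        refine (congrArg (fun x => res K eU.le (θ (res M eU.ge x))) h1).trans ?_
        change res K eU.le (θ (res M eU.ge (resO eU.le r • (show Γ(M, i ''ᵁ ⊤) from m)))) = _
        rw [res_osmul, resO_resO, resO_self, map_smul, res_osmul] }
  obtain ⟨α, hα'⟩ : ∃ α : M.restrict i ⟶ K.restrict i, ∀ m : Γ(M, i ''ᵁ ⊤),
      α.app ⊤ m = res K eU.le (θ (res M eU.ge m)) :=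
    exists_hom_top (M.restrict i) (K.restrict i) θ'
  let uM := (Scheme.Modules.restrictAdjunction i).unit.app M
  let uK := (Scheme.Modules.restrictAdjunction i).unit.app K
  have hu : ∀ (L : X.Modules) (V : X.Opens) (l : Γ(L, V)),
      (((Scheme.Modules.restrictAdjunction i).unit.app L).app V l : Γ(L, i ''ᵁ (i ⁻¹ᵁ V))) =
        res L (i.image_preimage_le V) l := by
    intro L V l
    rw [Scheme.Modules.restrictAdjunction_unit_app_app]
    rfl
  have : IsIso uK := by
    refine isIso_of_bijective uK fun V => ?_
    have e := image_preimage_fromSpec hU V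
    have h1 : (uK.app V : Γ(K, V) → Γ(K, i ''ᵁ (i ⁻¹ᵁ V))) =
        res K e.le ∘ res K (inf_le_left : V ⊓ U ≤ V) := by
      funext l
      exact (hu K V l).trans (res_res K _ _ l).symm
    refine (congrArg Function.Bijective h1).mpr ?_
    exact (res_bijective_of_eq K e _).comp (hK V)
  refine ⟨uM ≫ (Scheme.Modules.pushforward i).map α ≫ inv uK, fun m => ?_⟩
  apply (bijective_of_isIso uK U).1
  have h2 : uK.app U ((uM ≫ (Scheme.Modules.pushforward i).map α ≫ inv uK).app U m) =
      (uM ≫ (Scheme.Modules.pushforward i).map α).app U m := by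
    have : (uM ≫ (Scheme.Modules.pushforward i).map α ≫ inv uK) ≫ uK =
      uM ≫ (Scheme.Modules.pushforward i).map α := by simp
    exact ConcreteCategory.congr_hom (congrArg (fun f => Scheme.Modules.Hom.app f U) this) m
  rw [h2]
  refine Eq.trans ?_ (hu K U _).symm
  change α.app (i ⁻¹ᵁ U) (uM.app U m) = _
  rw [show uM.app U m = _ from hu M U m]
  have e2 : i ⁻¹ᵁ U = ⊤ := hU.fromSpec_preimage_self
  have key : ∀ (V : (Spec Γ(X, U)).Opens) (hV : V = ⊤) (h : i ''ᵁ V ≤ U),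
      (α.app V (show Γ(M.restrict i, V) from res M h m) : Γ(K, i ''ᵁ V)) = res K h (θ m) := by
    rintro V rfl h
    refine (hα' _).trans ?_
    rw [res_res, res_self]
  exact key _ e2 _

lemma hom_eq_of_isLocAt {U : X.Opens} (hU : IsAffineOpen U) {M K : X.Modules}
    (hM : IsLocAt M U)
    (hK : ∀ V : X.Opens, Function.Injective (res K (inf_le_left : V ⊓ U ≤ V)))
    {φ ψ : M ⟶ K} (h : ∀ m, φ.app U m = ψ.app U m) : φ = ψ := by
  refine hom_ext' fun V s => hK V ?_
  refine section_ext K fun x hx => ?_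
  obtain ⟨f, hf, hxf⟩ := hU.exists_basicOpen_le ⟨x, hx⟩ hx.2
  have hfV : X.basicOpen f ≤ V := hf.trans inf_le_left
  refine ⟨X.basicOpen f, hf, hxf, ?_⟩
  rw [res_res, res_res, ← hom_res, ← hom_res]
  obtain ⟨n, t, ht⟩ := (hM f).2 (res M hfV s)
  apply eq_of_resO_basicOpen_smul f le_rfl (X.basicOpen_le f) n
  rw [← Scheme.Modules.Hom.app_smul, ← Scheme.Modules.Hom.app_smul, ← ht, hom_res, hom_res, h]

lemma bijective_basicOpen_of_isLocAt {U : X.Opens} {M K : X.Modules} (hM : IsLocAt M U)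
    (hK : IsLocAt K U) (φ : M ⟶ K) (h : Function.Bijective (φ.app U)) (f : Γ(X, U)) :
    Function.Bijective (φ.app (X.basicOpen f)) := by
  have hi := X.basicOpen_le f
  constructor
  · rw [injective_iff_map_eq_zero]
    intro t ht
    obtain ⟨n, s, hs⟩ := (hM f).2 t
    obtain ⟨l, hl⟩ := (hK f).1 (φ.app U s) (by
      rw [← hom_res, hs, Scheme.Modules.Hom.app_smul, ht, smul_zero])
    rw [← Scheme.Modules.Hom.app_smul] at hl
    have h0 : f ^ l • s = 0 := h.1 (hl.trans (map_zero _).symm)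
    have h1 := congrArg (res M hi) h0
    rw [res_osmul, hs, map_pow, map_zero, smul_smul, ← pow_add] at h1
    exact eq_of_resO_basicOpen_smul f le_rfl hi _ (h1.trans (smul_zero _).symm)
  · intro t
    obtain ⟨n, s, hs⟩ := (hK f).2 t
    obtain ⟨s', rfl⟩ := h.2 s
    obtain ⟨w, hw⟩ := (isUnit_resO_basicOpen f le_rfl hi).pow n
    refine ⟨(↑w⁻¹ : Γ(X, X.basicOpen f)) • res M hi s', ?_⟩
    rw [Scheme.Modules.Hom.app_smul, hom_res, hs, ← hw, smul_smul, Units.inv_mul, one_smul]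

lemma isIso_of_bijective_basis {M K : X.Modules} (φ : M ⟶ K) {ι : Type u} (B : ι → X.Opens)
    (hB : TopologicalSpace.Opens.IsBasis (Set.range B))
    (h : ∀ a, Function.Bijective (φ.app (B a))) : IsIso φ := by
  have inj : ∀ U, Function.Injective (φ.app U) := by
    intro U s t hst
    refine section_ext M fun x hx => ?_
    obtain ⟨_, ⟨a, rfl⟩, hxa, ha⟩ := TopologicalSpace.Opens.isBasis_iff_nbhd.mp hB hx
    refine ⟨B a, ha, hxa, (h a).1 ?_⟩
    rw [hom_res, hom_res, hst]
  refine isIso_of_bijective φ fun U => ⟨inj U, fun t => ?_⟩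
  have hs : ∀ a : {a // B a ≤ U}, ∃ s, φ.app (B a.1) s = res K a.2 t := fun a => (h a.1).2 _
  choose s hs using hs
  obtain ⟨s', hs', -⟩ := exists_glue M (fun a : {a // B a ≤ U} => B a.1) U (fun a => a.2)
    (fun x hx => by
      obtain ⟨_, ⟨a, rfl⟩, hxa, ha⟩ := TopologicalSpace.Opens.isBasis_iff_nbhd.mp hB hx
      exact ⟨⟨a, ha⟩, hxa⟩) s (fun a b W i j => inj W (by
        rw [hom_res, hom_res, hs, hs, res_res, res_res]))
  refine ⟨s', section_ext K fun x hx => ?_⟩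
  obtain ⟨_, ⟨a, rfl⟩, hxa, ha⟩ := TopologicalSpace.Opens.isBasis_iff_nbhd.mp hB hx
  refine ⟨B a, ha, hxa, ?_⟩
  rw [← hom_res, hs' ⟨a, ha⟩]
  exact hs ⟨a, ha⟩

end QCHom
end EquivSheaf

end

noncomputable section
namespace EquivSheaf

section Extension
variable {Y : Scheme.{u}}

lemma isLocAt_of_bijective {M K : Y.Modules} {W : Y.Opens} (φ : M ⟶ K) (hK : IsLocAt K W)
    (h0 : Function.Injective (φ.app W)) (h0' : Function.Surjective (φ.app W))
    (h : ∀ f : Γ(Y, W), Function.Injective (φ.app (Y.basicOpen f))) : IsLocAt M W := by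
  refine fun f => ⟨fun s hs => ?_, fun t => ?_⟩
  · obtain ⟨n, hn⟩ := (hK f).1 (φ.app W s) (by rw [← hom_res, hs, map_zero])
    rw [← Scheme.Modules.Hom.app_smul] at hn
    exact ⟨n, h0 (hn.trans (map_zero _).symm)⟩
  · obtain ⟨n, s, hs⟩ := (hK f).2 (φ.app _ t)
    obtain ⟨s, rfl⟩ := h0' s
    refine ⟨n, s, h f ?_⟩
    rw [hom_res, hs, Scheme.Modules.Hom.app_smul]

lemma pushforward_res_bijective {X : Scheme.{u}} (p : Y ⟶ X) (N : Y.Modules) {U V : X.Opens}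
    (i : V ≤ U) (e : p ⁻¹ᵁ V = p ⁻¹ᵁ U) :
    Function.Bijective (res ((Scheme.Modules.pushforward p).obj N) i) :=
  res_bijective_of_eq N e (Scheme.Hom.preimage_mono p i)

lemma exists_extension (W : Y.Opens) (M : Y.Modules) : ∃ (K : Y.Modules) (η : M ⟶ K),
    (∀ V, Function.Bijective (res K (inf_le_left : V ⊓ W ≤ V))) ∧
      ∀ V, V ≤ W → Function.Bijective (η.app V) := by
  have e : ∀ V : Y.Opens, W.ι ''ᵁ (W.ι ⁻¹ᵁ V) = V ⊓ W := fun V => by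
    rw [Scheme.Hom.image_preimage_eq_opensRange_inf, Scheme.Opens.opensRange_ι, inf_comm]
  refine ⟨(Scheme.Modules.pushforward W.ι).obj (M.restrict W.ι),
    (Scheme.Modules.restrictAdjunction W.ι).unit.app M, fun V => ?_, fun V hV => ?_⟩
  · exact pushforward_res_bijective W.ι (M.restrict W.ι) _
      (by rw [Scheme.Hom.preimage_inf, Scheme.Opens.ι_preimage_self, inf_top_eq])
  · have h1 : (((Scheme.Modules.restrictAdjunction W.ι).unit.app M).app V :
        Γ(M, V) → Γ(M, W.ι ''ᵁ (W.ι ⁻¹ᵁ V))) = res M (W.ι.image_preimage_le V) := by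
      funext l
      rw [Scheme.Modules.restrictAdjunction_unit_app_app]
      rfl
    refine (congrArg Function.Bijective h1).mpr ?_
    exact res_bijective_of_eq M ((e V).trans (inf_eq_left.mpr hV)) _

lemma exists_extended {W : Y.Opens} (hW : IsAffineOpen W) (P : Type u) [AddCommGroup P]
    [Module Γ(Y, W) P] : ∃ (T : Y.Modules) (e : P ≃ₗ[Γ(Y, W)] Γ(T, W)), IsLocAt T W ∧
      ∀ V, Function.Bijective (res T (inf_le_left : V ⊓ W ≤ V)) := by
  let j := hW.fromSpec
  let T := tilde (ModuleCat.of Γ(Y, W) P)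
  have eW : j ⁻¹ᵁ W = ⊤ := hW.fromSpec_preimage_self
  let e0 : P →ₗ[Γ(Y, W)] Γ(T, ⊤) := (tilde.isoTop (ModuleCat.of Γ(Y, W) P)).hom.hom
  have he0 : Function.Bijective e0 :=
    ConcreteCategory.bijective_of_isIso (tilde.isoTop (ModuleCat.of Γ(Y, W) P)).hom
  let e1 : P →ₗ[Γ(Y, W)] Γ((Scheme.Modules.pushforward j).obj T, W) :=
    { toFun := fun x => (res T eW.le (e0 x))
      map_add' := fun x y => by rw [map_add]; exact map_add _ _ _
      map_smul' := fun r x => by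
        rw [map_smul, Scheme.Modules.smul_Spec_def, res_osmul]
        refine congrArg (fun z : Γ(Spec Γ(Y, W), j ⁻¹ᵁ W) => z • res T eW.le (e0 x)) ?_
        have h2 := IsAffineOpen.fromSpec_app_self hW
        have h3 : (j.app W) r = (Spec Γ(Y, W)).presheaf.map (eqToHom eW).op
          ((Scheme.ΓSpecIso Γ(Y, W)).inv r) := by rw [h2]; rfl
        refine Eq.trans ?_ h3.symm
        exact congrArg (resO eW.le) (resO_self _ _) }
  have he1 : Function.Bijective e1 := (res_bijective_of_eq T eW eW.le).comp he0
  refine ⟨(Scheme.Modules.pushforward j).obj T, LinearEquiv.ofBijective e1 he1, ?_, fun _ => ?_⟩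
  · rw [← isIso_fromTildeΓ_restrict_iff _ hW, isIso_fromTildeΓ_iff]
    exact ⟨ModuleCat.of Γ(Y, W) P,
      ⟨((Scheme.Modules.restrictFunctorAdjCounitIso j).app T).symm⟩⟩
  · exact res_bijective_of_eq T
      (by rw [Scheme.Hom.preimage_inf, eW, inf_top_eq]) _

end Extension

section Pull
variable {Z : Type u} [CommRing Z] {X Y : Scheme.{u}} (f : Y ⟶ Spec (.of Z)) (p : Y ⟶ X)

/-- Multiplication by an element of the base ring. -/
def zmul (N : Y.Modules) (z : Z) : N ⟶ N :=
  mkHom (fun U => LinearMap.lsmul Γ(Y, U) Γ(N, U) (baseHom f U z)) (fun i s => by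
    rw [LinearMap.lsmul_apply, LinearMap.lsmul_apply, res_osmul, resO_baseHom])

lemma zmul_app (N : Y.Modules) (z : Z) (U : Y.Opens) (s : Γ(N, U)) :
    (zmul f N z).app U s = baseHom f U z • s := rfl

lemma zmul_comm {N N' : Y.Modules} (z : Z) (g : N ⟶ N') : zmul f N z ≫ g = g ≫ zmul f N' z :=
  hom_ext' fun _ _ => Scheme.Modules.Hom.app_smul g _ _

/-- The quotient of the pullback of `M` on which given endomorphisms of `M` act as multiplication
by elements of the base ring. -/
lemma exists_universal_pull (M : X.Modules) (op : Z → (M ⟶ M)) :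
    ∃ (N : Y.Modules) (η : M ⟶ (Scheme.Modules.pushforward p).obj N),
      (∀ z, op z ≫ η = η ≫ (Scheme.Modules.pushforward p).map (zmul f N z)) ∧
      ∀ (K : Y.Modules) (φ : M ⟶ (Scheme.Modules.pushforward p).obj K),
        (∀ z, op z ≫ φ = φ ≫ (Scheme.Modules.pushforward p).map (zmul f K z)) →
          ∃! g : N ⟶ K, η ≫ (Scheme.Modules.pushforward p).map g = φ := by
  let P := (Scheme.Modules.pullback p).obj M
  let adj := Scheme.Modules.pullbackPushforwardAdjunction p
  let d : ∀ z : Z, P ⟶ P := fun z => (Scheme.Modules.pullback p).map (op z) - zmul f P z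
  let D : (∐ fun _ : Z => P) ⟶ P := Limits.Sigma.desc d
  let c : P ⟶ Limits.cokernel D := Limits.cokernel.π D
  have hc : ∀ z, d z ≫ c = 0 := fun z => by
    rw [← Limits.Sigma.ι_desc d z, Category.assoc, Limits.cokernel.condition, Limits.comp_zero]
  have key : ∀ (K : Y.Modules) (g : P ⟶ K) (z : Z), d z ≫ g = 0 ↔
      op z ≫ adj.homEquiv _ _ g = adj.homEquiv _ _ g ≫
        (Scheme.Modules.pushforward p).map (zmul f K z) := by
    intro K g z
    rw [← Adjunction.homEquiv_naturality_left, ← Adjunction.homEquiv_naturality_right,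
      (adj.homEquiv _ _).apply_eq_iff_eq, ← zmul_comm, Preadditive.sub_comp, sub_eq_zero]
  refine ⟨Limits.cokernel D, adj.homEquiv _ _ c, fun z => (key _ c z).mp (hc z), fun K φ hφ => ?_⟩
  obtain ⟨g, rfl⟩ := (adj.homEquiv _ _).surjective φ
  have hg : D ≫ g = 0 := by
    refine Limits.Sigma.hom_ext _ _ fun z => ?_
    rw [← Category.assoc, Limits.Sigma.ι_desc, Limits.comp_zero]
    exact (key K g z).mpr (hφ z)
  refine ⟨Limits.cokernel.desc D g hg, ?_, fun g' hg' => ?_⟩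
  · change adj.homEquiv _ _ c ≫ _ = _
    rw [← Adjunction.homEquiv_naturality_right, Limits.cokernel.π_desc]
  · have hg'' : adj.homEquiv _ _ c ≫ (Scheme.Modules.pushforward p).map g' = adj.homEquiv _ _ g :=
      hg'
    rw [← Adjunction.homEquiv_naturality_right, (adj.homEquiv _ _).apply_eq_iff_eq] at hg''
    rw [← cancel_epi c, hg'', Limits.cokernel.π_desc]

end Pull
end EquivSheaf

end

noncomputable section
namespace EquivSheaf

section Kappa
variable {k Z : Type u} [CommRing k] [CommRing Z] [Algebra k Z] {X Y : Scheme.{u}}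
  {s : X ⟶ Spec (.of k)} {f : Y ⟶ Spec (.of Z)} {p : Y ⟶ X}

lemma baseHom_eq {R : Type u} [CommRing R] (f : X ⟶ Spec (.of R)) (U : X.Opens) (r : R) :
    baseHom f U r = (f.appLE ⊤ U le_top).hom ((Scheme.ΓSpecIso (.of R)).inv.hom r) := by
  simp only [baseHom, resO, RingHom.comp_apply, Scheme.Hom.appLE, Scheme.Hom.appTop]
  rfl

lemma ΓSpecIso_hom_baseHom {R : Type u} [CommRing R] (f : X ⟶ Spec (.of R)) (U : X.Opens) :
    (Scheme.ΓSpecIso (.of R)).hom ≫ CommRingCat.ofHom (baseHom f U) = f.appLE ⊤ U le_top := by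
  have : CommRingCat.ofHom (baseHom f U) = (Scheme.ΓSpecIso (.of R)).inv ≫ f.appLE ⊤ U le_top := by
    ext r
    exact baseHom_eq f U r
  rw [this, Iso.hom_inv_id_assoc]

lemma isPushout_sections (sq : IsPullback p f s (Spec.map (CommRingCat.ofHom (algebraMap k Z))))
    {U : X.Opens} (hU : IsAffineOpen U) :
    IsPushout (CommRingCat.ofHom (baseHom s U)) (CommRingCat.ofHom (algebraMap k Z))
      (p.app U) (CommRingCat.ofHom (baseHom f (p ⁻¹ᵁ U))) := by
  have h1 := (isIso_pushoutSection_iff sq (US := ⊤) (UT := ⊤) (UX := U) (UY := p ⁻¹ᵁ U) le_top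
    le_top (by rw [Scheme.Hom.preimage_top, inf_top_eq])).mp
      (isIso_pushoutSection_of_isAffineOpen sq _ _ _ (isAffineOpen_top _) (isAffineOpen_top _) hU)
  refine h1.of_iso (Scheme.ΓSpecIso (.of k)) (Iso.refl _) (Scheme.ΓSpecIso (.of Z)) (Iso.refl _)
    ?_ ?_ ?_ ?_
  · exact (Category.comp_id _).trans (ΓSpecIso_hom_baseHom _ _).symm
  · rw [← Scheme.ΓSpecIso_naturality]
    congr 1
  · simp [Scheme.Hom.appLE]
  · exact (Category.comp_id _).trans (ΓSpecIso_hom_baseHom _ _).symm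

/-- Sections over the preimage of an affine open subset in a fibre product with an affine
scheme. -/
lemma exists_sectionsEquiv
    (sq : IsPullback p f s (Spec.map (CommRingCat.ofHom (algebraMap k Z))))
    {U : X.Opens} (hU : IsAffineOpen U) : ∃ e : FunSec s U ⊗[k] Z ≃+* Γ(Y, p ⁻¹ᵁ U),
      ∀ (r : FunSec s U) z, e (r ⊗ₜ z) = p.app U r * baseHom f (p ⁻¹ᵁ U) z := by
  have h1 := isPushout_sections sq hU
  have h2 := CommRingCat.isPushout_tensorProduct k (FunSec s U) Z
  let e : FunSec s U ⊗[k] Z ≃+* Γ(Y, p ⁻¹ᵁ U) := (h2.isColimit.coconePointUniqueUpToIso h1.isColimit).commRingCatIsoToRingEquiv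
  have hl : ∀ r : FunSec s U, e (r ⊗ₜ 1) = p.app U r := fun r =>
    ConcreteCategory.congr_hom (h2.isColimit.comp_coconePointUniqueUpToIso_hom h1.isColimit
      Limits.WalkingSpan.left) r
  have hr : ∀ z : Z, e ((1 : FunSec s U) ⊗ₜ z) = baseHom f (p ⁻¹ᵁ U) z := fun r =>
    ConcreteCategory.congr_hom (h2.isColimit.comp_coconePointUniqueUpToIso_hom h1.isColimit
      Limits.WalkingSpan.right) r
  refine ⟨e, fun r z => ?_⟩
  rw [← hl, ← hr, ← map_mul, Algebra.TensorProduct.tmul_mul_tmul, mul_one, one_mul]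

lemma baseHom_comp {R : Type u} [CommRing R] (g : X ⟶ Spec (.of R)) (U : X.Opens) (r : R) :
    p.app U (baseHom g U r) = baseHom (p ≫ g) (p ⁻¹ᵁ U) r := by
  have h := ConcreteCategory.congr_hom (p.naturality (homOfLE (le_top : U ≤ ⊤)).op)
    (g.appTop.hom ((Scheme.ΓSpecIso (.of R)).inv.hom r))
  simp only [baseHom, RingHom.comp_apply, Scheme.Hom.comp_appTop]
  exact h

/-- The sections over an affine open subset `U` of a sheaf with an action of `Z` are a module over
the functions on the preimage of `U` in the fibre product with `Spec Z`. -/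
lemma exists_module_sections
    (sq : IsPullback p f s (Spec.map (CommRingCat.ofHom (algebraMap k Z))))
    {U : X.Opens} (hU : IsAffineOpen U) (M : X.Modules) (op : Z →+* End M)
    (hop : ∀ c : k, op (algebraMap k Z c) = zmul s M c) :
    ∃ _ : Module Γ(Y, p ⁻¹ᵁ U) Γ(M, U),
      (∀ (r : Γ(X, U)) (m : Γ(M, U)), p.app U r • m = r • m) ∧
      ∀ z (m : Γ(M, U)), baseHom f (p ⁻¹ᵁ U) z • m = Scheme.Modules.Hom.app (op z) U m := by
  obtain ⟨e, he⟩ := exists_sectionsEquiv sq hU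
  let i1 : Module (FunSec s U) Γ(M, U) := inferInstanceAs (Module Γ(X, U) Γ(M, U))
  let i2 : Module k Γ(M, U) := Module.compHom Γ(M, U) (baseHom s U)
  let i3 : Module Z Γ(M, U) :=
    { smul := fun z m => (op z).app U m
      one_smul := fun m => by
        change (op 1).app U m = m
        rw [map_one]; rfl
      mul_smul := fun z z' m => by
        change (op (z * z')).app U m = _
        rw [map_mul]; rfl
      smul_zero := fun z => map_zero _
      smul_add := fun z => map_add _
      add_smul := fun z z' m => by
        change (op (z + z')).app U m = _
        rw [map_add]; rfl
      zero_smul := fun m => by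
        change (op 0).app U m = 0
        rw [map_zero]; rfl }
  have : IsScalarTower k (FunSec s U) Γ(M, U) := .of_algebraMap_smul fun _ _ => rfl
  have : IsScalarTower k Z Γ(M, U) := .of_algebraMap_smul fun c m => by
    change (op (algebraMap k Z c)).app U m = _
    rw [hop]; rfl
  have : SMulCommClass (FunSec s U) Z Γ(M, U) :=
    ⟨fun r z m => (Scheme.Modules.Hom.app_smul (op z) r m).symm⟩
  let i4 : Module (FunSec s U ⊗[k] Z) Γ(M, U) := TensorProduct.Algebra.module
  have h4 : ∀ (r : FunSec s U) (z : Z) (m : Γ(M, U)), (r ⊗ₜ[k] z) • m = r • z • m :=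
    fun r z m => TensorProduct.Algebra.smul_def r z m
  refine ⟨Module.compHom Γ(M, U) (e.symm : Γ(Y, p ⁻¹ᵁ U) →+* FunSec s U ⊗[k] Z), ?_, ?_⟩
  · intro r m
    let r' : FunSec s U := r
    have h : e.symm (p.app U r) = r' ⊗ₜ 1 :=
      e.symm_apply_eq.mpr ((he r' 1).trans ((congrArg _ (map_one _)).trans (mul_one _))).symm
    change e.symm (p.app U r) • m = r' • m
    rw [h, h4, one_smul]
  · intro z m
    have h : e.symm (baseHom f (p ⁻¹ᵁ U) z) = (1 : FunSec s U) ⊗ₜ z := by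
      rw [RingEquiv.symm_apply_eq, he]
      exact ((congrArg (· * _) (map_one (p.app U).hom)).trans (one_mul _)).symm
    change e.symm (baseHom f (p ⁻¹ᵁ U) z) • m = _
    rw [h, h4, one_smul]
    rfl

lemma pushforward_smul (N : Y.Modules) (U : X.Opens) (r : Γ(X, U))
    (n : Γ((Scheme.Modules.pushforward p).obj N, U)) :
    (show Γ(N, p ⁻¹ᵁ U) from r • n) = p.app U r • (show Γ(N, p ⁻¹ᵁ U) from n) := rfl

/-- The sheaf with `Z`-action `M` on `X` comes from a sheaf on the fibre product. -/
theorem isLocAt_universal_pull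
    (sq : IsPullback p f s (Spec.map (CommRingCat.ofHom (algebraMap k Z)))) [IsAffineHom p]
    {M : X.Modules} (op : Z →+* End M) (hop : ∀ c : k, op (algebraMap k Z c) = zmul s M c)
    {N : Y.Modules} (η : M ⟶ (Scheme.Modules.pushforward p).obj N)
    (hη : ∀ z, op z ≫ η = η ≫ (Scheme.Modules.pushforward p).map (zmul f N z))
    (huniv : ∀ (K : Y.Modules) (φ : M ⟶ (Scheme.Modules.pushforward p).obj K),
        (∀ z, op z ≫ φ = φ ≫ (Scheme.Modules.pushforward p).map (zmul f K z)) →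
          ∃! g : N ⟶ K, η ≫ (Scheme.Modules.pushforward p).map g = φ)
    {U : X.Opens} (hU : IsAffineOpen U) (hM : IsLocAt M U) :
    IsLocAt N (p ⁻¹ᵁ U) ∧ Function.Bijective (η.app U) := by
  have hW : IsAffineOpen (p ⁻¹ᵁ U) := hU.preimage p
  have hpf : ∀ K : Y.Modules, (∀ V, Function.Bijective (res K (inf_le_left : V ⊓ p ⁻¹ᵁ U ≤ V))) →
      ∀ V : X.Opens, Function.Bijective
        (res ((Scheme.Modules.pushforward p).obj K) (inf_le_left : V ⊓ U ≤ V)) :=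
    fun K hK V => hK (p ⁻¹ᵁ V)
  obtain ⟨inst, hr, hz⟩ := exists_module_sections sq hU M op hop
  obtain ⟨T, e, hT, hT'⟩ := exists_extended hW Γ(M, U)
  obtain ⟨K, ε, hK, hε⟩ := exists_extension (p ⁻¹ᵁ U) N
  obtain ⟨α, hα⟩ := exists_hom_of_isLocAt (K := (Scheme.Modules.pushforward p).obj T) hU hM
    (hpf T hT') (show Γ(M, U) →ₗ[Γ(X, U)] Γ((Scheme.Modules.pushforward p).obj T, U) from
      { toFun := e
        map_add' := map_add e
        map_smul' := fun r m => by
          rw [← hr]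
          exact map_smul e _ _ })
  have hα' : ∀ m, α.app U m = e m := hα
  obtain ⟨a, ha, -⟩ := huniv T α fun z => by
    refine hom_eq_of_isLocAt hU hM (fun V => (hpf T hT' V).1) fun m => ?_
    change α.app U ((op z).app U m) = baseHom f (p ⁻¹ᵁ U) z •
      (show Γ(T, p ⁻¹ᵁ U) from α.app U m)
    rw [hα', ← hz, map_smul]
    exact congrArg (fun x : Γ(T, p ⁻¹ᵁ U) => baseHom f (p ⁻¹ᵁ U) z • x) (hα' m).symm
  have ha' : ∀ m, a.app (p ⁻¹ᵁ U) (η.app U m) = e m := fun m => by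
    rw [← hα', ← ha]; rfl
  obtain ⟨ee, hee⟩ := exists_sectionsEquiv sq hU
  have hlin : ∀ (c : Γ(Y, p ⁻¹ᵁ U)) (m : Γ(M, U)),
      (η.app U (c • m) : Γ(N, p ⁻¹ᵁ U)) = c • (show Γ(N, p ⁻¹ᵁ U) from η.app U m) := by
    intro c m
    obtain ⟨x, rfl⟩ := ee.surjective c
    induction x using TensorProduct.induction_on with
    | zero => rw [map_zero, zero_smul, zero_smul, map_zero]; rfl
    | add x y hx hy =>
      rw [map_add, add_smul, add_smul, ← hx, ← hy, map_add]; rfl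
    | tmul r₀ z =>
      obtain ⟨r, hr₀⟩ : ∃ r : Γ(X, U), ee (r₀ ⊗ₜ z) = p.app U r * baseHom f (p ⁻¹ᵁ U) z :=
        ⟨r₀, hee r₀ z⟩
      rw [hr₀, mul_smul, mul_smul, hr, hz, Scheme.Modules.Hom.app_smul]
      refine congrArg (fun x : Γ(N, p ⁻¹ᵁ U) => p.app U r • x) ?_
      exact ConcreteCategory.congr_hom (congrArg (fun g => Scheme.Modules.Hom.app g U) (hη z)) m
  obtain ⟨b, hb⟩ := exists_hom_of_isLocAt hW hT hK
    (show Γ(T, p ⁻¹ᵁ U) →ₗ[Γ(Y, p ⁻¹ᵁ U)] Γ(K, p ⁻¹ᵁ U) from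
      { toFun := fun t => ε.app (p ⁻¹ᵁ U) (η.app U (e.symm t))
        map_add' := fun t t' => by
          rw [map_add, map_add]; exact map_add (ε.app (p ⁻¹ᵁ U)).hom _ _
        map_smul' := fun c t => by
          rw [map_smul, hlin, Scheme.Modules.Hom.app_smul]; rfl })
  have hb' : ∀ t, b.app (p ⁻¹ᵁ U) t = ε.app (p ⁻¹ᵁ U) (η.app U (e.symm t)) := hb
  have hab : a ≫ b = ε := by
    obtain ⟨g, -, hg⟩ := huniv K (η ≫ (Scheme.Modules.pushforward p).map ε) fun z => by
      rw [← Category.assoc, hη, Category.assoc, Category.assoc, ← Functor.map_comp, zmul_comm,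
        Functor.map_comp]
    refine (hg (a ≫ b) ?_).trans (hg ε rfl).symm
    refine hom_eq_of_isLocAt hU hM (fun V => (hpf K hK V).1) fun m => ?_
    change b.app (p ⁻¹ᵁ U) (a.app (p ⁻¹ᵁ U) (η.app U m)) = ε.app (p ⁻¹ᵁ U) (η.app U m)
    rw [ha', hb', LinearEquiv.symm_apply_apply]
  have hinj : ∀ V, V ≤ p ⁻¹ᵁ U → Function.Injective (a.app V) := by
    intro V hV
    have h := (hε V hV).1
    rw [← hab] at h
    exact Function.Injective.of_comp (f := b.app V) h
  have hbij : Function.Bijective (a.app (p ⁻¹ᵁ U)) := by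
    refine ⟨hinj _ le_rfl, fun t => ⟨η.app U (e.symm t), ?_⟩⟩
    rw [ha', LinearEquiv.apply_symm_apply]
  refine ⟨isLocAt_of_bijective a hT hbij.1 hbij.2 fun g => hinj _ (Y.basicOpen_le g), ?_⟩
  have h : a.app (p ⁻¹ᵁ U) ∘ (show Γ(M, U) → Γ(N, p ⁻¹ᵁ U) from η.app U) = e := funext ha'
  exact (hbij.of_comp_iff' (show Γ(M, U) → Γ(N, p ⁻¹ᵁ U) from η.app U)).mp (h ▸ e.bijective)

end Kappa
end EquivSheaf

end

noncomputable section
namespace EquivSheaf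

section Descent
variable {k Z : Type u} [CommRing k] [CommRing Z] [Algebra k Z] {X Y : Scheme.{u}}
  {s : X ⟶ Spec (.of k)} {f : Y ⟶ Spec (.of Z)} {p : Y ⟶ X}

lemma isLocAt_pushforward {N : Y.Modules} {U : X.Opens} (hN : IsLocAt N (p ⁻¹ᵁ U)) :
    IsLocAt ((Scheme.Modules.pushforward p).obj N) U := by
  intro g
  have e : p ⁻¹ᵁ (X.basicOpen g) = Y.basicOpen (p.app U g) := Scheme.preimage_basicOpen p g
  have hle : p ⁻¹ᵁ (X.basicOpen g) ≤ p ⁻¹ᵁ U := Scheme.Hom.preimage_mono p (X.basicOpen_le g)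
  obtain ⟨h1, h2⟩ := (isLocAt_iff_of_eq N (U' := p ⁻¹ᵁ U) rfl (p.app U g) e hle).mp
    (hN (p.app U g))
  have hpow : ∀ (n : ℕ) (t : Γ(N, p ⁻¹ᵁ U)),
      (show Γ(N, p ⁻¹ᵁ U) from g ^ n • (show Γ((Scheme.Modules.pushforward p).obj N, U) from t)) =
        (resO le_rfl (p.app U g)) ^ n • t := by
    intro n t
    rw [pushforward_smul, resO_self]
    exact congrArg (fun r : Γ(Y, p ⁻¹ᵁ U) => r • t) (map_pow (p.app U).hom g n)
  have hpow' : ∀ (n : ℕ) (t : Γ(N, p ⁻¹ᵁ X.basicOpen g)),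
      (show Γ(N, p ⁻¹ᵁ X.basicOpen g) from (resO (X.basicOpen_le g) g) ^ n •
        (show Γ((Scheme.Modules.pushforward p).obj N, X.basicOpen g) from t)) =
        (resO hle (p.app U g)) ^ n • t := by
    intro n t
    rw [pushforward_smul]
    refine congrArg (fun r : Γ(Y, p ⁻¹ᵁ X.basicOpen g) => r • t) ?_
    refine (map_pow (p.app _).hom _ n).trans (congrArg (· ^ n) ?_)
    exact ConcreteCategory.congr_hom (p.naturality (homOfLE (X.basicOpen_le g)).op) g
  refine ⟨fun t ht => ?_, fun t => ?_⟩
  · obtain ⟨n, hn⟩ := h1 t ht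
    exact ⟨n, (hpow n t).trans hn⟩
  · obtain ⟨n, t', hn⟩ := h2 t
    exact ⟨n, t', hn.trans (hpow' n t).symm⟩

lemma finite_app (sq : IsPullback p f s (Spec.map (CommRingCat.ofHom (algebraMap k Z))))
    [Module.Finite k Z] {U : X.Opens} (hU : IsAffineOpen U) : (p.app U).hom.Finite := by
  obtain ⟨e, he⟩ := exists_sectionsEquiv sq hU
  let i : FunSec s U →+* FunSec s U ⊗[k] Z := algebraMap _ _
  have hi : i.Finite := RingHom.finite_algebraMap.mpr inferInstance
  have h : (p.app U).hom = (e : FunSec s U ⊗[k] Z →+* Γ(Y, p ⁻¹ᵁ U)).comp i := by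
    ext r
    let r' : FunSec s U := r
    exact ((he r' 1).trans ((congrArg _ (map_one _)).trans (mul_one _))).symm
  rw [h]
  exact RingHom.Finite.comp (RingHom.Finite.of_surjective _ e.surjective) hi

lemma isCoherent_pushforward
    (sq : IsPullback p f s (Spec.map (CommRingCat.ofHom (algebraMap k Z))))
    [Module.Finite k Z] [IsAffineHom p] {N : Y.Modules} (hN : IsCoherent N) :
    IsCoherent ((Scheme.Modules.pushforward p).obj N) := by
  refine isCoherent_of_forall _ fun U hU =>
    ⟨isLocAt_pushforward (hN.isLocAt (hU.preimage p)), ?_⟩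
  have h1 := finite_app sq hU
  have h2 := hN.2 _ (hU.preimage p)
  algebraize [(p.app U).hom]
  let _ : Module Γ(X, U) Γ(N, p ⁻¹ᵁ U) := Module.compHom _ (p.app U).hom
  have : IsScalarTower Γ(X, U) Γ(Y, p ⁻¹ᵁ U) Γ(N, p ⁻¹ᵁ U) := .of_algebraMap_smul fun _ _ => rfl
  have h3 : Module.Finite Γ(X, U) Γ(N, p ⁻¹ᵁ U) := Module.Finite.trans Γ(Y, p ⁻¹ᵁ U) _
  exact h3

lemma iSup_preimage_affineOpens (p : Y ⟶ X) : ⨆ U : X.affineOpens, p ⁻¹ᵁ U.1 = ⊤ := by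
  rw [← Scheme.Hom.preimage_iSup, iSup_affineOpens_eq_top, Scheme.Hom.preimage_top]

/-- A coherent sheaf with an action of `Z` is the direct image of a coherent sheaf on the fibre
product with `Spec Z`. -/
theorem exists_isIso_pushforward
    (sq : IsPullback p f s (Spec.map (CommRingCat.ofHom (algebraMap k Z)))) [IsAffineHom p]
    {M : X.Modules} (hM : IsCoherent M) (op : Z →+* End M)
    (hop : ∀ c : k, op (algebraMap k Z c) = zmul s M c) :
    ∃ (N : Y.Modules) (η : M ⟶ (Scheme.Modules.pushforward p).obj N),
      IsCoherent N ∧ IsIso η ∧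
      ∀ z, op z ≫ η = η ≫ (Scheme.Modules.pushforward p).map (zmul f N z) := by
  obtain ⟨N, η, hη, huniv⟩ := exists_universal_pull f p M op
  have key := fun (U : X.affineOpens) =>
    isLocAt_universal_pull sq op hop η hη huniv U.2 (hM.isLocAt U.2)
  refine ⟨N, η, ?_, ?_, hη⟩
  · refine isCoherent_of_cover N (fun U : X.affineOpens => p ⁻¹ᵁ U.1) (fun U => U.2.preimage p)
      (iSup_preimage_affineOpens p) fun U => ⟨(key U).1, ?_⟩
    obtain ⟨S, hS⟩ := hM.2 U.1 U.2
    classical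
    refine ⟨⟨S.image (η.app U.1), ?_⟩⟩
    rw [eq_top_iff]
    rintro n -
    obtain ⟨m, rfl⟩ := (key U).2.2 n
    have hm : m ∈ Submodule.span Γ(X, U.1) (S : Set Γ(M, U.1)) := hS ▸ Submodule.mem_top
    induction hm using Submodule.span_induction with
    | mem x hx => exact Submodule.subset_span (by simpa using ⟨x, hx, rfl⟩)
    | zero => rw [map_zero]; exact zero_mem _
    | add x y _ _ hx hy => rw [map_add]; exact add_mem hx hy
    | smul a x _ hx =>
      rw [Scheme.Modules.Hom.app_smul]
      exact Submodule.smul_mem (M := Γ(N, p ⁻¹ᵁ U.1)) _ (p.app U.1 a) hx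
  · exact isIso_of_bijective_basis η (fun U : X.affineOpens => U.1)
      (by simpa using X.isBasis_affineOpens) fun U => (key U).2

lemma isBasis_basicOpen_preimage (p : Y ⟶ X) [IsAffineHom p] :
    TopologicalSpace.Opens.IsBasis (Set.range fun a : Σ U : X.affineOpens, Γ(Y, p ⁻¹ᵁ U.1) =>
      Y.basicOpen a.2) := by
  rw [TopologicalSpace.Opens.isBasis_iff_nbhd]
  intro V y hy
  obtain ⟨U, hU⟩ := TopologicalSpace.Opens.mem_iSup.mp
    ((iSup_preimage_affineOpens p).ge (show y ∈ (⊤ : Y.Opens) from trivial))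
  have hVU : y ∈ V ⊓ p ⁻¹ᵁ U.1 := ⟨hy, hU⟩
  obtain ⟨g, hg, hyg⟩ := (U.2.preimage p).exists_basicOpen_le ⟨y, hVU⟩ hU
  exact ⟨_, ⟨⟨U, g⟩, rfl⟩, hyg, hg.trans inf_le_left⟩

lemma baseHom_algebraMap (hw : p ≫ s = f ≫ Spec.map (CommRingCat.ofHom (algebraMap k Z)))
    (U : X.Opens) (c : k) :
    baseHom f (p ⁻¹ᵁ U) (algebraMap k Z c) = p.app U (baseHom s U c) := by
  rw [baseHom_comp]
  have h2 : ∀ g : Y ⟶ Spec (.of k), g = f ≫ Spec.map (CommRingCat.ofHom (algebraMap k Z)) →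
      baseHom f (p ⁻¹ᵁ U) (algebraMap k Z c) = baseHom g (p ⁻¹ᵁ U) c := by
    rintro _ rfl
    have h3 := ConcreteCategory.congr_hom
      (Scheme.ΓSpecIso_inv_naturality (CommRingCat.ofHom (algebraMap k Z))) c
    simp only [baseHom, RingHom.comp_apply, Scheme.Hom.comp_appTop]
    exact congrArg (fun z => resO _ (f.appTop.hom z)) h3
  exact h2 _ hw

/-- Direct image from a fibre product with `Spec Z` is fully faithful, up to the action of `Z`. -/
theorem existsUnique_pushforward_map
    (sq : IsPullback p f s (Spec.map (CommRingCat.ofHom (algebraMap k Z)))) [Module.Finite k Z]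
    [IsAffineHom p] {N K : Y.Modules} (hN : IsCoherent N)
    (φ : (Scheme.Modules.pushforward p).obj N ⟶ (Scheme.Modules.pushforward p).obj K)
    (hφ : ∀ z, (Scheme.Modules.pushforward p).map (zmul f N z) ≫ φ =
      φ ≫ (Scheme.Modules.pushforward p).map (zmul f K z)) :
    ∃! g : N ⟶ K, (Scheme.Modules.pushforward p).map g = φ := by
  let op : Z →+* End ((Scheme.Modules.pushforward p).obj N) :=
    { toFun := fun z => (Scheme.Modules.pushforward p).map (zmul f N z)
      map_one' := hom_ext' fun U n => by
        change baseHom f (p ⁻¹ᵁ U) 1 • (show Γ(N, p ⁻¹ᵁ U) from n) = n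
        rw [map_one, one_smul]
      map_mul' := fun a b => hom_ext' fun U n => by
        change baseHom f (p ⁻¹ᵁ U) (a * b) • (show Γ(N, p ⁻¹ᵁ U) from n) = _
        rw [map_mul, mul_smul]
        rfl
      map_zero' := hom_ext' fun U n => by
        change baseHom f (p ⁻¹ᵁ U) 0 • (show Γ(N, p ⁻¹ᵁ U) from n) = 0
        rw [map_zero, zero_smul]
      map_add' := fun a b => hom_ext' fun U n => by
        change baseHom f (p ⁻¹ᵁ U) (a + b) • (show Γ(N, p ⁻¹ᵁ U) from n) = _
        rw [map_add, add_smul]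
        rfl }
  have hop : ∀ c : k, op (algebraMap k Z c) = zmul s _ c := fun c => hom_ext' fun U n =>
    congrArg (fun r : Γ(Y, p ⁻¹ᵁ U) => r • (show Γ(N, p ⁻¹ᵁ U) from n)) (baseHom_algebraMap sq.w U c)
  obtain ⟨N', η, hη, huniv⟩ := exists_universal_pull f p _ op
  have hpN := isCoherent_pushforward sq hN
  have key := fun (U : X.affineOpens) =>
    isLocAt_universal_pull sq op hop η hη huniv U.2 (hpN.isLocAt U.2)
  obtain ⟨c, hc, -⟩ := huniv N (𝟙 _) fun z => (Category.comp_id _).trans (Category.id_comp _).symm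
  have hcU : ∀ U : X.affineOpens, Function.Bijective (c.app (p ⁻¹ᵁ U.1)) := by
    intro U
    refine ((key U).2.of_comp_iff (c.app (p ⁻¹ᵁ U.1) : Γ(N', p ⁻¹ᵁ U.1) → Γ(N, p ⁻¹ᵁ U.1))).mp ?_
    have : (c.app (p ⁻¹ᵁ U.1) : Γ(N', p ⁻¹ᵁ U.1) → Γ(N, p ⁻¹ᵁ U.1)) ∘
        (η.app U.1 : Γ(N, p ⁻¹ᵁ U.1) → Γ(N', p ⁻¹ᵁ U.1)) = id := funext fun n =>
      ConcreteCategory.congr_hom (congrArg (fun g => Scheme.Modules.Hom.app g U.1) hc) n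
    exact (congrArg Function.Bijective this).mpr Function.bijective_id
  have : IsIso c := isIso_of_bijective_basis c
    (fun a : Σ U : X.affineOpens, Γ(Y, p ⁻¹ᵁ U.1) => Y.basicOpen a.2)
    (isBasis_basicOpen_preimage p) fun a => bijective_basicOpen_of_isLocAt (key a.1).1
      (hN.isLocAt (a.1.2.preimage p)) c (hcU a.1) a.2
  have hinv : (Scheme.Modules.pushforward p).map (inv c) = η := by
    rw [Functor.map_inv, IsIso.inv_eq_of_inv_hom_id hc]
  obtain ⟨g, hg, hg'⟩ := huniv K φ hφ
  refine ⟨inv c ≫ g, ?_, fun g' h => ?_⟩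
  · change (Scheme.Modules.pushforward p).map _ = _
    rw [Functor.map_comp, hinv]
    exact hg
  · rw [← hg' (c ≫ g') ?_, IsIso.inv_hom_id_assoc]
    change η ≫ (Scheme.Modules.pushforward p).map _ = _
    rw [Functor.map_comp, ← Category.assoc, hc, Category.id_comp]
    exact h

end Descent
end EquivSheaf

end

noncomputable section
namespace EquivSheaf

section Ops
variable {R : Type u} [CommRing R] {X : Scheme.{u}} (f : X ⟶ Spec (.of R))

/-- Sections of a sheaf of modules, as a module over `FunSec f U`. -/
def ModSec (_f : X ⟶ Spec (.of R)) (M : X.Modules) (U : X.Opens) : Type u := Γ(M, U)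

instance (M : X.Modules) (U : X.Opens) : AddCommGroup (ModSec f M U) :=
  inferInstanceAs (AddCommGroup Γ(M, U))

instance (M : X.Modules) (U : X.Opens) : Module (FunSec f U) (ModSec f M U) :=
  inferInstanceAs (Module Γ(X, U) Γ(M, U))

instance (M : X.Modules) (U : X.Opens) : Module R (ModSec f M U) :=
  Module.compHom _ (algebraMap R (FunSec f U))

instance (M : X.Modules) (U : X.Opens) : IsScalarTower R (FunSec f U) (ModSec f M U) :=
  .of_algebraMap_smul fun _ _ => rfl

instance (M : X.Modules) (U : X.Opens) : SMulCommClass (FunSec f U) R (ModSec f M U) :=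
  inferInstance

variable {f} {A : Type u} [Ring A] [Algebra R A]

lemma end_mul_app {M : X.Modules} (a b : End M) (U : X.Opens) (m : Γ(M, U)) :
    Scheme.Modules.Hom.app (a * b) U m = Scheme.Modules.Hom.app a U (Scheme.Modules.Hom.app b U m) :=
  rfl

lemma end_one_app {M : X.Modules} (U : X.Opens) (m : Γ(M, U)) :
    Scheme.Modules.Hom.app (1 : End M) U m = m :=
  rfl

/-- The action on sections of the pulled back algebra, given an action of the algebra on the
sheaf. -/
def opSmul (M : X.Modules) (op : A →+* End M)
    (hop : ∀ r, op (algebraMap R A r) = zmul f M r) (U : X.Opens) :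
    PullSec f A U →ₐ[FunSec f U] Module.End (FunSec f U) (ModSec f M U) :=
  Algebra.TensorProduct.lift (Algebra.ofId _ _)
    { toFun := fun a => (homL (op a) U : Γ(M, U) →ₗ[Γ(X, U)] Γ(M, U))
      map_one' := LinearMap.ext fun m => by
        change Scheme.Modules.Hom.app (op 1) U m = m
        rw [map_one]; rfl
      map_mul' := fun a b => LinearMap.ext fun m => by
        change Scheme.Modules.Hom.app (op (a * b)) U m = _
        rw [map_mul]; rfl
      map_zero' := LinearMap.ext fun m => by
        change Scheme.Modules.Hom.app (op 0) U m = 0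
        rw [map_zero]; rfl
      map_add' := fun a b => LinearMap.ext fun m => by
        change Scheme.Modules.Hom.app (op (a + b)) U m = _
        rw [map_add]; rfl
      commutes' := fun r => LinearMap.ext fun m => by
        change Scheme.Modules.Hom.app (op (algebraMap R A r)) U m = _
        rw [hop]; rfl }
    (fun r a => Algebra.commutes r _)

lemma opSmul_tmul (M : X.Modules) (op : A →+* End M)
    (hop : ∀ r, op (algebraMap R A r) = zmul f M r) (U : X.Opens) (r : FunSec f U) (a : A)
    (m : ModSec f M U) :
    opSmul M op hop U (r ⊗ₜ a) m =
      r • (show ModSec f M U from Scheme.Modules.Hom.app (op a) U m) :=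
  LinearMap.congr_fun (Algebra.TensorProduct.lift_tmul _ _ _ r a) m

variable [Module.Finite R A] [Module.Projective R A]

/-- The action on sections of the pulled back algebra, as a bilinear map. -/
def opLin (M : X.Modules) (op : A →+* End M)
    (hop : ∀ r, op (algebraMap R A r) = zmul f M r) (U : X.Opens) :
    Γ((pullAlg f A).mod, U) →ₗ[Γ(X, U)] Γ(M, U) →ₗ[Γ(X, U)] Γ(M, U) :=
  (opSmul M op hop U).toLinearMap

/-- A module over the pullback of `A`, given by an action of `A`. -/
def AlgMod.ofOp (M : X.Modules) (op : A →+* End M)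
    (hop : ∀ r, op (algebraMap R A r) = zmul f M r) : AlgMod (pullAlg f A) where
  mod := M
  smul := opLin M op hop
  one_smul U m := LinearMap.congr_fun (map_one (opSmul M op hop U)) m
  mul_smul U a b m := LinearMap.congr_fun (map_mul (opSmul M op hop U) (show PullSec f A U from a)
    (show PullSec f A U from b)) m
  res_smul {U V} i b m := by
    suffices h : ∀ b : PullSec f A U, res M i (opSmul M op hop U b m) =
      opSmul M op hop V (PullSec.res f A i b) (res M i m) from h b
    intro b
    induction b using TensorProduct.induction_on with
    | zero => rw [map_zero, map_zero, map_zero]; exact map_zero _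
    | add b c hb hc =>
      rw [map_add, map_add, map_add]
      exact (map_add (res M i) _ _).trans (congrArg₂ (· + ·) hb hc)
    | tmul r a =>
      refine (congrArg (res M i) (opSmul_tmul M op hop U r a m)).trans ?_
      refine Eq.trans ?_ (opSmul_tmul M op hop V (FunSec.res f i r) a (res M i m)).symm
      refine (res_osmul M i r _).trans ?_
      rw [← hom_res]
      rfl

/-- The section `1 ⊗ a` of the pullback of `A`. -/
def pullSec (f : X ⟶ Spec (.of R)) (a : A) (U : X.Opens) : Γ((pullAlg f A).mod, U) :=
  (1 ⊗ₜ[R] a : PullSec f A U)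

lemma res_pullSec (a : A) {U V : X.Opens} (i : V ≤ U) :
    res (pullAlg f A).mod i (pullSec f a U) = pullSec f a V :=
  congrArg (· ⊗ₜ[R] a) (map_one (FunSec.res f i))

/-- The action of `A` on a module over the pullback of `A`. -/
def AlgMod.op (M : AlgMod (pullAlg f A)) : A →+* End M.mod where
  toFun a := mkHom (fun U => M.smul U (pullSec f a U)) fun i s => by
    rw [M.res_smul, res_pullSec]
  map_one' := hom_ext' fun U m => M.one_smul U m
  map_mul' a b := hom_ext' fun U m => by
    refine Eq.trans ?_ (M.mul_smul U (pullSec f a U) (pullSec f b U) m)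
    refine congrArg (fun x => M.smul U x m) ?_
    change _ = (1 ⊗ₜ[R] a : PullSec f A U) * (1 ⊗ₜ[R] b : PullSec f A U)
    rw [Algebra.TensorProduct.tmul_mul_tmul, one_mul]
    rfl
  map_zero' := hom_ext' fun U m => by
    refine (congrArg (fun x => M.smul U x m) ?_).trans
      (LinearMap.congr_fun (map_zero (M.smul U)) m)
    exact TensorProduct.tmul_zero _ _
  map_add' a b := hom_ext' fun U m => by
    refine (congrArg (fun x => M.smul U x m) ?_).trans
      (LinearMap.congr_fun (map_add (M.smul U) (pullSec f a U) (pullSec f b U)) m)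
    exact TensorProduct.tmul_add _ _ _

lemma AlgMod.op_app (M : AlgMod (pullAlg f A)) (a : A) (U : X.Opens) (m : Γ(M.mod, U)) :
    Scheme.Modules.Hom.app (M.op a) U m = M.smul U (pullSec f a U) m := rfl

lemma AlgMod.smul_tmul (M : AlgMod (pullAlg f A)) (U : X.Opens) (r : FunSec f U) (a : A)
    (m : Γ(M.mod, U)) :
    M.smul U (r ⊗ₜ[R] a : PullSec f A U) m =
      (show Γ(X, U) from r) • Scheme.Modules.Hom.app (M.op a) U m := by
  rw [AlgMod.op_app]
  refine Eq.trans ?_ (LinearMap.congr_fun (map_smul (M.smul U) (show Γ(X, U) from r)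
    (pullSec f a U)) m)
  refine congrArg (fun x => M.smul U x m) ?_
  change (r ⊗ₜ[R] a : PullSec f A U) = r • (1 ⊗ₜ[R] a : PullSec f A U)
  rw [TensorProduct.smul_tmul', smul_eq_mul, mul_one]

lemma AlgMod.op_algebraMap (M : AlgMod (pullAlg f A)) (r : R) :
    M.op (algebraMap R A r) = zmul f M.mod r := hom_ext' fun U m => by
  rw [AlgMod.op_app, zmul_app]
  have h : (pullSec f (algebraMap R A r) U) = (algebraMap R (FunSec f U) r ⊗ₜ[R] (1 : A)) := by
    change (1 : FunSec f U) ⊗ₜ[R] (algebraMap R A r) = _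
    rw [Algebra.algebraMap_eq_smul_one, Algebra.algebraMap_eq_smul_one, TensorProduct.smul_tmul]
  rw [h, M.smul_tmul, map_one]
  rfl

lemma AlgMod.op_ofOp (M : X.Modules) (op : A →+* End M)
    (hop : ∀ r, op (algebraMap R A r) = zmul f M r) : (AlgMod.ofOp M op hop).op = op := by
  ext a : 1
  refine hom_ext' fun U m => ?_
  exact (opSmul_tmul M op hop U 1 a m).trans (_root_.one_smul _ _)

/-- Every section of the pullback of `A` is a sum of multiples of elements of `A`. -/
lemma pullSec_induction {U : X.Opens} {P : Γ((pullAlg f A).mod, U) → Prop} (h0 : P 0)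
    (hadd : ∀ x y, P x → P y → P (x + y))
    (hs : ∀ (r : Γ(X, U)) (a : A), P (r • pullSec f a U)) (x : Γ((pullAlg f A).mod, U)) : P x := by
  suffices h : ∀ y : PullSec f A U, P y from h x
  intro y
  induction y using TensorProduct.induction_on with
  | zero => exact h0
  | add x y hx hy => exact hadd _ _ hx hy
  | tmul r a =>
    have : (r ⊗ₜ[R] a : PullSec f A U) = r • (1 ⊗ₜ[R] a : PullSec f A U) := by
      rw [TensorProduct.smul_tmul', smul_eq_mul, mul_one]
    rw [this]
    exact hs r a

lemma AlgMod.map_bsmul_of_op {M N : AlgMod (pullAlg f A)} (φ : M.mod ⟶ N.mod)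
    (h : ∀ a U m, φ.app U (Scheme.Modules.Hom.app (M.op a) U m) =
      Scheme.Modules.Hom.app (N.op a) U (φ.app U m))
    (U : X.Opens) (b : Γ((pullAlg f A).mod, U)) (m : Γ(M.mod, U)) :
    φ.app U (M.smul U b m) = N.smul U b (φ.app U m) := by
  induction b using pullSec_induction with
  | h0 => rw [map_zero, map_zero]; exact map_zero _
  | hadd x y hx hy =>
    rw [map_add, map_add, LinearMap.add_apply, LinearMap.add_apply, ← hx, ← hy, map_add]
  | hs r a =>
    rw [map_smul, map_smul, LinearMap.smul_apply, LinearMap.smul_apply,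
      Scheme.Modules.Hom.app_smul]
    exact congrArg (fun x => r • x) (h a U m)

/-- A coherent module over the pullback of `A`, given by an action of `A`. -/
def CohAlg.ofOp (M : X.Modules) (hM : IsCoherent M) (op : A →+* End M)
    (hop : ∀ r, op (algebraMap R A r) = zmul f M r) : CohAlg (pullAlg f A) where
  toAlgMod := AlgMod.ofOp M op hop
  coherent := hM

/-- A morphism of coherent modules over the pullback of `A`. -/
def CohAlg.homOfOp {M N : CohAlg (pullAlg f A)} (φ : M.mod ⟶ N.mod)
    (h : ∀ a U m, φ.app U (Scheme.Modules.Hom.app (M.op a) U m) =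
      Scheme.Modules.Hom.app (N.op a) U (φ.app U m)) : M ⟶ N :=
  CohAlg.Hom.mk φ (AlgMod.map_bsmul_of_op φ h)

lemma CohAlg.hom_op {M N : CohAlg (pullAlg f A)} (φ : M ⟶ N) (a : A) (U : X.Opens)
    (m : Γ(M.mod, U)) : φ.hom.app U (Scheme.Modules.Hom.app (M.op a) U m) =
      Scheme.Modules.Hom.app (N.op a) U (φ.hom.app U m) :=
  φ.map_bsmul U _ m

end Ops

section EqOps
variable {H : Type u} [Group H] {R : Type u} [CommRing R] {τ : H →* RingAut R}
  {X : Scheme.{u}} {ρ : H →* Aut X} {f : X ⟶ Spec (.of R)} (hf : IsEquivariant τ ρ f)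
  {A : RAlg τ} [Module.Finite R A.carrier] [Module.Projective R A.carrier]

lemma pullEqAlg_act_pullSec (h : H) (a : A.carrier) (U : X.Opens) :
    (pullEqAlg hf A).act h U (pullSec f a U) = pullSec f (A.act h a) (translate ρ h U) :=
  (pullAct_tmul hf A h U 1 a).trans (congrArg (· ⊗ₜ[R] A.act h a) (map_one (FunSec.act f ρ h U)))

lemma act_bsmul_of_op (L : AlgMod (pullAlg f A.carrier))
    (act : ∀ (h : H) (U : X.Opens), Γ(L.mod, U) →+ Γ(L.mod, translate ρ h U))
    (act_osmul : ∀ h U (r : Γ(X, U)) (s : Γ(L.mod, U)),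
      act h U (r • s) = actO ρ h U r • act h U s)
    (hact : ∀ h a U m, act h U (Scheme.Modules.Hom.app (L.op a) U m) =
      Scheme.Modules.Hom.app (L.op (A.act h a)) _ (act h U m)) (h : H) (U : X.Opens)
    (b : Γ((pullAlg f A.carrier).mod, U)) (m : Γ(L.mod, U)) :
    act h U (L.smul U b m) = L.smul _ ((pullEqAlg hf A).act h U b) (act h U m) := by
  induction b using pullSec_induction with
  | h0 => 
    refine (congrArg (act h U) (LinearMap.congr_fun (map_zero (L.smul U)) m)).trans ?_
    refine (map_zero (act h U)).trans (LinearMap.congr_fun (((congrArg _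
      (map_zero ((pullEqAlg hf A).act h U)))).trans (map_zero (L.smul _))) _).symm
  | hadd x y hx hy =>
    rw [map_add, LinearMap.add_apply, map_add, hx, hy]
    exact (LinearMap.congr_fun (((congrArg _ (map_add ((pullEqAlg hf A).act h U) x y))).trans
      (map_add (L.smul _) _ _)) _).symm
  | hs r a =>
    rw [map_smul, LinearMap.smul_apply, act_osmul]
    refine Eq.trans ?_ (LinearMap.congr_fun (((congrArg _ ((pullEqAlg hf A).act_osmul h U r
      (pullSec f a U)))).trans (map_smul (L.smul _) _ _)) _).symm
    refine congrArg (fun x => actO ρ h U r • x) ?_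
    refine (hact h a U m).trans ?_
    exact congrArg (fun x => L.smul _ x _) (pullEqAlg_act_pullSec hf h a U).symm

/-- An equivariant coherent module over the pullback of `A`, given by an action of `A`. -/
def EqCohAlg.ofOp (E : EqMod ρ) (hE : IsCoherent E.mod) (op : A.carrier →+* End E.mod)
    (hop : ∀ r, op (algebraMap R A.carrier r) = zmul f E.mod r)
    (hact : ∀ h a U m, E.act h U (Scheme.Modules.Hom.app (op a) U m) =
      Scheme.Modules.Hom.app (op (A.act h a)) _ (E.act h U m)) :
    EqCohAlg (pullEqAlg hf A) where
  toCohAlg := CohAlg.ofOp E.mod hE op hop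
  act := E.act
  act_osmul := E.act_osmul
  act_res := E.act_res
  act_one := E.act_one
  act_comp := E.act_comp
  act_bsmul := act_bsmul_of_op hf (AlgMod.ofOp E.mod op hop) E.act E.act_osmul
    (by rw [AlgMod.op_ofOp]; exact hact)

variable {hf} in
/-- The action of `A` on an equivariant module over the pullback of `A`. -/
def EqCohAlg.op (M : EqCohAlg (pullEqAlg hf A)) : A.carrier →+* End M.mod :=
  AlgMod.op (f := f) (A := A.carrier) M.toAlgMod

lemma EqCohAlg.op_algebraMap (M : EqCohAlg (pullEqAlg hf A)) (r : R) :
    M.op (algebraMap R A.carrier r) = zmul f M.mod r :=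
  AlgMod.op_algebraMap (f := f) (A := A.carrier) M.toAlgMod r

lemma EqCohAlg.op_ofOp (E : EqMod ρ) (hE : IsCoherent E.mod) (op : A.carrier →+* End E.mod)
    (hop : ∀ r, op (algebraMap R A.carrier r) = zmul f E.mod r)
    (hact : ∀ h a U m, E.act h U (Scheme.Modules.Hom.app (op a) U m) =
      Scheme.Modules.Hom.app (op (A.act h a)) _ (E.act h U m)) :
    (EqCohAlg.ofOp hf E hE op hop hact).op = op :=
  AlgMod.op_ofOp (f := f) _ _ _

lemma EqCohAlg.act_op {M : EqCohAlg (pullEqAlg hf A)} (h : H) (a : A.carrier) (U : X.Opens)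
    (m : Γ(M.mod, U)) :
    M.act h U (Scheme.Modules.Hom.app (M.op a) U m) =
      Scheme.Modules.Hom.app (M.op (A.act h a)) _
        (M.act h U m) := by
  refine (M.act_bsmul h U _ m).trans ?_
  exact congrArg (fun x => M.smul _ x _) (pullEqAlg_act_pullSec hf h a U)

/-- A morphism of equivariant coherent modules over the pullback of `A`. -/
def EqCohAlg.homOfOp {M N : EqCohAlg (pullEqAlg hf A)} (φ : M.mod ⟶ N.mod)
    (h : ∀ a U m, φ.app U (Scheme.Modules.Hom.app (M.op a) U m) =
      Scheme.Modules.Hom.app (N.op a) U (φ.app U m))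
    (h' : ∀ h U (s : Γ(M.mod, U)), φ.app (translate ρ h U) (M.act h U s) =
      N.act h U (φ.app U s)) : M ⟶ N :=
  EqCohAlg.Hom.mk φ (AlgMod.map_bsmul_of_op φ h) h'

lemma EqCohAlg.hom_op {M N : EqCohAlg (pullEqAlg hf A)} (φ : M ⟶ N) (a : A.carrier) (U : X.Opens)
    (m : Γ(M.mod, U)) : φ.hom.app U (Scheme.Modules.Hom.app (M.op a) U m) =
      Scheme.Modules.Hom.app (N.op a) U
        (φ.hom.app U m) :=
  φ.map_bsmul U _ m

end EqOps

section Isos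
variable {X : Scheme.{u}} {H : Type u} [Group H] {ρ : H →* Aut X}

/-- Isomorphisms of equivariant modules over a sheaf of algebras can be checked on sections. -/
lemma EqCohAlg.isIso_of_bijective {B : EqAlg ρ} {M N : EqCohAlg B} (φ : M ⟶ N)
    (h : ∀ U, Function.Bijective (φ.hom.app U)) : IsIso φ := by
  have := EquivSheaf.isIso_of_bijective φ.hom h
  have hinv : ∀ U n, φ.hom.app U ((inv φ.hom).app U n) = n := fun U n =>
    ConcreteCategory.congr_hom (congrArg (fun g => Scheme.Modules.Hom.app g U)
      (IsIso.inv_hom_id φ.hom)) n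
  refine ⟨⟨inv φ.hom, fun U b m => (h U).1 ?_, fun g U m => (h _).1 ?_⟩,
    EqCohAlg.Hom.ext (IsIso.hom_inv_id φ.hom), EqCohAlg.Hom.ext (IsIso.inv_hom_id φ.hom)⟩
  · rw [hinv, φ.map_bsmul, hinv]
  · rw [hinv, φ.map_act, hinv]

lemma CohAlg.isIso_of_bijective {B : SheafAlg X} {M N : CohAlg B} (φ : M ⟶ N)
    (h : ∀ U, Function.Bijective (φ.hom.app U)) : IsIso φ := by
  have := EquivSheaf.isIso_of_bijective φ.hom h
  have hinv : ∀ U n, φ.hom.app U ((inv φ.hom).app U n) = n := fun U n =>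
    ConcreteCategory.congr_hom (congrArg (fun g => Scheme.Modules.Hom.app g U)
      (IsIso.inv_hom_id φ.hom)) n
  refine ⟨⟨inv φ.hom, fun U b m => (h U).1 ?_⟩,
    CohAlg.Hom.ext (IsIso.hom_inv_id φ.hom), CohAlg.Hom.ext (IsIso.inv_hom_id φ.hom)⟩
  rw [hinv, φ.map_bsmul, hinv]

attribute [irreducible] opLin

end Isos
end EquivSheaf

end

noncomputable section
namespace EquivSheaf

section Act
variable {H : Type u} [Group H] {X : Scheme.{u}}

/-- The axioms of an equivariant structure. -/
structure IsAct (ρ : H →* Aut X) (M : X.Modules)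
    (act : ∀ (h : H) (U : X.Opens), Γ(M, U) →+ Γ(M, translate ρ h U)) : Prop where
  act_osmul : ∀ h U (r : Γ(X, U)) (s : Γ(M, U)), act h U (r • s) = actO ρ h U r • act h U s
  act_res : ∀ h {U V : X.Opens} (i : V ≤ U) (s : Γ(M, U)),
    act h V (res M i s) = res M (translate_mono ρ h i) (act h U s)
  act_one : ∀ U (s : Γ(M, U)), act 1 U s = res M (translate_one ρ U).le s
  act_comp : ∀ g h U (s : Γ(M, U)),
    act (g * h) U s = res M (translate_mul ρ g h U).le (act g (translate ρ h U) (act h U s))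

/-- The equivariant sheaf given by an equivariant structure. -/
def IsAct.eqMod {ρ : H →* Aut X} {M : X.Modules}
    {act : ∀ (h : H) (U : X.Opens), Γ(M, U) →+ Γ(M, translate ρ h U)} (ha : IsAct ρ M act) :
    EqMod ρ where
  mod := M
  act := act
  act_osmul := ha.act_osmul
  act_res := ha.act_res
  act_one := ha.act_one
  act_comp := ha.act_comp

end Act

section PushAct
variable {k Z : Type u} [CommRing k] [CommRing Z] [Algebra k Z] {X Y : Scheme.{u}}
  {s : X ⟶ Spec (.of k)} {f : Y ⟶ Spec (.of Z)} {p : Y ⟶ X}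
  {H : Type u} [Group H] {τ : H →* RingAut Z} {ρ : H →* Aut X} {ρ' : H →* Aut Y}

lemma hom_eq_of_pushforward
    (sq : IsPullback p f s (Spec.map (CommRingCat.ofHom (algebraMap k Z)))) [Module.Finite k Z]
    [IsAffineHom p] {N K : Y.Modules} (hN : IsCoherent N) {g g' : N ⟶ K}
    (h : ∀ (U : X.Opens) n, g.app (p ⁻¹ᵁ U) n = g'.app (p ⁻¹ᵁ U) n) : g = g' := by
  refine (existsUnique_pushforward_map sq hN ((Scheme.Modules.pushforward p).map g')
    fun z => ?_).unique (hom_ext' h) rfl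
  rw [← Functor.map_comp, ← Functor.map_comp, zmul_comm]

/-- A semilinear family of maps compatible with restriction is a morphism to a direct image. -/
def mkSemi (σ : Y ⟶ X) {M : X.Modules} {K : Y.Modules}
    (φ : ∀ U : X.Opens, Γ(M, U) →+ Γ(K, σ ⁻¹ᵁ U))
    (hsmul : ∀ U (r : Γ(X, U)) (m : Γ(M, U)), φ U (r • m) = σ.app U r • φ U m)
    (hres : ∀ {U V : X.Opens} (i : V ≤ U) m,
      φ V (res M i m) = res K (Scheme.Hom.preimage_mono σ i) (φ U m)) :
    M ⟶ (Scheme.Modules.pushforward σ).obj K :=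
  mkHom (fun U => show Γ(M, U) →ₗ[Γ(X, U)] Γ((Scheme.Modules.pushforward σ).obj K, U) from
    { toFun := φ U
      map_add' := map_add (φ U)
      map_smul' := hsmul U }) (fun i m => hres i m)

lemma mkSemi_app (σ : Y ⟶ X) {M : X.Modules} {K : Y.Modules}
    (φ : ∀ U : X.Opens, Γ(M, U) →+ Γ(K, σ ⁻¹ᵁ U))
    (hsmul : ∀ U (r : Γ(X, U)) (m : Γ(M, U)), φ U (r • m) = σ.app U r • φ U m)
    (hres : ∀ {U V : X.Opens} (i : V ≤ U) m,
      φ V (res M i m) = res K (Scheme.Hom.preimage_mono σ i) (φ U m)) (U : X.Opens)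
    (m : Γ(M, U)) :
    ((mkSemi σ φ hsmul hres).app U m : Γ(K, σ ⁻¹ᵁ U)) = φ U m := rfl

/-- A family of maps to the sections over translates, as a morphism to a direct image. -/
def mkTranslate (ρ : H →* Aut X) (h : H) {M K : X.Modules}
    (φ : ∀ U : X.Opens, Γ(M, U) →+ Γ(K, translate ρ h U))
    (hsmul : ∀ U (r : Γ(X, U)) (m : Γ(M, U)), φ U (r • m) = actO ρ h U r • φ U m)
    (hres : ∀ {U V : X.Opens} (i : V ≤ U) m,
      φ V (res M i m) = res K (translate_mono ρ h i) (φ U m)) :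
    M ⟶ (Scheme.Modules.pushforward (ρ h).inv).obj K :=
  mkSemi (ρ h).inv φ hsmul hres

lemma preimage_translate (hp : ∀ h, (ρ' h).inv ≫ p = p ≫ (ρ h).inv) (h : H) (U : X.Opens) :
    p ⁻¹ᵁ (translate ρ h U) = translate ρ' h (p ⁻¹ᵁ U) := by
  change (p ≫ (ρ h).inv) ⁻¹ᵁ U = ((ρ' h).inv ≫ p) ⁻¹ᵁ U
  rw [hp]

lemma actO_app (hp : ∀ h, (ρ' h).inv ≫ p = p ≫ (ρ h).inv) (h : H) (U : X.Opens) (r : Γ(X, U)) :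
    p.app (translate ρ h U) (actO ρ h U r) =
      resO (preimage_translate hp h U).le (actO ρ' h (p ⁻¹ᵁ U) (p.app U r)) := by
  have key : ∀ (g : Y ⟶ X) (hg : g = p ≫ (ρ h).inv) (e : p ⁻¹ᵁ (translate ρ h U) ≤ g ⁻¹ᵁ U),
      p.app (translate ρ h U) (actO ρ h U r) = resO e (g.app U r) := by
    rintro _ rfl e
    exact (resO_self e _).symm
  exact key _ (hp h) _

/-- The direct image of an equivariant sheaf. -/
def EqMod.push (hp : ∀ h, (ρ' h).inv ≫ p = p ≫ (ρ h).inv) (N : EqMod ρ') : EqMod ρ where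
  mod := (Scheme.Modules.pushforward p).obj N.mod
  act h U := (res N.mod (preimage_translate hp h U).le).comp (N.act h (p ⁻¹ᵁ U))
  act_osmul h U r n₀ := by
    let n : Γ(N.mod, p ⁻¹ᵁ U) := n₀
    change res N.mod _ (N.act h (p ⁻¹ᵁ U) (p.app U r • n)) = _
    rw [N.act_osmul, res_osmul, ← actO_app hp]
    rfl
  act_res h U V i n₀ := by
    let n : Γ(N.mod, p ⁻¹ᵁ U) := n₀
    change res N.mod _ (N.act h (p ⁻¹ᵁ V) (res N.mod (Scheme.Hom.preimage_mono p i) n)) =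
      res N.mod (Scheme.Hom.preimage_mono p (translate_mono ρ h i)) (res N.mod _ _)
    rw [N.act_res, res_res, res_res]
    rfl
  act_one U n₀ := by
    let n : Γ(N.mod, p ⁻¹ᵁ U) := n₀
    change res N.mod _ (N.act 1 (p ⁻¹ᵁ U) n) =
      res N.mod (Scheme.Hom.preimage_mono p (translate_one ρ U).le) n
    rw [N.act_one, res_res]
  act_comp g h U n₀ := by
    let n : Γ(N.mod, p ⁻¹ᵁ U) := n₀
    change res N.mod _ (N.act (g * h) (p ⁻¹ᵁ U) n) =
      res N.mod (Scheme.Hom.preimage_mono p (translate_mul ρ g h U).le)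
        (res N.mod _ (N.act g _ (res N.mod (preimage_translate hp h U).le _)))
    rw [N.act_comp, N.act_res, res_res, res_res, res_res]
    rfl

lemma family_eq_of_pushforward
    (sq : IsPullback p f s (Spec.map (CommRingCat.ofHom (algebraMap k Z)))) [Module.Finite k Z]
    [IsAffineHom p] {N : Y.Modules} (hN : IsCoherent N) (h : H)
    (b c : ∀ V : Y.Opens, Γ(N, V) →+ Γ(N, translate ρ' h V))
    (hb : ∀ V (r : Γ(Y, V)) n, b V (r • n) = actO ρ' h V r • b V n)
    (hc : ∀ V (r : Γ(Y, V)) n, c V (r • n) = actO ρ' h V r • c V n)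
    (hb' : ∀ {U V : Y.Opens} (i : V ≤ U) n,
      b V (res N i n) = res N (translate_mono ρ' h i) (b U n))
    (hc' : ∀ {U V : Y.Opens} (i : V ≤ U) n,
      c V (res N i n) = res N (translate_mono ρ' h i) (c U n))
    (e : ∀ (U : X.Opens) n, b (p ⁻¹ᵁ U) n = c (p ⁻¹ᵁ U) n) (V : Y.Opens) (n : Γ(N, V)) :
    b V n = c V n := by
  have h1 : mkTranslate ρ' h b hb hb' = mkTranslate ρ' h c hc hc' :=
    hom_eq_of_pushforward sq hN e
  exact ConcreteCategory.congr_hom (congrArg (fun g => Scheme.Modules.Hom.app g V) h1) n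

lemma exists_lift_act
    (sq : IsPullback p f s (Spec.map (CommRingCat.ofHom (algebraMap k Z)))) [Module.Finite k Z]
    [IsAffineHom p] (hf : IsEquivariant τ ρ' f) (hp : ∀ h, (ρ' h).inv ≫ p = p ≫ (ρ h).inv)
    {N : Y.Modules} (hN : IsCoherent N)
    (a : ∀ (h : H) (U : X.Opens), Γ(N, p ⁻¹ᵁ U) →+ Γ(N, p ⁻¹ᵁ (translate ρ h U)))
    (ha : IsAct ρ ((Scheme.Modules.pushforward p).obj N) a)
    (hz : ∀ h U z (n : Γ(N, p ⁻¹ᵁ U)),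
      a h U (baseHom f (p ⁻¹ᵁ U) z • n) =
        baseHom f (p ⁻¹ᵁ (translate ρ h U)) (τ h z) • a h U n) :
    ∃ a' : ∀ (h : H) (V : Y.Opens), Γ(N, V) →+ Γ(N, translate ρ' h V), IsAct ρ' N a' ∧
      ∀ h U (n : Γ(N, p ⁻¹ᵁ U)),
        res N (preimage_translate hp h U).le (a' h (p ⁻¹ᵁ U) n) = a h U n := by
  let α : ∀ h : H, (Scheme.Modules.pushforward p).obj N ⟶ (Scheme.Modules.pushforward p).obj
      ((Scheme.Modules.pushforward (ρ' h).inv).obj N) := fun h =>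
    mkSemi p (M := (Scheme.Modules.pushforward p).obj N)
      (K := (Scheme.Modules.pushforward (ρ' h).inv).obj N)
      (fun U => (res N (preimage_translate hp h U).ge).comp (a h U))
      (fun U r n => by
        refine (congrArg (res N (preimage_translate hp h U).ge) (ha.act_osmul h U r n)).trans ?_
        refine (res_osmul N (preimage_translate hp h U).ge (p.app _ (actO ρ h U r)) _).trans ?_
        rw [actO_app hp, resO_resO, resO_self]
        rfl)
      (fun {U V} i n => by
        refine (congrArg (res N (preimage_translate hp h V).ge) (ha.act_res h i n)).trans ?_
        refine (res_res N (Scheme.Hom.preimage_mono p (translate_mono ρ h i))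
          (preimage_translate hp h V).ge (a h U n)).trans ?_
        exact (res_res N (preimage_translate hp h U).ge
          (translate_mono ρ' h (Scheme.Hom.preimage_mono p i)) (a h U n)).symm)
  have hα : ∀ h U (n : Γ(N, p ⁻¹ᵁ U)),
      ((α h).app U n : Γ(N, translate ρ' h (p ⁻¹ᵁ U))) =
        res N (preimage_translate hp h U).ge (a h U n) := fun h U n =>
    mkSemi_app p (M := (Scheme.Modules.pushforward p).obj N)
      (K := (Scheme.Modules.pushforward (ρ' h).inv).obj N)
      (fun U => (res N (preimage_translate hp h U).ge).comp (a h U)) _ _ U n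
  have hg := fun h => (existsUnique_pushforward_map sq hN (α h) (fun z => hom_ext' fun U n => by
    change res N (preimage_translate hp h U).ge (a h U (baseHom f (p ⁻¹ᵁ U) z •
        (show Γ(N, p ⁻¹ᵁ U) from n))) = actO ρ' h (p ⁻¹ᵁ U) (baseHom f (p ⁻¹ᵁ U) z) • res N (preimage_translate hp h U).ge (a h U n)
    rw [hz, res_osmul, actO_baseHom hf, resO_baseHom])).exists
  choose g hg using hg
  let a' : ∀ (h : H) (V : Y.Opens), Γ(N, V) →+ Γ(N, translate ρ' h V) := fun h V =>
    ((g h).app V).hom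
  have ha' : ∀ h U (n : Γ(N, p ⁻¹ᵁ U)), a' h (p ⁻¹ᵁ U) n =
      res N (preimage_translate hp h U).ge (a h U n) := fun h U n => by
    rw [← hα, ← hg]; rfl
  have osmul : ∀ h U (r : Γ(Y, U)) (s : Γ(N, U)),
      a' h U (r • s) = actO ρ' h U r • a' h U s := fun h U r n =>
    (g h).app_smul r n
  have hres : ∀ h {U V : Y.Opens} (i : V ≤ U) (s : Γ(N, U)),
    a' h V (res N i s) = res N (translate_mono ρ' h i) (a' h U s) := fun h U V i n =>
    hom_res (g h) i n
  refine ⟨a', ⟨osmul, hres, fun V n => ?_, fun h₁ h₂ V n => ?_⟩, fun h U n => ?_⟩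
  · refine family_eq_of_pushforward sq hN 1 (a' 1) (fun U => res N (translate_one ρ' U).le)
      (osmul 1) (fun U r n => by rw [res_osmul, ← actO_one]) (hres 1)
      (fun i n => by rw [res_res, res_res]) (fun U n => ?_) V n
    rw [ha']
    refine (congrArg (res N _) (ha.act_one U n)).trans ?_
    exact res_res N (Scheme.Hom.preimage_mono p (translate_one ρ U).le) _ n
  · obtain ⟨c, hc⟩ : ∃ c : ∀ U : Y.Opens, Γ(N, U) →+ Γ(N, translate ρ' (h₁ * h₂) U),
        ∀ U n, c U n = res N (translate_mul ρ' h₁ h₂ U).le (a' h₁ _ (a' h₂ U n)) :=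
      ⟨fun U => (res N (translate_mul ρ' h₁ h₂ U).le).comp ((a' h₁ _).comp (a' h₂ U)),
        fun _ _ => rfl⟩
    rw [← hc]
    refine family_eq_of_pushforward sq hN (h₁ * h₂) (a' (h₁ * h₂)) c
      (osmul _) (fun U r n => ?_) (hres _) (fun i n => ?_) (fun U n => ?_) V n
    · rw [hc, hc, osmul, osmul, res_osmul, ← actO_mul]
    · rw [hc, hc, hres, hres, res_res, res_res]
    · have h2 : res N (preimage_translate hp h₂ U).ge (a h₂ U n) = a' h₂ (p ⁻¹ᵁ U) n :=
        (ha' h₂ U n).symm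
      have h3 := hres h₁ (preimage_translate hp h₂ U).ge (a h₂ U n)
      rw [h2, ha' h₁ (translate ρ h₂ U) (a h₂ U n), res_res] at h3
      rw [hc, ha', h3, res_res]
      refine (congrArg (res N _) (ha.act_comp h₁ h₂ U n)).trans ?_
      exact res_res N (Scheme.Hom.preimage_mono p (translate_mul ρ h₁ h₂ U).le) _ _
  · rw [ha', res_res, res_self]

/-- The action on the direct image of endomorphisms. -/
def pushEnd (p : Y ⟶ X) (N : Y.Modules) :
    End N →+* End ((Scheme.Modules.pushforward p).obj N) where
  toFun g := (Scheme.Modules.pushforward p).map g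
  map_one' := (Scheme.Modules.pushforward p).map_id N
  map_mul' g g' := (Scheme.Modules.pushforward p).map_comp g' g
  map_zero' := hom_ext' fun _ _ => rfl
  map_add' _ _ := hom_ext' fun _ _ => rfl

variable {τ₀ : H →* RingAut k} (hs : IsEquivariant τ₀ ρ s) (hf : IsEquivariant τ ρ' f)
  (hp : ∀ h, (ρ' h).inv ≫ p = p ≫ (ρ h).inv)
  {B : RAlg τ₀} [Module.Finite k B.carrier] [Module.Projective k B.carrier]
  {A : RAlg τ} [Module.Finite Z A.carrier] [Module.Projective Z A.carrier]
  (ι : B.carrier ≃+* A.carrier)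
  (hι : ∀ c, ι (algebraMap k B.carrier c) = algebraMap Z A.carrier (algebraMap k Z c))
  (hι' : ∀ h b, ι (B.act h b) = A.act h (ι b))

variable (sq : IsPullback p f s (Spec.map (CommRingCat.ofHom (algebraMap k Z))))
  [Module.Finite k Z] [IsAffineHom p]

/-- The direct image of an equivariant module over a pulled back algebra. -/
def pushEqObj (N : EqCohAlg (pullEqAlg hf A)) : EqCohAlg (pullEqAlg hs B) :=
  EqCohAlg.ofOp hs (EqMod.push hp N.toEqMod) (isCoherent_pushforward sq N.coherent)
    ((pushEnd p N.mod).comp (N.op.comp (ι : B.carrier →+* A.carrier)))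
    (fun c => by
      refine (congrArg (fun x => pushEnd p N.mod (N.op x)) (hι c)).trans ?_
      rw [EqCohAlg.op_algebraMap]
      refine hom_ext' fun U n => ?_
      exact congrArg (fun r : Γ(Y, p ⁻¹ᵁ U) => r • (show Γ(N.mod, p ⁻¹ᵁ U) from n))
        (baseHom_algebraMap sq.w U c))
    (fun h b U n => by
      refine (congrArg (res N.mod (preimage_translate hp h U).le)
        (EqCohAlg.act_op hf h (ι b) (p ⁻¹ᵁ U) n)).trans ?_
      rw [← hι']
      exact (hom_res (N.op (ι (B.act h b)))
        (preimage_translate hp h U).le (N.act h (p ⁻¹ᵁ U) n)).symm)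

lemma pushEqObj_op (N : EqCohAlg (pullEqAlg hf A)) :
    (pushEqObj hs hf hp ι hι hι' sq N).op =
      (pushEnd p N.mod).comp (N.op.comp (ι : B.carrier →+* A.carrier)) :=
  EqCohAlg.op_ofOp hs _ _ _ _ _

lemma pushEqObj_op_app (N : EqCohAlg (pullEqAlg hf A)) (b : B.carrier) (U : X.Opens)
    (n : Γ(N.mod, p ⁻¹ᵁ U)) :
    (Scheme.Modules.Hom.app ((pushEqObj hs hf hp ι hι hι' sq N).op b) U n : Γ(N.mod, p ⁻¹ᵁ U)) =
    Scheme.Modules.Hom.app (N.op (ι b)) (p ⁻¹ᵁ U) n := by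
  rw [pushEqObj_op]
  rfl

/-- Direct image of equivariant modules over a pulled back algebra. -/
def pushEq : EqCohAlg (pullEqAlg hf A) ⥤ EqCohAlg (pullEqAlg hs B) where
  obj N := pushEqObj hs hf hp ι hι hι' sq N
  map {N K} g := EqCohAlg.homOfOp hs ((Scheme.Modules.pushforward p).map g.hom)
    (fun b U n => by
      refine (congrArg (g.hom.app (p ⁻¹ᵁ U)) (pushEqObj_op_app hs hf hp ι hι hι' sq N b U n)).trans ?_
      refine (EqCohAlg.hom_op hf g (ι b) (p ⁻¹ᵁ U) n).trans ?_
      exact (pushEqObj_op_app hs hf hp ι hι hι' sq K b U _).symm)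
    (fun h U n => by
      refine (hom_res g.hom (preimage_translate hp h U).le (N.act h (p ⁻¹ᵁ U) n)).trans ?_
      exact congrArg (res K.mod (preimage_translate hp h U).le) (g.map_act h (p ⁻¹ᵁ U) n))

theorem pushEq_faithful : (pushEq hs hf hp ι hι hι' sq).Faithful where
  map_injective {N _ _ _} e := EqCohAlg.Hom.ext (hom_eq_of_pushforward sq N.coherent fun U n =>
    ConcreteCategory.congr_hom (congrArg (fun φ => Scheme.Modules.Hom.app φ U)
      (congrArg EqCohAlg.Hom.hom e)) n)

theorem pushEq_full : (pushEq hs hf hp ι hι hι' sq).Full where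
  map_surjective {N K} φ := by
    have key : ∀ (a : A.carrier) (U : X.Opens) (n : Γ(N.mod, p ⁻¹ᵁ U)),
        φ.hom.app U (Scheme.Modules.Hom.app
          (N.op a) (p ⁻¹ᵁ U) n) =
        Scheme.Modules.Hom.app (K.op a) (p ⁻¹ᵁ U)
          (show Γ(K.mod, p ⁻¹ᵁ U) from φ.hom.app U n) := by
      intro a U n
      obtain ⟨b, rfl⟩ := ι.surjective a
      have h1 := EqCohAlg.hom_op hs φ b U n
      refine (congrArg (φ.hom.app U) (pushEqObj_op_app hs hf hp ι hι hι' sq N b U n)).symm.trans ?_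
      refine h1.trans ?_
      exact pushEqObj_op_app hs hf hp ι hι hι' sq K b U _
    obtain ⟨g, hg, -⟩ := existsUnique_pushforward_map sq N.coherent φ.hom fun z =>
      hom_ext' fun U n => by
        have h2 := key (algebraMap Z A.carrier z) U n
        rw [EqCohAlg.op_algebraMap, EqCohAlg.op_algebraMap] at h2
        exact h2
    have hgU : ∀ (U : X.Opens) (n : Γ(N.mod, p ⁻¹ᵁ U)), g.app (p ⁻¹ᵁ U) n = φ.hom.app U n :=
      fun U n => ConcreteCategory.congr_hom (congrArg (fun φ => Scheme.Modules.Hom.app φ U) hg) n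
    refine ⟨EqCohAlg.homOfOp hf g (fun a V n => ?_) (fun h V n => ?_),
      EqCohAlg.Hom.ext hg⟩
    · have h1 : (show N.mod ⟶ N.mod from N.op a) ≫ g = g ≫ (show K.mod ⟶ K.mod from K.op a) :=
        hom_eq_of_pushforward sq N.coherent fun U n => by
          refine (hgU U _).trans ((key a U n).trans ?_)
          exact congrArg (Scheme.Modules.Hom.app (K.op a) (p ⁻¹ᵁ U)) (hgU U n).symm
      exact ConcreteCategory.congr_hom (congrArg (fun g => Scheme.Modules.Hom.app g V) h1) n
    · have h1 : mkTranslate ρ' h (M := N.mod) (K := K.mod)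
          (fun V => ((g.app (translate ρ' h V)).hom).comp (N.act h V))
          (fun V r n => (congrArg (g.app _) (N.act_osmul h V r n)).trans
            (Scheme.Modules.Hom.app_smul g _ _))
          (fun i n => (congrArg (g.app _) (N.act_res h i n)).trans (hom_res g _ _)) =
        mkTranslate ρ' h (M := N.mod) (K := K.mod)
          (fun V => (K.act h V).comp (g.app V).hom)
          (fun V r n => (congrArg (K.act h V) (Scheme.Modules.Hom.app_smul g r n)).trans
            (K.act_osmul h V r _))
          (fun i n => (congrArg (K.act h _) (hom_res g i n)).trans (K.act_res h i _)) :=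
        hom_eq_of_pushforward sq N.coherent fun U n => by
          have h2 := φ.map_act h U n
          have h3 := hgU (translate ρ h U) (res N.mod (preimage_translate hp h U).le
            (N.act h (p ⁻¹ᵁ U) n))
          have h4 : res K.mod (preimage_translate hp h U).le
              (g.app _ (N.act h (p ⁻¹ᵁ U) n)) =
            res K.mod (preimage_translate hp h U).le (K.act h (p ⁻¹ᵁ U) (g.app _ n)) := by
            refine (hom_res g (preimage_translate hp h U).le _).symm.trans (h3.trans (h2.trans ?_))
            exact congrArg (fun x => res K.mod (preimage_translate hp h U).le
              (K.act h (p ⁻¹ᵁ U) x)) (hgU U n).symm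
          have h5 := congrArg (res K.mod (preimage_translate hp h U).ge) h4
          rw [res_res, res_res, res_self, res_self] at h5
          exact h5
      exact ConcreteCategory.congr_hom (congrArg (fun g => Scheme.Modules.Hom.app g V) h1) n

theorem pushEq_essSurj : (pushEq hs hf hp ι hι hι' sq).EssSurj where
  mem_essImage M := by
    have hτ : ∀ h z, A.act h (algebraMap Z A.carrier z) = algebraMap Z A.carrier (τ h z) := by
      intro h z
      rw [Algebra.algebraMap_eq_smul_one, A.act_smul, map_one, ← Algebra.algebraMap_eq_smul_one]
    have hιs : ∀ h a, B.act h (ι.symm a) = ι.symm (A.act h a) := fun h a =>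
      ι.injective (by rw [hι', ι.apply_symm_apply, ι.apply_symm_apply])
    let opM : A.carrier →+* End M.mod := M.op.comp (ι.symm : A.carrier →+* B.carrier)
    have hact : ∀ h a U m, M.act h U (Scheme.Modules.Hom.app (opM a) U m) =
        Scheme.Modules.Hom.app (opM (A.act h a)) _ (M.act h U m) := fun h a U m => by
      refine (EqCohAlg.act_op hs h (ι.symm a) U m).trans ?_
      rw [hιs]
      rfl
    obtain ⟨N, η, hN, _, hη⟩ := exists_isIso_pushforward (f := f) sq M.coherent
      (opM.comp (algebraMap Z A.carrier)) (fun c => by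
        refine Eq.trans ?_ (EqCohAlg.op_algebraMap hs M c)
        refine congrArg M.op ?_
        exact ι.injective ((ι.apply_symm_apply _).trans (hι c).symm))
    let e : ∀ U : X.Opens, Γ(N, p ⁻¹ᵁ U) →+ Γ(M.mod, U) := fun U => ((inv η).app U).hom
    let t : ∀ U : X.Opens, Γ(M.mod, U) →+ Γ(N, p ⁻¹ᵁ U) := fun U => (η.app U).hom
    have te : ∀ U n, t U (e U n) = n := fun U n =>
      ConcreteCategory.congr_hom (congrArg (fun g => Scheme.Modules.Hom.app g U)
        (IsIso.inv_hom_id η)) n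
    have et : ∀ U n, e U (t U n) = n := fun U n =>
      ConcreteCategory.congr_hom (congrArg (fun g => Scheme.Modules.Hom.app g U)
        (IsIso.hom_inv_id η)) n
    have tres : ∀ {U V : X.Opens} (i : V ≤ U) m,
        t V (res M.mod i m) = res N (Scheme.Hom.preimage_mono p i) (t U m) := fun i m =>
      hom_res η i m
    have eres : ∀ {U V : X.Opens} (i : V ≤ U) n,
        e V (res N (Scheme.Hom.preimage_mono p i) n) = res M.mod i (e U n) := fun i n =>
      hom_res (inv η) i n
    have tsmul : ∀ U (r : Γ(X, U)) m, t U (r • m) = p.app U r • t U m := fun U r m =>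
      Scheme.Modules.Hom.app_smul η r m
    have esmul : ∀ U (r : Γ(X, U)) n, e U (p.app U r • n) = r • e U n := fun U r n =>
      Scheme.Modules.Hom.app_smul (inv η) r n
    have tz : ∀ z U m, t U (Scheme.Modules.Hom.app (opM (algebraMap Z A.carrier z)) U m) =
        baseHom f (p ⁻¹ᵁ U) z • t U m := fun z U m =>
      ConcreteCategory.congr_hom (congrArg (fun g => Scheme.Modules.Hom.app g U) (hη z)) m
    have ez : ∀ z U n, e U (baseHom f (p ⁻¹ᵁ U) z • n) =
        Scheme.Modules.Hom.app (opM (algebraMap Z A.carrier z)) U (e U n) := fun z U n => by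
      conv_lhs => rw [← te U n]
      rw [← tz, et]
    have hg := fun a => (existsUnique_pushforward_map sq hN
      (inv η ≫ (show M.mod ⟶ M.mod from opM a) ≫ η) (fun z => hom_ext' fun U n => by
        change t U (Scheme.Modules.Hom.app (opM a) U (e U (baseHom f (p ⁻¹ᵁ U) z •
          (show Γ(N, p ⁻¹ᵁ U) from n)))) = baseHom f (p ⁻¹ᵁ U) z • t U
            (Scheme.Modules.Hom.app (opM a) U (e U n))
        rw [← tz, ← end_mul_app, ← map_mul, Algebra.commutes, map_mul, end_mul_app, ez])).exists
    choose g hg using hg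
    have hgU : ∀ a (U : X.Opens) (n : Γ(N, p ⁻¹ᵁ U)), (g a).app (p ⁻¹ᵁ U) n =
        t U (Scheme.Modules.Hom.app (opM a) U (e U n)) := fun a U n =>
      ConcreteCategory.congr_hom (congrArg (fun φ => Scheme.Modules.Hom.app φ U) (hg a)) n
    let opN : A.carrier →+* End N :=
      { toFun := g
        map_one' := hom_eq_of_pushforward sq hN fun U n => by
          rw [hgU, map_one, end_one_app, te]
          rfl
        map_mul' := fun a b => hom_eq_of_pushforward sq hN fun U n => by
          refine Eq.trans ?_ (congrArg ((g a).app (p ⁻¹ᵁ U)) (hgU b U n)).symm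
          rw [hgU, hgU, et, map_mul, end_mul_app]
        map_zero' := hom_eq_of_pushforward sq hN fun U n => by
          rw [hgU, map_zero]
          exact map_zero (t U)
        map_add' := fun a b => hom_eq_of_pushforward sq hN fun U n => by
          refine Eq.trans ?_ (congrArg₂ (· + ·) (hgU a U n) (hgU b U n)).symm
          rw [hgU, map_add]
          exact map_add (t U) _ _ }
    have hopN : ∀ a (U : X.Opens) (n : Γ(N, p ⁻¹ᵁ U)),
        Scheme.Modules.Hom.app (opN a) (p ⁻¹ᵁ U) n =
          t U (Scheme.Modules.Hom.app (opM a) U (e U n)) := hgU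
    obtain ⟨c, hc, hcU⟩ := exists_lift_act sq hf hp hN
      (fun h U => (t _).comp ((M.act h U).comp (e U)))
      { act_osmul := fun h U r n => by
          change t _ (M.act h U (e U (p.app U r • (show Γ(N, p ⁻¹ᵁ U) from n)))) = _
          rw [esmul, M.act_osmul, tsmul]
          rfl
        act_res := fun h U V i n => by
          refine (congrArg (fun x => t _ (M.act h V x)) (eres i n)).trans ?_
          exact (congrArg (t _) (M.act_res h i _)).trans (tres _ _)
        act_one := fun U n => by
          refine (congrArg (t _) (M.act_one U (e U n))).trans ((tres _ _).trans ?_)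
          exact congrArg (res N _) (te U n)
        act_comp := fun h₁ h₂ U n => by
          refine (congrArg (t _) (M.act_comp h₁ h₂ U (e U n))).trans ((tres _ _).trans ?_)
          exact congrArg (fun x => res N _ (t _ (M.act h₁ _ x))) (et _ _).symm }
      (fun h U z n => by
        change t _ (M.act h U (e U (baseHom f (p ⁻¹ᵁ U) z • n))) = _ • t _ (M.act h U (e U n))
        rw [ez, hact, hτ, tz])
    have hcU' : ∀ h U (n : Γ(N, p ⁻¹ᵁ U)), c h (p ⁻¹ᵁ U) n =
        res N (preimage_translate hp h U).ge (t _ (M.act h U (e U n))) := fun h U n => by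
      refine Eq.trans ?_ (congrArg (res N (preimage_translate hp h U).ge) (hcU h U n))
      rw [res_res, res_self]
    let K : EqCohAlg (pullEqAlg hf A) := EqCohAlg.ofOp hf hc.eqMod hN opN
      (fun z => hom_eq_of_pushforward sq hN fun U n => by
        refine (hopN _ U n).trans ?_
        rw [tz, te]
        rfl)
      (fun h a V n => by
        let b₁ : ∀ V : Y.Opens, Γ(N, V) →+ Γ(N, translate ρ' h V) := fun V =>
          (c h V).comp ((Scheme.Modules.Hom.app (opN a) V).hom)
        let b₂ : ∀ V : Y.Opens, Γ(N, V) →+ Γ(N, translate ρ' h V) := fun V =>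
          ((Scheme.Modules.Hom.app (opN (A.act h a)) _).hom).comp (c h V)
        refine family_eq_of_pushforward sq hN h b₁ b₂
          (fun V r n => (congrArg (c h V) (Scheme.Modules.Hom.app_smul (opN a) r n)).trans
            (hc.act_osmul h V r _))
          (fun V r n => (congrArg (Scheme.Modules.Hom.app (opN (A.act h a)) _)
            (hc.act_osmul h V r n)).trans
              (Scheme.Modules.Hom.app_smul (opN (A.act h a)) _ _))
          (fun i n => (congrArg (c h _) (hom_res (opN a) i n)).trans (hc.act_res h i _))
          (fun i n => (congrArg (Scheme.Modules.Hom.app (opN (A.act h a)) _)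
            (hc.act_res h i n)).trans (hom_res (opN (A.act h a)) _ _)) (fun U n => ?_) V n
        have h1 := hom_res (opN (A.act h a)) (preimage_translate hp h U).ge
          (t _ (M.act h U (e U n)))
        rw [← hcU', hopN, et] at h1
        refine (congrArg (c h _) (hopN a U n)).trans ((hcU' h U _).trans ?_)
        rw [et, hact]
        exact h1.symm)
    have hK : K.op = opN := EqCohAlg.op_ofOp hf _ _ _ _ _
    let φ : M ⟶ pushEqObj hs hf hp ι hι hι' sq K := EqCohAlg.homOfOp hs η
      (fun b U m => by
        refine Eq.trans ?_ (pushEqObj_op_app hs hf hp ι hι hι' sq K b U (t U m)).symm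
        rw [hK]
        refine Eq.trans ?_ (hopN (ι b) U (t U m)).symm
        rw [et]
        change t U _ = t U (Scheme.Modules.Hom.app (M.op (ι.symm (ι b))) U m)
        rw [ι.symm_apply_apply])
      (fun h U m => by
        refine Eq.trans ?_ (hcU h U (t U m)).symm
        exact congrArg (fun x => t _ (M.act h U x)) (et U m).symm)
    have : IsIso φ := EqCohAlg.isIso_of_bijective φ fun U =>
      ⟨Function.LeftInverse.injective (et U), Function.RightInverse.surjective (te U)⟩
    exact ⟨K, ⟨(asIso φ).symm⟩⟩

/-- Equivariant modules over an algebra pulled back to a fibre product with `Spec Z` are modules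
over the algebra on the base. -/
theorem pushEq_isEquivalence : (pushEq hs hf hp ι hι hι' sq).IsEquivalence where
  faithful := pushEq_faithful hs hf hp ι hι hι' sq
  full := pushEq_full hs hf hp ι hι hι' sq
  essSurj := pushEq_essSurj hs hf hp ι hι hι' sq

end PushAct
end EquivSheaf

end

noncomputable section
namespace EquivSheaf

section HomSheaf
variable {X : Scheme.{u}} {A : Type u} [Ring A] (Q : Type u) [AddCommGroup Q] [Module A Q]
  (M : X.Modules) (op : A →+* End M)

/-- Families of sections of `M` indexed by `Q` which are additive and `A`-linear. -/
def homCond : LocalCond M Q where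
  carrier U :=
    { carrier := {ψ | (∀ q q', ψ (q + q') = ψ q + ψ q') ∧
        ∀ (a : A) q, ψ (a • q) = Scheme.Modules.Hom.app (op a) U (ψ q)}
      add_mem' := fun {s t} hs ht => ⟨fun q q' => by
          rw [Pi.add_apply, Pi.add_apply, Pi.add_apply, hs.1, ht.1, add_add_add_comm],
        fun a q => by rw [Pi.add_apply, Pi.add_apply, hs.2, ht.2, map_add]⟩
      zero_mem' := ⟨fun _ _ => (add_zero _).symm, fun _ _ => (map_zero _).symm⟩
      smul_mem' := fun r s hs => ⟨fun q q' => by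
          rw [Pi.smul_apply, Pi.smul_apply, Pi.smul_apply, hs.1, smul_add],
        fun a q => by
          rw [Pi.smul_apply, Pi.smul_apply, hs.2, Scheme.Modules.Hom.app_smul]⟩ }
  res_mem {U V} i s hs := ⟨fun q q' => by beta_reduce; rw [hs.1, map_add],
    fun a q => by beta_reduce; rw [hs.2, hom_res]⟩
  local_mem U s h := by
    refine ⟨fun q q' => section_ext M fun x hx => ?_, fun a q => section_ext M fun x hx => ?_⟩
    · obtain ⟨V, i, hxV, hV⟩ := h x hx
      exact ⟨V, i, hxV, by rw [map_add]; exact hV.1 q q'⟩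
    · obtain ⟨V, i, hxV, hV⟩ := h x hx
      exact ⟨V, i, hxV, by rw [← hom_res]; exact hV.2 a q⟩

/-- The sheaf of `A`-linear maps from a module `Q` to a sheaf of modules with an action of `A`. -/
def homSheaf : X.Modules := (homCond Q M op).sheaf

variable {Q M op}

/-- Evaluation at an element of `Q`. -/
def homEval (q : Q) : homSheaf Q M op ⟶ M :=
  mkHom (M := homSheaf Q M op)
    (fun U => show (homCond Q M op).carrier U →ₗ[Γ(X, U)] Γ(M, U) from
      { toFun := fun s => s.1 q
        map_add' := fun _ _ => rfl
        map_smul' := fun _ _ => rfl }) (fun _ _ => rfl)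

/-- A section of the sheaf of linear maps. -/
def homSec {U : X.Opens} (ψ : Q → Γ(M, U)) (h : ∀ q q', ψ (q + q') = ψ q + ψ q')
    (h' : ∀ (a : A) q, ψ (a • q) = Scheme.Modules.Hom.app (op a) U (ψ q)) :
    Γ(homSheaf Q M op, U) :=
  (⟨ψ, h, h'⟩ : (homCond Q M op).carrier U)

lemma homEval_homSec {U : X.Opens} (ψ : Q → Γ(M, U)) (h h') (q : Q) :
    (homEval q).app U (homSec (op := op) ψ h h') = ψ q := rfl

lemma homSheaf_sec_ext {U : X.Opens} {s t : Γ(homSheaf Q M op, U)}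
    (h : ∀ q, (homEval q).app U s = (homEval q).app U t) : s = t :=
  Subtype.ext (funext h)

lemma homSheaf_hom_ext {K : X.Modules} {g g' : K ⟶ homSheaf Q M op}
    (h : ∀ q, g ≫ homEval q = g' ≫ homEval q) : g = g' :=
  hom_ext' fun U s => homSheaf_sec_ext fun q =>
    ConcreteCategory.congr_hom (congrArg (fun g => Scheme.Modules.Hom.app g U) (h q)) s

lemma homEval_add (q q' : Q) : homEval (op := op) (q + q') = homEval q + homEval q' :=
  hom_ext' fun _ s => s.2.1 q q'

lemma homEval_smul (a : A) (q : Q) :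
    homEval (op := op) (a • q) = homEval q ≫ (show M ⟶ M from op a) :=
  hom_ext' fun _ s => s.2.2 a q

/-- A morphism to the sheaf of linear maps. -/
def homLift {K : X.Modules} (φ : Q → (K ⟶ M)) (h : ∀ q q', φ (q + q') = φ q + φ q')
    (h' : ∀ (a : A) q, φ (a • q) = φ q ≫ (show M ⟶ M from op a)) : K ⟶ homSheaf Q M op :=
  mkHom (N := homSheaf Q M op) (fun U => show Γ(K, U) →ₗ[Γ(X, U)] (homCond Q M op).carrier U from
    { toFun := fun s => ⟨fun q => (φ q).app U s, fun q q' => by beta_reduce; rw [h]; rfl,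
        fun a q => by beta_reduce; rw [h']; rfl⟩
      map_add' := fun s t => Subtype.ext (funext fun q => map_add _ s t)
      map_smul' := fun r s => Subtype.ext (funext fun q =>
        Scheme.Modules.Hom.app_smul (φ q) r s) })
    (fun i s => Subtype.ext (funext fun q => hom_res (φ q) i s))

@[simp]
lemma homLift_eval {K : X.Modules} (φ : Q → (K ⟶ M)) (h : ∀ q q', φ (q + q') = φ q + φ q')
    (h' : ∀ (a : A) q, φ (a • q) = φ q ≫ (show M ⟶ M from op a)) (q : Q) :
    homLift φ h h' ≫ homEval q = φ q := rfl

/-- A section of the sheaf of linear maps as an additive map. -/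
def evalHom {U : X.Opens} (s : Γ(homSheaf Q M op, U)) : Q →+ Γ(M, U) :=
  AddMonoidHom.mk' (fun q => (homEval q).app U s) s.2.1

lemma isCoherent_homSheaf (hM : IsCoherent M) {n : ℕ} (l : Fin n → Q →+ A) (e : Fin n → Q)
    (hl : ∀ i a q, l i (a • q) = a * l i q) (h : ∀ q, ∑ i, l i q • e i = q) :
    IsCoherent (homSheaf Q M op) := by
  refine hM.of_retract (fun i => homEval (e i))
    (fun i => homLift (fun q => (show M ⟶ M from op (l i q))) (fun q q' => by
      rw [map_add, map_add]) (fun a q => by rw [hl, map_mul]; rfl)) fun U s => ?_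
  refine homSheaf_sec_ext fun q => ?_
  rw [finsum_eq_sum_of_fintype, map_sum]
  conv_rhs => rw [← h q]
  refine Eq.symm ((map_sum (evalHom s) _ _).trans (Finset.sum_congr rfl fun i _ => ?_))
  exact congrArg (fun g => Scheme.Modules.Hom.app g U s) (homEval_smul (op := op) (l i q) (e i))

section EqHom
variable {H : Type u} [Group H] {ρ : H →* Aut X} (E : EqMod ρ) (oE : A →+* End E.mod)
    (σ : H →* RingAut A) (β : H →* AddMonoid.End Q) (hβ : ∀ h (a : A) q, β h (a • q) = σ h a • β h q)
    (hact : ∀ h a U m, E.act h U (Scheme.Modules.Hom.app (oE a) U m) =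
      Scheme.Modules.Hom.app (oE (σ h a)) _ (E.act h U m))

/-- The action on sections of sheaves of linear maps. -/
def homAct (h : H) (U : X.Opens) :
    Γ(homSheaf Q E.mod oE, U) →+ Γ(homSheaf Q E.mod oE, translate ρ h U) where
  toFun s := homSec (fun q => E.act h U ((homEval (β h⁻¹ q)).app U s))
    (fun q q' => by
      rw [map_add, homEval_add]
      exact map_add (E.act h U) _ _)
    (fun a q => by
      rw [hβ, homEval_smul]
      refine (hact h _ U _).trans ?_
      rw [← RingAut.mul_apply, ← map_mul, mul_inv_cancel, map_one]
      rfl)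
  map_zero' := homSheaf_sec_ext fun q => by
    rw [homEval_homSec, map_zero, map_zero, map_zero]
  map_add' s t := homSheaf_sec_ext fun q => by
    rw [homEval_homSec, map_add, map_add, map_add]; rfl

lemma homEval_homAct (h : H) (U : X.Opens) (s : Γ(homSheaf Q E.mod oE, U)) (q : Q) :
    (homEval q).app _ (homAct E oE σ β hβ hact h U s) =
      E.act h U ((homEval (β h⁻¹ q)).app U s) := rfl

/-- Equivariant structures on sheaves of linear maps. -/
def EqMod.hom : EqMod ρ where
  mod := homSheaf Q E.mod oE
  act := homAct E oE σ β hβ hact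
  act_osmul h U r s := homSheaf_sec_ext fun q => by
    rw [Scheme.Modules.Hom.app_smul, homEval_homAct, homEval_homAct, Scheme.Modules.Hom.app_smul,
      E.act_osmul]
  act_res h U V i s := homSheaf_sec_ext fun q => by
    rw [hom_res, homEval_homAct, homEval_homAct, hom_res, E.act_res]
  act_one U s := homSheaf_sec_ext fun q => by
    rw [hom_res, homEval_homAct, E.act_one, inv_one, map_one, AddMonoid.End.coe_one, id]
  act_comp g h U s := homSheaf_sec_ext fun q => by
    rw [hom_res, homEval_homAct, homEval_homAct, homEval_homAct, E.act_comp, mul_inv_rev, map_mul,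
      AddMonoid.End.coe_mul, Function.comp_apply]

end EqHom

end HomSheaf
end EquivSheaf

end

noncomputable section
namespace EquivSheaf

section Ctx
variable {G : Type u} [Group G] {R : Type u} [CommRing R] {τ : G →* RingAut R}

/-- An equivariant Morita context with surjective pairings between two equivariant algebras:
bimodules `P`, `Q` with compatible pairings `P × Q → A'` and `Q × P → A`. -/
structure MoritaCtx (A' A : RAlg τ) where
  P : Type u
  Q : Type u
  [addCommGroupP : AddCommGroup P]
  [addCommGroupQ : AddCommGroup Q]
  [moduleP : Module A'.carrier P]
  [moduleQ : Module A.carrier Q]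
  pr : P →+ A.carrier →+ P
  qr : Q →+ A'.carrier →+ Q
  pr_one : ∀ p, pr p 1 = p
  qr_one : ∀ q, qr q 1 = q
  pr_mul : ∀ p a b, pr p (a * b) = pr (pr p a) b
  qr_mul : ∀ q a b, qr q (a * b) = qr (qr q a) b
  pr_smul : ∀ (a : A'.carrier) p b, pr (a • p) b = a • pr p b
  qr_smul : ∀ (a : A.carrier) q b, qr (a • q) b = a • qr q b
  pr_base : ∀ p r, pr p (algebraMap R A.carrier r) = algebraMap R A'.carrier r • p
  qr_base : ∀ q r, qr q (algebraMap R A'.carrier r) = algebraMap R A.carrier r • q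
  pq : P →+ Q →+ A'.carrier
  qp : Q →+ P →+ A.carrier
  pq_smul : ∀ (a : A'.carrier) p q, pq (a • p) q = a * pq p q
  qp_smul : ∀ (a : A.carrier) q p, qp (a • q) p = a * qp q p
  pq_qr : ∀ p q a, pq p (qr q a) = pq p q * a
  qp_pr : ∀ q p a, qp q (pr p a) = qp q p * a
  pq_bal : ∀ p (a : A.carrier) q, pq (pr p a) q = pq p (a • q)
  qp_bal : ∀ q (a : A'.carrier) p, qp (qr q a) p = qp q (a • p)
  pq_assoc : ∀ p q p', pq p q • p' = pr p (qp q p')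
  qp_assoc : ∀ q p q', qp q p • q' = qr q (pq p q')
  exists_pq : ∃ (n : ℕ) (p : Fin n → P) (q : Fin n → Q), ∑ i, pq (p i) (q i) = 1
  exists_qp : ∃ (n : ℕ) (q : Fin n → Q) (p : Fin n → P), ∑ i, qp (q i) (p i) = 1
  actP : G →* AddMonoid.End P
  actQ : G →* AddMonoid.End Q
  actP_smul : ∀ g (a : A'.carrier) p, actP g (a • p) = A'.act g a • actP g p
  actQ_smul : ∀ g (a : A.carrier) q, actQ g (a • q) = A.act g a • actQ g q
  actP_pr : ∀ g p a, actP g (pr p a) = pr (actP g p) (A.act g a)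
  actQ_qr : ∀ g q a, actQ g (qr q a) = qr (actQ g q) (A'.act g a)
  act_pq : ∀ g p q, A'.act g (pq p q) = pq (actP g p) (actQ g q)
  act_qp : ∀ g q p, A.act g (qp q p) = qp (actQ g q) (actP g p)

attribute [instance] MoritaCtx.addCommGroupP MoritaCtx.addCommGroupQ MoritaCtx.moduleP
  MoritaCtx.moduleQ

namespace MoritaCtx
variable {A' A : RAlg τ} (c : MoritaCtx A' A)

/-- The Morita context with the roles of the two algebras exchanged. -/
def swap : MoritaCtx A A' where
  P := c.Q
  Q := c.P
  pr := c.qr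
  qr := c.pr
  pr_one := c.qr_one
  qr_one := c.pr_one
  pr_mul := c.qr_mul
  qr_mul := c.pr_mul
  pr_smul := c.qr_smul
  qr_smul := c.pr_smul
  pr_base := c.qr_base
  qr_base := c.pr_base
  pq := c.qp
  qp := c.pq
  pq_smul := c.qp_smul
  qp_smul := c.pq_smul
  pq_qr := c.qp_pr
  qp_pr := c.pq_qr
  pq_bal := c.qp_bal
  qp_bal := c.pq_bal
  pq_assoc := c.qp_assoc
  qp_assoc := c.pq_assoc
  exists_pq := c.exists_qp
  exists_qp := c.exists_pq
  actP := c.actQ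
  actQ := c.actP
  actP_smul := c.actQ_smul
  actQ_smul := c.actP_smul
  actP_pr := c.actQ_qr
  actQ_qr := c.actP_pr
  act_pq := c.act_qp
  act_qp := c.act_pq

lemma act_qp_inv (h : G) (q : c.Q) (p : c.P) :
    A.act h (c.qp (c.actQ h⁻¹ q) (c.actP h⁻¹ p)) = c.qp q p := by
  rw [← c.act_qp, ← RingAut.mul_apply, ← map_mul, mul_inv_cancel, map_one]
  rfl

section Sheaf
variable {X : Scheme.{u}} {f : X ⟶ Spec (.of R)}

lemma isCoherent_homSheaf {M : X.Modules} (op : A.carrier →+* End M) (hM : IsCoherent M) :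
    IsCoherent (homSheaf c.Q M op) := by
  obtain ⟨n, p, q, h⟩ := c.exists_pq
  refine EquivSheaf.isCoherent_homSheaf hM (fun i => c.qp.flip (p i)) q
    (fun i a q => c.qp_smul a q (p i)) fun x => ?_
  rw [← c.qr_one x, ← h, map_sum]
  exact Finset.sum_congr rfl fun i _ => by
    rw [AddMonoidHom.flip_apply, c.qp_assoc, ← map_sum, h, c.qr_one]

/-- The action of `A'` on the sheaf of `A`-linear maps from `Q`. -/
def op {M : X.Modules} (op : A.carrier →+* End M) : A'.carrier →+* End (homSheaf c.Q M op) where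
  toFun a := homLift (fun q => homEval (c.qr q a))
    (fun q q' => by rw [map_add, AddMonoidHom.add_apply, homEval_add])
    (fun b q => by rw [c.qr_smul, homEval_smul])
  map_one' := homSheaf_hom_ext fun q => by
    rw [homLift_eval, c.qr_one]; exact (Category.id_comp _).symm
  map_mul' a b := homSheaf_hom_ext fun q => by
    rw [homLift_eval, c.qr_mul]; rfl
  map_zero' := homSheaf_hom_ext fun q => by
    rw [homLift_eval, map_zero]
    exact hom_ext' fun U s => map_zero (evalHom s)
  map_add' a b := homSheaf_hom_ext fun q => by
    rw [homLift_eval, map_add, homEval_add]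
    rfl

lemma op_eval {M : X.Modules} (op : A.carrier →+* End M) (a : A'.carrier) (q : c.Q) (U : X.Opens)
    (s : Γ(homSheaf c.Q M op, U)) :
    (homEval q).app U (Scheme.Modules.Hom.app (c.op op a) U s) =
      (homEval (c.qr q a)).app U s := rfl

lemma op_base {M : X.Modules} (op : A.carrier →+* End M)
    (hop : ∀ r, op (algebraMap R A.carrier r) = zmul f M r) (r : R) :
    c.op op (algebraMap R A'.carrier r) = zmul f (homSheaf c.Q M op) r :=
  homSheaf_hom_ext fun q => by
    refine Eq.trans ?_ (zmul_comm f r (homEval q)).symm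
    rw [← hop, ← homEval_smul, ← c.qr_base]
    rfl

/-- The canonical map from a sheaf to its double dual with respect to a Morita context. -/
def unit {M : X.Modules} (op : A.carrier →+* End M)
    {o : A'.carrier →+* End (homSheaf c.Q M op)} (ho : o = c.op op) :
    M ⟶ homSheaf c.P (homSheaf c.Q M op) o :=
  homLift (fun p => homLift (fun q => (show M ⟶ M from op (c.qp q p)))
      (fun q q' => by rw [map_add, AddMonoidHom.add_apply, map_add])
      (fun a q => by rw [c.qp_smul, map_mul]; rfl))
    (fun p p' => homSheaf_hom_ext fun q => by
      rw [homLift_eval, map_add, map_add]; rfl)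
    (fun a p => homSheaf_hom_ext fun q => by
      rw [homLift_eval, ← c.qp_bal, ho]; rfl)

lemma unit_eval {M : X.Modules} (op : A.carrier →+* End M)
    {o : A'.carrier →+* End (homSheaf c.Q M op)} (ho : o = c.op op) (p : c.P) (q : c.Q) (U : X.Opens)
    (m : Γ(M, U)) :
    (homEval q).app U ((homEval p).app U ((c.unit op ho).app U m)) =
      Scheme.Modules.Hom.app (op (c.qp q p)) U m := rfl

lemma unit_bijective {M : X.Modules} (op : A.carrier →+* End M)
    {o : A'.carrier →+* End (homSheaf c.Q M op)} (ho : o = c.op op) (U : X.Opens) :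
    Function.Bijective ((c.unit op ho).app U) := by
  subst ho
  obtain ⟨n, q, p, h⟩ := c.exists_qp
  let e : Γ(homSheaf c.P (homSheaf c.Q M op) (c.op op), U) → Γ(M, U) := fun ψ =>
    ∑ i, (homEval (q i)).app U ((homEval (p i)).app U ψ)
  have sum_app : ∀ (a : Fin n → A.carrier) (m : Γ(M, U)),
      Scheme.Modules.Hom.app (op (∑ i, a i)) U m =
        ∑ i, Scheme.Modules.Hom.app (op (a i)) U m := by
    intro a m
    let φ : A.carrier →+ Γ(M, U) := AddMonoidHom.mk' (fun a => Scheme.Modules.Hom.app (op a) U m)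
      (fun a b => by rw [map_add]; rfl)
    exact map_sum φ _ _
  refine Function.bijective_iff_has_inverse.mpr ⟨e, fun m => ?_, fun ψ => ?_⟩
  · change ∑ i, Scheme.Modules.Hom.app (op (c.qp (q i) (p i))) U m = m
    rw [← sum_app, h, map_one]
    rfl
  · refine homSheaf_sec_ext fun x => homSheaf_sec_ext fun y => ?_
    rw [unit_eval, map_sum]
    have h1 : ∀ i, Scheme.Modules.Hom.app (op (c.qp y x)) U
        ((homEval (q i)).app U ((homEval (p i)).app U ψ)) =
        (homEval y).app U (evalHom ψ (c.pr x (c.qp (q i) (p i)))) := by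
      intro i
      have h2 := congrArg (fun g => Scheme.Modules.Hom.app g U ((homEval (p i)).app U ψ))
        (homEval_smul (op := op) (c.qp y x) (q i))
      have h3 := congrArg (fun g => Scheme.Modules.Hom.app g U ψ)
        (homEval_smul (op := c.op op) (c.pq x (q i)) (p i))
      rw [c.qp_assoc] at h2
      rw [c.pq_assoc] at h3
      exact h2.symm.trans (congrArg ((homEval y).app U) h3).symm
    rw [Finset.sum_congr rfl fun i _ => h1 i, ← map_sum, ← map_sum, ← map_sum, h, c.pr_one]
    rfl

/-- Functoriality of the sheaf of linear maps. -/
def mapHom {M N : X.Modules} (oM : A.carrier →+* End M) (oN : A.carrier →+* End N) (g : M ⟶ N)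
    (hg : ∀ a U m, g.app U (Scheme.Modules.Hom.app (oM a) U m) =
      Scheme.Modules.Hom.app (oN a) U (g.app U m)) :
    homSheaf c.Q M oM ⟶ homSheaf c.Q N oN :=
  homLift (fun q => homEval q ≫ g)
    (fun q q' => by rw [homEval_add, Preadditive.add_comp])
    (fun a q => hom_ext' fun U s => by
      rw [homEval_smul]
      exact hg a U _)

lemma mapHom_eval {M N : X.Modules} (oM : A.carrier →+* End M) (oN : A.carrier →+* End N)
    (g : M ⟶ N) (hg : ∀ a U m, g.app U (Scheme.Modules.Hom.app (oM a) U m) =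
      Scheme.Modules.Hom.app (oN a) U (g.app U m)) (q : c.Q) (U : X.Opens)
    (s : Γ(homSheaf c.Q M oM, U)) :
    (homEval q).app U ((c.mapHom oM oN g hg).app U s) = g.app U ((homEval q).app U s) := rfl

lemma mapHom_op {M N : X.Modules} (oM : A.carrier →+* End M) (oN : A.carrier →+* End N)
    (g : M ⟶ N) (hg : ∀ a U m, g.app U (Scheme.Modules.Hom.app (oM a) U m) =
      Scheme.Modules.Hom.app (oN a) U (g.app U m)) (a : A'.carrier) (U : X.Opens)
    (s : Γ(homSheaf c.Q M oM, U)) :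
    (c.mapHom oM oN g hg).app U (Scheme.Modules.Hom.app (c.op oM a) U s) =
      Scheme.Modules.Hom.app (c.op oN a) U ((c.mapHom oM oN g hg).app U s) :=
  homSheaf_sec_ext fun q => by
    rw [mapHom_eval, op_eval, op_eval, mapHom_eval]

lemma unit_op {M : X.Modules} (op : A.carrier →+* End M)
    {o : A'.carrier →+* End (homSheaf c.Q M op)} (ho : o = c.op op) (a : A.carrier) (U : X.Opens)
    (m : Γ(M, U)) :
    (c.unit op ho).app U (Scheme.Modules.Hom.app (op a) U m) =
      Scheme.Modules.Hom.app (c.swap.op o a) U ((c.unit op ho).app U m) :=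
  homSheaf_sec_ext fun p => homSheaf_sec_ext fun q => by
    refine (c.unit_eval op ho p q U _).trans ?_
    refine Eq.trans ?_ (congrArg ((homEval q).app U)
      (c.swap.op_eval o a p U ((c.unit op ho).app U m))).symm
    refine Eq.trans ?_ (c.unit_eval op ho (c.pr p a) q U m).symm
    rw [c.qp_pr, map_mul]
    rfl

lemma unit_naturality {M N : X.Modules} (oM : A.carrier →+* End M) (oN : A.carrier →+* End N)
    {o : A'.carrier →+* End (homSheaf c.Q M oM)} (ho : o = c.op oM)
    {o' : A'.carrier →+* End (homSheaf c.Q N oN)} (ho' : o' = c.op oN) (g : M ⟶ N)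
    (hg : ∀ a U m, g.app U (Scheme.Modules.Hom.app (oM a) U m) =
      Scheme.Modules.Hom.app (oN a) U (g.app U m))
    (hg' : ∀ a U m, (c.mapHom oM oN g hg).app U (Scheme.Modules.Hom.app (o a) U m) =
      Scheme.Modules.Hom.app (o' a) U ((c.mapHom oM oN g hg).app U m)) :
    g ≫ c.unit oN ho' = c.unit oM ho ≫ c.swap.mapHom o o' (c.mapHom oM oN g hg) hg' :=
  hom_ext' fun U m => homSheaf_sec_ext fun _ => homSheaf_sec_ext fun _ => (hg _ U m).symm

section Plain
variable (f) [Module.Finite R A.carrier] [Module.Projective R A.carrier]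
  [Module.Finite R A'.carrier] [Module.Projective R A'.carrier]

/-- The module of `A`-linear maps from `Q` to a module over the pullback of `A`. -/
def obj (M : CohAlg (pullAlg f A.carrier)) : CohAlg (pullAlg f A'.carrier) :=
  CohAlg.ofOp (homSheaf c.Q M.mod M.op) (c.isCoherent_homSheaf M.op M.coherent)
    (c.op M.op) (c.op_base M.op M.op_algebraMap)

lemma obj_op (M : CohAlg (pullAlg f A.carrier)) : (c.obj f M).op = c.op M.op :=
  AlgMod.op_ofOp (f := f) _ _ _

/-- The functor `Hom_A(Q, -)` between modules over pulled back algebras. -/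
def functor : CohAlg (pullAlg f A.carrier) ⥤ CohAlg (pullAlg f A'.carrier) where
  obj M := c.obj f M
  map {M N} g := CohAlg.homOfOp (f := f) (M := c.obj f M) (N := c.obj f N)
    (c.mapHom M.op N.op g.hom (CohAlg.hom_op g))
    (by
      intro a U m
      rw [obj_op, obj_op]
      exact c.mapHom_op M.op N.op g.hom _ a U m)
  map_id M := CohAlg.Hom.ext (homSheaf_hom_ext fun q => rfl)
  map_comp g g' := CohAlg.Hom.ext (homSheaf_hom_ext fun q => rfl)

/-- The canonical map from a module to its double dual. -/
def unitHom (M : CohAlg (pullAlg f A.carrier)) : M ⟶ c.swap.obj f (c.obj f M) :=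
  CohAlg.homOfOp (f := f) (c.unit M.op (c.obj_op f M)) (fun a U m => by
    rw [c.swap.obj_op f (c.obj f M)]
    exact c.unit_op M.op (c.obj_op f M) a U m)

/-- The canonical natural isomorphism to the double dual. -/
def unitIso : 𝟭 _ ≅ c.functor f ⋙ c.swap.functor f :=
  NatIso.ofComponents (fun M =>
    @asIso _ _ _ _ (c.unitHom f M)
      (CohAlg.isIso_of_bijective _ (c.unit_bijective M.op (c.obj_op f M))))
    (fun {M N} g => CohAlg.Hom.ext
      (c.unit_naturality M.op N.op (c.obj_op f M) (c.obj_op f N) g.hom (CohAlg.hom_op g)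
        (CohAlg.hom_op ((c.functor f).map g))))

/-- A Morita context gives an equivalence between coherent modules over pulled back algebras. -/
def equiv : CohAlg (pullAlg f A.carrier) ≌ CohAlg (pullAlg f A'.carrier) :=
  CategoryTheory.Equivalence.mk (c.functor f) (c.swap.functor f) (c.unitIso f) (c.swap.unitIso f).symm

end Plain

section Equivariant
variable {ρ : G →* Aut X} (hf : IsEquivariant τ ρ f)
  [Module.Finite R A.carrier] [Module.Projective R A.carrier]
  [Module.Finite R A'.carrier] [Module.Projective R A'.carrier]

/-- The module of `A`-linear maps from `Q` to an equivariant module over the pullback of `A`. -/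
def eqObj (M : EqCohAlg (pullEqAlg hf A)) : EqCohAlg (pullEqAlg hf A') :=
  EqCohAlg.ofOp hf (EqMod.hom M.toEqMod M.op A.act c.actQ c.actQ_smul (EqCohAlg.act_op hf))
    (c.isCoherent_homSheaf M.op M.coherent) (c.op M.op) (c.op_base M.op (EqCohAlg.op_algebraMap hf M))
    (fun h a U m => homSheaf_sec_ext fun q => by
      refine (homEval_homAct M.toEqMod M.op A.act c.actQ c.actQ_smul
        (EqCohAlg.act_op hf) h U _ q).trans ?_
      refine Eq.trans ?_ (homEval_homAct M.toEqMod M.op A.act c.actQ c.actQ_smul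
        (EqCohAlg.act_op hf) h U m (c.qr q (A'.act h a))).symm
      refine congrArg (M.act h U) ((c.op_eval M.op a (c.actQ h⁻¹ q) U m).trans ?_)
      rw [c.actQ_qr, ← RingAut.mul_apply, ← map_mul, inv_mul_cancel, map_one]
      rfl)

lemma eqObj_op (M : EqCohAlg (pullEqAlg hf A)) : (c.eqObj hf M).op = c.op M.op :=
  EqCohAlg.op_ofOp hf _ _ _ _ _

lemma eqObj_act (M : EqCohAlg (pullEqAlg hf A)) (h : G) (U : X.Opens)
    (s : Γ(homSheaf c.Q M.mod M.op, U)) (q : c.Q) :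
    (homEval q).app _ (show Γ(homSheaf c.Q M.mod M.op, translate ρ h U) from
      (c.eqObj hf M).act h U s) = M.act h U ((homEval (c.actQ h⁻¹ q)).app U s) := rfl

/-- The functor `Hom_A(Q, -)` between equivariant modules over pulled back algebras. -/
def eqFunctor : EqCohAlg (pullEqAlg hf A) ⥤ EqCohAlg (pullEqAlg hf A') where
  obj M := c.eqObj hf M
  map {M N} g := EqCohAlg.homOfOp hf (M := c.eqObj hf M) (N := c.eqObj hf N)
    (c.mapHom M.op N.op g.hom (EqCohAlg.hom_op hf g))
    (by
      intro a U m
      rw [eqObj_op, eqObj_op]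
      exact c.mapHom_op M.op N.op g.hom _ a U m)
    (fun h U s => homSheaf_sec_ext fun q => g.map_act h U _)
  map_id M := EqCohAlg.Hom.ext (homSheaf_hom_ext fun q => rfl)
  map_comp g g' := EqCohAlg.Hom.ext (homSheaf_hom_ext fun q => rfl)

/-- The canonical map from an equivariant module to its double dual. -/
def eqUnitHom (M : EqCohAlg (pullEqAlg hf A)) : M ⟶ c.swap.eqObj hf (c.eqObj hf M) :=
  EqCohAlg.homOfOp hf (c.unit M.op (c.eqObj_op hf M)) (fun a U m => by
    rw [c.swap.eqObj_op hf (c.eqObj hf M)]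
    exact c.unit_op M.op (c.eqObj_op hf M) a U m)
    (fun h U m => homSheaf_sec_ext fun p => homSheaf_sec_ext fun q => by
      refine (c.unit_eval M.op (c.eqObj_op hf M) p q _ (M.act h U m)).trans ?_
      have h1 := EqCohAlg.act_op hf (M := M) h (c.qp (c.actQ h⁻¹ q) (c.actP h⁻¹ p)) U m
      exact (congrArg (fun a => Scheme.Modules.Hom.app (M.op a) _ (M.act h U m))
        (c.act_qp_inv h q p).symm).trans h1.symm)

/-- The canonical natural isomorphism to the double dual. -/
def eqUnitIso : 𝟭 _ ≅ c.eqFunctor hf ⋙ c.swap.eqFunctor hf :=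
  NatIso.ofComponents (fun M =>
    @asIso _ _ _ _ (c.eqUnitHom hf M)
      (EqCohAlg.isIso_of_bijective _ (c.unit_bijective M.op (c.eqObj_op hf M))))
    (fun {M N} g => EqCohAlg.Hom.ext
      (c.unit_naturality M.op N.op (c.eqObj_op hf M) (c.eqObj_op hf N) g.hom
        (EqCohAlg.hom_op hf g) (EqCohAlg.hom_op hf ((c.eqFunctor hf).map g))))

/-- A Morita context gives an equivalence between equivariant modules over pulled back
algebras. -/
def eqEquiv : EqCohAlg (pullEqAlg hf A) ≌ EqCohAlg (pullEqAlg hf A') :=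
  CategoryTheory.Equivalence.mk (c.eqFunctor hf) (c.swap.eqFunctor hf) (c.eqUnitIso hf)
    (c.swap.eqUnitIso hf).symm

end Equivariant
end Sheaf
end MoritaCtx
end Ctx
end EquivSheaf

end

noncomputable section
namespace EquivSheaf

section Regular
variable {H : Type u} [Group H] {R : Type u} [CommRing R] {τ : H →* RingAut R}
  {X : Scheme.{u}} {ρ : H →* Aut X} {f : X ⟶ Spec (.of R)} (hf : IsEquivariant τ ρ f)
  (A : RAlg τ) [Module.Finite R A.carrier] [Module.Projective R A.carrier]

/-- The pullback of `A` as a module over itself. -/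
def regular : EqCohAlg (pullEqAlg hf A) where
  mod := pullModule f A.carrier
  smul := (pullEqAlg hf A).mul
  one_smul := (pullEqAlg hf A).one_mul
  mul_smul := (pullEqAlg hf A).mul_assoc
  res_smul := (pullEqAlg hf A).res_mul
  coherent := isCoherent_pullModule f A.carrier
  act := (pullEqAlg hf A).act
  act_osmul := (pullEqAlg hf A).act_osmul
  act_res := (pullEqAlg hf A).act_res
  act_one := (pullEqAlg hf A).act_one
  act_comp := (pullEqAlg hf A).act_comp
  act_bsmul := (pullEqAlg hf A).act_prod

variable {A}

/-- The section `1 ⊗ a` of the pullback of `A`. -/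
def eqPullSec (a : A.carrier) (U : X.Opens) : Γ((pullEqAlg hf A).mod, U) := pullSec f a U

lemma eqPullSec_induction {U : X.Opens} {P : Γ((pullEqAlg hf A).mod, U) → Prop} (h0 : P 0)
    (hadd : ∀ x y, P x → P y → P (x + y))
    (hs : ∀ (r : Γ(X, U)) (a : A.carrier), P (r • eqPullSec hf a U))
    (x : Γ((pullEqAlg hf A).mod, U)) : P x :=
  pullSec_induction h0 hadd hs x

end Regular

namespace MoritaCtx
variable {G : Type u} [Group G] {R : Type u} [CommRing R] {τ : G →* RingAut R}
  {A' A : RAlg τ} (c : MoritaCtx A' A) {X : Scheme.{u}} {f : X ⟶ Spec (.of R)}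
  {ρ : G →* Aut X} (hf : IsEquivariant τ ρ f)
  [Module.Finite R A.carrier] [Module.Projective R A.carrier]

/-- The sheaf of `A`-linear maps from `Q` to the pullback of `A`. -/
abbrev dual : X.Modules := homSheaf c.Q (regular hf A).mod (regular hf A).op

/-- The values of an `A`-linear map from `Q` to the pullback of `A`. -/
def val (q : c.Q) (U : X.Opens) : Γ(c.dual hf, U) →ₗ[Γ(X, U)] Γ((pullEqAlg hf A).mod, U) :=
  homL (homEval q) U

lemma val_add (q q' : c.Q) (U : X.Opens) (ψ : Γ(c.dual hf, U)) :
    c.val hf (q + q') U ψ = c.val hf q U ψ + c.val hf q' U ψ :=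
  congrArg (fun g => Scheme.Modules.Hom.app g U ψ) (homEval_add q q')

lemma val_smul (a : A.carrier) (q : c.Q) (U : X.Opens) (ψ : Γ(c.dual hf, U)) :
    c.val hf (a • q) U ψ = (pullEqAlg hf A).mul U (eqPullSec hf a U) (c.val hf q U ψ) :=
  congrArg (fun g => Scheme.Modules.Hom.app g U ψ) (homEval_smul a q)

lemma val_res (q : c.Q) {U V : X.Opens} (i : V ≤ U) (ψ : Γ(c.dual hf, U)) :
    c.val hf q V (res (c.dual hf) i ψ) = res (pullEqAlg hf A).mod i (c.val hf q U ψ) :=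
  hom_res (homEval q) i ψ

/-- An `A`-linear map from `Q` to the pullback of `A`. -/
def ofVal {U : X.Opens} (ψ : c.Q → Γ((pullEqAlg hf A).mod, U))
    (h : ∀ q q', ψ (q + q') = ψ q + ψ q')
    (h' : ∀ (a : A.carrier) q, ψ (a • q) = (pullEqAlg hf A).mul U (eqPullSec hf a U) (ψ q)) :
    Γ(c.dual hf, U) :=
  homSec ψ h h'

lemma dual_ext {U : X.Opens} {s t : Γ(c.dual hf, U)}
    (h : ∀ q, c.val hf q U s = c.val hf q U t) : s = t :=
  homSheaf_sec_ext h

/-- Pairing of an `A`-linear map from `Q` to the pullback of `A` with a section of a module. -/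
def pairSec (M : EqCohAlg (pullEqAlg hf A)) (U : X.Opens)
    (ψ : Γ(c.dual hf, U)) (m : Γ(M.mod, U)) : Γ(homSheaf c.Q M.mod M.op, U) :=
  homSec (fun q => M.smul U (c.val hf q U ψ) m)
    (fun q q' => by rw [val_add, map_add, LinearMap.add_apply])
    (fun a q => by
      rw [val_smul]
      exact M.mul_smul U (eqPullSec hf a U) (c.val hf q U ψ) m)

lemma homEval_pairSec (M : EqCohAlg (pullEqAlg hf A)) (U : X.Opens)
    (ψ : Γ(c.dual hf, U)) (m : Γ(M.mod, U)) (q : c.Q) :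
    (homEval q).app U (c.pairSec hf M U ψ m) = M.smul U (c.val hf q U ψ) m := rfl

/-- The pairing as a bilinear map. -/
def pairing (M : EqCohAlg (pullEqAlg hf A)) (U : X.Opens) :
    Γ(c.dual hf, U) →ₗ[Γ(X, U)] Γ(M.mod, U) →ₗ[Γ(X, U)] Γ(homSheaf c.Q M.mod M.op, U) :=
  LinearMap.mk₂ Γ(X, U) (c.pairSec hf M U)
    (fun ψ ψ' m => homSheaf_sec_ext fun q => by
      rw [map_add, homEval_pairSec, homEval_pairSec, homEval_pairSec, map_add, map_add,
        LinearMap.add_apply])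
    (fun r ψ m => homSheaf_sec_ext fun q => by
      rw [Scheme.Modules.Hom.app_smul, homEval_pairSec, homEval_pairSec,
        map_smul, map_smul, LinearMap.smul_apply])
    (fun ψ m m' => homSheaf_sec_ext fun q => by
      rw [map_add, homEval_pairSec, homEval_pairSec, homEval_pairSec, map_add])
    (fun r ψ m => homSheaf_sec_ext fun q => by
      rw [Scheme.Modules.Hom.app_smul, homEval_pairSec, homEval_pairSec, map_smul])

lemma homEval_pairing (M : EqCohAlg (pullEqAlg hf A)) (U : X.Opens)
    (ψ : Γ(c.dual hf, U)) (m : Γ(M.mod, U)) (q : c.Q) :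
    (homEval q).app U (c.pairing hf M U ψ m) = M.smul U (c.val hf q U ψ) m := rfl

/-- The right action of the pullback of `A` on `A`-linear maps from `Q` to it. -/
def rmul (U : X.Opens) :
    Γ(c.dual hf, U) →ₗ[Γ(X, U)] Γ((pullEqAlg hf A).mod, U) →ₗ[Γ(X, U)] Γ(c.dual hf, U) :=
  c.pairing hf (regular hf A) U

lemma val_rmul (U : X.Opens) (ψ : Γ(c.dual hf, U)) (b : Γ((pullEqAlg hf A).mod, U)) (q : c.Q) :
    c.val hf q U (c.rmul hf U ψ b) = (pullEqAlg hf A).mul U (c.val hf q U ψ) b := rfl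

/-- The linear map from `Q` to the pullback of `A` given by an element of `P`. -/
def pairElem (p : c.P) (U : X.Opens) : Γ(c.dual hf, U) :=
  c.ofVal hf (fun x => eqPullSec hf (c.qp x p) U)
    (fun x x' => by
      rw [map_add, AddMonoidHom.add_apply]
      exact TensorProduct.tmul_add _ _ _)
    (fun a x => by
      rw [c.qp_smul]
      refine Eq.trans ?_ (Algebra.TensorProduct.tmul_mul_tmul (R := R) (1 : FunSec f U) 1 a
        (c.qp x p)).symm
      rw [mul_one]
      rfl)

lemma exists_expansion : ∃ (n : ℕ) (e : Fin n → c.Q) (l : ∀ U : X.Opens, Fin n → Γ(c.dual hf, U)),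
    (∀ {U V : X.Opens} (i : V ≤ U) j, res (c.dual hf) i (l U j) = l V j) ∧
    ∀ (M : EqCohAlg (pullEqAlg hf A)) (U : X.Opens) (φ : Γ(homSheaf c.Q M.mod M.op, U)),
      ∑ j, c.pairing hf M U (l U j) ((homEval (e j)).app U φ) = φ := by
  obtain ⟨n, p, q, h⟩ := c.exists_pq
  refine ⟨n, q, fun U j => c.pairElem hf (p j) U, fun i j => c.dual_ext hf fun x => ?_,
    fun M U φ => homSheaf_sec_ext fun x => ?_⟩
  · rw [val_res]
    exact res_pullSec (f := f) _ i
  · rw [map_sum]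
    have h1 : ∀ j, (homEval x).app U (c.pairing hf M U (c.pairElem hf (p j) U)
        ((homEval (q j)).app U φ)) = evalHom φ (c.qr x (c.pq (p j) (q j))) := by
      intro j
      rw [← c.qp_assoc]
      exact (congrArg (fun g => Scheme.Modules.Hom.app g U φ)
        (homEval_smul (op := M.op) (c.qp x (p j)) (q j))).symm
    refine (Finset.sum_congr rfl fun j _ => h1 j).trans ?_
    rw [← map_sum, ← map_sum, h, c.qr_one]
    rfl

variable [Module.Finite R A'.carrier] [Module.Projective R A'.carrier]

/-- The action of the pullback of `A'` on sheaves of `A`-linear maps from `Q`. -/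
def hsmul (M : EqCohAlg (pullEqAlg hf A)) (U : X.Opens) :
    Γ((pullEqAlg hf A').mod, U) →ₗ[Γ(X, U)] Γ(homSheaf c.Q M.mod M.op, U) →ₗ[Γ(X, U)]
      Γ(homSheaf c.Q M.mod M.op, U) :=
  (c.eqObj hf M).smul U

/-- The group action on sheaves of `A`-linear maps from `Q`. -/
def hact (M : EqCohAlg (pullEqAlg hf A)) (h : G) (U : X.Opens) :
    Γ(homSheaf c.Q M.mod M.op, U) →+ Γ(homSheaf c.Q M.mod M.op, translate ρ h U) :=
  (c.eqObj hf M).act h U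

lemma homEval_hsmul (M : EqCohAlg (pullEqAlg hf A)) (U : X.Opens) (a : A'.carrier)
    (s : Γ(homSheaf c.Q M.mod M.op, U)) (q : c.Q) :
    (homEval q).app U (c.hsmul hf M U (eqPullSec hf a U) s) =
      (homEval (c.qr q a)).app U s :=
  congrArg (fun o : A'.carrier →+* End (homSheaf c.Q M.mod M.op) =>
    (homEval q).app U (Scheme.Modules.Hom.app (o a) U s)) (c.eqObj_op hf M)

lemma val_hact (h : G) (U : X.Opens) (s : Γ(c.dual hf, U)) (q : c.Q) :
    c.val hf q _ (c.hact hf (regular hf A) h U s) =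
      (pullEqAlg hf A).act h U (c.val hf (c.actQ h⁻¹ q) U s) := rfl

lemma pairing_smul (M : EqCohAlg (pullEqAlg hf A)) (U : X.Opens)
    (b : Γ((pullEqAlg hf A').mod, U))
    (ψ : Γ(c.dual hf, U)) (m : Γ(M.mod, U)) :
    c.pairing hf M U (c.hsmul hf (regular hf A) U b ψ) m =
      c.hsmul hf M U b (c.pairing hf M U ψ m) := by
  induction b using eqPullSec_induction hf with
  | h0 => simp only [map_zero, LinearMap.zero_apply]
  | hadd x y hx hy => simp only [map_add, LinearMap.add_apply, hx, hy]
  | hs r a =>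
    simp only [map_smul, LinearMap.smul_apply]
    refine congrArg (fun x => r • x) (homSheaf_sec_ext fun q => ?_)
    rw [homEval_hsmul, homEval_pairing, homEval_pairing]
    exact congrArg (fun x => M.smul U x m) (c.homEval_hsmul hf (regular hf A) U a ψ q)

/-- The bimodule of `A`-linear maps from `Q` to the pullback of `A`. -/
def bimod : EqBimod (pullEqAlg hf A') (pullEqAlg hf A) where
  mod := c.dual hf
  act := c.hact hf (regular hf A)
  act_osmul := (c.eqObj hf (regular hf A)).act_osmul
  act_res := (c.eqObj hf (regular hf A)).act_res
  act_one := (c.eqObj hf (regular hf A)).act_one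
  act_comp := (c.eqObj hf (regular hf A)).act_comp
  coherent := (c.eqObj hf (regular hf A)).coherent
  lsmul := c.hsmul hf (regular hf A)
  rsmul := c.rmul hf
  one_lsmul := (c.eqObj hf (regular hf A)).one_smul
  mul_lsmul := (c.eqObj hf (regular hf A)).mul_smul
  rsmul_one U p := c.dual_ext hf fun q => by rw [val_rmul, (pullEqAlg hf A).mul_one]
  rsmul_mul U p a b := c.dual_ext hf fun q => by
    rw [val_rmul, val_rmul, val_rmul, (pullEqAlg hf A).mul_assoc]
  lsmul_rsmul U a p b := c.pairing_smul hf (regular hf A) U a p b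
  res_lsmul := (c.eqObj hf (regular hf A)).res_smul
  res_rsmul i p b := c.dual_ext hf fun q => by
    rw [val_res, val_rmul, val_rmul, val_res, (pullEqAlg hf A).res_mul]
  act_lsmul := (c.eqObj hf (regular hf A)).act_bsmul
  act_rsmul h U p b := c.dual_ext hf fun q => by
    rw [val_hact, val_rmul, val_rmul, val_hact, (pullEqAlg hf A).act_prod]

/-- The balanced pairing with the bimodule of `A`-linear maps from `Q`. -/
def balancedMap (M : EqCohAlg (pullEqAlg hf A)) :
    BalancedMap (c.bimod hf) M (c.eqObj hf M) where
  toFun := c.pairing hf M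
  map_lsmul U a p m := c.pairing_smul hf M U a p m
  balanced U p b m := homSheaf_sec_ext fun q => M.mul_smul U (c.val hf q U p) b m
  map_res i p m := homSheaf_sec_ext fun q => by
    refine (hom_res (homEval q) i _).trans ((M.res_smul i (c.val hf q _ p) m).trans ?_)
    exact congrArg (fun x => M.smul _ x _) (c.val_res hf q i p).symm
  map_act h U p m := homSheaf_sec_ext fun q => M.act_bsmul h U (c.val hf (c.actQ h⁻¹ q) U p) m

lemma balancedMap_universal (M : EqCohAlg (pullEqAlg hf A)) (N : EqCohAlg (pullEqAlg hf A'))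
    (γ : BalancedMap (c.bimod hf) M N) :
    ∃! g : c.eqObj hf M ⟶ N, ∀ U p m,
      g.hom.app U (c.pairing hf M U p m) = γ.toFun U p m := by
  obtain ⟨n, e, l, hl, hexp⟩ := c.exists_expansion hf
  let γ' : ∀ U : X.Opens, Γ(c.dual hf, U) →ₗ[Γ(X, U)] Γ(M.mod, U) →ₗ[Γ(X, U)] Γ(N.mod, U) :=
    γ.toFun
  have huniq : ∀ g : c.eqObj hf M ⟶ N, (∀ U p m,
      g.hom.app U (c.pairing hf M U p m) = γ.toFun U p m) → ∀ U φ, g.hom.app U φ =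
        ∑ j, γ' U (l U j) ((homEval (e j)).app U φ) := fun g hg U φ => by
    refine (congrArg (g.hom.app U) (hexp M U φ).symm).trans ?_
    refine (map_sum (g.hom.app U).hom _ _).trans (Finset.sum_congr rfl fun j _ => hg U _ _)
  let g₀ : ∀ U : X.Opens, Γ(homSheaf c.Q M.mod M.op, U) →ₗ[Γ(X, U)] Γ(N.mod, U) := fun U =>
    ∑ j, (γ' U (l U j)).comp (homL (homEval (e j)) U)
  have hg₀ : ∀ U φ, g₀ U φ = ∑ j, γ' U (l U j) ((homEval (e j)).app U φ) := fun U φ => by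
    rw [LinearMap.sum_apply]
    rfl
  have hpair : ∀ U p m, g₀ U (c.pairing hf M U p m) = γ' U p m := fun U p m => by
    rw [hg₀]
    have h1 : ∑ j, c.rmul hf U (l U j) (c.val hf (e j) U p) = p := hexp (regular hf A) U p
    conv_rhs => rw [← h1]
    rw [map_sum, LinearMap.sum_apply]
    exact Finset.sum_congr rfl fun j _ => (γ.balanced U _ _ m).symm
  have hexp' : ∀ U φ, g₀ U φ = ∑ j, g₀ U (c.pairing hf M U (l U j) ((homEval (e j)).app U φ)) :=
    fun U φ => by rw [← map_sum, hexp]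
  refine ⟨⟨mkHom (M := homSheaf c.Q M.mod M.op) g₀ fun i s => ?_, fun U b φ => ?_,
    fun h U φ => ?_⟩, fun U p m => hpair U p m, fun g hg => ?_⟩
  · rw [hg₀, hg₀, map_sum]
    refine Finset.sum_congr rfl fun j _ => ?_
    rw [hom_res, ← hl i j]
    exact (γ.map_res i _ _).symm
  · change g₀ U (c.hsmul hf M U b φ) = N.smul U b (g₀ U φ)
    rw [hg₀ U φ, map_sum]
    conv_lhs => rw [← hexp M U φ, map_sum, map_sum]
    refine Finset.sum_congr rfl fun j _ => ?_
    rw [← pairing_smul, hpair]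
    exact γ.map_lsmul U _ _ _
  · change g₀ _ (c.hact hf M h U φ) = N.act h U (g₀ U φ)
    rw [hg₀ U φ, map_sum]
    conv_lhs => rw [← hexp M U φ, map_sum, map_sum]
    refine Finset.sum_congr rfl fun j _ => ?_
    have h1 : c.hact hf M h U (c.pairing hf M U (l U j) ((homEval (e j)).app U φ)) =
        c.pairing hf M _ (c.hact hf (regular hf A) h U (l U j))
          (M.act h U ((homEval (e j)).app U φ)) :=
      (c.balancedMap hf M).map_act h U _ _
    rw [h1, hpair]
    exact (γ.map_act h U _ _).symm
  · refine EqCohAlg.Hom.ext (hom_ext' fun U φ => ?_)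
    exact (huniq g hg U φ).trans (hg₀ U φ).symm

/-- A Morita context gives a Morita equivalence of the pulled back algebras. -/
theorem morita (c : MoritaCtx A' A) : Morita (pullEqAlg hf A) (pullEqAlg hf A') :=
  ⟨c.bimod hf, c.eqFunctor hf,
    ⟨{ pair := c.balancedMap hf
       natural := fun g U p m => homSheaf_sec_ext fun q => g.map_bsmul U (c.val hf q U p) m
       universal := c.balancedMap_universal hf }⟩,
    (c.eqEquiv hf).isEquivalence_functor⟩

end MoritaCtx
end EquivSheaf

end

noncomputable section
namespace EquivSheaf

section Trivial
variable {X : Scheme.{u}} {K : Type u} [Group K] {ρ : K →* Aut X}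

lemma EqMod.act_congr (E : EqMod ρ) {a b : K} (h : a = b) (U : X.Opens) (s : Γ(E.mod, U))
    (e : translate ρ a U ≤ translate ρ b U) : E.act a U s = res E.mod e (E.act b U s) := by
  subst h
  exact (res_self _ _ _).symm

lemma actO_of_eq_one {a : K} (h : ρ a = 1) (U : X.Opens) (r : Γ(X, U))
    (e : U ≤ translate ρ a U) : resO e (actO ρ a U r) = r := by
  have key : ∀ (b : Aut X) (hb : b = 1) (e : U ≤ b.inv ⁻¹ᵁ U),
      resO e ((b.inv.app U).hom r) = r := by
    rintro b rfl e
    exact resO_self e r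
  exact key (ρ a) h e

lemma translate_of_eq_one {a : K} (h : ρ a = 1) (U : X.Opens) : translate ρ a U = U := by
  rw [translate, h]; rfl

/-- The operator on a sheaf defined by a group element acting trivially on the scheme. -/
def EqMod.trivOp (E : EqMod ρ) (h : ∀ n, ρ n = 1) : K →* End E.mod where
  toFun n := mkHom (fun U =>
      { toFun := fun s => res E.mod (translate_of_eq_one (h n) U).ge (E.act n U s)
        map_add' := fun s t => by rw [map_add, map_add]
        map_smul' := fun r s => by
          rw [E.act_osmul, res_osmul, actO_of_eq_one (h n)]; rfl })
    (fun i s => by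
      change res E.mod _ (E.act n _ (res E.mod i s)) = res E.mod i (res E.mod _ (E.act n _ s))
      rw [E.act_res, res_res, res_res])
  map_one' := hom_ext' fun U s => by
    change res E.mod _ (E.act 1 U s) = s
    rw [E.act_one, res_res, res_self]
  map_mul' m n := hom_ext' fun U s => by
    change res E.mod _ (E.act (m * n) U s) =
      res E.mod _ (E.act m U (res E.mod _ (E.act n U s)))
    rw [E.act_comp, E.act_res, res_res, res_res]

lemma EqMod.trivOp_app (E : EqMod ρ) (h : ∀ n, ρ n = 1) (n : K) (U : X.Opens)
    (s : Γ(E.mod, U)) (e : U ≤ translate ρ n U) :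
    Scheme.Modules.Hom.app (E.trivOp h n) U s = res E.mod e (E.act n U s) := rfl

/-- Multiplication by scalars as a ring homomorphism. -/
def zmulHom {R : Type u} [CommRing R] (f : X ⟶ Spec (.of R)) (M : X.Modules) : R →+* End M where
  toFun := zmul f M
  map_one' := hom_ext' fun U s => by
    rw [zmul_app, map_one, _root_.one_smul]; rfl
  map_mul' a b := hom_ext' fun U s => by
    rw [zmul_app, map_mul, SemigroupAction.mul_smul]; rfl
  map_zero' := hom_ext' fun U s => by
    rw [zmul_app, map_zero, zero_smul]; rfl
  map_add' a b := hom_ext' fun U s => by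
    rw [zmul_app, map_add, add_smul]; rfl

variable {k : Type u} [Field k] (f : X ⟶ Spec (.of k))

/-- The action of the group algebra on a sheaf with an action of a group acting trivially on the
scheme. -/
def EqMod.groupOp (E : EqMod ρ) (h : ∀ n, ρ n = 1) : MonoidAlgebra k K →+* End E.mod :=
  MonoidAlgebra.liftNCRingHom (zmulHom f E.mod) (E.trivOp h)
    fun c n => (zmul_comm f c (show E.mod ⟶ E.mod from E.trivOp h n)).symm

lemma EqMod.groupOp_single (E : EqMod ρ) (h : ∀ n, ρ n = 1) (n : K) (c : k) :
    E.groupOp f h (MonoidAlgebra.single n c) = zmulHom f E.mod c * E.trivOp h n :=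
  MonoidAlgebra.liftNCRingHom_single _ _ _ _ _

lemma EqMod.groupOp_single_one (E : EqMod ρ) (h : ∀ n, ρ n = 1) (n : K) :
    E.groupOp f h (MonoidAlgebra.single n 1) = E.trivOp h n := by
  rw [groupOp_single, map_one, _root_.one_mul]

lemma EqMod.groupOp_algebraMap (E : EqMod ρ) (h : ∀ n, ρ n = 1) (c : k) :
    E.groupOp f h (algebraMap k _ c) = zmul f E.mod c := by
  refine (E.groupOp_single f h 1 _).trans ?_
  rw [map_one, _root_.mul_one]; rfl

lemma EqMod.groupOp_eq (E : EqMod ρ) (h : ∀ n, ρ n = 1) (op : MonoidAlgebra k K →+* End E.mod)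
    (hop : ∀ c, op (algebraMap k _ c) = zmul f E.mod c)
    (hn : ∀ n, op (MonoidAlgebra.single n 1) = E.trivOp h n) : E.groupOp f h = op :=
  MonoidAlgebra.ringHom_ext (fun c => (E.groupOp_algebraMap f h c).trans (hop c).symm)
    (fun n => (E.groupOp_single_one f h n).trans (hn n).symm)

lemma EqCoh.hom_trivOp {M N : EqCoh ρ} (h : ∀ n, ρ n = 1) (g : M ⟶ N) (n : K) (U : X.Opens)
    (s : Γ(M.mod, U)) : g.hom.app U (Scheme.Modules.Hom.app (M.trivOp h n) U s) =
      Scheme.Modules.Hom.app (N.trivOp h n) U (g.hom.app U s) := by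
  refine (hom_res g.hom _ _).trans ?_
  rw [g.map_act]; rfl

lemma hom_groupOp {E F : EqMod ρ} (h : ∀ n, ρ n = 1) (g : E.mod ⟶ F.mod)
    (hg : ∀ n U s, g.app U (Scheme.Modules.Hom.app (E.trivOp h n) U s) =
      Scheme.Modules.Hom.app (F.trivOp h n) U (g.app U s)) (x : MonoidAlgebra k K) (U : X.Opens)
    (s : Γ(E.mod, U)) : g.app U (Scheme.Modules.Hom.app (E.groupOp f h x) U s) =
      Scheme.Modules.Hom.app (F.groupOp f h x) U (g.app U s) := by
  induction x using MonoidAlgebra.induction_linear with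
  | zero => rw [map_zero, map_zero]; exact map_zero _
  | add x y hx hy =>
    rw [map_add, map_add]
    exact (map_add _ _ _).trans (congrArg₂ (· + ·) hx hy)
  | single n c =>
    rw [EqMod.groupOp_single, EqMod.groupOp_single]
    refine (Scheme.Modules.Hom.app_smul g _ _).trans ?_
    exact congrArg (fun t => baseHom f U c • t) (hg n U s)

lemma act_eq_trivOp (h : ∀ n, ρ n = 1) (F : EqMod ρ) (n : K) (U : X.Opens) (s : Γ(F.mod, U)) :
    F.act n U s = res F.mod (translate_of_eq_one (h n) U).le
      (Scheme.Modules.Hom.app (F.trivOp h n) U s) := by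
  rw [F.trivOp_app h n U s (translate_of_eq_one (h n) U).ge, res_res, res_self]

variable [Finite K] (h : ∀ n, ρ n = 1)

/-- Coherent sheaves with an action of a group acting trivially, as modules over the group
algebra. -/
def toGroupAlg : EqCoh ρ ⥤ CohAlg (pullAlg f (MonoidAlgebra k K)) where
  obj F := CohAlg.ofOp F.mod F.coherent (F.groupOp f h) (F.groupOp_algebraMap f h)
  map {F F'} g := CohAlg.homOfOp (f := f) g.hom (fun x U m => by
    have e (F : EqCoh ρ) : AlgMod.op (CohAlg.ofOp F.mod F.coherent (F.groupOp f h)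
      (F.groupOp_algebraMap f h)).toAlgMod = F.groupOp f h := AlgMod.op_ofOp _ _ _
    rw [e, e]
    exact hom_groupOp f h g.hom (EqCoh.hom_trivOp h g) x U m)

lemma toGroupAlg_op (F : EqCoh ρ) : ((toGroupAlg f h).obj F).op = F.groupOp f h :=
  AlgMod.op_ofOp _ _ _

/-- The sheaf with a group action given by a module over the group algebra. -/
def ofGroupAlg (M : CohAlg (pullAlg f (MonoidAlgebra k K))) : EqCoh ρ where
  mod := M.mod
  act n U := (res M.mod (translate_of_eq_one (h n) U).le).comp
    (homL (M.op (MonoidAlgebra.single n 1)) U).toAddMonoidHom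
  act_osmul n U r s := by
    change res M.mod _ (Scheme.Modules.Hom.app _ U (r • s)) = actO ρ n U r • res M.mod _ _
    rw [Scheme.Modules.Hom.app_smul, res_osmul]
    refine congrArg (· • _) ?_
    rw [← actO_of_eq_one (h n) U r (translate_of_eq_one (h n) U).ge, resO_resO, resO_self]
    congr 1
    rw [actO_of_eq_one (h n) U r (translate_of_eq_one (h n) U).ge]
  act_res n U V i s := by
    change res M.mod _ (Scheme.Modules.Hom.app _ V (res M.mod i s)) =
      res M.mod _ (res M.mod _ (Scheme.Modules.Hom.app _ U s))
    rw [hom_res, res_res, res_res]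
  act_one U s := by
    change res M.mod _ (Scheme.Modules.Hom.app (M.op 1) U s) = _
    rw [map_one]; rfl
  act_comp m n U s := by
    change res M.mod _ (Scheme.Modules.Hom.app _ U s) = res M.mod _ (res M.mod _
      (Scheme.Modules.Hom.app _ _ (res M.mod _ (Scheme.Modules.Hom.app _ U s))))
    rw [hom_res, res_res, res_res, ← end_mul_app, ← map_mul, MonoidAlgebra.single_mul_single,
      _root_.mul_one]
  coherent := M.coherent

lemma ofGroupAlg_op (M : CohAlg (pullAlg f (MonoidAlgebra k K))) :
    (ofGroupAlg f h M).groupOp f h = M.op :=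
  EqMod.groupOp_eq f _ h _ M.op_algebraMap fun n => hom_ext' fun U s => by
    rw [EqMod.trivOp_app _ h n U s (translate_of_eq_one (h n) U).ge]
    exact ((res_res M.mod _ _ _).trans (res_self _ _ _)).symm

instance toGroupAlg_isEquivalence : (toGroupAlg f h).IsEquivalence where
  faithful := ⟨fun e => EqCoh.Hom.ext (congrArg CohAlg.Hom.hom e)⟩
  full := ⟨fun {F F'} φ => ⟨⟨φ.hom, fun n U s => by
    have e (F : EqCoh ρ) : ((toGroupAlg f h).obj F).op (MonoidAlgebra.single n 1) =
        F.trivOp h n := by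
      rw [toGroupAlg_op]; exact F.groupOp_single_one f h n
    have h1 : φ.hom.app U (Scheme.Modules.Hom.app (F.trivOp h n) U s) =
        Scheme.Modules.Hom.app (F'.trivOp h n) U (φ.hom.app U s) := by
      rw [← e F, ← e F']
      exact CohAlg.hom_op (f := f) φ (MonoidAlgebra.single n 1) U s
    rw [act_eq_trivOp h F'.toEqMod, act_eq_trivOp h F.toEqMod]
    refine (hom_res φ.hom _ _).trans ?_
    exact congrArg (res F'.mod _) h1⟩, rfl⟩⟩
  essSurj := ⟨fun M => ⟨ofGroupAlg f h M, ⟨@asIso _ _ _ _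
    (CohAlg.homOfOp (f := f) (M := (toGroupAlg f h).obj (ofGroupAlg f h M)) (N := M) (𝟙 M.mod)
      (fun x U m => by
        rw [toGroupAlg_op, ofGroupAlg_op]; rfl))
    (CohAlg.isIso_of_bijective _ fun U => Function.bijective_id)⟩⟩⟩

end Trivial
end EquivSheaf

end

noncomputable section
namespace EquivSheaf

lemma EqMod.act_act {X : Scheme.{u}} {K : Type u} [Group K] {ρ : K →* Aut X} (E : EqMod ρ)
    (g h : K) (U : X.Opens) (s : Γ(E.mod, U)) (e : translate ρ g (translate ρ h U) ≤
      translate ρ (g * h) U) :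
    E.act g _ (E.act h U s) = res E.mod e (E.act (g * h) U s) := by
  rw [E.act_comp, res_res, res_self]

section Ext
variable {k : Type u} [Field k] {G H : Type u} [Group G] [Group H] {π : G →* H}
  {X : Scheme.{u}} {s : X ⟶ Spec (.of k)} {ρ : H →* Aut X} (hs : IsOver ρ s)

lemma ker_act (π : G →* H) (ρ : H →* Aut X) (n : π.ker) :
    ((ρ.comp π).comp π.ker.subtype) n = 1 := by
  change ρ (π n) = 1
  rw [n.2, map_one]

variable (k π) in
/-- The group algebra of the kernel, with the action of the group by conjugation. -/
def kerAlg : RAlg (1 : G →* RingAut k) where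
  carrier := MonoidAlgebra k π.ker
  act :=
    { toFun := fun g => (conjAlg k π g).toRingEquiv
      map_one' := by rw [map_one]; rfl
      map_mul' := fun g h => by rw [map_mul]; rfl }
  act_smul g c x := map_smul (conjAlg k π g) c x

instance [Finite G] : Module.Finite k (kerAlg k π).carrier :=
  inferInstanceAs (Module.Finite k (MonoidAlgebra k π.ker))

lemma IsOver.comp {X S : Scheme.{u}} {ρ : H →* Aut X} {s : X ⟶ S} (hs : IsOver ρ s)
    (π : G →* H) : IsOver (ρ.comp π) s :=
  fun g => hs (π g)

variable (s) in
/-- The action of the group algebra of the kernel on an equivariant sheaf. -/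
def kerOp (F : CohG π ρ) : MonoidAlgebra k π.ker →+* End F.mod :=
  ((forgetGN π ρ).obj F).groupOp s (ker_act π ρ)

lemma act_kerOp (hs : IsOver ρ s) (F : CohG π ρ) (g : G) (x : MonoidAlgebra k π.ker) (U : X.Opens)
    (m : Γ(F.mod, U)) : F.act g U (Scheme.Modules.Hom.app (kerOp s F x) U m) =
      Scheme.Modules.Hom.app (kerOp s F (conjAlg k π g x)) _ (F.act g U m) := by
  induction x using MonoidAlgebra.induction_linear with
  | zero => rw [map_zero, map_zero, map_zero]; exact map_zero (F.act g U)
  | add x y hx hy =>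
    rw [map_add, map_add, map_add]
    exact (map_add (F.act g U) _ _).trans (congrArg₂ (· + ·) hx hy)
  | single n c =>
    have e0 (n : π.ker) (U : X.Opens) : translate (ρ.comp π) (n : G) U = U :=
      translate_of_eq_one (ker_act π ρ n) U
    have key : F.act g U (res F.mod (e0 n U).ge (F.act (n : G) U m)) =
        res F.mod (e0 (MulAut.conjNormal g n) _).ge
          (F.act ((MulAut.conjNormal g n : π.ker) : G) _ (F.act g U m)) := by
      have e1 : translate (ρ.comp π) g U ≤ translate (ρ.comp π) (g * n) U := by
        refine le_of_eq ?_
        rw [translate_mul]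
        exact congrArg (translate (ρ.comp π) g) (translate_of_eq_one (ker_act π ρ n) U).symm
      have e2 : (MulAut.conjNormal g n : π.ker) * g = g * n := by
        rw [MulAut.conjNormal_apply, inv_mul_cancel_right]
      rw [F.act_res, F.act_act _ _ _ _ (translate_mul _ _ _ _).ge, res_res,
        F.act_act _ _ _ _ (translate_mul _ _ _ _).ge,
        F.act_congr e2 U m (by rw [e2]), res_res, res_res]
    rw [conjAlg_single]
    refine (congrArg (fun o : End F.mod => F.act g U (Scheme.Modules.Hom.app o U m))
      (EqMod.groupOp_single _ _ _ n c)).trans ?_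
    refine Eq.trans ?_ (congrArg (fun o : End F.mod => Scheme.Modules.Hom.app o _ (F.act g U m))
      (EqMod.groupOp_single _ _ _ (MulAut.conjNormal g n) c)).symm
    refine (F.act_osmul g U _ _).trans ?_
    refine congrArg₂ (· • ·) (actO_baseHom (hs.comp π).isEquivariant g U c) key

lemma kerOp_algebraMap (F : CohG π ρ) (c : k) :
    kerOp s F (algebraMap k (MonoidAlgebra k π.ker) c) = zmul s F.mod c :=
  EqMod.groupOp_algebraMap _ _ _ _

variable [Finite G]

/-- Equivariant sheaves as equivariant modules over the group algebra of the kernel. -/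
def kerObj (F : CohG π ρ) : EqCohAlg (pullEqAlg (hs.comp π).isEquivariant (kerAlg k π)) :=
  EqCohAlg.ofOp _ F.toEqMod F.coherent (kerOp s F) (kerOp_algebraMap F)
    (fun g x U m => act_kerOp hs F g x U m)

lemma kerObj_op (F : CohG π ρ) : (kerObj hs F).op = kerOp s F :=
  EqCohAlg.op_ofOp _ _ _ _ _ _

/-- Equivariant sheaves as equivariant modules over the group algebra of the kernel. -/
def toKerAlg : CohG π ρ ⥤ EqCohAlg (pullEqAlg (hs.comp π).isEquivariant (kerAlg k π)) where
  obj F := kerObj hs F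
  map {F F'} g := EqCohAlg.homOfOp (M := kerObj hs F) (N := kerObj hs F') _ g.hom
    (fun x U m => by
      rw [kerObj_op, kerObj_op]
      exact hom_groupOp (E := ((forgetGN π ρ).obj F).toEqMod)
        (F := ((forgetGN π ρ).obj F').toEqMod) s (ker_act π ρ) g.hom
        (EqCoh.hom_trivOp (ker_act π ρ) ((forgetGN π ρ).map g)) x U m)
    (fun h U m => g.map_act h U m)

instance : (toKerAlg (k := k) hs).Faithful (C := CohG π ρ) :=
  ⟨fun e => EqCoh.Hom.ext (congrArg EqCohAlg.Hom.hom e)⟩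

instance : (toKerAlg (k := k) hs).Full (C := CohG π ρ) :=
  ⟨fun φ => ⟨⟨φ.hom, φ.map_act⟩, rfl⟩⟩

/-- An equivariant module over the group algebra of the kernel, on which the kernel acts through
the group algebra, comes from an equivariant sheaf. -/
def kerObjIso (M : EqCohAlg (pullEqAlg (hs.comp π).isEquivariant (kerAlg k π)))
    (hM : ∀ (n : π.ker) (U : X.Opens) (m : Γ(M.mod, U)) (e : U ≤ translate (ρ.comp π) n U),
      Scheme.Modules.Hom.app (M.op (MonoidAlgebra.single n (1 : k))) U m =
        res M.mod e (M.act (n : G) U m)) :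
    (toKerAlg hs).obj { toEqMod := M.toEqMod, coherent := M.coherent } ≅ M :=
  have e : kerOp s { toEqMod := M.toEqMod, coherent := M.coherent } = M.op :=
    EqMod.groupOp_eq s _ (ker_act π ρ) _ (fun c => EqCohAlg.op_algebraMap _ M c)
      (fun n => hom_ext' fun U m => hM n U m (translate_of_eq_one (ker_act π ρ n) U).ge)
  @asIso _ _ _ _ (EqCohAlg.homOfOp (M := (toKerAlg hs).obj
      { toEqMod := M.toEqMod, coherent := M.coherent }) (N := M) _ (𝟙 M.mod)
      (fun x U m => by
        change Scheme.Modules.Hom.app ((kerObj hs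
          { toEqMod := M.toEqMod, coherent := M.coherent }).op x) U m = _
        rw [kerObj_op, e]; rfl) (fun h U m => rfl))
    (EqCohAlg.isIso_of_bijective _ fun U => Function.bijective_id)

end Ext

section Inflate
variable {R : Type u} [CommRing R] {G H : Type u} [Group G] [Group H] {π : G →* H}

/-- Inflation of an equivariant algebra along a homomorphism of groups. -/
def RAlg.infl (π : G →* H) (B : RAlg (1 : H →* RingAut R)) : RAlg (1 : G →* RingAut R) where
  carrier := B.carrier
  act := B.act.comp π
  act_smul g := B.act_smul (π g)

instance (B : RAlg (1 : H →* RingAut R)) [h : Module.Finite R B.carrier] :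
    Module.Finite R (B.infl π).carrier := h

instance (B : RAlg (1 : H →* RingAut R)) [h : Module.Projective R B.carrier] :
    Module.Projective R (B.infl π).carrier := h

variable {X : Scheme.{u}} {s : X ⟶ Spec (.of R)} {ρ : H →* Aut X} (hs : IsOver ρ s)
  (B : RAlg (1 : H →* RingAut R)) [Module.Finite R B.carrier] [Module.Projective R B.carrier]

/-- Inflation of an equivariant module along a homomorphism of groups. -/
def inflObj (M : EqCohAlg (pullEqAlg hs.isEquivariant B)) :
    EqCohAlg (pullEqAlg (hs.comp π).isEquivariant (B.infl π)) :=
  EqCohAlg.ofOp _ ((EqCoh.restrictGroup π).obj { toEqMod := M.toEqMod, coherent := M.coherent }).toEqMod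
    M.coherent M.op (EqCohAlg.op_algebraMap _ M) (fun g a U m => EqCohAlg.act_op _ (π g) a U m)

lemma inflObj_op (M : EqCohAlg (pullEqAlg hs.isEquivariant B)) :
    (inflObj (π := π) hs B M).op = M.op :=
  EqCohAlg.op_ofOp _ _ _ _ _ _

variable {B} (hπ : Function.Surjective π)
  (M : EqCohAlg (pullEqAlg (hs.comp π).isEquivariant (B.infl π)))
  (hM : ∀ (n : π.ker) (U : X.Opens) (m : Γ(M.mod, U)) (e : translate (ρ.comp π) n U ≤ U),
    M.act (n : G) U m = res M.mod e m)

/-- The action on sections of an inflated module. -/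
def descAct (h : H) (U : X.Opens) : Γ(M.mod, U) →+ Γ(M.mod, translate ρ h U) :=
  (res M.mod (by
    change _ ≤ translate ρ (π (Function.surjInv hπ h)) U
    rw [Function.surjInv_eq hπ])).comp (M.act (Function.surjInv hπ h) U)

lemma descAct_apply (hM : ∀ (n : π.ker) (U : X.Opens) (m : Γ(M.mod, U))
      (e : translate (ρ.comp π) n U ≤ U), M.act (n : G) U m = res M.mod e m)
    (g : G) (U : X.Opens) (m : Γ(M.mod, U)) : descAct hs hπ M (π g) U m = M.act g U m := by
  have h1 : π (Function.surjInv hπ (π g)) = π g := Function.surjInv_eq hπ _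
  obtain ⟨n, hn⟩ : ∃ n : π.ker, Function.surjInv hπ (π g) = g * n :=
    ⟨⟨g⁻¹ * Function.surjInv hπ (π g), by rw [MonoidHom.mem_ker, map_mul, h1, map_inv,
      inv_mul_cancel]⟩, by simp⟩
  have e0 : translate (ρ.comp π) (n : G) U = U := translate_of_eq_one (ker_act π ρ n) U
  change res M.mod _ (M.act _ U m) = _
  rw [M.act_congr hn U m (by rw [hn]), M.act_comp, hM n U m e0.le, M.act_res, res_res]
  have h2 : ∀ (W W' : X.Opens) (i : W ≤ translate (ρ.comp π) g U) (j : W' ≤ W)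
      (j' : translate (ρ.comp π) g U ≤ W'),
      res M.mod j' (res M.mod j (res M.mod i (M.act g U m))) = M.act g U m := fun W W' i j j' => by
    rw [res_res, res_res, res_self]
  exact h2 _ _ _ _ _

/-- An equivariant module on which the kernel acts trivially is an equivariant module for the
quotient group. -/
def descMod : EqMod ρ where
  mod := M.mod
  act := descAct hs hπ M
  act_osmul h U r m := by
    obtain ⟨g, rfl⟩ := hπ h
    rw [descAct_apply hs hπ M hM, descAct_apply hs hπ M hM]
    exact M.act_osmul g U r m
  act_res h U V i m := by
    obtain ⟨g, rfl⟩ := hπ h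
    rw [descAct_apply hs hπ M hM, descAct_apply hs hπ M hM]
    exact M.act_res g i m
  act_one U m := by
    have h1 := descAct_apply hs hπ M hM 1 U m
    have key : ∀ (a : H) (ha : a = 1) (e : translate ρ a U ≤ translate ρ 1 U),
      descAct hs hπ M a U m = res M.mod e (descAct hs hπ M 1 U m) := by
      rintro _ rfl e
      exact (res_self _ _ _).symm
    have h2 := (key (π 1) (map_one π) (by rw [map_one])).symm.trans (h1.trans (M.act_one U m))
    have h3 := congrArg (res M.mod (show translate ρ 1 U ≤ translate ρ (π 1) U by rw [map_one])) h2
    rw [res_res, res_self] at h3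
    exact h3.trans (res_res M.mod _ _ _)
  act_comp g' h' U m := by
    obtain ⟨g, rfl⟩ := hπ g'
    obtain ⟨h, rfl⟩ := hπ h'
    have h1 := descAct_apply hs hπ M hM (g * h) U m
    have key : ∀ (a : H) (ha : a = π g * π h) (e : translate ρ a U ≤ translate ρ (π g * π h) U),
      descAct hs hπ M a U m = res M.mod e (descAct hs hπ M (π g * π h) U m) := by
      rintro _ rfl e
      exact (res_self _ _ _).symm
    have h2 := (key (π (g * h)) (map_mul π g h) (by rw [map_mul])).symm.trans
      (h1.trans (M.act_comp g h U m))
    have h3 := congrArg (res M.mod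
      (show translate ρ (π g * π h) U ≤ translate ρ (π (g * h)) U by rw [map_mul])) h2
    rw [res_res, res_self] at h3
    rw [descAct_apply hs hπ M hM, descAct_apply hs hπ M hM]
    exact h3.trans (res_res M.mod _ _ _)

/-- The action of an algebra on a module over its inflation. -/
def inflOp (M : EqCohAlg (pullEqAlg (hs.comp π).isEquivariant (B.infl π))) :
    B.carrier →+* End M.mod := M.op

lemma inflOp_algebraMap (r : R) : inflOp hs M (algebraMap R B.carrier r) = zmul s M.mod r :=
  EqCohAlg.op_algebraMap _ M r

lemma act_inflOp (g : G) (a : B.carrier) (U : X.Opens) (m : Γ(M.mod, U)) :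
    M.act g U (Scheme.Modules.Hom.app (inflOp hs M a) U m) =
      Scheme.Modules.Hom.app (inflOp hs M (B.act (π g) a)) (translate (ρ.comp π) g U)
        (M.act g U m) :=
  EqCohAlg.act_op (A := B.infl π) (hs.comp π).isEquivariant (M := M) g a U m

lemma descAct_inflOp (hM : ∀ (n : π.ker) (U : X.Opens) (m : Γ(M.mod, U))
      (e : translate (ρ.comp π) n U ≤ U), M.act (n : G) U m = res M.mod e m)
    (h : H) (a : B.carrier) (U : X.Opens) (m : Γ(M.mod, U)) :
    descAct hs hπ M h U (Scheme.Modules.Hom.app (inflOp hs M a) U m) =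
      Scheme.Modules.Hom.app (inflOp hs M (B.act h a)) _ (descAct hs hπ M h U m) := by
  obtain ⟨g, rfl⟩ := hπ h
  rw [descAct_apply hs hπ M hM, descAct_apply hs hπ M hM]
  exact act_inflOp hs M g a U m

/-- An equivariant module on which the kernel acts trivially is an equivariant module for the
quotient group. -/
def descObj : EqCohAlg (pullEqAlg hs.isEquivariant B) :=
  EqCohAlg.ofOp hs.isEquivariant (descMod hs hπ M hM) M.coherent (inflOp hs M)
    (inflOp_algebraMap hs M) (descAct_inflOp hs hπ M hM)

lemma descObj_op : (descObj hs hπ M hM).op = inflOp hs M :=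
  EqCohAlg.op_ofOp hs.isEquivariant _ _ _ _ _

lemma descObj_act (g : G) (U : X.Opens) (m : Γ(M.mod, U)) :
    (descObj hs hπ M hM).act (π g) U m = M.act g U m :=
  descAct_apply hs hπ M hM g U m

end Inflate
end EquivSheaf

end

noncomputable section
namespace EquivSheaf

section Generator

/-- A module over a semisimple ring having every simple quotient of the ring as a direct summand
is a generator. -/
lemma exists_sum_eq_one {R M : Type*} [Ring R] [IsSemisimpleRing R] [AddCommGroup M] [Module R M]
    (h : ∀ m : Ideal R, m.IsMaximal →
      ∃ (i : (R ⧸ m) →ₗ[R] M) (p : M →ₗ[R] (R ⧸ m)), ∀ x, p (i x) = x) :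
    ∃ (n : ℕ) (p : Fin n → M →ₗ[R] R) (v : Fin n → M), ∑ j, p j (v j) = 1 := by
  let T : Ideal R := Submodule.span R {r | ∃ (p : M →ₗ[R] R) (v : M), p v = r}
  have hT : T = ⊤ := by
    by_contra hT
    obtain ⟨m, hm, hTm⟩ := Ideal.exists_le_maximal T hT
    obtain ⟨i, p, hip⟩ := h m hm
    have : Module.Projective R (R ⧸ m) := Module.projective_of_isSemisimpleRing _ _
    obtain ⟨j, hj⟩ := Module.projective_lifting_property m.mkQ LinearMap.id m.mkQ_surjective
    have h1 : j (m.mkQ 1) ∈ m := hTm (Submodule.subset_span ⟨j ∘ₗ p, i (m.mkQ 1), by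
      rw [LinearMap.comp_apply, hip]⟩)
    have h2 : m.mkQ 1 = 0 := by
      rw [← LinearMap.id_apply (R := R) (m.mkQ 1), ← hj]
      exact (Submodule.Quotient.mk_eq_zero m).mpr h1
    exact hm.ne_top ((Ideal.eq_top_iff_one m).mpr ((Submodule.Quotient.mk_eq_zero m).mp h2))
  have h1 : (1 : R) ∈ T := hT ▸ Submodule.mem_top
  obtain ⟨n, c, g, hg⟩ := Submodule.mem_span_set'.mp h1
  choose p v hpv using fun j => (g j).2
  refine ⟨n, p, fun j => c j • v j, ?_⟩
  rw [← hg]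
  exact Finset.sum_congr rfl fun j _ => by rw [map_smul, hpv]

/-- A finitely generated projective module has a finite dual basis. -/
lemma exists_dual_basis (R M : Type*) [Ring R] [AddCommGroup M] [Module R M] [Module.Finite R M]
    [Module.Projective R M] :
    ∃ (n : ℕ) (p : Fin n → M →ₗ[R] R) (v : Fin n → M), ∀ x, ∑ j, p j x • v j = x := by
  obtain ⟨n, p, hp⟩ := Module.Finite.exists_fin' R M
  obtain ⟨j, hj⟩ := Module.projective_lifting_property p LinearMap.id hp
  refine ⟨n, fun c => LinearMap.proj c ∘ₗ j, fun c => p (Pi.single c 1), fun a => ?_⟩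
  have h1 : p (j a) = a := LinearMap.congr_fun hj a
  conv_rhs => rw [← h1, pi_eq_sum_univ' (j a), map_sum]
  simp only [LinearMap.comp_apply, LinearMap.proj_apply, map_smul]

end Generator

section Rep
variable {k : Type u} [Field k] {G H : Type u} [Group G] [Group H] {π : G →* H}
  {V : Type u} [AddCommGroup V] [Module k V] (σ : Representation k G V)

/-- The action of a group element on a representation, semilinear over the group algebra of the
kernel. -/
def repAct (π : G →* H) (σ : Representation k G V) : G →* AddMonoid.End (resN π σ).asModule where
  toFun g := (σ g).toAddMonoidHom
  map_one' := by rw [map_one]; rfl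
  map_mul' g h := by rw [map_mul]; rfl

lemma repAct_smul (g : G) (x : MonoidAlgebra k π.ker) (v : (resN π σ).asModule) :
    repAct π σ g (x • v) = conjAlg k π g x • repAct π σ g v := by
  have h := LinearMap.congr_fun (asAlgebraHom_conj σ g x) (σ g (show V from v))
  have h2 : σ g⁻¹ (σ g (show V from v)) = v :=
    LinearMap.congr_fun (rep_inv_mul σ g) (show V from v)
  refine Eq.trans ?_ h.symm
  change _ = σ g ((resN π σ).asAlgebraHom x (σ g⁻¹ (σ g (show V from v))))
  rw [h2]; rfl

lemma repAct_inv_apply (g : G) (v : (resN π σ).asModule) :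
    repAct π σ g (repAct π σ g⁻¹ v) = v :=
  LinearMap.congr_fun (rep_mul_inv σ g) (show V from v)

lemma repAct_ker (n : π.ker) (v : (resN π σ).asModule) :
    repAct π σ n v = MonoidAlgebra.single n (1 : k) • v := by
  refine Eq.trans ?_ (Representation.single_smul (resN π σ) 1 n v).symm
  rw [one_smul]; rfl

lemma asAlgebraHom_comm (φ : EndN π σ) (x : MonoidAlgebra k π.ker) :
    (resN π σ).asAlgebraHom x * (φ : Module.End k V) = φ * (resN π σ).asAlgebraHom x := by
  induction x using MonoidAlgebra.induction_linear with
  | zero => simp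
  | add x y hx hy => rw [map_add, add_mul, mul_add, hx, hy]
  | single n c =>
    rw [Representation.asAlgebraHom_single, smul_mul_assoc, mul_smul_comm]
    exact congrArg (c • ·) (Subalgebra.mem_centralizer_iff k |>.mp φ.2 _ ⟨n, rfl⟩)

/-- Endomorphisms commuting with the kernel are the endomorphisms over its group algebra. -/
def endNEquiv : EndN π σ ≃+* Module.End (MonoidAlgebra k π.ker) (resN π σ).asModule where
  toFun φ :=
    { toFun := fun v => (φ : Module.End k V) v
      map_add' := fun v w => map_add (φ : Module.End k V) v w
      map_smul' := fun x v => (LinearMap.congr_fun (asAlgebraHom_comm σ φ x) (show V from v)).symm }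
  invFun f := ⟨(f.restrictScalars k : (resN π σ).asModule →ₗ[k] (resN π σ).asModule), by
    refine (Subalgebra.mem_centralizer_iff k).mpr ?_
    rintro _ ⟨n, rfl⟩
    refine LinearMap.ext fun v => ?_
    have h1 := f.map_smul (MonoidAlgebra.single n (1 : k)) (show (resN π σ).asModule from v)
    rw [← repAct_ker, ← repAct_ker] at h1
    exact h1.symm⟩
  left_inv _ := rfl
  right_inv _ := rfl
  map_mul' _ _ := rfl
  map_add' _ _ := rfl

variable {σ}

/-- The generator property in terms of modules over the group algebra of the kernel. -/
lemma IsNGenerator.exists_sum_eq_one [Finite G] [CharZero k] (h : IsNGenerator π σ) :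
    ∃ (n : ℕ) (p : Fin n → (resN π σ).asModule →ₗ[MonoidAlgebra k π.ker] MonoidAlgebra k π.ker)
      (v : Fin n → (resN π σ).asModule), ∑ j, p j (v j) = 1 := by
  have : NeZero (Nat.card π.ker : k) := ⟨by exact_mod_cast Nat.card_pos.ne'⟩
  refine EquivSheaf.exists_sum_eq_one fun m hm => ?_
  have hS : IsSimpleModule (MonoidAlgebra k π.ker) (MonoidAlgebra k π.ker ⧸ m) :=
    isSimpleModule_iff_isCoatom.mpr (Ideal.isMaximal_def.mp hm)
  let ω : Representation k π.ker (MonoidAlgebra k π.ker ⧸ m) := Representation.ofModule' _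
  have hω : ∀ (r : MonoidAlgebra k π.ker) (x : MonoidAlgebra k π.ker ⧸ m),
      ω.asAlgebraHom r x = r • x := fun r x => LinearMap.congr_fun (AlgHom.congr_fun
    ((MonoidAlgebra.lift k (Module.End k (MonoidAlgebra k π.ker ⧸ m)) π.ker).apply_symm_apply
      (Algebra.lsmul k k (MonoidAlgebra k π.ker ⧸ m))) r) x
  let e : ω.asModule ≃ₗ[MonoidAlgebra k π.ker] (MonoidAlgebra k π.ker ⧸ m) :=
    { ω.asModuleEquiv.toAddEquiv with
      map_smul' := fun r x => hω r x }
  obtain ⟨i, p, hip⟩ := h _ ω ((Representation.irreducible_iff_isSimpleModule_asModule ω).mpr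
    (IsSimpleModule.congr e))
  refine ⟨(Representation.IntertwiningMap.equivLinearMapAsModule ω (resN π σ) i) ∘ₗ e.symm.toLinearMap,
    e.toLinearMap ∘ₗ Representation.IntertwiningMap.equivLinearMapAsModule (resN π σ) ω p,
    fun x => ?_⟩
  refine Eq.trans ?_ (e.apply_symm_apply x)
  exact congrArg e (hip _)

end Rep
end EquivSheaf

end

noncomputable section
namespace EquivSheaf

section KerCtx
variable {k : Type u} [Field k] {G H : Type u} [Group G] [Group H] {π : G →* H}
  (hπ : Function.Surjective π)
  {V : Type u} [AddCommGroup V] [Module k V] (σ : Representation k G V)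

/-- The dual of a representation over the group algebra of the kernel. -/
def KerDual (π : G →* H) (σ : Representation k G V) : Type u :=
  (resN π σ).asModule →ₗ[MonoidAlgebra k π.ker] MonoidAlgebra k π.ker

instance : AddCommGroup (KerDual π σ) :=
  inferInstanceAs (AddCommGroup ((resN π σ).asModule →ₗ[MonoidAlgebra k π.ker] MonoidAlgebra k π.ker))

/-- The endomorphism over the group algebra of the kernel defined by an element of the opposite
of the endomorphism algebra. -/
def endLin (a : ((endAlg hπ σ).infl π).carrier) :
    Module.End (MonoidAlgebra k π.ker) (resN π σ).asModule :=
  endNEquiv σ (MulOpposite.unop (show (EndN π σ)ᵐᵒᵖ from a))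

lemma endLin_one : endLin hπ σ 1 = 1 := map_one (endNEquiv σ)

lemma endLin_mul (a b : ((endAlg hπ σ).infl π).carrier) :
    endLin hπ σ (a * b) = endLin hπ σ b * endLin hπ σ a := map_mul (endNEquiv σ) _ _

lemma endLin_add (a b : ((endAlg hπ σ).infl π).carrier) :
    endLin hπ σ (a + b) = endLin hπ σ a + endLin hπ σ b := map_add (endNEquiv σ) _ _

lemma endLin_algebraMap (c : k) (v : (resN π σ).asModule) :
    endLin hπ σ (algebraMap k _ c) v = algebraMap k (MonoidAlgebra k π.ker) c • v := by
  refine Eq.trans ?_ (Representation.single_smul (resN π σ) c 1 v).symm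
  rw [map_one]; rfl

lemma endLin_injective : Function.Injective (endLin hπ σ) := fun _ _ h =>
  MulOpposite.unop_injective ((endNEquiv σ).injective h)

/-- The element of the opposite of the endomorphism algebra defined by an endomorphism over the
group algebra of the kernel. -/
def linEnd (f : Module.End (MonoidAlgebra k π.ker) (resN π σ).asModule) :
    ((endAlg hπ σ).infl π).carrier :=
  MulOpposite.op ((endNEquiv σ).symm f)

lemma endLin_linEnd (f : Module.End (MonoidAlgebra k π.ker) (resN π σ).asModule) :
    endLin hπ σ (linEnd hπ σ f) = f := (endNEquiv σ).apply_symm_apply f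

lemma endLin_act (g : G) (a : ((endAlg hπ σ).infl π).carrier) (v : (resN π σ).asModule) :
    endLin hπ σ (((endAlg hπ σ).infl π).act g a) v =
      repAct π σ g (endLin hπ σ a (repAct π σ g⁻¹ v)) := by
  change endNEquiv σ (MulOpposite.unop (endAct hπ σ (π g) a)) v = _
  rw [endAct_apply]; rfl

instance : Module ((endAlg hπ σ).infl π).carrier (KerDual π σ) where
  smul a p := LinearMap.comp p (endLin hπ σ a)
  one_smul p := by
    change LinearMap.comp p (endLin hπ σ 1) = p
    rw [endLin_one]; rfl
  mul_smul a b p := by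
    change LinearMap.comp p (endLin hπ σ (a * b)) = _
    rw [endLin_mul]; rfl
  smul_zero a := LinearMap.zero_comp _
  smul_add a p q := LinearMap.add_comp _ _ _
  add_smul a b p := by
    change LinearMap.comp p (endLin hπ σ (a + b)) = _
    rw [endLin_add]; exact LinearMap.comp_add _ _ _
  zero_smul p := by
    change LinearMap.comp p (endNEquiv σ (MulOpposite.unop (0 : (EndN π σ)ᵐᵒᵖ))) = _
    rw [MulOpposite.unop_zero, map_zero]; exact LinearMap.comp_zero _

/-- Evaluation of a linear form. -/
def KerDual.eval (p : KerDual π σ) : (resN π σ).asModule →ₗ[MonoidAlgebra k π.ker]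
    MonoidAlgebra k π.ker := p

variable {σ} in
lemma KerDual.ext {p q : KerDual π σ} (h : ∀ v, p.eval σ v = q.eval σ v) : p = q :=
  LinearMap.ext h

lemma KerDual.smul_eval (a : ((endAlg hπ σ).infl π).carrier) (p : KerDual π σ) (v) :
    (a • p).eval σ v = p.eval σ (endLin hπ σ a v) := rfl

/-- The conjugation action on linear forms. -/
def KerDual.act : G →* AddMonoid.End (KerDual π σ) where
  toFun g :=
    { toFun := fun p =>
        { toFun := fun v => conjAlg k π g (p.eval σ (repAct π σ g⁻¹ v))
          map_add' := fun v w => by rw [map_add, map_add, map_add]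
          map_smul' := fun x v => by
            rw [repAct_smul, map_smul, smul_eq_mul, map_mul, ← AlgEquiv.mul_apply, ← map_mul,
              mul_inv_cancel, map_one]; rfl }
      map_zero' := KerDual.ext fun v => map_zero (conjAlg k π g)
      map_add' := fun p q => KerDual.ext fun v => map_add (conjAlg k π g) _ _ }
  map_one' := AddMonoidHom.ext fun p => KerDual.ext fun v => by
    change conjAlg k π 1 (p.eval σ (repAct π σ 1⁻¹ v)) = _
    rw [inv_one, map_one, map_one]; rfl
  map_mul' g h := AddMonoidHom.ext fun p => KerDual.ext fun v => by
    change conjAlg k π (g * h) (p.eval σ (repAct π σ (g * h)⁻¹ v)) =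
      conjAlg k π g (conjAlg k π h (p.eval σ (repAct π σ h⁻¹ (repAct π σ g⁻¹ v))))
    rw [mul_inv_rev, map_mul, map_mul]; rfl

lemma KerDual.act_eval (g : G) (p : KerDual π σ) (v) :
    (KerDual.act σ g p).eval σ v = conjAlg k π g (p.eval σ (repAct π σ g⁻¹ v)) := rfl

/-- Right multiplication of a linear form. -/
def KerDual.rmul : KerDual π σ →+ MonoidAlgebra k π.ker →+ KerDual π σ :=
  AddMonoidHom.mk' (fun p => AddMonoidHom.mk' (fun x =>
      (LinearMap.toSpanSingleton (MonoidAlgebra k π.ker) (MonoidAlgebra k π.ker) x).comp (p.eval σ))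
      (fun _ _ => KerDual.ext fun _ => mul_add _ _ _))
    (fun _ _ => AddMonoidHom.ext fun _ => KerDual.ext fun _ => add_mul _ _ _)

lemma KerDual.rmul_eval (p : KerDual π σ) (x : MonoidAlgebra k π.ker) (v) :
    (KerDual.rmul σ p x).eval σ v = p.eval σ v * x := rfl

/-- The rank one endomorphism defined by a linear form and a vector. -/
def KerDual.pair : KerDual π σ →+ (resN π σ).asModule →+ ((endAlg hπ σ).infl π).carrier :=
  AddMonoidHom.mk' (fun p => AddMonoidHom.mk' (fun v => linEnd hπ σ ((p.eval σ).smulRight v))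
      (fun v w => endLin_injective hπ σ (LinearMap.ext fun x => by
        rw [endLin_add, endLin_linEnd, LinearMap.add_apply, endLin_linEnd, endLin_linEnd]
        exact smul_add _ _ _)))
    (fun p q => AddMonoidHom.ext fun v => endLin_injective hπ σ (LinearMap.ext fun x => by
      rw [AddMonoidHom.add_apply, endLin_add]
      change endLin hπ σ (linEnd hπ σ _) x = (endLin hπ σ (linEnd hπ σ _) +
        endLin hπ σ (linEnd hπ σ _)) x
      rw [endLin_linEnd, LinearMap.add_apply, endLin_linEnd, endLin_linEnd]
      exact add_smul _ _ _))

lemma KerDual.endLin_pair (p : KerDual π σ) (v w : (resN π σ).asModule) :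
    endLin hπ σ (KerDual.pair hπ σ p v) w = p.eval σ w • v := by
  change endLin hπ σ (linEnd hπ σ _) w = _
  rw [endLin_linEnd]; rfl

lemma endLin_sum {n : ℕ} (a : Fin n → ((endAlg hπ σ).infl π).carrier) (v) :
    endLin hπ σ (∑ i, a i) v = ∑ i, endLin hπ σ (a i) v := by
  let φ : ((endAlg hπ σ).infl π).carrier →+ (resN π σ).asModule :=
    AddMonoidHom.mk' (fun a => endLin hπ σ a v) (fun a b => by rw [endLin_add]; rfl)
  exact map_sum φ _ _

instance : Module (kerAlg k π).carrier (resN π σ).asModule :=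
  (inferInstance : Module (MonoidAlgebra k π.ker) (resN π σ).asModule)

variable [Finite G] [CharZero k] [FiniteDimensional k V] (hσ : IsNGenerator π σ)

/-- The Morita context between the group algebra of the kernel and the opposite of the
endomorphism algebra of a generator. -/
def kerCtx : MoritaCtx ((endAlg hπ σ).infl π) (kerAlg k π) where
  P := KerDual π σ
  Q := (resN π σ).asModule
  pr := KerDual.rmul σ
  qr := AddMonoidHom.mk' (fun v => AddMonoidHom.mk' (fun a => endLin hπ σ a v)
      (fun a b => by rw [endLin_add]; rfl))
    (fun v w => AddMonoidHom.ext fun a => map_add (endLin hπ σ a) v w)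
  pr_one p := KerDual.ext fun v => mul_one _
  qr_one v := by
    change endLin hπ σ 1 v = v
    rw [endLin_one]; rfl
  pr_mul p a b := KerDual.ext fun v => (mul_assoc _ _ _).symm
  qr_mul v a b := by
    change endLin hπ σ (a * b) v = _
    rw [endLin_mul]; rfl
  pr_smul a p b := rfl
  qr_smul x v b := map_smul (endLin hπ σ b) x v
  pr_base p c := KerDual.ext fun v => by
    refine (KerDual.rmul_eval σ p _ v).trans ?_
    rw [KerDual.smul_eval, endLin_algebraMap, map_smul]
    exact (Algebra.commutes c (p.eval σ v)).symm
  qr_base v c := endLin_algebraMap hπ σ c v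
  pq := KerDual.pair hπ σ
  qp := AddMonoidHom.mk' (fun v => AddMonoidHom.mk' (fun p => p.eval σ v) (fun p q => rfl))
    (fun v w => AddMonoidHom.ext fun p => map_add (p.eval σ) v w)
  pq_smul a p v := endLin_injective hπ σ (LinearMap.ext fun w => by
    rw [endLin_mul, Module.End.mul_apply, KerDual.endLin_pair, KerDual.endLin_pair]; rfl)
  qp_smul x v p := map_smul (p.eval σ) (show MonoidAlgebra k π.ker from x) v
  pq_qr p v a := endLin_injective hπ σ (LinearMap.ext fun w => by
    rw [endLin_mul, KerDual.endLin_pair]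
    refine Eq.trans ?_ (congrArg (endLin hπ σ a) (KerDual.endLin_pair hπ σ p v w)).symm
    exact (map_smul (endLin hπ σ a) _ v).symm)
  qp_pr v p x := rfl
  pq_bal p x v := endLin_injective hπ σ (LinearMap.ext fun w => by
    rw [KerDual.endLin_pair, KerDual.endLin_pair]
    exact SemigroupAction.mul_smul _ _ _)
  qp_bal v a p := rfl
  pq_assoc p v q := KerDual.ext fun w => by
    rw [KerDual.smul_eval, KerDual.endLin_pair, map_smul]; rfl
  qp_assoc v p w := (KerDual.endLin_pair hπ σ p w v).symm
  exists_pq := by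
    have : NeZero (Nat.card π.ker : k) := ⟨by exact_mod_cast Nat.card_pos.ne'⟩
    have : Module.Finite k (resN π σ).asModule := inferInstance
    have : Module.Finite (MonoidAlgebra k π.ker) (resN π σ).asModule :=
      Module.Finite.of_restrictScalars_finite k _ _
    have : Module.Projective (MonoidAlgebra k π.ker) (resN π σ).asModule :=
      Module.projective_of_isSemisimpleRing _ _
    obtain ⟨n, p, v, h⟩ := exists_dual_basis (MonoidAlgebra k π.ker) (resN π σ).asModule
    refine ⟨n, p, v, endLin_injective hπ σ (LinearMap.ext fun w => ?_)⟩
    rw [endLin_sum, endLin_one]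
    refine Eq.trans (Finset.sum_congr rfl fun i _ => ?_) (h w)
    exact KerDual.endLin_pair hπ σ (p i) (v i) w
  exists_qp := by
    obtain ⟨n, p, v, h⟩ := hσ.exists_sum_eq_one
    exact ⟨n, v, p, h⟩
  actP := KerDual.act σ
  actQ := repAct π σ
  actP_smul g a p := KerDual.ext fun v => by
    rw [KerDual.act_eval, KerDual.smul_eval, KerDual.smul_eval, KerDual.act_eval, endLin_act]
    congr 2
    exact (LinearMap.congr_fun (rep_inv_mul σ g) _).symm
  actQ_smul g x v := repAct_smul σ g x v
  actP_pr g p x := KerDual.ext fun v => map_mul (conjAlg k π g) _ _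
  actQ_qr g v a := by
    refine Eq.trans ?_ (endLin_act hπ σ g a _).symm
    refine congrArg (fun w => repAct π σ g (endLin hπ σ a w)) ?_
    exact (LinearMap.congr_fun (rep_inv_mul σ g) v).symm
  act_pq g p v := endLin_injective hπ σ (LinearMap.ext fun w => by
    rw [endLin_act, KerDual.endLin_pair, KerDual.endLin_pair, repAct_smul, KerDual.act_eval])
  act_qp g v p := by
    refine Eq.trans ?_ (KerDual.act_eval σ g p _).symm
    refine congrArg (fun w => conjAlg k π g (p.eval σ w)) ?_
    exact (LinearMap.congr_fun (rep_inv_mul σ g) v).symm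

end KerCtx
end EquivSheaf

end

noncomputable section
namespace EquivSheaf

section DescHom
variable {R : Type u} [CommRing R] {G H : Type u} [Group G] [Group H] {π : G →* H}
  {X : Scheme.{u}} {s : X ⟶ Spec (.of R)} {ρ : H →* Aut X} (hs : IsOver ρ s)
  {B : RAlg (1 : H →* RingAut R)} [Module.Finite R B.carrier] [Module.Projective R B.carrier]
  (hπ : Function.Surjective π)
  {M M' : EqCohAlg (pullEqAlg (hs.comp π).isEquivariant (B.infl π))}
  (hM : ∀ (n : π.ker) (U : X.Opens) (m : Γ(M.mod, U)) (e : translate (ρ.comp π) n U ≤ U),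
    M.act (n : G) U m = res M.mod e m)
  (hM' : ∀ (n : π.ker) (U : X.Opens) (m : Γ(M'.mod, U)) (e : translate (ρ.comp π) n U ≤ U),
    M'.act (n : G) U m = res M'.mod e m)

lemma hom_inflOp (φ : M ⟶ M') (a : B.carrier) (U : X.Opens) (m : Γ(M.mod, U)) :
    φ.hom.app U (Scheme.Modules.Hom.app (inflOp hs M a) U m) =
      Scheme.Modules.Hom.app (inflOp hs M' a) U (φ.hom.app U m) :=
  EqCohAlg.hom_op (A := B.infl π) (hs.comp π).isEquivariant φ a U m

lemma hom_descAct (hM : ∀ (n : π.ker) (U : X.Opens) (m : Γ(M.mod, U))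
      (e : translate (ρ.comp π) n U ≤ U), M.act (n : G) U m = res M.mod e m)
    (hM' : ∀ (n : π.ker) (U : X.Opens) (m : Γ(M'.mod, U))
      (e : translate (ρ.comp π) n U ≤ U), M'.act (n : G) U m = res M'.mod e m)
    (φ : M.mod ⟶ M'.mod) (hφ : ∀ (g : G) (U : X.Opens) (m : Γ(M.mod, U)),
      φ.app (translate (ρ.comp π) g U) (M.act g U m) = M'.act g U (φ.app U m))
    (h : H) (U : X.Opens) (m : Γ(M.mod, U)) :
    φ.app (translate ρ h U) (descAct hs hπ M h U m) = descAct hs hπ M' h U (φ.app U m) := by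
  obtain ⟨g, rfl⟩ := hπ h
  rw [descAct_apply hs hπ M hM, descAct_apply hs hπ M' hM']
  exact hφ g U m

lemma hom_of_descAct (hM : ∀ (n : π.ker) (U : X.Opens) (m : Γ(M.mod, U))
      (e : translate (ρ.comp π) n U ≤ U), M.act (n : G) U m = res M.mod e m)
    (hM' : ∀ (n : π.ker) (U : X.Opens) (m : Γ(M'.mod, U))
      (e : translate (ρ.comp π) n U ≤ U), M'.act (n : G) U m = res M'.mod e m)
    (φ : M.mod ⟶ M'.mod) (hφ : ∀ (h : H) (U : X.Opens) (m : Γ(M.mod, U)),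
      φ.app (translate ρ h U) (descAct hs hπ M h U m) = descAct hs hπ M' h U (φ.app U m))
    (g : G) (U : X.Opens) (m : Γ(M.mod, U)) :
    φ.app (translate (ρ.comp π) g U) (M.act g U m) = M'.act g U (φ.app U m) := by
  have h1 := hφ (π g) U m
  rw [descAct_apply hs hπ M hM, descAct_apply hs hπ M' hM'] at h1
  exact h1

lemma hom_descAct_infl (hM : ∀ (n : π.ker) (U : X.Opens) (m : Γ(M.mod, U))
      (e : translate (ρ.comp π) n U ≤ U), M.act (n : G) U m = res M.mod e m)
    (M₀ : EqMod ρ) (φ : M.mod ⟶ M₀.mod) (hφ : ∀ (g : G) (U : X.Opens) (m : Γ(M.mod, U)),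
      φ.app (translate (ρ.comp π) g U) (M.act g U m) = M₀.act (π g) U (φ.app U m))
    (h : H) (U : X.Opens) (m : Γ(M.mod, U)) :
    φ.app (translate ρ h U) (descAct hs hπ M h U m) = M₀.act h U (φ.app U m) := by
  obtain ⟨g, rfl⟩ := hπ h
  rw [descAct_apply hs hπ M hM]
  exact hφ g U m

/-- Descent of morphisms to the quotient group. -/
def descHom (φ : M ⟶ M') : descObj hs hπ M hM ⟶ descObj hs hπ M' hM' :=
  EqCohAlg.homOfOp (M := descObj hs hπ M hM) (N := descObj hs hπ M' hM') hs.isEquivariant φ.hom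
    (fun a U m => ((congrArg (fun o : B.carrier →+* End M.mod =>
        φ.hom.app U (Scheme.Modules.Hom.app (o a) U m)) (descObj_op hs hπ M hM)).trans
      (hom_inflOp hs φ a U m)).trans (congrArg (fun o : B.carrier →+* End M'.mod =>
        Scheme.Modules.Hom.app (o a) U (φ.hom.app U m)) (descObj_op hs hπ M' hM')).symm)
    (hom_descAct hs hπ hM hM' φ.hom φ.map_act)

lemma descHom_op (φ : descObj hs hπ M hM ⟶ descObj hs hπ M' hM') (a : B.carrier) (U : X.Opens)
    (m : Γ(M.mod, U)) : (show M.mod ⟶ M'.mod from φ.hom).app U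
      (Scheme.Modules.Hom.app (inflOp hs M a) U m) = Scheme.Modules.Hom.app (inflOp hs M' a) U
        ((show M.mod ⟶ M'.mod from φ.hom).app U m) := by
  have h1 := EqCohAlg.hom_op (A := B) hs.isEquivariant φ a U m
  rw [descObj_op, descObj_op] at h1
  exact h1

/-- Descent of morphisms to the quotient group is full. -/
def ofDescHom (φ : descObj hs hπ M hM ⟶ descObj hs hπ M' hM') : M ⟶ M' :=
  EqCohAlg.homOfOp (M := M) (N := M') (hs.comp π).isEquivariant
    (show M.mod ⟶ M'.mod from φ.hom) (descHom_op hs hπ hM hM' φ)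
    (hom_of_descAct hs hπ hM hM' (show M.mod ⟶ M'.mod from φ.hom) φ.map_act)

lemma descHom_injective {φ φ' : M ⟶ M'}
    (h : descHom hs hπ hM hM' φ = descHom hs hπ hM hM' φ') : φ = φ' :=
  EqCohAlg.Hom.ext (congrArg (fun ψ : descObj hs hπ M hM ⟶ descObj hs hπ M' hM' =>
    (show M.mod ⟶ M'.mod from ψ.hom)) h)

lemma descHom_ofDescHom (φ : descObj hs hπ M hM ⟶ descObj hs hπ M' hM') :
    descHom hs hπ hM hM' (ofDescHom hs hπ hM hM' φ) = φ := rfl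

lemma hom_inflObj_act (M₀ : EqCohAlg (pullEqAlg hs.isEquivariant B))
    (φ : M ⟶ inflObj hs B M₀) (g : G) (U : X.Opens) (m : Γ(M.mod, U)) :
    (show M.mod ⟶ M₀.mod from φ.hom).app (translate (ρ.comp π) g U) (M.act g U m) =
      M₀.act (π g) U ((show M.mod ⟶ M₀.mod from φ.hom).app U m) :=
  φ.map_act g U m

/-- Descent of an isomorphism to an inflated module. -/
def descIso {M₀ : EqCohAlg (pullEqAlg hs.isEquivariant B)} (e : M ≅ inflObj hs B M₀) :
    descObj hs hπ M hM ≅ M₀ :=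
  @asIso _ _ _ _
    (EqCohAlg.homOfOp (M := descObj hs hπ M hM) (N := M₀) hs.isEquivariant e.hom.hom
      (by
        have h1 := EqCohAlg.hom_op (A := B.infl π) (hs.comp π).isEquivariant e.hom
        rw [inflObj_op] at h1
        exact fun a U m => (congrArg (fun o : B.carrier →+* End M.mod =>
          (show M.mod ⟶ M₀.mod from e.hom.hom).app U (Scheme.Modules.Hom.app (o a) U m))
            (descObj_op hs hπ M hM)).trans (h1 a U m))
      (hom_descAct_infl hs hπ hM M₀.toEqMod (show M.mod ⟶ M₀.mod from e.hom.hom)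
        (hom_inflObj_act hs M₀ e.hom)))
    (EqCohAlg.isIso_of_bijective _ fun U => by
      refine Function.bijective_iff_has_inverse.mpr ⟨e.inv.hom.app U, fun m => ?_, fun m => ?_⟩
      · exact ConcreteCategory.congr_hom (congrArg (fun g => Scheme.Modules.Hom.app g U)
          (congrArg EqCohAlg.Hom.hom e.hom_inv_id)) m
      · exact ConcreteCategory.congr_hom (congrArg (fun g => Scheme.Modules.Hom.app g U)
          (congrArg EqCohAlg.Hom.hom e.inv_hom_id)) m)

lemma inflObj_act (M₀ : EqCohAlg (pullEqAlg hs.isEquivariant B)) (n : π.ker) (U : X.Opens)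
    (m : Γ((inflObj (π := π) hs B M₀).mod, U)) (e : translate (ρ.comp π) n U ≤ U) :
    (inflObj hs B M₀).act (n : G) U m = res (inflObj (π := π) hs B M₀).mod e m := by
  have key : ∀ (a : H) (ha : a = 1) (e : translate ρ a U ≤ U),
      M₀.act a U m = res M₀.mod e m := by
    rintro _ rfl e
    exact M₀.act_one U m
  exact key (π n) n.2 e

end DescHom

section Psi
variable {k : Type u} [Field k] {G H : Type u} [Group G] [Group H] {π : G →* H}
  (hπ : Function.Surjective π)
  {V : Type u} [AddCommGroup V] [Module k V] (σ : Representation k G V)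
  [Finite G] [CharZero k] [FiniteDimensional k V] (hσ : IsNGenerator π σ)
  {X : Scheme.{u}} {s : X ⟶ Spec (.of k)} {ρ : H →* Aut X} (hs : IsOver ρ s)

lemma act_kerObj (F : CohG π ρ) (n : π.ker) (U : X.Opens) (m : Γ(F.mod, U))
    (e : translate (ρ.comp π) n U ≤ U) :
    (kerObj hs F).act (n : G) U m =
      res F.mod e (Scheme.Modules.Hom.app ((kerObj hs F).op (MonoidAlgebra.single n (1 : k))) U m) := by
  rw [kerObj_op]
  have h1 := act_eq_trivOp (ker_act π ρ) ((forgetGN π ρ).obj F).toEqMod n U m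
  rw [← EqMod.groupOp_single_one s] at h1
  exact h1

lemma kerHom_act (M : EqCohAlg (pullEqAlg (hs.comp π).isEquivariant (kerAlg k π)))
    (hM : ∀ (n : π.ker) (U : X.Opens) (m : Γ(M.mod, U)) (e : translate (ρ.comp π) n U ≤ U),
      M.act (n : G) U m =
        res M.mod e (Scheme.Modules.Hom.app (M.op (MonoidAlgebra.single n (1 : k))) U m))
    (n : π.ker) (U : X.Opens)
    (m : Γ(homSheaf (kerCtx hπ σ hσ).Q M.mod M.op, U)) (e : translate (ρ.comp π) n U ≤ U) :
    ((kerCtx hπ σ hσ).eqObj (hs.comp π).isEquivariant M).act (n : G) U m =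
      res (homSheaf (kerCtx hπ σ hσ).Q M.mod M.op) e m :=
  homSheaf_sec_ext fun q => by
    rw [hom_res]
    refine ((kerCtx hπ σ hσ).eqObj_act (hs.comp π).isEquivariant M n U m q).trans ?_
    refine (hM n U _ e).trans (congrArg (res M.mod e) ?_)
    have h1 : (kerCtx hπ σ hσ).actQ (n : G)⁻¹ q =
        (show (kerAlg k π).carrier from MonoidAlgebra.single n⁻¹ (1 : k)) • q :=
      repAct_ker σ n⁻¹ q
    rw [h1, homEval_smul]
    refine (end_mul_app (M.op (MonoidAlgebra.single n (1 : k)))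
      (M.op (MonoidAlgebra.single n⁻¹ (1 : k))) U _).symm.trans ?_
    have h2 : M.op (MonoidAlgebra.single n (1 : k)) * M.op (MonoidAlgebra.single n⁻¹ (1 : k)) =
        1 := by
      refine (map_mul M.op _ _).symm.trans ((congrArg M.op ?_).trans (map_one M.op))
      refine (MonoidAlgebra.single_mul_single ..).trans ?_
      rw [mul_inv_cancel, mul_one]; rfl
    rw [h2]; rfl

lemma KerDual.act_ker (n : π.ker) (p : KerDual π σ) :
    KerDual.act σ (n : G)⁻¹ p = KerDual.rmul σ p (MonoidAlgebra.single n 1) :=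
  KerDual.ext fun v => by
    rw [KerDual.act_eval, KerDual.rmul_eval, inv_inv, repAct_ker, map_smul, smul_eq_mul]
    have h1 := conjAlg_mem π n
      (conjAlg k π (n : G)⁻¹ (MonoidAlgebra.single n 1 * p.eval σ v))
    rw [← AlgEquiv.mul_apply, ← map_mul, mul_inv_cancel, map_one, AlgEquiv.one_apply,
      mul_assoc] at h1
    have h2 := congrArg (fun x => MonoidAlgebra.single n⁻¹ (1 : k) * x) h1
    simpa only [← mul_assoc, MonoidAlgebra.single_mul_single, inv_mul_cancel, mul_one,
      ← MonoidAlgebra.one_def, one_mul] using h2.symm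

lemma kerHom_compat (M : EqCohAlg (pullEqAlg (hs.comp π).isEquivariant ((endAlg hπ σ).infl π)))
    (hM : ∀ (n : π.ker) (U : X.Opens) (m : Γ(M.mod, U)) (e : translate (ρ.comp π) n U ≤ U),
      M.act (n : G) U m = res M.mod e m)
    (n : π.ker) (U : X.Opens)
    (m : Γ(homSheaf (kerCtx hπ σ hσ).swap.Q M.mod M.op, U)) (e : U ≤ translate (ρ.comp π) n U) :
    Scheme.Modules.Hom.app (((kerCtx hπ σ hσ).swap.eqObj (hs.comp π).isEquivariant M).op
      (MonoidAlgebra.single n (1 : k))) U m = res (homSheaf (kerCtx hπ σ hσ).swap.Q M.mod M.op) e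
        (((kerCtx hπ σ hσ).swap.eqObj (hs.comp π).isEquivariant M).act (n : G) U m) :=
  homSheaf_sec_ext fun p => by
    refine Eq.trans ?_ (hom_res (homEval p) e _).symm
    refine Eq.trans ?_ (congrArg (res M.mod e)
      ((kerCtx hπ σ hσ).swap.eqObj_act (hs.comp π).isEquivariant M n U m p)).symm
    rw [hM n U _ (translate_of_eq_one (ker_act π ρ n) U).le]
    refine Eq.trans ?_ ((res_res M.mod _ _ _).trans (res_self M.mod _ _)).symm
    refine (congrArg (fun o : (kerAlg k π).carrier →+* End (homSheaf (kerCtx hπ σ hσ).swap.Q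
      M.mod M.op) => (homEval p).app U (Scheme.Modules.Hom.app
      (o (show (kerAlg k π).carrier from MonoidAlgebra.single n (1 : k))) U m))
      ((kerCtx hπ σ hσ).swap.eqObj_op (hs.comp π).isEquivariant M)).trans ?_
    refine ((kerCtx hπ σ hσ).swap.op_eval M.op _ p U m).trans ?_
    refine congrArg (fun q : (kerCtx hπ σ hσ).swap.Q => (homEval q).app U m) ?_
    exact (KerDual.act_ker σ n p).symm

lemma psi_act (F : CohG π ρ) (n : π.ker) (U : X.Opens)
    (m : Γ(((kerCtx hπ σ hσ).eqObj (hs.comp π).isEquivariant (kerObj hs F)).mod, U))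
    (e : translate (ρ.comp π) n U ≤ U) :
    ((kerCtx hπ σ hσ).eqObj (hs.comp π).isEquivariant (kerObj hs F)).act (n : G) U m =
      res ((kerCtx hπ σ hσ).eqObj (hs.comp π).isEquivariant (kerObj hs F)).mod e m :=
  kerHom_act hπ σ hσ hs (kerObj hs F) (act_kerObj hs F) n U m e

/-- Functoriality of the sheaf of `N`-equivariant maps from a generator. -/
def psiHom {F F' : CohG π ρ} (g : F ⟶ F') :
    (kerCtx hπ σ hσ).eqObj (hs.comp π).isEquivariant (kerObj hs F) ⟶
      (kerCtx hπ σ hσ).eqObj (hs.comp π).isEquivariant (kerObj hs F') :=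
  ((kerCtx hπ σ hσ).eqFunctor (hs.comp π).isEquivariant).map ((toKerAlg hs).map g)

/-- The functor of `N`-equivariant maps from a generator. -/
def psiG : CohG π ρ ⥤ EqCohAlg (calA hπ hs σ) where
  obj F := descObj hs hπ ((kerCtx hπ σ hσ).eqObj (hs.comp π).isEquivariant (kerObj hs F))
    (psi_act hπ σ hσ hs F)
  map {F F'} g := descHom hs hπ (psi_act hπ σ hσ hs F) (psi_act hπ σ hσ hs F')
    (psiHom hπ σ hσ hs g)
  map_id F := EqCohAlg.Hom.ext (homSheaf_hom_ext fun q => rfl)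
  map_comp g g' := EqCohAlg.Hom.ext (homSheaf_hom_ext fun q => rfl)

lemma psiHom_injective {F F' : CohG π ρ} {g g' : F ⟶ F'}
    (h : psiHom hπ σ hσ hs g = psiHom hπ σ hσ hs g') : g = g' := by
  have : ((kerCtx hπ σ hσ).eqFunctor (hs.comp π).isEquivariant).IsEquivalence :=
    ((kerCtx hπ σ hσ).eqEquiv (hs.comp π).isEquivariant).isEquivalence_functor
  exact (toKerAlg (k := k) hs).map_injective
    (((kerCtx hπ σ hσ).eqFunctor (hs.comp π).isEquivariant).map_injective h)

lemma psiHom_surjective {F F' : CohG π ρ}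
    (φ : (kerCtx hπ σ hσ).eqObj (hs.comp π).isEquivariant (kerObj hs F) ⟶
      (kerCtx hπ σ hσ).eqObj (hs.comp π).isEquivariant (kerObj hs F')) :
    ∃ g : F ⟶ F', psiHom hπ σ hσ hs g = φ := by
  have : ((kerCtx hπ σ hσ).eqFunctor (hs.comp π).isEquivariant).IsEquivalence :=
    ((kerCtx hπ σ hσ).eqEquiv (hs.comp π).isEquivariant).isEquivalence_functor
  obtain ⟨φ₁, h₁⟩ := ((kerCtx hπ σ hσ).eqFunctor (hs.comp π).isEquivariant).map_surjective
    (X := (toKerAlg hs).obj F) (Y := (toKerAlg hs).obj F') φ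
  obtain ⟨φ₂, h₂⟩ := (toKerAlg (k := k) hs).map_surjective φ₁
  exact ⟨φ₂, (congrArg _ h₂).trans h₁⟩

/-- The inverse image of a module under the functor of `N`-equivariant maps. -/
def psiInv (M : EqCohAlg (pullEqAlg hs.isEquivariant (endAlg hπ σ))) : CohG π ρ where
  toEqMod := ((kerCtx hπ σ hσ).swap.eqObj (hs.comp π).isEquivariant
    (inflObj (π := π) hs (endAlg hπ σ) M)).toEqMod
  coherent := ((kerCtx hπ σ hσ).swap.eqObj (hs.comp π).isEquivariant
    (inflObj (π := π) hs (endAlg hπ σ) M)).coherent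

/-- The isomorphism exhibiting the inverse image of a module. -/
def psiInvIso (M : EqCohAlg (pullEqAlg hs.isEquivariant (endAlg hπ σ))) :
    (kerCtx hπ σ hσ).eqObj (hs.comp π).isEquivariant (kerObj hs (psiInv hπ σ hσ hs M)) ≅
      inflObj (π := π) hs (endAlg hπ σ) M :=
  ((kerCtx hπ σ hσ).eqFunctor (hs.comp π).isEquivariant).mapIso
      (kerObjIso hs _ (kerHom_compat hπ σ hσ hs _ (inflObj_act hs M))) ≪≫
    ((kerCtx hπ σ hσ).swap.eqUnitIso (hs.comp π).isEquivariant).symm.app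
      (inflObj (π := π) hs (endAlg hπ σ) M)

instance psiG_isEquivalence : (psiG hπ σ hσ hs).IsEquivalence where
  faithful := ⟨fun e => psiHom_injective hπ σ hσ hs (descHom_injective hs hπ _ _ e)⟩
  full := ⟨fun {F F'} φ => by
    obtain ⟨g, hg⟩ := psiHom_surjective hπ σ hσ hs
      (ofDescHom hs hπ (psi_act hπ σ hσ hs F) (psi_act hπ σ hσ hs F') φ)
    exact ⟨g, (congrArg (descHom hs hπ (psi_act hπ σ hσ hs F) (psi_act hπ σ hσ hs F')) hg).trans
      (descHom_ofDescHom hs hπ (psi_act hπ σ hσ hs F) (psi_act hπ σ hσ hs F') φ)⟩⟩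
  essSurj := ⟨fun M => ⟨psiInv hπ σ hσ hs M, ⟨descIso hs hπ
    (psi_act hπ σ hσ hs (psiInv hπ σ hσ hs M)) (psiInvIso hπ σ hσ hs M)⟩⟩⟩

end Psi
end EquivSheaf

end

noncomputable section
namespace EquivSheaf

section Pairing
variable {k : Type u} [Field k] {G H : Type u} [Group G] [Group H] {π : G →* H}
  (hπ : Function.Surjective π)
  {V : Type u} [AddCommGroup V] [Module k V] [FiniteDimensional k V] (σ : Representation k G V)
  {X : Scheme.{u}} {s : X ⟶ Spec (.of k)} {ρ : H →* Aut X} (hs : IsOver ρ s)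

lemma algebraMap_smul_asModule (c : k) (v : V) :
    (show (resN π σ).asModule from c • v) =
      algebraMap k (MonoidAlgebra k π.ker) c • (show (resN π σ).asModule from v) := by
  refine Eq.symm ((Representation.single_smul (resN π σ) c 1 _).trans ?_)
  rw [map_one]; rfl

/-- The pairing defined by a morphism to a sheaf of linear maps. -/
def VPairing.ofHom (M : AlgMod (calA hπ hs σ).toSheafAlg) (F : X.Modules)
    (op : MonoidAlgebra k π.ker →+* End F) (hop : ∀ c, op (algebraMap k _ c) = zmul s F c)
    (j : M.mod ⟶ homSheaf (resN π σ).asModule F op)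
    (hj : ∀ (φ : EndN π σ) U (m : Γ(M.mod, U)) (v : (resN π σ).asModule),
      (homEval v).app U (j.app U (M.smul U (constSec hπ hs σ φ U) m)) =
        (homEval (endNEquiv σ φ v)).app U (j.app U m)) : VPairing hπ hs σ M F where
  toFun U := AddMonoidHom.mk'
    (fun v => homL (j ≫ homEval (show (resN π σ).asModule from v)) U)
    (fun v w => LinearMap.ext fun m => (evalHom (j.app U m)).map_add v w)
  map_ksmul U c v m := by
    change (homEval (show (resN π σ).asModule from c • v)).app U (j.app U m) =
      baseHom s U c • (homEval (show (resN π σ).asModule from v)).app U (j.app U m)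
    rw [algebraMap_smul_asModule, homEval_smul, hop]; rfl
  balanced U φ v m := (hj φ U m v).symm
  map_res i v m := (hom_res (j ≫ homEval (show (resN π σ).asModule from v)) i m).symm

variable {F : CohN π ρ} {op : MonoidAlgebra k π.ker →+* End F.mod}

/-- Multiplicative maps are linear over the group algebra. -/
lemma IsNHom.map_smul {σ : Representation k G V} {U : X.Opens} {φ : V →+ Γ(F.mod, U)}
    (hφ : IsNHom σ s F U φ)
    (ho : op = F.groupOp s (ker_act π ρ)) (x : MonoidAlgebra k π.ker)
    (v : (resN π σ).asModule) :
    φ (show V from x • v) = Scheme.Modules.Hom.app (op x) U (φ (show V from v)) := by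
  subst ho
  induction x using MonoidAlgebra.induction_linear with
  | zero =>
    rw [map_zero]
    exact (congrArg φ (zero_smul (MonoidAlgebra k π.ker) v)).trans (map_zero φ)
  | add x y hx hy =>
    rw [map_add]
    refine (congrArg φ (add_smul x y v)).trans ((map_add φ _ _).trans ?_)
    exact congrArg₂ (· + ·) hx hy
  | single n c =>
    refine (congrArg φ (Representation.single_smul (resN π σ) c n v)).trans ((hφ.1 c _).trans ?_)
    rw [EqMod.groupOp_single]
    refine congrArg (fun t => baseHom s U c • t) ?_
    have h1 := hφ.2 n v U le_rfl (translate_of_eq_one (ker_act π ρ n) U).ge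
    rw [res_self] at h1
    exact h1

/-- The section of the sheaf of linear maps defined by an `N`-equivariant map. -/
def nHomSec (ho : op = F.groupOp s (ker_act π ρ)) {U : X.Opens} {φ : V →+ Γ(F.mod, U)}
    (hφ : IsNHom σ s F U φ) : Γ(homSheaf (resN π σ).asModule F.mod op, U) :=
  homSec (fun v => φ (show V from v)) (fun v w => map_add φ v w)
    (fun x v => hφ.map_smul ho x v)

variable {σ}

lemma isNHom_of_sec (ho : op = F.groupOp s (ker_act π ρ)) {U : X.Opens}
    (t : Γ(homSheaf (resN π σ).asModule F.mod op, U)) (φ : V →+ Γ(F.mod, U))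
    (hφ : ∀ v : V, φ v = (homEval (show (resN π σ).asModule from v)).app U t) :
    IsNHom σ s F U φ := by
  subst ho
  refine ⟨fun c v => ?_, fun n v W i j => ?_⟩
  · rw [hφ, hφ, algebraMap_smul_asModule, homEval_smul, EqMod.groupOp_algebraMap]; rfl
  · have h1 := repAct_ker σ n (show (resN π σ).asModule from v)
    rw [hφ, hφ]
    have h2 : (show (resN π σ).asModule from σ n v) =
      MonoidAlgebra.single n (1 : k) • (show (resN π σ).asModule from v) := h1
    rw [h2, homEval_smul, EqMod.groupOp_single_one]
    exact (res_res F.mod (translate_of_eq_one (ker_act π ρ n) U).ge i _)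

variable {hπ hs} {M : AlgMod (calA hπ hs σ).toSheafAlg}

lemma VPairing.ofHom_isNEquiv (ho : op = F.groupOp s (ker_act π ρ)) {hop}
    {j : M.mod ⟶ homSheaf (resN π σ).asModule F.mod op} {hj} :
    (VPairing.ofHom hπ σ hs M F.mod op hop j hj).IsNEquiv (F := F) := fun U m =>
  isNHom_of_sec ho (j.app U m) _ fun _ => rfl

lemma VPairing.ofHom_isPerfect (ho : op = F.groupOp s (ker_act π ρ)) {hop}
    {j : M.mod ⟶ homSheaf (resN π σ).asModule F.mod op} {hj}
    (hb : ∀ U, Function.Bijective (j.app U)) :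
    (VPairing.ofHom hπ σ hs M F.mod op hop j hj).IsPerfect (F := F) := by
  intro U φ hφ
  obtain ⟨m, hm⟩ := (hb U).2 (nHomSec σ ho hφ)
  refine ⟨m, AddMonoidHom.ext fun v => ?_, fun m' hm' => (hb U).1 ?_⟩
  · change (homEval (show (resN π σ).asModule from v)).app U (j.app U m) = φ v
    rw [hm]; rfl
  · rw [hm]
    refine homSheaf_sec_ext fun v => ?_
    exact DFunLike.congr_fun hm' v

/-- The morphism to a sheaf of linear maps defined by an equivariant pairing. -/
def VPairing.toHom (γ : VPairing hπ hs σ M F.mod) (hγ : γ.IsNEquiv)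
    (ho : op = F.groupOp s (ker_act π ρ)) : M.mod ⟶ homSheaf (resN π σ).asModule F.mod op :=
  mkHom (fun U =>
    { toFun := fun m => nHomSec σ ho (hγ U m)
      map_add' := fun m m' => homSheaf_sec_ext fun v => map_add (γ.toFun U v) m m'
      map_smul' := fun r m => homSheaf_sec_ext fun v => by
        rw [Scheme.Modules.Hom.app_smul]
        exact map_smul (γ.toFun U v) r m })
    (fun i m => homSheaf_sec_ext fun v => by
      rw [hom_res]
      exact (γ.map_res i v m).symm)

end Pairing

section DescOp
variable {R : Type u} [CommRing R] {G H : Type u} [Group G] [Group H] {π : G →* H}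
  {X : Scheme.{u}} {s : X ⟶ Spec (.of R)} {ρ : H →* Aut X} (hs : IsOver ρ s)
  {B : RAlg (1 : H →* RingAut R)} [Module.Finite R B.carrier] [Module.Projective R B.carrier]
  {A : RAlg (1 : G →* RingAut R)} [Module.Finite R A.carrier] [Module.Projective R A.carrier]
  (hπ : Function.Surjective π) (c : MoritaCtx (B.infl π) A)
  (M : EqCohAlg (pullEqAlg (hs.comp π).isEquivariant A))
  (hM : ∀ (n : π.ker) (U : X.Opens) (m : Γ((c.eqObj (hs.comp π).isEquivariant M).mod, U))
    (e : translate (ρ.comp π) n U ≤ U), (c.eqObj (hs.comp π).isEquivariant M).act (n : G) U m =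
      res (c.eqObj (hs.comp π).isEquivariant M).mod e m)

/-- The action of the algebra of a Morita context, without inflation. -/
def ctxOp {M : X.Modules} (op : A.carrier →+* End M) : B.carrier →+* End (homSheaf c.Q M op) :=
  c.op op

/-- The right action of the algebra of a Morita context, without inflation. -/
def ctxR (q : c.Q) (b : B.carrier) : c.Q := c.qr q b

lemma ctxOp_eval {M : X.Modules} (op : A.carrier →+* End M) (b : B.carrier) (q : c.Q)
    (U : X.Opens) (t : Γ(homSheaf c.Q M op, U)) :
    (homEval q).app U (Scheme.Modules.Hom.app (ctxOp c op b) U t) =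
      (homEval (ctxR c q b)).app U t := rfl

lemma inflOp_eqObj : inflOp hs (c.eqObj (hs.comp π).isEquivariant M) = ctxOp c M.op :=
  c.eqObj_op (hs.comp π).isEquivariant M

lemma descObj_smul (N : EqCohAlg (pullEqAlg (hs.comp π).isEquivariant (B.infl π)))
    (hN : ∀ (n : π.ker) (U : X.Opens) (m : Γ(N.mod, U)) (e : translate (ρ.comp π) n U ≤ U),
      N.act (n : G) U m = res N.mod e m) (b : B.carrier) (U : X.Opens) (t : Γ(N.mod, U)) :
    (show Γ(N.mod, U) from (descObj hs hπ N hN).smul U (pullSec s b U) t) =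
      Scheme.Modules.Hom.app (inflOp hs N b) U t :=
  congrArg (fun o : End N.mod => Scheme.Modules.Hom.app o U t)
    (DFunLike.congr_fun (descObj_op hs hπ N hN) b)

lemma inflOp_eqObj_eval (b : B.carrier) (q : c.Q) (U : X.Opens)
    (t : Γ(homSheaf c.Q M.mod M.op, U)) :
    (homEval q).app U (show Γ(homSheaf c.Q M.mod M.op, U) from
      Scheme.Modules.Hom.app (inflOp hs (c.eqObj (hs.comp π).isEquivariant M) b) U t) =
      (homEval (ctxR c q b)).app U t :=
  congrArg (fun o : B.carrier →+* End (homSheaf c.Q M.mod M.op) =>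
    (homEval q).app U (Scheme.Modules.Hom.app (o b) U t)) (inflOp_eqObj hs c M)

lemma descObj_eqObj_eval (b : B.carrier) (q : c.Q) (U : X.Opens)
    (t : Γ(homSheaf c.Q M.mod M.op, U)) :
    (homEval q).app U (show Γ(homSheaf c.Q M.mod M.op, U) from
      (descObj hs hπ (c.eqObj (hs.comp π).isEquivariant M) hM).smul U (pullSec s b U) t) =
      (homEval (ctxR c q b)).app U t :=
  (congrArg (fun x : Γ(homSheaf c.Q M.mod M.op, U) => (homEval q).app U x)
    (descObj_smul hs hπ (c.eqObj (hs.comp π).isEquivariant M) hM b U t)).trans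
    (inflOp_eqObj_eval hs c M b q U t)

lemma descObj_eqObj_act (g : G) (q : c.Q) (U : X.Opens)
    (t : Γ(homSheaf c.Q M.mod M.op, U)) :
    (homEval q).app (translate ρ (π g) U)
      (show Γ(homSheaf c.Q M.mod M.op, translate ρ (π g) U) from
        (descObj hs hπ (c.eqObj (hs.comp π).isEquivariant M) hM).act (π g) U t) =
      (show Γ(M.mod, translate ρ (π g) U) from
        M.act g U ((homEval (c.actQ g⁻¹ q)).app U t)) := by
  have h1 := descObj_act hs hπ _ hM g U t
  exact (congrArg (fun x : Γ(homSheaf c.Q M.mod M.op, translate ρ (π g) U) =>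
    (homEval q).app (translate ρ (π g) U) x) h1).trans
    (c.eqObj_act (hs.comp π).isEquivariant M g U t q)

/-- The module of maps of a Morita context over a pulled back algebra, without inflation. -/
def ctxObj (L : CohAlg (pullAlg s A.carrier)) : CohAlg (pullAlg s B.carrier) := c.obj s L

lemma ctxObj_op (L : CohAlg (pullAlg s A.carrier)) : (ctxObj c L).op = ctxOp c L.op :=
  c.obj_op s L

lemma ctxObj_eval (L : CohAlg (pullAlg s A.carrier)) (b : B.carrier) (q : c.Q) (U : X.Opens)
    (t : Γ(homSheaf c.Q L.mod L.op, U)) :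
    (homEval q).app U (show Γ(homSheaf c.Q L.mod L.op, U) from
      (ctxObj c L).smul U (pullSec s b U) t) = (homEval (ctxR c q b)).app U t := by
  have h1 := DFunLike.congr_fun (ctxObj_op c L) b
  exact congrArg (fun o : End (homSheaf c.Q L.mod L.op) =>
    (homEval q).app U (Scheme.Modules.Hom.app o U t)) h1

lemma descCompat_aux (L : CohAlg (pullAlg s A.carrier)) (φ : M.mod ⟶ L.mod)
    (hφ : ∀ a U m, φ.app U (Scheme.Modules.Hom.app (M.op a) U m) =
      Scheme.Modules.Hom.app (L.op a) U (φ.app U m)) (b : B.carrier) (U : X.Opens)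
    (t : Γ(homSheaf c.Q M.mod M.op, U)) (q : c.Q) :
    (homEval q).app U ((c.mapHom M.op L.op φ hφ).app U (show Γ(homSheaf c.Q M.mod M.op, U) from
      (descObj hs hπ (c.eqObj (hs.comp π).isEquivariant M) hM).smul U (pullSec s b U) t)) =
      (homEval q).app U (Scheme.Modules.Hom.app (ctxOp c L.op b) U
        ((c.mapHom M.op L.op φ hφ).app U t)) := by
  rw [c.mapHom_eval, ctxOp_eval, c.mapHom_eval]
  exact congrArg (φ.app U) (descObj_eqObj_eval hs hπ c M hM b q U t)

/-- Comparison of the modules of maps with and without equivariant structures. -/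
def descCompat (L : CohAlg (pullAlg s A.carrier)) (φ : M.mod ⟶ L.mod) (ψ : L.mod ⟶ M.mod)
    (h₁ : φ ≫ ψ = 𝟙 _) (h₂ : ψ ≫ φ = 𝟙 _)
    (hφ : ∀ a U m, φ.app U (Scheme.Modules.Hom.app (M.op a) U m) =
      Scheme.Modules.Hom.app (L.op a) U (φ.app U m))
    (hψ : ∀ a U m, ψ.app U (Scheme.Modules.Hom.app (L.op a) U m) =
      Scheme.Modules.Hom.app (M.op a) U (ψ.app U m)) :
    (EqCohAlg.forgetAct (pullEqAlg hs.isEquivariant B)).obj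
      (descObj hs hπ (c.eqObj (hs.comp π).isEquivariant M) hM) ≅ ctxObj c L :=
  @asIso _ _ _ _ (CohAlg.homOfOp (f := s) (A := B.carrier) (N := ctxObj c L)
      (M := (EqCohAlg.forgetAct (pullEqAlg hs.isEquivariant B)).obj
        (descObj hs hπ (c.eqObj (hs.comp π).isEquivariant M) hM))
      (c.mapHom M.op L.op φ hφ)
      (fun b U t => by
        rw [ctxObj_op]
        exact homSheaf_sec_ext fun q => descCompat_aux hs hπ c M hM L φ hφ b U t q))
    (CohAlg.isIso_of_bijective _ fun U => Function.bijective_iff_has_inverse.mpr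
      ⟨(c.mapHom L.op M.op ψ hψ).app U,
        fun t => homSheaf_sec_ext fun q => by
          refine ((c.mapHom_eval L.op M.op ψ hψ q U _).trans
            (congrArg (ψ.app U) (c.mapHom_eval M.op L.op φ hφ q U t))).trans ?_
          exact ConcreteCategory.congr_hom (congrArg (fun g => Scheme.Modules.Hom.app g U) h₁) _,
        fun t => homSheaf_sec_ext fun q => by
          refine ((c.mapHom_eval M.op L.op φ hφ q U _).trans
            (congrArg (φ.app U) (c.mapHom_eval L.op M.op ψ hψ q U t))).trans ?_
          exact ConcreteCategory.congr_hom (congrArg (fun g => Scheme.Modules.Hom.app g U) h₂) _⟩)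

end DescOp

section PsiN
variable {k : Type u} [Field k] {G H : Type u} [Group G] [Group H] {π : G →* H}
  (hπ : Function.Surjective π)
  {V : Type u} [AddCommGroup V] [Module k V] (σ : Representation k G V)
  [Finite G] [CharZero k] [FiniteDimensional k V] (hσ : IsNGenerator π σ)
  {X : Scheme.{u}} {s : X ⟶ Spec (.of k)} {ρ : H →* Aut X} (hs : IsOver ρ s)

/-- The functor of `N`-equivariant maps from a generator, without the action of `H`. -/
def psiN : CohN π ρ ⥤ CohAlg (calA hπ hs σ).toSheafAlg :=
  toGroupAlg s (ker_act π ρ) ⋙ ((kerCtx hπ σ hσ).equiv s).functor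

instance psiN_isEquivalence : (psiN hπ σ hσ hs).IsEquivalence :=
  @Functor.isEquivalence_trans _ _ _ _ _ _ (toGroupAlg s (ker_act π ρ))
    ((kerCtx hπ σ hσ).equiv s).functor (toGroupAlg_isEquivalence s (ker_act π ρ))
    ((kerCtx hπ σ hσ).equiv s).isEquivalence_functor

/-- The action of the group algebra on the underlying sheaf does not depend on the larger group. -/
lemma kerObj_op_eq (F : CohG π ρ) : (kerObj hs F).op =
    (show (kerAlg k π).carrier →+* End F.mod from
      ((toGroupAlg s (ker_act π ρ)).obj ((forgetGN π ρ).obj F)).op) :=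
  (kerObj_op hs F).trans (toGroupAlg_op s (ker_act π ρ) ((forgetGN π ρ).obj F)).symm

end PsiN
end EquivSheaf

end

noncomputable section
namespace EquivSheaf

section Precomp
variable {k : Type u} [Field k] {G H : Type u} [Group G] [Group H] {π : G →* H}
  {hπ : Function.Surjective π}
  {V : Type u} [AddCommGroup V] [Module k V] [FiniteDimensional k V] {σ : Representation k G V}
  {X : Scheme.{u}} {s : X ⟶ Spec (.of k)} {ρ : H →* Aut X} {hs : IsOver ρ s}

/-- Composition of a pairing with a morphism of modules. -/
def VPairing.precomp {M M' : AlgMod (calA hπ hs σ).toSheafAlg} {F : X.Modules}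
    (β : VPairing hπ hs σ M' F) (f : M.mod ⟶ M'.mod)
    (hf : ∀ U (b : Γ((calA hπ hs σ).mod, U)) (m : Γ(M.mod, U)),
      f.app U (M.smul U b m) = M'.smul U b (f.app U m)) : VPairing hπ hs σ M F where
  toFun U := AddMonoidHom.mk' (fun v => (β.toFun U v).comp (homL f U))
    (fun v w => by rw [map_add]; rfl)
  map_ksmul U c v m := β.map_ksmul U c v (f.app U m)
  balanced U φ v m := by
    refine (β.balanced U φ v (f.app U m)).trans ?_
    exact congrArg (β.toFun U v) (hf U _ m).symm
  map_res i v m := by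
    refine (β.map_res i v (f.app _ m)).trans ?_
    exact congrArg (β.toFun _ v) (hom_res f i m).symm

lemma VPairing.precomp_isPerfect {M M' : AlgMod (calA hπ hs σ).toSheafAlg} {F : CohN π ρ}
    {β : VPairing hπ hs σ M' F.mod} (hβ : β.IsPerfect) {f : M.mod ⟶ M'.mod}
    {hf : ∀ U (b : Γ((calA hπ hs σ).mod, U)) (m : Γ(M.mod, U)),
      f.app U (M.smul U b m) = M'.smul U b (f.app U m)}
    (hb : ∀ U, Function.Bijective (f.app U)) : (β.precomp f hf).IsPerfect := by
  intro U φ hφ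
  obtain ⟨m', hm', hu⟩ := hβ U φ hφ
  obtain ⟨m, rfl⟩ := (hb U).2 m'
  exact ⟨m, hm', fun y hy => (hb U).1 (hu _ hy)⟩

lemma VPairing.precomp_isNEquiv {M M' : AlgMod (calA hπ hs σ).toSheafAlg} {F : CohN π ρ}
    {β : VPairing hπ hs σ M' F.mod} (hβ : β.IsNEquiv) {f : M.mod ⟶ M'.mod}
    {hf : ∀ U (b : Γ((calA hπ hs σ).mod, U)) (m : Γ(M.mod, U)),
      f.app U (M.smul U b m) = M'.smul U b (f.app U m)} : (β.precomp f hf).IsNEquiv :=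
  fun U m => hβ U (f.app U m)

lemma CohAlg.bijective_of_isIso {B : SheafAlg X} {M N : CohAlg B} (φ : M ⟶ N) [IsIso φ]
    (U : X.Opens) : Function.Bijective (φ.hom.app U) :=
  Function.bijective_iff_has_inverse.mpr ⟨(inv φ).hom.app U,
    fun m => ConcreteCategory.congr_hom (congrArg (fun g => Scheme.Modules.Hom.app g U)
      (congrArg CohAlg.Hom.hom (IsIso.hom_inv_id φ))) m,
    fun m => ConcreteCategory.congr_hom (congrArg (fun g => Scheme.Modules.Hom.app g U)
      (congrArg CohAlg.Hom.hom (IsIso.inv_hom_id φ))) m⟩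

lemma EqCohAlg.bijective_of_isIso {B : EqAlg ρ} {M N : EqCohAlg B} (φ : M ⟶ N) [IsIso φ]
    (U : X.Opens) : Function.Bijective (φ.hom.app U) :=
  CohAlg.bijective_of_isIso ((EqCohAlg.forgetAct B).map φ) U

variable (hπ hs σ) in
/-- A functor is the tensor product with `𝒱` if it is inverse to a functor representing
equivariant pairings. -/
def isTensorN_of_inverse (E : CohN π ρ ≌ CohAlg (calA hπ hs σ).toSheafAlg)
    (ev : ∀ F : CohN π ρ, VPairing hπ hs σ (E.functor.obj F).toAlgMod F.mod)
    (hev : ∀ F, (ev F).IsNEquiv) (hev' : ∀ F, (ev F).IsPerfect)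
    (hnat : ∀ {F F' : CohN π ρ} (g : F ⟶ F') U v m,
      g.hom.app U ((ev F).toFun U v m) = (ev F').toFun U v ((E.functor.map g).hom.app U m))
    (hun : ∀ M (F : CohN π ρ) (γ : VPairing hπ hs σ M.toAlgMod F.mod), γ.IsNEquiv →
      ∃! f : M ⟶ E.functor.obj F, ∀ U v m, (ev F).toFun U v (f.hom.app U m) = γ.toFun U v m) :
    IsTensorN hπ hs σ E.inverse where
  pair M := (ev (E.inverse.obj M)).precomp (E.counitInv.app M).hom (E.counitInv.app M).map_bsmul
  equivariant M := VPairing.precomp_isNEquiv (hev _)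
  natural {M M'} f U v m := by
    refine (hnat (E.inverse.map f) U v _).trans ?_
    refine congrArg ((ev (E.inverse.obj M')).toFun U v) ?_
    exact ConcreteCategory.congr_hom (congrArg (fun g => Scheme.Modules.Hom.app g U)
      (congrArg CohAlg.Hom.hom (E.counitInv.naturality f).symm)) m
  universal M F γ hγ := by
    obtain ⟨f, hf, hu⟩ := hun M F γ hγ
    obtain ⟨g, hg⟩ := E.functor.map_surjective ((E.counit.app M : _ ⟶ M) ≫ f)
    have key : ∀ g' : E.inverse.obj M ⟶ F, ∀ U v m, g'.hom.app U
        (((ev (E.inverse.obj M)).precomp (E.counitInv.app M).hom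
          (E.counitInv.app M).map_bsmul).toFun U v m) =
        (ev F).toFun U v ((E.counitInv.app M ≫ E.functor.map g').hom.app U m) :=
      fun g' U v m => hnat g' U v _
    refine ⟨g, fun U v m => ?_, fun g' hg' => ?_⟩
    · rw [key, hg, ← hf]
      have : E.counitInv.app M ≫ E.counit.app M ≫ f = f := by
        rw [← Category.assoc]
        exact (congrArg (· ≫ f) (E.counitIso.inv_hom_id_app M)).trans (Category.id_comp f)
      exact congrArg (fun t : M ⟶ E.functor.obj F => (ev F).toFun U v (t.hom.app U m)) this
    · refine E.functor.map_injective ?_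
      have := hu (E.counitInv.app M ≫ E.functor.map g') fun U v m => (key g' U v m).symm.trans
        (hg' U v m)
      rw [hg, ← this, ← Category.assoc]
      refine Eq.symm ((congrArg (· ≫ E.functor.map g') (E.counitIso.hom_inv_id_app M)).trans ?_)
      exact Category.id_comp _
  perfect M := VPairing.precomp_isPerfect (hev' _) (CohAlg.bijective_of_isIso _)

variable (hπ hs σ) in
/-- A functor is the equivariant tensor product with `𝒱` if it is inverse to a functor
representing equivariant pairings. -/
def isTensorG_of_inverse (E : CohG π ρ ≌ EqCohAlg (calA hπ hs σ))
    (ev : ∀ F : CohG π ρ, VPairing hπ hs σ (E.functor.obj F).toAlgMod F.mod)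
    (hev : ∀ F, (ev F).IsGEquiv)
    (hev' : ∀ F, VPairing.IsPerfect (F := (forgetGN π ρ).obj F) (ev F))
    (hnat : ∀ {F F' : CohG π ρ} (g : F ⟶ F') U v m,
      g.hom.app U ((ev F).toFun U v m) = (ev F').toFun U v ((E.functor.map g).hom.app U m))
    (hun : ∀ M (F : CohG π ρ) (γ : VPairing hπ hs σ M.toAlgMod F.mod), γ.IsGEquiv →
      ∃! f : M ⟶ E.functor.obj F, ∀ U v m, (ev F).toFun U v (f.hom.app U m) = γ.toFun U v m) :
    IsTensorG hπ hs σ E.inverse where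
  pair M := (ev (E.inverse.obj M)).precomp (E.counitInv.app M).hom (E.counitInv.app M).map_bsmul
  equivariant M g U v m := by
    refine (hev (E.inverse.obj M) g U v _).trans ?_
    exact congrArg ((ev (E.inverse.obj M)).toFun _ _) ((E.counitInv.app M).map_act (π g) U m).symm
  natural {M M'} f U v m := by
    refine (hnat (E.inverse.map f) U v _).trans ?_
    refine congrArg ((ev (E.inverse.obj M')).toFun U v) ?_
    exact ConcreteCategory.congr_hom (congrArg (fun g => Scheme.Modules.Hom.app g U)
      (congrArg EqCohAlg.Hom.hom (E.counitInv.naturality f).symm)) m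
  universal M F γ hγ := by
    obtain ⟨f, hf, hu⟩ := hun M F γ hγ
    obtain ⟨g, hg⟩ := E.functor.map_surjective ((E.counit.app M : _ ⟶ M) ≫ f)
    have key : ∀ g' : E.inverse.obj M ⟶ F, ∀ U v m, g'.hom.app U
        (((ev (E.inverse.obj M)).precomp (E.counitInv.app M).hom
          (E.counitInv.app M).map_bsmul).toFun U v m) =
        (ev F).toFun U v ((E.counitInv.app M ≫ E.functor.map g').hom.app U m) :=
      fun g' U v m => hnat g' U v _
    refine ⟨g, fun U v m => ?_, fun g' hg' => ?_⟩
    · rw [key, hg, ← hf]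
      have : E.counitInv.app M ≫ E.counit.app M ≫ f = f := by
        rw [← Category.assoc]
        exact (congrArg (· ≫ f) (E.counitIso.inv_hom_id_app M)).trans (Category.id_comp f)
      exact congrArg (fun t : M ⟶ E.functor.obj F => (ev F).toFun U v (t.hom.app U m)) this
    · refine E.functor.map_injective ?_
      have := hu (E.counitInv.app M ≫ E.functor.map g') fun U v m => (key g' U v m).symm.trans
        (hg' U v m)
      rw [hg, ← this, ← Category.assoc]
      refine Eq.symm ((congrArg (· ≫ E.functor.map g') (E.counitIso.hom_inv_id_app M)).trans ?_)
      exact Category.id_comp _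
  perfect M := VPairing.precomp_isPerfect (F := (forgetGN π ρ).obj (E.inverse.obj M)) (hev' _)
    (EqCohAlg.bijective_of_isIso _)

lemma VPairing.toHom_op {M : AlgMod (calA hπ hs σ).toSheafAlg} {F : CohN π ρ}
    {op : MonoidAlgebra k π.ker →+* End F.mod} (γ : VPairing hπ hs σ M F.mod) (hγ : γ.IsNEquiv)
    (ho : op = F.groupOp s (ker_act π ρ)) (φ : EndN π σ) (U : X.Opens) (m : Γ(M.mod, U))
    (v : (resN π σ).asModule) :
    (homEval v).app U ((γ.toHom hγ ho).app U (M.smul U (constSec hπ hs σ φ U) m)) =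
      (homEval (endNEquiv σ φ v)).app U ((γ.toHom hγ ho).app U m) :=
  (γ.balanced U φ v m).symm

lemma VPairing.IsGEquiv.isNEquiv {M : EqCohAlg (calA hπ hs σ)} {F : CohG π ρ}
    {γ : VPairing hπ hs σ M.toAlgMod F.mod} (hγ : γ.IsGEquiv) :
    VPairing.IsNEquiv (F := (forgetGN π ρ).obj F) γ := by
  refine fun U m => ⟨fun c v => γ.map_ksmul U c v m, fun n v W i j => ?_⟩
  have hn : π n = 1 := n.2
  have e : translate ρ (π n) U ≤ U :=
    (translate_of_eq_one (by rw [hn, map_one] : ρ (π n) = 1) U).le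
  have h2 : M.act (π n) U m = res M.mod e m := by
    rw [M.act_congr hn U m ((translate_mono ρ _ le_rfl).trans
      (e.trans (translate_one ρ U).ge)), M.act_one, res_res]
  have h1 : F.act n U (γ.toFun U v m) =
      res F.mod e (γ.toFun U (σ n v) m) := by
    rw [γ.map_res, ← h2]
    exact hγ n U v m
  refine Eq.trans ?_ (congrArg (res F.mod j) h1).symm
  exact (res_res F.mod e j _).symm

end Precomp
end EquivSheaf

end

noncomputable section
namespace EquivSheaf

section Ev
variable {k : Type u} [Field k] {G H : Type u} [Group G] [Group H] {π : G →* H}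
  (hπ : Function.Surjective π)
  {V : Type u} [AddCommGroup V] [Module k V] (σ : Representation k G V)
  [Finite G] [CharZero k] [FiniteDimensional k V] (hσ : IsNGenerator π σ)
  {X : Scheme.{u}} {s : X ⟶ Spec (.of k)} {ρ : H →* Aut X} (hs : IsOver ρ s)

lemma psiN_eval (F : CohN π ρ) (φ : EndN π σ) (U : X.Opens)
    (m : Γ((psiN hπ σ hσ hs).obj F |>.mod, U)) (v : (resN π σ).asModule) :
    (homEval v).app U (show Γ(homSheaf (resN π σ).asModule F.mod
      ((toGroupAlg s (ker_act π ρ)).obj F).op, U) from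
        ((psiN hπ σ hσ hs).obj F).smul U (constSec hπ hs σ φ U) m) =
      (homEval (endNEquiv σ φ v)).app U m :=
  ctxObj_eval (kerCtx hπ σ hσ) ((toGroupAlg s (ker_act π ρ)).obj F)
    (show (endAlg hπ σ).carrier from MulOpposite.op φ) v U m

/-- The universal `N`-equivariant pairing. -/
def evN (F : CohN π ρ) : VPairing hπ hs σ ((psiN hπ σ hσ hs).obj F).toAlgMod F.mod :=
  VPairing.ofHom hπ σ hs ((psiN hπ σ hσ hs).obj F).toAlgMod F.mod
    (show MonoidAlgebra k π.ker →+* End F.mod from ((toGroupAlg s (ker_act π ρ)).obj F).op)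
    (fun c => AlgMod.op_algebraMap (f := s) (A := MonoidAlgebra k π.ker)
      ((toGroupAlg s (ker_act π ρ)).obj F).toAlgMod c)
    (𝟙 _) (psiN_eval hπ σ hσ hs F)

lemma evN_isNEquiv (F : CohN π ρ) : (evN hπ σ hσ hs F).IsNEquiv :=
  VPairing.ofHom_isNEquiv (toGroupAlg_op s (ker_act π ρ) F)

lemma evN_isPerfect (F : CohN π ρ) : (evN hπ σ hσ hs F).IsPerfect :=
  VPairing.ofHom_isPerfect (toGroupAlg_op s (ker_act π ρ) F) fun _ => Function.bijective_id

lemma psiG_eval (F : CohG π ρ) (φ : EndN π σ) (U : X.Opens)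
    (m : Γ((psiG hπ σ hσ hs).obj F |>.mod, U)) (v : (resN π σ).asModule) :
    (homEval v).app U (show Γ(homSheaf (resN π σ).asModule F.mod (kerObj hs F).op, U) from
        ((psiG hπ σ hσ hs).obj F).smul U (constSec hπ hs σ φ U) m) =
      (homEval (endNEquiv σ φ v)).app U m :=
  descObj_eqObj_eval hs hπ (kerCtx hπ σ hσ) (kerObj hs F) (psi_act hπ σ hσ hs F)
    (show (endAlg hπ σ).carrier from MulOpposite.op φ) v U m

/-- The universal `G`-equivariant pairing. -/
def evG (F : CohG π ρ) : VPairing hπ hs σ ((psiG hπ σ hσ hs).obj F).toAlgMod F.mod :=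
  VPairing.ofHom hπ σ hs ((psiG hπ σ hσ hs).obj F).toAlgMod F.mod
    (show MonoidAlgebra k π.ker →+* End F.mod from (kerObj hs F).op)
    (fun c => EqCohAlg.op_algebraMap (A := kerAlg k π) (hs.comp π).isEquivariant (kerObj hs F) c)
    (𝟙 _) (psiG_eval hπ σ hσ hs F)

lemma evG_isPerfect (F : CohG π ρ) :
    VPairing.IsPerfect (F := (forgetGN π ρ).obj F) (evG hπ σ hσ hs F) :=
  VPairing.ofHom_isPerfect (F := (forgetGN π ρ).obj F) (kerObj_op hs F)
    fun _ => Function.bijective_id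

lemma evG_isGEquiv (F : CohG π ρ) : (evG hπ σ hσ hs F).IsGEquiv := by
  intro g U v m
  have h1 := descObj_eqObj_act hs hπ (kerCtx hπ σ hσ) (kerObj hs F) (psi_act hπ σ hσ hs F) g
    (show (resN π σ).asModule from σ g v) U m
  refine Eq.trans ?_ h1.symm
  have h2 : (kerCtx hπ σ hσ).actQ g⁻¹ (show (resN π σ).asModule from σ g v) =
      (show (resN π σ).asModule from v) := by
    change σ g⁻¹ (σ g v) = v
    rw [← Module.End.mul_apply, rep_inv_mul]; rfl
  rw [h2]
  rfl

lemma evN_natural {F F' : CohN π ρ} (g : F ⟶ F') (U : X.Opens) (v : V)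
    (m : Γ((psiN hπ σ hσ hs).obj F |>.mod, U)) :
    g.hom.app U ((evN hπ σ hσ hs F).toFun U v m) =
      (evN hπ σ hσ hs F').toFun U v (((psiN hπ σ hσ hs).map g).hom.app U m) := rfl

lemma evG_natural {F F' : CohG π ρ} (g : F ⟶ F') (U : X.Opens) (v : V)
    (m : Γ((psiG hπ σ hσ hs).obj F |>.mod, U)) :
    g.hom.app U ((evG hπ σ hσ hs F).toFun U v m) =
      (evG hπ σ hσ hs F').toFun U v (((psiG hπ σ hσ hs).map g).hom.app U m) := rfl

variable {hπ σ hs}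

lemma evN_universal (M : CohAlg (calA hπ hs σ).toSheafAlg) (F : CohN π ρ)
    (γ : VPairing hπ hs σ M.toAlgMod F.mod) (hγ : γ.IsNEquiv) :
    ∃! f : M ⟶ (psiN hπ σ hσ hs).obj F, ∀ U v m,
      (evN hπ σ hσ hs F).toFun U v (f.hom.app U m) = γ.toFun U v m := by
  have ho := toGroupAlg_op s (ker_act π ρ) F
  refine ⟨CohAlg.homOfOp (f := s) (A := (endAlg hπ σ).carrier) (M := M)
    (N := (psiN hπ σ hσ hs).obj F) (γ.toHom hγ ho) (fun a U m => ?_), fun U v m => rfl,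
    fun f hf => ?_⟩
  · refine homSheaf_sec_ext fun v => ?_
    refine (γ.toHom_op hγ ho (MulOpposite.unop a) U m v).trans ?_
    exact (psiN_eval hπ σ hσ hs F (MulOpposite.unop a) U _ v).symm
  · refine CohAlg.Hom.ext (hom_ext' fun U m => ?_)
    exact homSheaf_sec_ext fun v => hf U v m

lemma evG_universal (M : EqCohAlg (calA hπ hs σ)) (F : CohG π ρ)
    (γ : VPairing hπ hs σ M.toAlgMod F.mod) (hγ : γ.IsGEquiv) :
    ∃! f : M ⟶ (psiG hπ σ hσ hs).obj F, ∀ U v m,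
      (evG hπ σ hσ hs F).toFun U v (f.hom.app U m) = γ.toFun U v m := by
  have ho := kerObj_op hs F
  refine ⟨EqCohAlg.homOfOp (A := endAlg hπ σ) hs.isEquivariant (M := M)
    (N := (psiG hπ σ hσ hs).obj F)
    (VPairing.toHom (F := (forgetGN π ρ).obj F) γ hγ.isNEquiv ho) (fun a U m => ?_)
    (fun h U m => ?_), fun U v m => rfl, fun f hf => ?_⟩
  · refine homSheaf_sec_ext fun v => ?_
    refine (VPairing.toHom_op (F := (forgetGN π ρ).obj F) γ hγ.isNEquiv ho
      (MulOpposite.unop a) U m v).trans ?_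
    exact (psiG_eval hπ σ hσ hs F (MulOpposite.unop a) U _ v).symm
  · obtain ⟨g, rfl⟩ := hπ h
    refine homSheaf_sec_ext fun (v : V) => ?_
    have h1 := evG_isGEquiv hπ σ hσ hs F g U (σ g⁻¹ v)
      ((VPairing.toHom (F := (forgetGN π ρ).obj F) γ hγ.isNEquiv ho).app U m)
    have h2 := hγ g U (σ g⁻¹ v) m
    have h3 : σ g (σ g⁻¹ v) = v := by
      rw [← Module.End.mul_apply, rep_mul_inv]; rfl
    rw [h3] at h1 h2
    exact h2.symm.trans h1
  · refine EqCohAlg.Hom.ext (hom_ext' fun U m => ?_)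
    exact homSheaf_sec_ext fun v => hf U v m

variable (hπ σ hs)
/-- The functors given by a generator with and without equivariant structures are compatible. -/
def psiCompat : psiG hπ σ hσ hs ⋙ EqCohAlg.forgetAct (calA hπ hs σ) ≅
    forgetGN π ρ ⋙ psiN hπ σ hσ hs :=
  NatIso.ofComponents (fun F => descCompat hs hπ (kerCtx hπ σ hσ) (kerObj hs F)
    (psi_act hπ σ hσ hs F) ((toGroupAlg s (ker_act π ρ)).obj ((forgetGN π ρ).obj F))
    (𝟙 F.mod) (𝟙 F.mod) (Category.id_comp _) (Category.id_comp _)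
    (fun a U m => congrArg (fun o : (kerAlg k π).carrier →+* End F.mod =>
      Scheme.Modules.Hom.app (o a) U m) (kerObj_op_eq hs F))
    (fun a U m => congrArg (fun o : (kerAlg k π).carrier →+* End F.mod =>
      Scheme.Modules.Hom.app (o a) U m) (kerObj_op_eq hs F).symm))
    (fun _ => CohAlg.Hom.ext (homSheaf_hom_ext fun _ => rfl))

end Ev
end EquivSheaf

end

noncomputable section
namespace EquivSheaf

section Generator
variable {k : Type u} [Field k] {G H : Type u} [Group G] [Group H] {π : G →* H}
  (hπ : Function.Surjective π)
  {V : Type u} [AddCommGroup V] [Module k V] (σ : Representation k G V)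
  [Finite G] [CharZero k] [FiniteDimensional k V]
  {X : Scheme.{u}} {s : X ⟶ Spec (.of k)} {ρ : H →* Aut X} (hs : IsOver ρ s)

theorem exists_generator_equivalence (hσ : IsNGenerator π σ) :
    ∃ (E : EqCohAlg (calA hπ hs σ) ≌ CohG π ρ)
    (E₀ : CohAlg (calA hπ hs σ).toSheafAlg ≌ CohN π ρ),
    Nonempty (IsTensorG hπ hs σ E.functor) ∧ Nonempty (IsTensorN hπ hs σ E₀.functor) ∧
    Nonempty (E.functor ⋙ forgetGN π ρ ≅ EqCohAlg.forgetAct (calA hπ hs σ) ⋙ E₀.functor) :=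
  ⟨(psiG hπ σ hσ hs).asEquivalence.symm, (psiN hπ σ hσ hs).asEquivalence.symm,
    ⟨isTensorG_of_inverse hπ σ hs (psiG hπ σ hσ hs).asEquivalence (evG hπ σ hσ hs)
      (evG_isGEquiv hπ σ hσ hs) (evG_isPerfect hπ σ hσ hs) (evG_natural hπ σ hσ hs)
      (evG_universal hσ)⟩,
    ⟨isTensorN_of_inverse hπ σ hs (psiN hπ σ hσ hs).asEquivalence (evN hπ σ hσ hs)
      (evN_isNEquiv hπ σ hσ hs) (evN_isPerfect hπ σ hσ hs) (evN_natural hπ σ hσ hs)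
      (evN_universal hσ)⟩,
    ⟨Iso.inverseCompIso (G := (psiG hπ σ hσ hs).asEquivalence)
      (Iso.isoCompInverse (G := forgetGN π ρ) (H := (psiN hπ σ hσ hs).asEquivalence)
        (psiCompat hπ σ hσ hs).symm)⟩⟩

end Generator
end EquivSheaf

end

noncomputable section
namespace EquivSheaf

section Azumaya
variable {R A : Type*} [CommRing R] [Ring A] [Algebra R A]

lemma mul_tensor_eq {e₀ : A ⊗[R] Aᵐᵒᵖ}
    (h : ∀ b, (b ⊗ₜ[R] (1 : Aᵐᵒᵖ)) * e₀ = ((1 : A) ⊗ₜ[R] MulOpposite.op b) * e₀)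
    (w : A ⊗[R] Aᵐᵒᵖ) :
    w * e₀ = (AlgHom.mulLeftRight R A w 1 ⊗ₜ[R] (1 : Aᵐᵒᵖ)) * e₀ := by
  induction w using TensorProduct.induction_on with
  | zero => simp
  | add x y hx hy => rw [add_mul, hx, hy, map_add, LinearMap.add_apply, TensorProduct.add_tmul,
      add_mul]
  | tmul a b =>
    have h1 : a ⊗ₜ[R] b = (a ⊗ₜ[R] (1 : Aᵐᵒᵖ)) * ((1 : A) ⊗ₜ[R] b) := by
      rw [Algebra.TensorProduct.tmul_mul_tmul, mul_one, one_mul]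
    have h2 := h b.unop
    rw [MulOpposite.op_unop] at h2
    rw [h1, mul_assoc, ← h2, ← mul_assoc, Algebra.TensorProduct.tmul_mul_tmul, one_mul, ← h1,
      AlgHom.mulLeftRight_apply, mul_one]

lemma mulLeftRight_left_mul (a : A) (w : A ⊗[R] Aᵐᵒᵖ) (x : A) :
    AlgHom.mulLeftRight R A ((a ⊗ₜ[R] (1 : Aᵐᵒᵖ)) * w) x = a * AlgHom.mulLeftRight R A w x := by
  rw [map_mul, Module.End.mul_apply, AlgHom.mulLeftRight_apply]; simp

lemma mulLeftRight_right_mul (a : A) (w : A ⊗[R] Aᵐᵒᵖ) (x : A) :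
    AlgHom.mulLeftRight R A (((1 : A) ⊗ₜ[R] MulOpposite.op a) * w) x =
      AlgHom.mulLeftRight R A w x * a := by
  rw [map_mul, Module.End.mul_apply, AlgHom.mulLeftRight_apply]; simp

/-- An algebra with a splitting of the identity of its enveloping algebra through central maps is
Azumaya. -/
theorem isAzumaya_of_splitting {ι : Type*} [Fintype ι] (e : ι → A) (t : ι → A →ₗ[R] R)
    (ε : ι → A ⊗[R] Aᵐᵒᵖ)
    (h₁ : ∀ c x, AlgHom.mulLeftRight R A (ε c) x = algebraMap R A (t c x))
    (h₂ : ∀ c b, (b ⊗ₜ[R] (1 : Aᵐᵒᵖ)) * ε c = ((1 : A) ⊗ₜ[R] MulOpposite.op b) * ε c)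
    (h₃ : ∑ c, (e c ⊗ₜ[R] (1 : Aᵐᵒᵖ)) * ε c = 1)
    (hR : Function.Injective (algebraMap R A)) : IsAzumaya R A := by
  have key : ∀ x, ∑ c, t c x • e c = x := fun x => by
    have := congrArg (fun w => AlgHom.mulLeftRight R A w x) h₃
    simp only [map_sum, LinearMap.sum_apply, mulLeftRight_left_mul, h₁, map_one,
      Module.End.one_apply] at this
    refine Eq.trans ?_ this
    exact Finset.sum_congr rfl fun c _ => by rw [Algebra.smul_def, Algebra.commutes]
  have fin : Module.Finite R A := Module.Finite.of_surjective (Fintype.linearCombination R e)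
    fun x => ⟨fun c => t c x, key x⟩
  have proj : Module.Projective R A := Module.Projective.of_split (LinearMap.pi t)
    (Fintype.linearCombination R e) (LinearMap.ext key)
  have faith : FaithfulSMul R A := (faithfulSMul_iff_algebraMap_injective R A).mpr hR
  refine ⟨⟨(injective_iff_map_eq_zero _).mpr fun w hw => ?_, fun φ => ?_⟩⟩
  · rw [← mul_one w, ← h₃, Finset.mul_sum]
    refine Finset.sum_eq_zero fun c _ => ?_
    rw [← mul_assoc, mul_tensor_eq (h₂ c), map_mul, hw, zero_mul, LinearMap.zero_apply,
      TensorProduct.zero_tmul, zero_mul]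
  · refine ⟨∑ c, (φ (e c) ⊗ₜ[R] (1 : Aᵐᵒᵖ)) * ε c, LinearMap.ext fun x => ?_⟩
    rw [map_sum, LinearMap.sum_apply]
    simp only [mulLeftRight_left_mul, h₁]
    conv_rhs => rw [← key x, map_sum]
    exact Finset.sum_congr rfl fun c _ => by
      rw [map_smul, Algebra.smul_def, Algebra.commutes]

/-- Azumaya algebras have splittings of the identity of their enveloping algebras. -/
theorem exists_splitting (R A : Type*) [CommRing R] [Ring A] [Algebra R A] [IsAzumaya R A] :
    ∃ (n : ℕ) (e : Fin n → A) (t : Fin n → A →ₗ[R] R) (ε : Fin n → A ⊗[R] Aᵐᵒᵖ),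
      (∀ c x, AlgHom.mulLeftRight R A (ε c) x = algebraMap R A (t c x)) ∧
      (∀ c b, (b ⊗ₜ[R] (1 : Aᵐᵒᵖ)) * ε c = ((1 : A) ⊗ₜ[R] MulOpposite.op b) * ε c) ∧
      ∑ c, (e c ⊗ₜ[R] (1 : Aᵐᵒᵖ)) * ε c = 1 := by
  obtain ⟨n, t, e, h⟩ := exists_dual_basis R A
  have hb : Function.Bijective (AlgHom.mulLeftRight R A) := IsAzumaya.bij
  choose ε hε using fun c => hb.2 ((Algebra.linearMap R A).comp (t c))
  have h₁ : ∀ c x, AlgHom.mulLeftRight R A (ε c) x = algebraMap R A (t c x) := fun c x => by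
    rw [hε]; rfl
  refine ⟨n, e, t, ε, h₁, fun c b => hb.1 (LinearMap.ext fun x => ?_),
    hb.1 (LinearMap.ext fun x => ?_)⟩
  · rw [mulLeftRight_left_mul, mulLeftRight_right_mul, h₁, Algebra.commutes]
  · rw [map_sum, LinearMap.sum_apply]
    simp only [mulLeftRight_left_mul, h₁, map_one, Module.End.one_apply]
    refine Eq.trans ?_ (h x)
    exact Finset.sum_congr rfl fun c _ => by rw [Algebra.smul_def, Algebra.commutes]

/-- A separable algebra whose centre is the base ring is Azumaya if its separability element
generates the enveloping algebra. -/
theorem isAzumaya_of_casimir {ι : Type*} [Fintype ι] (e₀ : A ⊗[R] Aᵐᵒᵖ) (a v : ι → A)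
    (h₂ : ∀ b, (b ⊗ₜ[R] (1 : Aᵐᵒᵖ)) * e₀ = ((1 : A) ⊗ₜ[R] MulOpposite.op b) * e₀)
    (h₃ : ∑ c, (a c ⊗ₜ[R] (1 : Aᵐᵒᵖ)) * (e₀ * (v c ⊗ₜ[R] (1 : Aᵐᵒᵖ))) = 1)
    (hR : Function.Injective (algebraMap R A))
    (hC : ∀ x : A, (∀ y, y * x = x * y) → ∃ r, algebraMap R A r = x) : IsAzumaya R A := by
  let eqv := LinearEquiv.ofInjective (Algebra.linearMap R A) hR
  have hm : ∀ c x, AlgHom.mulLeftRight R A (e₀ * (v c ⊗ₜ[R] (1 : Aᵐᵒᵖ))) x ∈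
      LinearMap.range (Algebra.linearMap R A) := fun c x =>
    hC _ fun y => by
      rw [← mulLeftRight_left_mul, ← mulLeftRight_right_mul, ← mul_assoc, h₂, mul_assoc]
  refine isAzumaya_of_splitting a
    (fun c => eqv.symm.toLinearMap ∘ₗ LinearMap.codRestrict _ _ (hm c))
    (fun c => e₀ * (v c ⊗ₜ[R] (1 : Aᵐᵒᵖ))) (fun c x => ?_)
    (fun c b => by rw [← mul_assoc, h₂, mul_assoc]) h₃ hR
  have := congrArg Subtype.val (eqv.apply_symm_apply (LinearMap.codRestrict _ _ (hm c) x))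
  exact this.symm

/-- Azumaya algebras are stable under base change. -/
theorem isAzumaya_baseChange {R S A : Type u} [CommRing R] [CommRing S] [Algebra R S] [Ring A]
    [Algebra R A] [IsAzumaya R A] (l : A →ₗ[R] R) (hl : l 1 = 1) :
    IsAzumaya S (S ⊗[R] A) := by
  obtain ⟨n, e, t, ε, h₁, h₂, h₃⟩ := exists_splitting R A
  let i : A →ₐ[R] S ⊗[R] A := Algebra.TensorProduct.includeRight
  let j : Aᵐᵒᵖ →ₐ[R] (S ⊗[R] A)ᵐᵒᵖ := i.op
  let Φ : A ⊗[R] Aᵐᵒᵖ →ₐ[R] (S ⊗[R] A) ⊗[S] (S ⊗[R] A)ᵐᵒᵖ :=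
    Algebra.TensorProduct.lift
      ((Algebra.TensorProduct.includeLeft (R := S) (S := S) (A := S ⊗[R] A)
        (B := (S ⊗[R] A)ᵐᵒᵖ)).restrictScalars R |>.comp i)
      (((Algebra.TensorProduct.includeRight (R := S) (A := S ⊗[R] A)
        (B := (S ⊗[R] A)ᵐᵒᵖ)).restrictScalars R).comp j)
      (fun a b => by
        change ((i a) ⊗ₜ[S] (1 : (S ⊗[R] A)ᵐᵒᵖ)) * ((1 : S ⊗[R] A) ⊗ₜ[S] (j b)) =
          ((1 : S ⊗[R] A) ⊗ₜ[S] (j b)) * ((i a) ⊗ₜ[S] (1 : (S ⊗[R] A)ᵐᵒᵖ))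
        simp)
  have hΦ : ∀ a b, Φ (a ⊗ₜ b) = i a ⊗ₜ[S] j b := fun a b => by
    change ((i a) ⊗ₜ[S] (1 : (S ⊗[R] A)ᵐᵒᵖ)) * ((1 : S ⊗[R] A) ⊗ₜ[S] (j b)) = _
    simp
  have hμ : ∀ (w : A ⊗[R] Aᵐᵒᵖ) (r : S) (x : A),
      AlgHom.mulLeftRight S (S ⊗[R] A) (Φ w) (r ⊗ₜ x) = r ⊗ₜ (AlgHom.mulLeftRight R A w x) := by
    intro w r x
    induction w using TensorProduct.induction_on with
    | zero => simp
    | add y z hy hz => rw [map_add, map_add, LinearMap.add_apply, hy, hz, map_add,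
        LinearMap.add_apply, TensorProduct.tmul_add]
    | tmul a b =>
      rw [hΦ, AlgHom.mulLeftRight_apply, AlgHom.mulLeftRight_apply]
      change (1 : S) ⊗ₜ[R] a * r ⊗ₜ[R] x * (1 : S) ⊗ₜ[R] b.unop = _
      simp
  let T : (A →ₗ[R] R) → (S ⊗[R] A →ₗ[S] S) := fun t =>
    (TensorProduct.AlgebraTensorModule.rid R S S).toLinearMap ∘ₗ t.baseChange S
  have hT : ∀ (t : A →ₗ[R] R) s x, T t (s ⊗ₜ x) = t x • s := fun t s x => by
    simp [T]
  have h2 : ∀ c b, (b ⊗ₜ[S] 1) * Φ (ε c) = (1 ⊗ₜ[S] MulOpposite.op b) * Φ (ε c) := by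
    intro c b
    induction b using TensorProduct.induction_on with
    | zero => simp
    | add y z hy hz => rw [TensorProduct.add_tmul, add_mul, hy, hz, MulOpposite.op_add,
        TensorProduct.tmul_add, add_mul]
    | tmul r b =>
      have h := congrArg Φ (h₂ c b)
      rw [map_mul, map_mul, hΦ, hΦ, map_one, map_one] at h
      have h' : r ⊗ₜ[R] b = r • i b := by
        change _ = r • ((1 : S) ⊗ₜ[R] b)
        rw [TensorProduct.smul_tmul', smul_eq_mul, mul_one]
      rw [h', ← TensorProduct.smul_tmul', MulOpposite.op_smul, TensorProduct.tmul_smul,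
        smul_mul_assoc, smul_mul_assoc]
      exact congrArg (r • ·) h
  refine isAzumaya_of_splitting (fun c => i (e c)) (fun c => T (t c)) (fun c => Φ (ε c))
    (fun c x => ?_) h2 ?_ ?_
  · induction x using TensorProduct.induction_on with
    | zero => simp
    | add y z hy hz => rw [map_add, hy, hz, map_add, map_add]
    | tmul r x =>
      rw [hμ, h₁, hT, Algebra.TensorProduct.algebraMap_apply, Algebra.algebraMap_self_apply,
        Algebra.algebraMap_eq_smul_one, TensorProduct.tmul_smul, TensorProduct.smul_tmul']
  · have := congrArg Φ h₃
    rw [map_sum, map_one] at this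
    rw [← this]
    exact Finset.sum_congr rfl fun c _ => by rw [map_mul, hΦ, map_one]
  · refine Function.LeftInverse.injective (g := T l) fun r => ?_
    rw [Algebra.TensorProduct.algebraMap_apply, hT, hl, one_smul]; rfl

end Azumaya
end EquivSheaf

end

noncomputable section
namespace EquivSheaf

section Casimir
variable {k B : Type*} [Field k] [Ring B] [Algebra k B] {ι : Type*} [Fintype ι]

/-- Semisimple rings are von Neumann regular. -/
lemma exists_mul_mul_eq [IsSemisimpleRing B] (x : B) : ∃ y, x * y * x = x := by
  obtain ⟨h, hh⟩ := IsSemisimpleModule.extension_property (R := B) (Submodule.span B {x}).subtype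
    Subtype.val_injective LinearMap.id
  obtain ⟨y, hy⟩ := Submodule.mem_span_singleton.mp (h 1).2
  refine ⟨y, ?_⟩
  have h1 := congrArg Subtype.val (LinearMap.congr_fun hh ⟨x, Submodule.mem_span_singleton_self x⟩)
  have h2 : h x = x • h 1 := by rw [← map_smul, smul_eq_mul, mul_one]
  rw [mul_assoc, ← smul_eq_mul y, hy]
  exact (congrArg Subtype.val h2).symm.trans h1

variable (k B) in
/-- The trace of the regular representation. -/
def regTrace : B →ₗ[k] k := LinearMap.trace k B ∘ₗ (LinearMap.mul k B)

lemma regTrace_comm (x y : B) : regTrace k B (x * y) = regTrace k B (y * x) := by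
  change LinearMap.trace k B (LinearMap.mulLeft k (x * y)) =
    LinearMap.trace k B (LinearMap.mulLeft k (y * x))
  rw [LinearMap.mulLeft_mul, LinearMap.mulLeft_mul]
  exact LinearMap.trace_mul_comm k _ _

lemma regTrace_nondegenerate [FiniteDimensional k B] [CharZero k] [IsSemisimpleRing B] {x : B}
    (h : ∀ y, regTrace k B (x * y) = 0) : x = 0 := by
  obtain ⟨y, hy⟩ := exists_mul_mul_eq x
  have hi : IsIdempotentElem (LinearMap.mulLeft k (x * y)) := by
    change _ ∘ₗ _ = _
    rw [← LinearMap.mulLeft_mul, ← mul_assoc, hy]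
  have h0 := (LinearMap.IsIdempotentElem.trace_eq_zero_iff hi).mp (h y)
  have h1 : x * y = 0 := by
    have := LinearMap.congr_fun h0 1
    rwa [LinearMap.mulLeft_apply, mul_one] at this
  rw [← hy, h1, zero_mul]

variable (k) in
/-- A pair of dual bases for a symmetric linear form on an algebra. -/
structure DualBases (l : B →ₗ[k] k) (b d : ι → B) : Prop where
  symm : ∀ x y, l (x * y) = l (y * x)
  left : ∀ x, ∑ i, l (x * d i) • b i = x
  right : ∀ x, ∑ i, l (x * b i) • d i = x
  trace : ∀ f : B →ₗ[k] B, LinearMap.trace k B f = ∑ i, l (f (b i) * d i)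

variable (k B) in
lemma exists_dualBases [FiniteDimensional k B] [CharZero k] [IsSemisimpleRing B] :
    ∃ (n : ℕ) (b d : Fin n → B), DualBases k (regTrace k B) b d := by
  let F : LinearMap.BilinForm k B := (LinearMap.mul k B).compr₂ (regTrace k B)
  have hs : F.IsSymm := ⟨fun x y => regTrace_comm x y⟩
  have hF : F.Nondegenerate := by
    refine (LinearMap.BilinForm.IsSymm.isRefl hs).nondegenerate_iff_separatingLeft.mpr ?_
    exact fun x h => regTrace_nondegenerate h
  let b := Module.finBasis k B
  let d := F.dualBasis hF b
  have hd : ∀ x i, b.repr x i = regTrace k B (x * d i) := fun x i => by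
    conv_rhs => rw [← b.sum_repr x]
    rw [Finset.sum_mul, map_sum, Finset.sum_eq_single i]
    · rw [smul_mul_assoc, map_smul]
      have := LinearMap.BilinForm.apply_dualBasis_right hF hs b i i
      rw [if_pos rfl] at this
      change _ = _ • F (b i) (d i)
      rw [this, smul_eq_mul, mul_one]
    · intro j _ hj
      have := LinearMap.BilinForm.apply_dualBasis_right hF hs b j i
      rw [if_neg hj] at this
      rw [smul_mul_assoc, map_smul]
      change _ • F (b j) (d i) = 0
      rw [this, smul_zero]
    · simp
  refine ⟨_, b, d, ⟨regTrace_comm, fun x => ?_, fun x => ?_, fun f => ?_⟩⟩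
  · conv_rhs => rw [← b.sum_repr x]
    exact Finset.sum_congr rfl fun i _ => by rw [hd]
  · conv_rhs => rw [← d.sum_repr x]
    exact Finset.sum_congr rfl fun i _ => by
      rw [LinearMap.BilinForm.dualBasis_repr_apply]; rfl
  · rw [LinearMap.trace_eq_matrix_trace k b]
    exact Finset.sum_congr rfl fun i _ => by
      rw [Matrix.diag_apply, LinearMap.toMatrix_apply, hd]

namespace DualBases
variable {l : B →ₗ[k] k} {b d : ι → B}

lemma sum_left (D : DualBases k l b d) {M : Type*} [AddCommGroup M] (ψ : B →+ B →+ M)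
    (hψ : ∀ (c : k) x y, ψ (c • x) y = ψ x (c • y)) (x : B) :
    ∑ i, ψ (x * b i) (d i) = ∑ i, ψ (b i) (d i * x) := by
  have h1 : ∀ i, ψ (x * b i) (d i) = ∑ j, ψ (b j) (l (d j * x * b i) • d i) := fun i => by
    conv_lhs => rw [← D.left (x * b i)]
    rw [map_sum, AddMonoidHom.finsetSum_apply]
    exact Finset.sum_congr rfl fun j _ => by rw [hψ, D.symm, mul_assoc]
  rw [Finset.sum_congr rfl fun i _ => h1 i, Finset.sum_comm]
  exact Finset.sum_congr rfl fun j _ => by rw [← map_sum, D.right]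

lemma sum_right (D : DualBases k l b d) {M : Type*} [AddCommGroup M] (ψ : B →+ B →+ M)
    (hψ : ∀ (c : k) x y, ψ (c • x) y = ψ x (c • y)) (x : B) :
    ∑ i, ψ (b i * x) (d i) = ∑ i, ψ (b i) (x * d i) := by
  have h1 : ∀ i, ψ (b i * x) (d i) = ∑ j, ψ (b j) (l (x * d j * b i) • d i) := fun i => by
    conv_lhs => rw [← D.left (b i * x)]
    rw [map_sum, AddMonoidHom.finsetSum_apply]
    exact Finset.sum_congr rfl fun j _ => by rw [hψ, mul_assoc, D.symm]
  rw [Finset.sum_congr rfl fun i _ => h1 i, Finset.sum_comm]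
  exact Finset.sum_congr rfl fun j _ => by rw [← map_sum, D.right]

variable (b d) in
/-- The sandwich operator `x ↦ ∑ bᵢ x dᵢ`. -/
def avg : B →ₗ[k] B := ∑ i, LinearMap.mulRight k (d i) ∘ₗ LinearMap.mulLeft k (b i)

lemma avg_apply (x : B) : avg (k := k) b d x = ∑ i, b i * x * d i := by
  rw [avg, LinearMap.sum_apply]; rfl

lemma avg_central (D : DualBases k l b d) (x y : B) : y * avg (k := k) b d x = avg (k := k) b d x * y := by
  have := D.sum_left (AddMonoidHom.mul.comp (AddMonoidHom.mulRight x)) (fun c u v => by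
    change c • u * x * v = u * x * (c • v)
    simp) y
  rw [avg_apply, Finset.mul_sum, Finset.sum_mul]
  refine Eq.trans (Finset.sum_congr rfl fun i _ => ?_) (this.trans
    (Finset.sum_congr rfl fun i _ => ?_))
  · change _ = y * b i * x * d i
    simp only [mul_assoc]
  · change b i * x * (d i * y) = _
    simp only [mul_assoc]

lemma avg_comm (D : DualBases k l b d) (x y : B) : avg (k := k) b d (x * y) = avg (k := k) b d (y * x) := by
  have := D.sum_right (AddMonoidHom.mul.comp (AddMonoidHom.mulRight y)) (fun c u v => by
    change c • u * y * v = u * y * (c • v)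
    simp) x
  rw [avg_apply, avg_apply]
  refine Eq.trans (Finset.sum_congr rfl fun i _ => ?_) (this.trans
    (Finset.sum_congr rfl fun i _ => ?_))
  · change _ = b i * x * y * d i
    simp only [mul_assoc]
  · change b i * y * (x * d i) = _
    simp only [mul_assoc]

lemma avg_mul {z : B} (hz : ∀ y, y * z = z * y) (x : B) :
    avg (k := k) b d (z * x) = z * avg (k := k) b d x := by
  rw [avg_apply, avg_apply, Finset.mul_sum]
  exact Finset.sum_congr rfl fun i _ => by
    rw [← mul_assoc, hz, mul_assoc, mul_assoc, mul_assoc]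

variable (k b d) in
/-- The value `∑ bⱼ bᵢ dⱼ dᵢ`. -/
def twist : B := ∑ i, avg (k := k) b d (b i) * d i

lemma twist_central (D : DualBases k l b d) (y : B) : y * twist k b d = twist k b d * y := by
  let ψ : B →+ B →+ B := AddMonoidHom.mul.comp (avg (k := k) b d).toAddMonoidHom
  have hψ : ∀ (c : k) u v, ψ (c • u) v = ψ u (c • v) := fun c u v => by
    change avg (k := k) b d (c • u) * v = avg (k := k) b d u * (c • v)
    rw [map_smul, smul_mul_assoc, mul_smul_comm]
  have h1 := D.sum_left ψ hψ y
  have h2 := D.sum_right ψ hψ y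
  rw [twist, Finset.mul_sum, Finset.sum_mul]
  calc ∑ i, y * (avg (k := k) b d (b i) * d i) = ∑ i, ψ (b i) (y * d i) :=
        Finset.sum_congr rfl fun i _ => by
          rw [← mul_assoc, D.avg_central, mul_assoc]; rfl
    _ = ∑ i, ψ (b i * y) (d i) := h2.symm
    _ = ∑ i, ψ (y * b i) (d i) := Finset.sum_congr rfl fun i _ =>
        congrArg (· * d i) (D.avg_comm (b i) y)
    _ = ∑ i, ψ (b i) (d i * y) := h1
    _ = _ := Finset.sum_congr rfl fun i _ => (mul_assoc _ _ _).symm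

lemma avg_one {b d : ι → B} (D : DualBases k (regTrace k B) b d) :
    avg (k := k) b d 1 = 1 := by
  have h : ∀ x, regTrace k B ((avg (k := k) b d 1 - 1) * x) = 0 := fun x => by
    rw [sub_mul, map_sub, one_mul, avg_apply, Finset.sum_mul, map_sum, sub_eq_zero]
    refine Eq.trans (Finset.sum_congr rfl fun i _ => ?_)
      (D.trace (LinearMap.mulLeft k x)).symm
    rw [mul_one, D.symm, ← mul_assoc]; rfl
  rw [← sub_eq_zero, ← D.left (avg (k := k) b d 1 - 1)]
  exact Finset.sum_eq_zero fun i _ => by rw [h, zero_smul]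

lemma exists_mul_twist_eq_one [FiniteDimensional k B] [CharZero k] [IsSemisimpleRing B]
    {b d : ι → B} (D : DualBases k (regTrace k B) b d) :
    ∃ z, (∀ y, y * z = z * y) ∧ twist k b d * z = 1 := by
  obtain ⟨y, hy⟩ := exists_mul_mul_eq (twist k b d)
  set w := twist k b d
  set z := avg (k := k) b d y
  have hw : ∀ y, y * w = w * y := D.twist_central
  have hz : ∀ y, y * z = z * y := D.avg_central y
  have h1 : w * z * w = w := by
    have h2 := congrArg (avg (k := k) b d) hy
    rw [mul_assoc, avg_mul hw, hw, avg_mul hw, ← mul_one w, avg_mul hw, D.avg_one, mul_one] at h2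
    rw [mul_assoc, hw z, h2]
  refine ⟨z, hz, ?_⟩
  set e := 1 - w * z
  have he : e * e = e := by
    have : w * z * (w * z) = w * z := by rw [← mul_assoc, h1]
    simp only [e, mul_sub, sub_mul, one_mul, mul_one, this, sub_self, sub_zero]
  have hec : ∀ y, y * e = e * y := fun y => by
    simp only [e, mul_sub, sub_mul, one_mul, mul_one]
    rw [← mul_assoc, hw, mul_assoc, hz, mul_assoc]
  have hew : e * w = 0 := by
    simp only [e, sub_mul, one_mul, h1, sub_self]
  let f : B →ₗ[k] B := LinearMap.mulLeft k e ∘ₗ avg (k := k) b d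
  have hf : ∀ x, f x = e * avg (k := k) b d x := fun x => rfl
  have hi : IsIdempotentElem f := LinearMap.ext fun x => by
    change f (f x) = f x
    rw [hf, hf, avg_mul hec, ← mul_assoc, he, ← mul_one (avg (k := k) b d x),
      avg_mul (D.avg_central x), D.avg_one]
  have h0 := (LinearMap.IsIdempotentElem.trace_eq_zero_iff hi).mp (by
    rw [D.trace]
    refine Eq.trans ?_ (congrArg (regTrace k B) hew |>.trans (map_zero _))
    rw [← map_sum]
    refine congrArg _ ?_
    simp only [w, twist, Finset.mul_sum, hf, mul_assoc])
  have h3 : e = 0 := by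
    have := LinearMap.congr_fun h0 1
    rwa [hf, D.avg_one, mul_one] at this
  exact (sub_eq_zero.mp h3).symm

end DualBases

/-- A semisimple algebra over a field of characteristic zero is Azumaya over its centre. -/
theorem isAzumaya_of_isSemisimpleRing (k : Type*) {R A : Type*} [Field k] [CharZero k]
    [CommRing R] [Ring A] [Algebra k R] [Algebra k A] [Algebra R A] [IsScalarTower k R A]
    [FiniteDimensional k A] [IsSemisimpleRing A] (hR : Function.Injective (algebraMap R A))
    (hC : ∀ x : A, (∀ y, y * x = x * y) → ∃ r, algebraMap R A r = x) : IsAzumaya R A := by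
  obtain ⟨n, b, d, D⟩ := exists_dualBases k A
  obtain ⟨z, hz, hwz⟩ := D.exists_mul_twist_eq_one
  obtain ⟨r, rfl⟩ := hC z hz
  let ψ : A →+ A →+ A ⊗[R] Aᵐᵒᵖ := AddMonoidHom.mk'
    (fun x => AddMonoidHom.mk' (fun y => x ⊗ₜ MulOpposite.op y)
      fun y y' => TensorProduct.tmul_add _ _ _)
    fun x x' => AddMonoidHom.ext fun y => TensorProduct.add_tmul _ _ _
  have hψ : ∀ (c : k) x y, ψ (c • x) y = ψ x (c • y) := fun c x y => by
    change (c • x) ⊗ₜ[R] MulOpposite.op y = x ⊗ₜ[R] (c • MulOpposite.op y)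
    rw [← algebraMap_smul R c x, TensorProduct.smul_tmul, algebraMap_smul]
  choose t ht using fun i => hC (DualBases.avg (k := k) b d (b i)) (D.avg_central (b i))
  refine isAzumaya_of_casimir (∑ i, b i ⊗ₜ[R] MulOpposite.op (d i)) b (fun i => r • d i)
    (fun x => ?_) ?_ hR hC
  · rw [Finset.mul_sum, Finset.mul_sum]
    refine Eq.trans (Finset.sum_congr rfl fun i _ => ?_) ((D.sum_left ψ hψ x).trans
      (Finset.sum_congr rfl fun i _ => ?_))
    · rw [Algebra.TensorProduct.tmul_mul_tmul, one_mul]; rfl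
    · rw [Algebra.TensorProduct.tmul_mul_tmul, one_mul]; rfl
  · have h1 : ∀ j, (b j ⊗ₜ[R] (1 : Aᵐᵒᵖ)) * ((∑ i, b i ⊗ₜ[R] MulOpposite.op (d i)) *
        ((r • d j) ⊗ₜ[R] (1 : Aᵐᵒᵖ))) =
        ∑ i, (r • (b j * b i * d j)) ⊗ₜ[R] MulOpposite.op (d i) := fun j => by
      rw [Finset.sum_mul, Finset.mul_sum]
      refine Finset.sum_congr rfl fun i _ => ?_
      rw [Algebra.TensorProduct.tmul_mul_tmul, Algebra.TensorProduct.tmul_mul_tmul, one_mul,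
        mul_one, mul_smul_comm, mul_smul_comm, mul_assoc]
    rw [Finset.sum_congr rfl fun j _ => h1 j, Finset.sum_comm]
    have h2 : ∀ i, ∑ j, (r • (b j * b i * d j)) ⊗ₜ[R] MulOpposite.op (d i) =
        (1 : A) ⊗ₜ[R] MulOpposite.op (DualBases.avg (k := k) b d (b i) * d i *
          algebraMap R A r) := fun i => by
      rw [← TensorProduct.sum_tmul, ← Finset.smul_sum, ← DualBases.avg_apply (k := k), ← ht,
        Algebra.algebraMap_eq_smul_one (t i), smul_smul, TensorProduct.smul_tmul,
        ← MulOpposite.op_smul, smul_mul_assoc, one_mul, smul_mul_assoc,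
        ← Algebra.commutes r (d i), ← Algebra.smul_def, smul_smul, mul_comm]
    rw [Finset.sum_congr rfl fun i _ => h2 i]
    refine (map_sum (ψ 1) _ _).symm.trans ?_
    rw [← Finset.sum_mul]
    exact congrArg (ψ 1) hwz

end Casimir
end EquivSheaf

end

noncomputable section
namespace EquivSheaf

section Centre
variable {k : Type u} [Field k] [CharZero k] {G H : Type u} [Group G] [Finite G] [Group H]
  {π : G →* H}

variable (k π) in
lemma isSemisimpleRing_monoidAlgebra : IsSemisimpleRing (MonoidAlgebra k π.ker) := by
  have : NeZero (Nat.card π.ker : k) := ⟨by exact_mod_cast Nat.card_pos.ne'⟩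
  infer_instance

instance finite_ZN : Module.Finite k (ZN k π) :=
  Module.Finite.of_injective (ZN.incl π).toLinearMap (ZN.incl_injective π)

instance isSemisimpleRing_ZN : IsSemisimpleRing (ZN k π) := by
  have h1 := isSemisimpleRing_monoidAlgebra k π
  have : IsReduced (ZN k π) := by
    refine isReduced_iff_pow_one_lt 2 one_lt_two |>.mpr fun z hz => ?_
    obtain ⟨y, hy⟩ := exists_mul_mul_eq (ZN.incl π z)
    refine ZN.incl_injective π ?_
    rw [map_zero, ← hy, mul_assoc, ← ZN.incl_comm, mul_assoc, ← map_mul, ← sq, hz, map_zero,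
      mul_zero]
  have : IsArtinianRing (ZN k π) := IsArtinianRing.of_finite k _
  exact IsArtinianRing.isSemisimpleRing_of_isReduced _

variable {V : Type u} [AddCommGroup V] [Module k V] {σ : Representation k G V}

lemma centerToEndN_eq_smul (z : ZN k π) (v : (resN π σ).asModule) :
    endNEquiv σ (centerToEndN π σ z) v = ZN.incl π z • v := rfl

lemma IsNGenerator.eq_zero_of_smul (hσ : IsNGenerator π σ) {x : MonoidAlgebra k π.ker}
    (h : ∀ v : (resN π σ).asModule, x • v = 0) : x = 0 := by
  obtain ⟨n, p, v, hpv⟩ := hσ.exists_sum_eq_one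
  rw [← mul_one x, ← hpv, Finset.mul_sum]
  exact Finset.sum_eq_zero fun j _ => by rw [← smul_eq_mul, ← map_smul, h, map_zero]

lemma IsNGenerator.centerToEndN_injective (hσ : IsNGenerator π σ) :
    Function.Injective (centerToEndN π σ) := by
  refine (injective_iff_map_eq_zero _).mpr fun z hz => ZN.incl_injective π ?_
  rw [map_zero]
  refine hσ.eq_zero_of_smul fun v => ?_
  rw [← centerToEndN_eq_smul, hz, map_zero]; rfl

lemma IsNGenerator.exists_centerToEndN (hσ : IsNGenerator π σ) (ζ : EndN π σ)
    (hζ : ∀ φ, φ * ζ = ζ * φ) : ∃ z, centerToEndN π σ z = ζ := by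
  obtain ⟨n, p, v, hpv⟩ := hσ.exists_sum_eq_one
  let f := endNEquiv σ ζ
  have hf : ∀ φ : Module.End (MonoidAlgebra k π.ker) (resN π σ).asModule, φ * f = f * φ :=
    fun φ => by
      have := congrArg (endNEquiv σ) (hζ ((endNEquiv σ).symm φ))
      rwa [map_mul, map_mul, RingEquiv.apply_symm_apply] at this
  let x : MonoidAlgebra k π.ker := ∑ j, p j (f (v j))
  have hx : ∀ u, x • u = f u := fun u => by
    have h1 : ∀ j, p j (f (v j)) • u = f (p j (v j) • u) := fun j =>
      LinearMap.congr_fun (hf ((p j).smulRight u)) (v j)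
    rw [Finset.sum_smul, Finset.sum_congr rfl fun j _ => h1 j, ← map_sum, ← Finset.sum_smul, hpv,
      one_smul]
  have hc : x ∈ Subalgebra.center k (MonoidAlgebra k π.ker) := by
    refine Subalgebra.mem_center_iff.mpr fun y => ?_
    rw [← sub_eq_zero]
    refine hσ.eq_zero_of_smul fun u => ?_
    rw [sub_smul, mul_smul, mul_smul, hx, hx, map_smul, sub_self]
  exact ⟨⟨x, hc⟩, (endNEquiv σ).injective (LinearMap.ext hx)⟩

lemma centerToEndN_algebraMap (c : k) :
    centerToEndN π σ (algebraMap k (ZN k π) c) = algebraMap k (EndN π σ) c :=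
  Subtype.ext ((resN π σ).asAlgebraHom.commutes c)

lemma isSemisimpleRing_EndN [FiniteDimensional k V] : IsSemisimpleRing (EndN π σ)ᵐᵒᵖ := by
  have h1 := isSemisimpleRing_monoidAlgebra k π
  have h2 : Module.Finite k (resN π σ).asModule := inferInstanceAs (Module.Finite k V)
  have h3 : Module.Finite (MonoidAlgebra k π.ker) (resN π σ).asModule :=
    Module.Finite.of_restrictScalars_finite k _ _
  have h4 : IsSemisimpleRing (EndN π σ) := by
    have := IsSemisimpleRing.moduleEnd (MonoidAlgebra k π.ker) (resN π σ).asModule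
    exact (endNEquiv σ).symm.isSemisimpleRing
  infer_instance

theorem IsNGenerator.isAzumaya (hπ : Function.Surjective π) [FiniteDimensional k V]
    (hσ : IsNGenerator π σ) : IsAzumaya (ZN k π) (endAlgZ hπ σ).carrier := by
  let := centerAlgebra (k := k) π σ
  have := isSemisimpleRing_EndN (π := π) (σ := σ)
  have : IsScalarTower k (ZN k π) (EndN π σ)ᵐᵒᵖ := IsScalarTower.of_algebraMap_eq fun c =>
    congrArg MulOpposite.op (centerToEndN_algebraMap c).symm
  refine isAzumaya_of_isSemisimpleRing k (R := ZN k π) (A := (EndN π σ)ᵐᵒᵖ)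
    (fun z z' h => hσ.centerToEndN_injective (MulOpposite.op_injective h)) fun x hx => ?_
  obtain ⟨z, hz⟩ := hσ.exists_centerToEndN x.unop fun φ =>
    congrArg MulOpposite.unop (hx (MulOpposite.op φ)).symm
  exact ⟨z, congrArg MulOpposite.op hz⟩

end Centre

section Regular
variable (k : Type u) [Field k] (G : Type u) [Group G]

/-- The representation of a group on functions, by right translations. -/
def rightRegular : Representation k G (G → k) where
  toFun g := LinearMap.funLeft k k (· * g)
  map_one' := LinearMap.ext fun f => funext fun x => congrArg f (mul_one x)
  map_mul' g h := LinearMap.ext fun f => funext fun x => congrArg f (mul_assoc x g h).symm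

theorem isNGenerator_rightRegular [CharZero k] [Finite G] {H : Type u} [Group H] (π : G →* H) :
    IsNGenerator π (rightRegular k G) := by
  intro W _ _ ω hω
  have hs := (Representation.irreducible_iff_isSimpleModule_asModule ω).mp hω
  have hW : Nontrivial W := IsSimpleModule.nontrivial (MonoidAlgebra k π.ker) ω.asModule
  obtain ⟨w, hw⟩ := exists_ne (0 : W)
  obtain ⟨l, hl⟩ : ∃ l : Module.Dual k W, l w ≠ 0 := by
    by_contra! h
    exact hw ((Module.forall_dual_apply_eq_zero_iff k w).mp h)
  classical
  let i₀ : W →ₗ[k] (G → k) := LinearMap.pi fun x =>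
    if hx : x ∈ π.ker then l ∘ₗ ω ⟨x, hx⟩ else 0
  let i : ω.IntertwiningMap (resN π (rightRegular k G)) :=
    LinearMap.intertwiningMap_of_isIntertwiningMap ω _ i₀ fun n v => funext fun x => by
      change (if hx : x ∈ π.ker then l ∘ₗ ω ⟨x, hx⟩ else 0) (ω n v) =
        (if hx : x * n ∈ π.ker then l ∘ₗ ω ⟨x * n, hx⟩ else 0) v
      by_cases hx : x ∈ π.ker
      · have hxn : x * n ∈ π.ker := mul_mem hx n.2
        rw [dif_pos hx, dif_pos hxn]
        have : (⟨x * n, hxn⟩ : π.ker) = ⟨x, hx⟩ * n := rfl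
        rw [this, map_mul]; rfl
      · have hxn : x * n ∉ π.ker := fun h => hx ((mul_mem_cancel_right n.2).mp h)
        rw [dif_neg hx, dif_neg hxn]; rfl
  have hi : Function.Injective i := (Representation.IsIrreducible.injective_or_eq_zero i).resolve_right
    fun h => hl (by
      have h1 : i w 1 = 0 := by rw [h]; rfl
      change (if hx : (1 : G) ∈ π.ker then l ∘ₗ ω ⟨1, hx⟩ else 0) w = 0 at h1
      rw [dif_pos π.ker.one_mem] at h1
      have h2 : ω ⟨1, π.ker.one_mem⟩ = 1 := map_one ω
      rw [h2] at h1
      exact h1)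
  have hR := isSemisimpleRing_monoidAlgebra k π
  obtain ⟨p, hp⟩ := IsSemisimpleModule.extension_property
    (Representation.IntertwiningMap.equivLinearMapAsModule ω _ i) hi LinearMap.id
  exact ⟨i, (Representation.IntertwiningMap.equivLinearMapAsModule _ ω).symm p,
    fun w => LinearMap.congr_fun hp w⟩

end Regular
end EquivSheaf

end

noncomputable section
namespace EquivSheaf

section Pull
variable {R : Type u} [CommRing R] [IsSemisimpleRing R]

lemma exists_linearMap_one_eq_one (A : Type u) [Ring A] [Algebra R A] [FaithfulSMul R A] :
    ∃ l : A →ₗ[R] R, l 1 = 1 := by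
  obtain ⟨l, hl⟩ := IsSemisimpleModule.extension_property (Algebra.linearMap R A)
    (FaithfulSMul.algebraMap_injective R A) LinearMap.id
  exact ⟨l, (congrArg l (map_one (algebraMap R A)).symm).trans (LinearMap.congr_fun hl 1)⟩

/-- Pull-backs of Azumaya algebras are Azumaya. -/
theorem isAzumaya_pullAlg {X : Scheme.{u}} (f : X ⟶ Spec (.of R)) (A : Type u) [Ring A]
    [Algebra R A] [hA : IsAzumaya R A] : (pullAlg f A).IsAzumaya := by
  refine ⟨isCoherent_pullModule f A, fun U _ => ?_⟩
  obtain ⟨l, hl⟩ := exists_linearMap_one_eq_one (R := R) A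
  have h1 : IsAzumaya (FunSec f U) (PullSec f A U) := isAzumaya_baseChange l hl
  let a : Algebra (FunSec f U) ((pullAlg f A).Sec U) :=
    inferInstanceAs (Algebra Γ(X, U) ((pullAlg f A).Sec U))
  let e : PullSec f A U ≃ₐ[FunSec f U] (pullAlg f A).Sec U :=
    { toFun := fun x => x
      invFun := fun x => x
      left_inv := fun _ => rfl
      right_inv := fun _ => rfl
      map_mul' := fun _ _ => rfl
      map_add' := fun _ _ => rfl
      commutes' := fun r => Algebra.algebraMap_eq_smul_one (R := FunSec f U)
        (A := PullSec f A U) r }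
  exact IsAzumaya.of_AlgEquiv (FunSec f U) (PullSec f A U) ((pullAlg f A).Sec U) e

end Pull
end EquivSheaf

end

noncomputable section
namespace EquivSheaf

section RingMorita
variable {G : Type u} [Group G] {R : Type u} [CommRing R] {τ : G →* RingAut R}

lemma AddMonoid.End.map_inv_apply {M : Type*} [AddCommGroup M] (f : G →* AddMonoid.End M) (g : G)
    (x : M) : f g (f g⁻¹ x) = x := by
  have h := DFunLike.congr_fun (f.map_mul g g⁻¹) x
  rw [mul_inv_cancel, map_one] at h
  exact h.symm

lemma RMod.isIso_of_bijective {A : RAlg τ} {M N : RMod A} (φ : M ⟶ N)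
    (h : Function.Bijective φ.hom) : IsIso φ := by
  let e := LinearEquiv.ofBijective φ.hom h
  have he : ∀ n, φ.hom (e.symm n) = n := e.apply_symm_apply
  refine ⟨RMod.Hom.mk e.symm.toLinearMap (fun g n => h.1 ?_), RMod.Hom.ext ?_, RMod.Hom.ext ?_⟩
  · refine (he _).trans ?_
    rw [φ.map_act]
    exact congrArg (N.act g) (he n).symm
  · exact LinearMap.ext e.symm_apply_apply
  · exact LinearMap.ext he

namespace MoritaCtx
variable {A' A : RAlg τ} (c : MoritaCtx A' A)

/-- The linear maps from the bimodule of a Morita context. -/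
def Maps (M : RMod A) : Type u := c.Q →ₗ[A.carrier] M.carrier

namespace Maps
variable {c} {M : RMod A}

instance : AddCommGroup (c.Maps M) := inferInstanceAs (AddCommGroup (c.Q →ₗ[A.carrier] M.carrier))

instance : FunLike (c.Maps M) c.Q M.carrier :=
  inferInstanceAs (FunLike (c.Q →ₗ[A.carrier] M.carrier) c.Q M.carrier)

instance : LinearMapClass (c.Maps M) A.carrier c.Q M.carrier :=
  inferInstanceAs (LinearMapClass (c.Q →ₗ[A.carrier] M.carrier) A.carrier c.Q M.carrier)

@[ext] lemma ext {f g : c.Maps M} (h : ∀ q, f q = g q) : f = g := LinearMap.ext h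

lemma sum_apply {ι : Type*} (s : Finset ι) (f : ι → c.Maps M) (q : c.Q) :
    (∑ i ∈ s, f i) q = ∑ i ∈ s, f i q :=
  LinearMap.sum_apply s (fun i => (show c.Q →ₗ[A.carrier] M.carrier from f i)) q

instance : Module A'.carrier (c.Maps M) where
  smul a f :=
    { toFun := fun q => f (c.qr q a)
      map_add' := fun q q' => by rw [map_add, AddMonoidHom.add_apply, map_add]
      map_smul' := fun b q => by rw [c.qr_smul, map_smul]; rfl }
  one_smul f := ext fun q => congrArg f (c.qr_one q)
  mul_smul a b f := ext fun q => congrArg f (c.qr_mul q a b)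
  smul_zero a := rfl
  smul_add a f g := rfl
  add_smul a b f := ext fun q => by
    change f (c.qr q (a + b)) = f (c.qr q a) + f (c.qr q b)
    rw [map_add, map_add]
  zero_smul f := ext fun q => by
    change f (c.qr q 0) = 0
    rw [map_zero, map_zero]

lemma smul_apply (a : A'.carrier) (f : c.Maps M) (q : c.Q) : (a • f) q = f (c.qr q a) := rfl

instance : Module R (c.Maps M) := Module.compHom _ (algebraMap R A'.carrier)

instance : IsScalarTower R A'.carrier (c.Maps M) where
  smul_assoc r a f := by
    rw [Algebra.smul_def, mul_smul]; rfl

/-- The pairing with the other bimodule. -/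
def pair (p : c.P) : M.carrier →+ c.Maps M :=
  AddMonoidHom.mk' (fun m => (LinearMap.toSpanSingleton A.carrier M.carrier m).comp
    ({ toFun := fun q => c.qp q p
       map_add' := fun q q' => by rw [map_add]; rfl
       map_smul' := fun a q => c.qp_smul a q p } : c.Q →ₗ[A.carrier] A.carrier))
    fun m m' => ext fun q => smul_add (c.qp q p) m m'

lemma pair_apply (p : c.P) (m : M.carrier) (q : c.Q) : pair p m q = c.qp q p • m := rfl

lemma pair_add (p p' : c.P) (m : M.carrier) : pair (p + p') m = pair p m + pair p' m :=
  ext fun q => by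
    change c.qp q (p + p') • m = c.qp q p • m + c.qp q p' • m
    rw [map_add, add_smul]

lemma pair_pr (p : c.P) (a : A.carrier) (m : M.carrier) : pair (c.pr p a) m = pair p (a • m) :=
  ext fun q => by rw [pair_apply, pair_apply, c.qp_pr, mul_smul]

lemma smul_pair (a : A'.carrier) (p : c.P) (m : M.carrier) : a • pair p m = pair (a • p) m :=
  ext fun q => by rw [smul_apply, pair_apply, pair_apply, c.qp_bal]

lemma eq_sum {n : ℕ} {p : Fin n → c.P} {q : Fin n → c.Q} (h : ∑ i, c.pq (p i) (q i) = 1)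
    (f : c.Maps M) : f = ∑ i, pair (p i) (f (q i)) := ext fun x => by
  conv_lhs => rw [← c.qr_one x, ← h, map_sum, map_sum]
  rw [sum_apply]
  exact Finset.sum_congr rfl fun i _ => by rw [pair_apply, ← c.qp_assoc, map_smul]

instance [Module.Finite R A.carrier] : Module.Finite R (c.Maps M) := by
  obtain ⟨n, p, q, h⟩ := c.exists_pq
  let F : (Fin n → M.carrier) →ₗ[R] c.Maps M :=
    { toFun := fun m => ∑ i, pair (p i) (m i)
      map_add' := fun m m' => by
        rw [← Finset.sum_add_distrib]
        exact Finset.sum_congr rfl fun i _ => map_add _ _ _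
      map_smul' := fun r m => by
        change _ = algebraMap R A'.carrier r • ∑ i, (pair (p i) (m i) : c.Maps M)
        rw [Finset.smul_sum]
        refine Finset.sum_congr rfl fun i _ => ?_
        rw [smul_pair, ← c.pr_base]
        refine ext fun x => ?_
        change c.qp x (p i) • (r • m i) = c.qp x (c.pr (p i) _) • m i
        rw [c.qp_pr, mul_smul, algebraMap_smul] }
  exact Module.Finite.of_surjective F fun f => ⟨fun i => f (q i), (eq_sum h f).symm⟩

end Maps

/-- The equivariant module of maps from the bimodule of a Morita context. -/
def rObj [Module.Finite R A.carrier] (M : RMod A) : RMod A' where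
  carrier := c.Maps M
  act :=
    { toFun := fun h => AddMonoidHom.mk' (fun f =>
        { toFun := fun q => M.act h (f (c.actQ h⁻¹ q))
          map_add' := fun q q' => by rw [map_add, map_add, map_add]
          map_smul' := fun a q => by
            rw [c.actQ_smul, map_smul, M.act_smul, ← RingAut.mul_apply, ← map_mul, mul_inv_cancel,
              map_one]; rfl })
        fun f g => Maps.ext fun q => map_add (M.act h) _ _
      map_one' := AddMonoidHom.ext fun f => Maps.ext fun q => by
        change M.act 1 (f (c.actQ 1⁻¹ q)) = f q
        rw [inv_one, map_one, map_one]; rfl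
      map_mul' := fun g h => AddMonoidHom.ext fun f => Maps.ext fun q => by
        change M.act (g * h) (f (c.actQ (g * h)⁻¹ q)) =
          M.act g (M.act h (f (c.actQ h⁻¹ (c.actQ g⁻¹ q))))
        rw [mul_inv_rev, map_mul, map_mul]; rfl }
  act_smul h a f := Maps.ext fun q => by
    change M.act h (f (c.qr (c.actQ h⁻¹ q) a)) = M.act h (f (c.actQ h⁻¹ (c.qr q (A'.act h a))))
    rw [c.actQ_qr, ← RingAut.mul_apply, ← map_mul, inv_mul_cancel, map_one]; rfl

variable [Module.Finite R A.carrier]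

lemma rObj_act (M : RMod A) (h : G) (f : c.Maps M) (q : c.Q) :
    (show c.Maps M from (c.rObj M).act h f) q = M.act h (f (c.actQ h⁻¹ q)) := rfl

lemma act_pair (M : RMod A) (h : G) (p : c.P) (m : M.carrier) :
    (c.rObj M).act h (Maps.pair p m) = Maps.pair (c.actP h p) (M.act h m) := Maps.ext fun q => by
  refine (c.rObj_act M h _ q).trans ?_
  rw [Maps.pair_apply, Maps.pair_apply, M.act_smul, c.act_qp,
    AddMonoid.End.map_inv_apply]

/-- The functor of maps from the bimodule of a Morita context. -/
def rFunctor : RMod A ⥤ RMod A' where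
  obj := c.rObj
  map {M N} φ := RMod.Hom.mk
    { toFun := fun f => (φ.hom.comp f : c.Q →ₗ[A.carrier] N.carrier)
      map_add' := fun f g => Maps.ext fun q => map_add φ.hom _ _
      map_smul' := fun a f => rfl }
    (fun h f => Maps.ext fun q => φ.map_act h _)

/-- The bimodule of a Morita context. -/
def rBimod [Module.Finite R A'.carrier] : RBimod A' A :=
  letI : Module R c.P := Module.compHom c.P (algebraMap R A'.carrier)
  haveI : IsScalarTower R A'.carrier c.P :=
    ⟨fun r a p => by rw [Algebra.smul_def, mul_smul]; rfl⟩
  letI : Module A.carrierᵐᵒᵖ c.P :=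
    { smul := fun a p => c.pr p a.unop
      one_smul := c.pr_one
      mul_smul := fun a b p => c.pr_mul p b.unop a.unop
      smul_zero := fun a => by
        change c.pr 0 a.unop = 0
        rw [map_zero]; rfl
      smul_add := fun a p p' => by
        change c.pr (p + p') a.unop = c.pr p a.unop + c.pr p' a.unop
        rw [map_add]; rfl
      add_smul := fun a b p => map_add (c.pr p) _ _
      zero_smul := fun p => map_zero (c.pr p) }
  { carrier := c.P
    towerRight := ⟨fun r a p => by
      change c.pr p (r • a.unop) = algebraMap R A'.carrier r • c.pr p a.unop
      rw [Algebra.smul_def, Algebra.commutes, c.pr_mul, c.pr_base]⟩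
    comm := ⟨fun a b p => (c.pr_smul a p b.unop).symm⟩
    finite := by
      obtain ⟨n, q, p, h⟩ := c.exists_qp
      have : Module.Finite A'.carrier c.P := Module.Finite.of_surjective
        (Fintype.linearCombination A'.carrier p) fun x => ⟨fun i => c.pq x (q i), by
          rw [Fintype.linearCombination_apply]
          refine (Finset.sum_congr rfl fun i _ => c.pq_assoc x (q i) (p i)).trans ?_
          rw [← map_sum, h, c.pr_one]⟩
      exact Module.Finite.trans A'.carrier c.P
    act := c.actP
    act_lsmul := c.actP_smul
    act_rsmul := fun h p a => c.actP_pr h p a }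

/-- The functor of a Morita context is a tensor product. -/
def rTensor [Module.Finite R A'.carrier] : RTensorFunctor c.rBimod c.rFunctor where
  pair M :=
    { toFun := AddMonoidHom.mk' (fun (p : c.P) => (Maps.pair p : M.carrier →+ c.Maps M))
        (fun p p' => AddMonoidHom.ext fun m => Maps.pair_add p p' m)
      map_lsmul := fun a p m => (Maps.smul_pair a p m).symm
      balanced := fun a p m => Maps.pair_pr (c := c) p a m
      map_act := fun h p m => c.act_pair M h p m }
  natural f p m := Maps.ext fun q => map_smul f.hom (c.qp q (show c.P from p)) m
  universal M N γ := by
    obtain ⟨n, p, q, h⟩ := c.exists_pq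
    let γ' : c.P →+ M.carrier →+ N.carrier := γ.toFun
    let g : c.Maps M →+ N.carrier := AddMonoidHom.mk' (fun f => ∑ i, γ' (p i) (f (q i)))
      fun f f' => by
        rw [← Finset.sum_add_distrib]
        exact Finset.sum_congr rfl fun i _ => map_add (γ' (p i)) _ _
    have hg : ∀ (x : c.P) (m : M.carrier), g (Maps.pair x m) = γ' x m := fun x m => by
      have h1 : ∀ i, γ' (p i) (Maps.pair x m (q i)) =
          γ'.flip m (c.pq (p i) (q i) • x) := fun i => by
        rw [c.pq_assoc]
        exact (γ.balanced (c.qp (q i) x) (p i) m).symm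
      change ∑ i, γ' (p i) (Maps.pair x m (q i)) = _
      refine (Finset.sum_congr rfl fun i _ => h1 i).trans ?_
      rw [← map_sum, ← Finset.sum_smul, h, one_smul]; rfl
    refine ⟨RMod.Hom.mk { g with map_smul' := fun a (f : c.Maps M) => ?_ } (fun b (f : c.Maps M) => ?_), fun x m => hg x m,
      fun g' hg' => RMod.Hom.ext (LinearMap.ext fun (f : c.Maps M) => ?_)⟩
    · change g (a • f) = a • g f
      conv_lhs => rw [Maps.eq_sum h f, Finset.smul_sum, map_sum]
      conv_rhs => rw [Maps.eq_sum h f, map_sum, Finset.smul_sum]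
      exact Finset.sum_congr rfl fun i _ => by
        rw [Maps.smul_pair, hg, hg]; exact γ.map_lsmul a _ _
    · change g ((c.rObj M).act b f) = N.act b (g f)
      conv_lhs => rw [Maps.eq_sum h f]
      conv_rhs => rw [Maps.eq_sum h f, map_sum, map_sum]
      refine (congrArg g (map_sum ((c.rObj M).act b) _ _)).trans ((map_sum g _ _).trans ?_)
      exact Finset.sum_congr rfl fun i _ => by
        rw [act_pair, hg, hg]; exact (γ.map_act b _ _).symm
    · have h1 : g'.hom f = g'.hom (∑ i, Maps.pair (p i) (f (q i))) :=
        congrArg g'.hom (Maps.eq_sum h f)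
      refine h1.trans ((map_sum g'.hom _ _).trans ?_)
      exact Finset.sum_congr rfl fun i _ => hg' _ _

/-- The unit of the equivalence given by a Morita context. -/
def rUnit [Module.Finite R A'.carrier] (M : RMod A) :
    M ⟶ c.swap.rObj (c.rObj M) :=
  RMod.Hom.mk
    { toFun := fun m =>
        { toFun := fun p => (Maps.pair (c := c) p m : c.Maps M)
          map_add' := fun p p' => Maps.pair_add (c := c) p p' m
          map_smul' := fun a p => (Maps.smul_pair a p m).symm }
      map_add' := fun m m' => LinearMap.ext fun p => map_add (Maps.pair (c := c) p) m m'
      map_smul' := fun a m => LinearMap.ext fun p => (Maps.pair_pr (c := c) p a m).symm }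
    (fun h m => LinearMap.ext fun p => by
      refine Eq.trans ?_ (c.act_pair M h (c.actP h⁻¹ p) m).symm
      exact (congrArg (fun x => (Maps.pair x (M.act h m) : c.Maps M))
        (AddMonoid.End.map_inv_apply c.actP h p)).symm)

lemma rUnit_apply [Module.Finite R A'.carrier] (M : RMod A) (m : M.carrier) (p : c.P) :
    (show c.P →ₗ[A'.carrier] c.Maps M from (c.rUnit M).hom m) p = Maps.pair p m := rfl

lemma isIso_rUnit [Module.Finite R A'.carrier] (M : RMod A) : IsIso (c.rUnit M) := by
  obtain ⟨n, q, p, h⟩ := c.exists_qp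
  refine RMod.isIso_of_bijective _ ⟨(injective_iff_map_eq_zero _).mpr fun m hm => ?_, fun θ => ?_⟩
  · rw [← one_smul A.carrier m, ← h, Finset.sum_smul]
    refine Finset.sum_eq_zero fun i _ => (Maps.pair_apply (p i) m (q i)).symm.trans ?_
    rw [← c.rUnit_apply, hm]; rfl
  · let θ' : c.P →ₗ[A'.carrier] c.Maps M := θ
    refine ⟨∑ i, θ' (p i) (q i), LinearMap.ext fun (x : c.P) => Maps.ext fun y => ?_⟩
    refine (congrArg (fun f : c.Maps M => f y) (c.rUnit_apply M _ x)).trans ?_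
    rw [Maps.pair_apply, Finset.smul_sum]
    have h1 : ∀ i, c.qp y x • θ' (p i) (q i) = θ' (c.pr x (c.qp (q i) (p i))) y := fun i => by
      rw [← c.pq_assoc, map_smul, Maps.smul_apply, ← c.qp_assoc, map_smul]
    rw [Finset.sum_congr rfl fun i _ => h1 i, ← Maps.sum_apply, ← map_sum, ← map_sum, h, c.pr_one]
    rfl

/-- The natural isomorphism given by the unit. -/
def rUnitIso [Module.Finite R A'.carrier] :
    𝟭 (RMod A) ≅ c.rFunctor ⋙ c.swap.rFunctor :=
  NatIso.ofComponents (fun M => @asIso _ _ _ _ (c.rUnit M) (c.isIso_rUnit M)) fun f => RMod.Hom.ext <| LinearMap.ext fun m =>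
    LinearMap.ext fun (p : c.P) => Maps.ext fun q => (map_smul f.hom (c.qp q (show c.P from p)) m).symm

/-- A Morita context with surjective pairings defines an equivariant Morita equivalence. -/
theorem rMorita (c : MoritaCtx A' A) [Module.Finite R A'.carrier] : RMorita A A' :=
  ⟨c.rBimod, c.rFunctor, ⟨c.rTensor⟩, (CategoryTheory.Equivalence.mk c.rFunctor c.swap.rFunctor
    c.rUnitIso c.swap.rUnitIso.symm).isEquivalence_functor⟩

end MoritaCtx
end RingMorita
end EquivSheaf

end

noncomputable section
namespace EquivSheaf

section GeneratorCtx
variable {k : Type u} [Field k] {G H : Type u} [Group G] [Group H] {π : G →* H}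
  (hπ : Function.Surjective π)

section One
variable {V : Type u} [AddCommGroup V] [Module k V] (σ : Representation k G V)

/-- The endomorphism over the group algebra of the kernel defined by an element of the opposite
of the endomorphism algebra, viewed over the centre. -/
def endLinZ : (endAlgZ hπ σ).carrier ≃+
    Module.End (MonoidAlgebra k π.ker) (resN π σ).asModule :=
  MulOpposite.opAddEquiv.symm.trans (endNEquiv σ).toAddEquiv

lemma endLinZ_one : endLinZ hπ σ 1 = 1 := map_one (endNEquiv σ)

lemma endLinZ_mul (a b : (endAlgZ hπ σ).carrier) :
    endLinZ hπ σ (a * b) = endLinZ hπ σ b ∘ₗ endLinZ hπ σ a := map_mul (endNEquiv σ) _ _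

lemma endLinZ_act (g : G) (a : (endAlgZ hπ σ).carrier) (v : (resN π σ).asModule) :
    endLinZ hπ σ ((endAlgZ hπ σ).act (π g) a) v =
      repAct π σ g (endLinZ hπ σ a (repAct π σ g⁻¹ v)) := by
  change endNEquiv σ (MulOpposite.unop (endAct hπ σ (π g) a)) v = _
  rw [endAct_apply]; rfl

lemma repAct_ker_inv (n : π.ker) (v : (resN π σ).asModule) :
    repAct π σ (n : G)⁻¹ v = MonoidAlgebra.single n⁻¹ (1 : k) • v := repAct_ker σ n⁻¹ v

end One

section Two
variable {V : Type u} [AddCommGroup V] [Module k V] (σ : Representation k G V)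
  {V' : Type u} [AddCommGroup V'] [Module k V'] (σ' : Representation k G V')

variable (π) in
/-- The linear maps between two representations which commute with the kernel. -/
def KerHom : Type u := (resN π σ').asModule →ₗ[MonoidAlgebra k π.ker] (resN π σ).asModule

namespace KerHom

instance : AddCommGroup (KerHom π σ σ') := inferInstanceAs
  (AddCommGroup ((resN π σ').asModule →ₗ[MonoidAlgebra k π.ker] (resN π σ).asModule))

variable {σ σ'}

/-- The linear map underlying a map between two representations. -/
def lin (f : KerHom π σ σ') :
    (resN π σ').asModule →ₗ[MonoidAlgebra k π.ker] (resN π σ).asModule := f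

@[ext] lemma ext {f g : KerHom π σ σ'} (h : ∀ v, f.lin v = g.lin v) : f = g := LinearMap.ext h

variable (π σ σ') in
/-- The conjugation action on maps between representations. -/
def conj : G →* AddMonoid.End (KerHom π σ σ') where
  toFun g := AddMonoidHom.mk' (fun f =>
      { toFun := fun v => repAct π σ g (f.lin (repAct π σ' g⁻¹ v))
        map_add' := fun v w => by rw [map_add, map_add, map_add]
        map_smul' := fun x v => by
          rw [repAct_smul, map_smul, repAct_smul]
          refine congrArg (· • _) ?_
          have h := DFunLike.congr_fun ((conjAlg k π).map_mul g g⁻¹) x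
          rw [mul_inv_cancel, map_one] at h
          exact h.symm })
    fun f f' => ext fun v => map_add (repAct π σ g) _ _
  map_one' := AddMonoidHom.ext fun f => ext fun v => by
    change repAct π σ 1 (f.lin (repAct π σ' 1⁻¹ v)) = f.lin v
    rw [inv_one, map_one, map_one]; rfl
  map_mul' g h := AddMonoidHom.ext fun f => ext fun v => by
    change repAct π σ (g * h) (f.lin (repAct π σ' (g * h)⁻¹ v)) =
      repAct π σ g (repAct π σ h (f.lin (repAct π σ' h⁻¹ (repAct π σ' g⁻¹ v))))
    rw [mul_inv_rev, map_mul, map_mul]; rfl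

variable (π σ σ') in
lemma conj_ker : π.ker ≤ (conj π σ σ').ker := by
  intro n hn
  refine AddMonoidHom.ext fun f => ext fun v => ?_
  change repAct π σ n (f.lin (repAct π σ' n⁻¹ v)) = f.lin v
  have h1 := repAct_ker_inv σ' ⟨n, hn⟩ v
  have h2 := repAct_inv_apply σ n (f.lin v)
  have h3 := repAct_ker_inv σ ⟨n, hn⟩ (f.lin v)
  refine (congrArg (fun w => repAct π σ n (f.lin w)) h1).trans ?_
  rw [map_smul]
  exact (congrArg (repAct π σ n) h3).symm.trans h2

variable (σ σ') in
/-- The action of the quotient group on maps between representations. -/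
def act : H →* AddMonoid.End (KerHom π σ σ') :=
  (QuotientGroup.lift π.ker (conj π σ σ') (conj_ker π σ σ')).comp
    (QuotientGroup.quotientKerEquivOfSurjective π hπ).symm.toMonoidHom

lemma act_lin (g : G) (f : KerHom π σ σ') (v : (resN π σ').asModule) :
    (act hπ σ σ' (π g) f).lin v = repAct π σ g (f.lin (repAct π σ' g⁻¹ v)) := by
  have h : (QuotientGroup.quotientKerEquivOfSurjective π hπ).symm (π g) = QuotientGroup.mk g :=
    (MulEquiv.symm_apply_eq _).mpr rfl
  change ((QuotientGroup.lift π.ker (conj π σ σ') (conj_ker π σ σ'))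
    ((QuotientGroup.quotientKerEquivOfSurjective π hπ).symm (π g)) f).lin v = _
  rw [h]; rfl

instance : Module (endAlgZ hπ σ').carrier (KerHom π σ σ') where
  smul a f := f.lin ∘ₗ endLinZ hπ σ' a
  one_smul f := ext fun v => congrArg f.lin (LinearMap.congr_fun (endLinZ_one hπ σ') v)
  mul_smul a b f := ext fun v => congrArg f.lin (LinearMap.congr_fun (endLinZ_mul hπ σ' a b) v)
  smul_zero a := rfl
  smul_add a f g := rfl
  add_smul a b f := ext fun v => by
    change f.lin (endLinZ hπ σ' (a + b) v) = f.lin (endLinZ hπ σ' a v) + f.lin (endLinZ hπ σ' b v)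
    rw [map_add, LinearMap.add_apply, map_add]
  zero_smul f := ext fun v => by
    change f.lin (endLinZ hπ σ' 0 v) = 0
    rw [map_zero, LinearMap.zero_apply, map_zero]

lemma smul_lin (a : (endAlgZ hπ σ').carrier) (f : KerHom π σ σ') (v : (resN π σ').asModule) :
    (a • f).lin v = f.lin (endLinZ hπ σ' a v) := rfl

variable (σ σ') in
/-- The right action of the opposite of the endomorphism algebra. -/
def rmul : KerHom π σ σ' →+ (endAlgZ hπ σ).carrier →+ KerHom π σ σ' :=
  AddMonoidHom.mk' (fun f => AddMonoidHom.mk' (fun a => endLinZ hπ σ a ∘ₗ f.lin)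
    fun a b => ext fun v => by
      change endLinZ hπ σ (a + b) (f.lin v) = _
      rw [map_add]; rfl)
    fun f g => AddMonoidHom.ext fun a => ext fun v => map_add (endLinZ hπ σ a) _ _

lemma rmul_lin (f : KerHom π σ σ') (a : (endAlgZ hπ σ).carrier) (v : (resN π σ').asModule) :
    (rmul hπ σ σ' f a).lin v = endLinZ hπ σ a (f.lin v) := rfl

variable (σ σ') in
/-- The composition pairing with values in the opposite of the endomorphism algebra. -/
def pairing : KerHom π σ σ' →+ KerHom π σ' σ →+ (endAlgZ hπ σ').carrier :=
  AddMonoidHom.mk' (fun f => AddMonoidHom.mk' (fun g => (endLinZ hπ σ').symm (g.lin ∘ₗ f.lin))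
    fun g g' => ((endLinZ hπ σ').symm_apply_eq.mpr (by
      rw [map_add, AddEquiv.apply_symm_apply, AddEquiv.apply_symm_apply]; rfl)))
    fun f f' => AddMonoidHom.ext fun g => ((endLinZ hπ σ').symm_apply_eq.mpr (by
      refine LinearMap.ext fun v => (map_add g.lin _ _).trans ?_
      change _ = endLinZ hπ σ' ((endLinZ hπ σ').symm _ + (endLinZ hπ σ').symm _) v
      rw [map_add, AddEquiv.apply_symm_apply, AddEquiv.apply_symm_apply]; rfl))

lemma endLinZ_pairing (f : KerHom π σ σ') (g : KerHom π σ' σ) (v : (resN π σ').asModule) :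
    endLinZ hπ σ' (pairing hπ σ σ' f g) v = g.lin (f.lin v) :=
  LinearMap.congr_fun ((endLinZ hπ σ').apply_symm_apply (g.lin ∘ₗ f.lin)) v

lemma endLinZ_ext {a b : (endAlgZ hπ σ).carrier}
    (h : ∀ v, endLinZ hπ σ a v = endLinZ hπ σ b v) : a = b :=
  (endLinZ hπ σ).injective (LinearMap.ext h)

lemma act_pairing (h : H) (f : KerHom π σ σ') (g : KerHom π σ' σ) :
    (endAlgZ hπ σ').act h (pairing hπ σ σ' f g) =
      pairing hπ σ σ' (act hπ σ σ' h f) (act hπ σ' σ h g) := by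
  obtain ⟨x, rfl⟩ := hπ h
  refine endLinZ_ext hπ fun v => ?_
  have h1 := AddMonoid.End.map_inv_apply (repAct π σ) x⁻¹ (f.lin (repAct π σ' x⁻¹ v))
  rw [inv_inv] at h1
  rw [endLinZ_act, endLinZ_pairing, endLinZ_pairing, act_lin, act_lin, h1]

lemma act_smul (h : H) (a : (endAlgZ hπ σ').carrier) (f : KerHom π σ σ') :
    act hπ σ σ' h (a • f) = (endAlgZ hπ σ').act h a • act hπ σ σ' h f := by
  obtain ⟨x, rfl⟩ := hπ h
  refine ext fun v => ?_
  have h1 := AddMonoid.End.map_inv_apply (repAct π σ') x⁻¹ (endLinZ hπ σ' a (repAct π σ' x⁻¹ v))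
  rw [inv_inv] at h1
  rw [act_lin, smul_lin, smul_lin, act_lin, endLinZ_act, h1]

lemma act_rmul (h : H) (f : KerHom π σ σ') (a : (endAlgZ hπ σ).carrier) :
    act hπ σ σ' h (rmul hπ σ σ' f a) =
      rmul hπ σ σ' (act hπ σ σ' h f) ((endAlgZ hπ σ).act h a) := by
  obtain ⟨x, rfl⟩ := hπ h
  refine ext fun v => ?_
  have h1 := AddMonoid.End.map_inv_apply (repAct π σ) x⁻¹ (f.lin (repAct π σ' x⁻¹ v))
  rw [inv_inv] at h1
  rw [act_lin, rmul_lin, rmul_lin, act_lin, endLinZ_act, h1]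

lemma exists_sum_pairing [Finite G] [CharZero k] [FiniteDimensional k V']
    (hσ : IsNGenerator π σ) : ∃ (n : ℕ) (f : Fin n → KerHom π σ σ') (g : Fin n → KerHom π σ' σ),
      ∑ i, pairing hπ σ σ' (f i) (g i) = 1 := by
  have h1 := isSemisimpleRing_monoidAlgebra k π
  have h2 : Module.Finite k (resN π σ').asModule := inferInstanceAs (Module.Finite k V')
  have h3 : Module.Finite (MonoidAlgebra k π.ker) (resN π σ').asModule :=
    Module.Finite.of_restrictScalars_finite k _ _
  have h4 : Module.Projective (MonoidAlgebra k π.ker) (resN π σ').asModule :=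
    Module.projective_of_isSemisimpleRing _ _
  obtain ⟨m, φ, w, hφ⟩ := hσ.exists_sum_eq_one
  obtain ⟨n, p, v, hp⟩ := exists_dual_basis (MonoidAlgebra k π.ker) (resN π σ').asModule
  let f : Fin n × Fin m → KerHom π σ σ' := fun ij => (p ij.1).smulRight (w ij.2)
  let g : Fin n × Fin m → KerHom π σ' σ := fun ij => (φ ij.2).smulRight (v ij.1)
  refine ⟨n * m, f ∘ finProdFinEquiv.symm, g ∘ finProdFinEquiv.symm, ?_⟩
  refine (finProdFinEquiv.symm.sum_comp fun ij => pairing hπ σ σ' (f ij) (g ij)).trans ?_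
  refine endLinZ_ext hπ fun x => ?_
  rw [map_sum, LinearMap.sum_apply, endLinZ_one, Module.End.one_apply, Fintype.sum_prod_type]
  conv_rhs => rw [← hp x]
  refine Finset.sum_congr rfl fun i _ => ?_
  have h5 : ∀ j, endLinZ hπ σ' (pairing hπ σ σ' (f (i, j)) (g (i, j))) x =
      (p i x * φ j (w j)) • v i := fun j => by
    rw [endLinZ_pairing]
    change φ j (p i x • w j) • v i = _
    rw [map_smul, smul_eq_mul]
  rw [Finset.sum_congr rfl fun j _ => h5 j, ← Finset.sum_smul, ← Finset.mul_sum, hφ, mul_one]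

end KerHom

variable {σ σ'}
open KerHom in
/-- The Morita context between the endomorphism algebras of two generators. -/
def genCtx [Finite G] [CharZero k] [FiniteDimensional k V] [FiniteDimensional k V']
    (hσ : IsNGenerator π σ) (hσ' : IsNGenerator π σ') :
    MoritaCtx (endAlgZ hπ σ') (endAlgZ hπ σ) where
  P := KerHom π σ σ'
  Q := KerHom π σ' σ
  pr := rmul hπ σ σ'
  qr := rmul hπ σ' σ
  pr_one p := KerHom.ext fun v => LinearMap.congr_fun (endLinZ_one hπ σ) _
  qr_one q := KerHom.ext fun v => LinearMap.congr_fun (endLinZ_one hπ σ') _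
  pr_mul p a b := KerHom.ext fun v => LinearMap.congr_fun (endLinZ_mul hπ σ a b) _
  qr_mul q a b := KerHom.ext fun v => LinearMap.congr_fun (endLinZ_mul hπ σ' a b) _
  pr_smul a p b := rfl
  qr_smul a q b := rfl
  pr_base p z := KerHom.ext fun v => (map_smul p.lin (ZN.incl π z) v).symm
  qr_base q z := KerHom.ext fun v => (map_smul q.lin (ZN.incl π z) v).symm
  pq := pairing hπ σ σ'
  qp := pairing hπ σ' σ
  pq_smul a p q := endLinZ_ext hπ fun v => by
    rw [endLinZ_mul, LinearMap.comp_apply, endLinZ_pairing, endLinZ_pairing, smul_lin]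
  qp_smul a p q := endLinZ_ext hπ fun v => by
    rw [endLinZ_mul, LinearMap.comp_apply, endLinZ_pairing, endLinZ_pairing, smul_lin]
  pq_qr p q a := endLinZ_ext hπ fun v => by
    rw [endLinZ_mul, LinearMap.comp_apply, endLinZ_pairing, endLinZ_pairing, rmul_lin]
  qp_pr p q a := endLinZ_ext hπ fun v => by
    rw [endLinZ_mul, LinearMap.comp_apply, endLinZ_pairing, endLinZ_pairing, rmul_lin]
  pq_bal p a q := endLinZ_ext hπ fun v => by
    rw [endLinZ_pairing, endLinZ_pairing, smul_lin, rmul_lin]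
  qp_bal p a q := endLinZ_ext hπ fun v => by
    rw [endLinZ_pairing, endLinZ_pairing, smul_lin, rmul_lin]
  pq_assoc p q p' := KerHom.ext fun v => by
    rw [smul_lin, rmul_lin, endLinZ_pairing, endLinZ_pairing]
  qp_assoc p q p' := KerHom.ext fun v => by
    rw [smul_lin, rmul_lin, endLinZ_pairing, endLinZ_pairing]
  exists_pq := exists_sum_pairing hπ hσ
  exists_qp := exists_sum_pairing hπ hσ'
  actP := KerHom.act hπ σ σ'
  actQ := KerHom.act hπ σ' σ
  actP_smul := KerHom.act_smul hπ
  actQ_smul := KerHom.act_smul hπ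
  actP_pr := act_rmul hπ
  actQ_qr := act_rmul hπ
  act_pq := act_pairing hπ
  act_qp := act_pairing hπ

end Two
end GeneratorCtx
end EquivSheaf

end

noncomputable section
namespace EquivSheaf

section Separable

/-- Azumaya algebras over semisimple rings are semisimple. -/
theorem isSemisimpleRing_of_isAzumaya {R A : Type u} [CommRing R] [IsSemisimpleRing R] [Ring A]
    [Algebra R A] [IsAzumaya R A] : IsSemisimpleRing A := by
  obtain ⟨l, hl⟩ := exists_linearMap_one_eq_one (R := R) A
  have hb : Function.Bijective (AlgHom.mulLeftRight R A) := IsAzumaya.bij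
  obtain ⟨w, hw⟩ := hb.2 ((Algebra.linearMap R A).comp l)
  have hw₁ : AlgHom.mulLeftRight R A w 1 = 1 := by
    rw [hw, LinearMap.comp_apply, hl]; exact map_one (algebraMap R A)
  have hw₂ : ∀ b, (b ⊗ₜ[R] (1 : Aᵐᵒᵖ)) * w = ((1 : A) ⊗ₜ[R] MulOpposite.op b) * w := fun b =>
    hb.1 (LinearMap.ext fun x => by
      rw [mulLeftRight_left_mul, mulLeftRight_right_mul, hw]
      exact (Algebra.commutes (l x) b).symm)
  refine (isSemisimpleModule_iff A A).mpr ⟨fun I => ?_⟩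
  obtain ⟨f, hf⟩ := IsSemisimpleModule.extension_property (R := R)
    (I.subtype.restrictScalars R) Subtype.val_injective LinearMap.id
  let Ψ (x : A) : A ⊗[R] Aᵐᵒᵖ →ₗ[R] I := TensorProduct.lift
    (LinearMap.mk₂ R (fun a b => a • f (b.unop * x))
      (fun a a' b => add_smul a a' _) (fun r a b => smul_assoc r a _)
      (fun a b b' => by rw [MulOpposite.unop_add, add_mul, map_add, smul_add])
      (fun r a b => by
        rw [MulOpposite.unop_smul, smul_mul_assoc, map_smul]
        exact smul_algebra_smul_comm r a _))
  have hΨ : ∀ x a b, Ψ x (a ⊗ₜ b) = a • f (b.unop * x) := fun x a b => rfl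
  have hadd : ∀ x y u, Ψ (x + y) u = Ψ x u + Ψ y u := fun x y u => by
    induction u using TensorProduct.induction_on with
    | zero => simp
    | add u v hu hv => rw [map_add, map_add, map_add, hu, hv]; abel
    | tmul a b => rw [hΨ, hΨ, hΨ, mul_add, map_add, smul_add]
  have hleft : ∀ x b u, Ψ x ((b ⊗ₜ[R] (1 : Aᵐᵒᵖ)) * u) = b • Ψ x u := fun x b u => by
    induction u using TensorProduct.induction_on with
    | zero => simp
    | add u v hu hv => rw [mul_add, map_add, map_add, hu, hv, smul_add]
    | tmul a c => rw [Algebra.TensorProduct.tmul_mul_tmul, hΨ, hΨ, one_mul, mul_smul]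
  have hright : ∀ x b u, Ψ x (((1 : A) ⊗ₜ[R] MulOpposite.op b) * u) = Ψ (b * x) u :=
    fun x b u => by
      induction u using TensorProduct.induction_on with
      | zero => simp
      | add u v hu hv => rw [mul_add, map_add, map_add, hu, hv]
      | tmul a c =>
        rw [Algebra.TensorProduct.tmul_mul_tmul, hΨ, hΨ, one_mul, MulOpposite.unop_mul,
          MulOpposite.unop_op, mul_assoc]
  let g : A →ₗ[A] I :=
    { toFun := fun x => Ψ x w
      map_add' := fun x y => hadd x y w
      map_smul' := fun b x => by
        rw [smul_eq_mul, ← hright, ← hw₂, hleft]; rfl }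
  have hid : ∀ (x : I) (u : A ⊗[R] Aᵐᵒᵖ),
      (Ψ (x : A) u : A) = AlgHom.mulLeftRight R A u 1 * x := fun x u => by
    induction u using TensorProduct.induction_on with
    | zero => simp
    | add u v hu hv =>
      rw [map_add, map_add, LinearMap.add_apply, add_mul, ← hu, ← hv]; rfl
    | tmul a b =>
      have h1 : f (b.unop * x) = b.unop • x := LinearMap.congr_fun hf (b.unop • x)
      rw [hΨ, h1, AlgHom.mulLeftRight_apply, mul_one, mul_assoc]; rfl
  exact ⟨_, LinearMap.isCompl_of_proj (f := g) fun x => Subtype.ext (by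
    change (Ψ (x : A) w : A) = x
    rw [hid, hw₁, one_mul])⟩

end Separable

section OfRMorita
variable {H : Type u} [Group H] {R : Type u} [CommRing R] {τ : H →* RingAut R}
  {A' A : RAlg τ} {P : RBimod A' A} {F : RMod A ⥤ RMod A'}

lemma RTensorFunctor.hom_ext (T : RTensorFunctor P F) {M : RMod A} {N : RMod A'}
    {f g : F.obj M ⟶ N}
    (h : ∀ p m, f.hom ((T.pair M).toFun p m) = g.hom ((T.pair M).toFun p m)) : f = g := by
  let γ : RBalancedMap P M N :=
    { toFun := AddMonoidHom.mk' (fun p => f.hom.toAddMonoidHom.comp ((T.pair M).toFun p))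
        fun p p' => AddMonoidHom.ext fun m => by
          change f.hom ((T.pair M).toFun (p + p') m) = _
          rw [map_add, AddMonoidHom.add_apply, map_add]; rfl
      map_lsmul := fun a p m => by
        refine (congrArg f.hom ((T.pair M).map_lsmul a p m)).trans ?_
        exact map_smul f.hom a _
      balanced := fun a p m => congrArg f.hom ((T.pair M).balanced a p m)
      map_act := fun h p m => (f.map_act h _).symm.trans (congrArg f.hom ((T.pair M).map_act h p m)) }
  exact (T.universal M N γ).unique (fun p m => rfl) (fun p m => (h p m).symm)

/-- An algebra as a module over itself. -/
def RAlg.self (A : RAlg τ) [Module.Finite R A.carrier] : RMod A where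
  carrier := A.carrier
  act :=
    { toFun := fun h => (A.act h).toAddMonoidHom
      map_one' := by rw [map_one]; rfl
      map_mul' := fun g h => by rw [map_mul]; rfl }
  act_smul h a m := map_mul (A.act h) a m

/-- Functions on the group with values in a module. -/
def RMod.coind [Finite H] (M : RMod A) : RMod A where
  carrier := H → M.carrier
  act :=
    { toFun := fun g => AddMonoidHom.mk' (fun φ h => M.act g (φ (g⁻¹ * h)))
        fun φ ψ => funext fun h => map_add (M.act g) _ _
      map_one' := AddMonoidHom.ext fun φ => funext fun h => by
        change M.act 1 (φ (1⁻¹ * h)) = φ h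
        rw [inv_one, one_mul, map_one]; rfl
      map_mul' := fun g g' => AddMonoidHom.ext fun φ => funext fun h => by
        change M.act (g * g') (φ ((g * g')⁻¹ * h)) = M.act g (M.act g' (φ (g'⁻¹ * (g⁻¹ * h))))
        rw [map_mul, mul_inv_rev, mul_assoc]; rfl }
  act_smul g a φ := funext fun h => M.act_smul g a (φ (g⁻¹ * h))

/-- A bimodule as a left module. -/
def RBimod.left (P : RBimod A' A) : RMod A' where
  carrier := P.carrier
  act := P.act
  act_smul := P.act_lsmul

lemma RAlg.act_act_inv (A : RAlg τ) (g : H) (a : A.carrier) : A.act g (A.act g⁻¹ a) = a := by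
  rw [← RingAut.mul_apply, ← map_mul, mul_inv_cancel, map_one]; rfl

lemma RAlg.act_inv_act (A : RAlg τ) (g : H) (a : A.carrier) : A.act g⁻¹ (A.act g a) = a := by
  rw [← RingAut.mul_apply, ← map_mul, inv_mul_cancel, map_one]; rfl

section Coind
variable [Finite H] [Module.Finite R A.carrier] (T : RTensorFunctor P F)

open Classical in
/-- The function supported at one element of the group. -/
def deltaFun (A : RAlg τ) [Module.Finite R A.carrier] (h : H) (a : A.carrier) :
    A.self.coind.carrier :=
  (Pi.single h a : H → A.carrier)

lemma smul_deltaFun (h : H) (a b : A.carrier) : a • deltaFun A h b = deltaFun A h (a * b) := by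
  classical
  exact (Pi.single_smul (f := fun _ : H => A.carrier) h a b).symm

lemma act_deltaFun (g h : H) (a : A.carrier) :
    A.self.coind.act g (deltaFun A h a) = deltaFun A (g * h) (A.act g a) := by
  classical
  refine funext fun (x : H) => ?_
  change A.act g ((Pi.single h a : H → A.carrier) (g⁻¹ * x)) =
    (Pi.single (g * h) (A.act g a) : H → A.carrier) x
  by_cases hx : x = g * h
  · subst hx
    rw [inv_mul_cancel_left, Pi.single_eq_same, Pi.single_eq_same]
  · rw [Pi.single_eq_of_ne hx, Pi.single_eq_of_ne (fun e => hx (by rw [← e, mul_inv_cancel_left])),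
      map_zero]

lemma sum_deltaFun [Fintype H] (φ : H → A.carrier) : ∑ h, deltaFun A h (φ h) = φ := by
  classical
  exact Finset.univ_sum_single φ

lemma pair_deltaFun (h : H) (p : P.carrier) (a : A.carrier) :
    (T.pair A.self.coind).toFun p (deltaFun A h a) =
      (T.pair A.self.coind).toFun (MulOpposite.op a • p) (deltaFun A h 1) := by
  rw [(T.pair A.self.coind).balanced, smul_deltaFun, mul_one]

/-- The morphism to functions on the group given by a translate of right multiplication. -/
def coindHom (a : A.carrier) : A.self ⟶ A.self.coind :=
  RMod.Hom.mk
    { toFun := fun x => (fun h => (show A.carrier from x) * A.act h a : H → A.carrier)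
      map_add' := fun x y => funext fun h => add_mul (R := A.carrier) _ _ _
      map_smul' := fun b x => funext fun h => mul_assoc (G := A.carrier) _ _ _ }
    (fun g x => funext fun (h : H) => by
      refine Eq.trans ?_ (map_mul (A.act g) _ _).symm
      rw [← RingAut.mul_apply, ← map_mul, mul_inv_cancel_left]; rfl)

lemma RTensorFunctor.eq_zero_of_smul (T : RTensorFunctor P F) [F.Faithful] {a : A.carrier}
    (h : ∀ p : P.carrier, MulOpposite.op a • p = 0) : a = 0 := by
  have := Fintype.ofFinite H
  have h1 : F.map (coindHom a) = F.map (coindHom 0) := by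
    refine T.hom_ext fun p (x : A.carrier) => ?_
    have key : ∀ b : A.carrier, (∀ p : P.carrier, MulOpposite.op b • p = 0) →
        (F.map (coindHom b)).hom ((T.pair A.self).toFun p x) = 0 := fun b hb => by
      refine (T.natural (coindHom b) p x).trans ?_
      have : (coindHom b).hom x = ∑ h, deltaFun A h (x * A.act h b) :=
        (sum_deltaFun fun h => x * A.act h b).symm
      rw [this, map_sum]
      refine Finset.sum_eq_zero fun g _ => ?_
      rw [pair_deltaFun, MulOpposite.op_mul, mul_smul]
      have h2 : MulOpposite.op (A.act g b) • (MulOpposite.op x • p) = 0 := by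
        have h3 := P.act_rsmul g (P.act g⁻¹ (MulOpposite.op x • p)) b
        rw [AddMonoid.End.map_inv_apply, hb] at h3
        exact h3.symm.trans (map_zero _)
      rw [h2, map_zero]; rfl
    rw [key a h, key 0 fun p => by rw [MulOpposite.op_zero, zero_smul]]
  have h2 := congrArg (fun φ : A.self ⟶ A.self.coind =>
    (show H → A.carrier from φ.hom (1 : A.carrier)) 1) (F.map_injective h1)
  change 1 * A.act 1 a = 1 * A.act 1 0 at h2
  rwa [one_mul, map_zero, mul_zero, map_one] at h2

/-- The translate of an endomorphism of a bimodule by a group element. -/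
def RBimod.translate (P : RBimod A' A) (f : P.carrier →ₗ[A'.carrier] P.carrier) (h : H) :
    P.carrier →ₗ[A'.carrier] P.carrier where
  toFun p := P.act h (f (P.act h⁻¹ p))
  map_add' p p' := by rw [map_add, map_add, map_add]
  map_smul' a p := by
    rw [P.act_lsmul, map_smul, P.act_lsmul, A'.act_act_inv]; rfl

lemma RBimod.act_translate (f : P.carrier →ₗ[A'.carrier] P.carrier) (g h : H) (p : P.carrier) :
    P.act g (P.translate f h p) = P.translate f (g * h) (P.act g p) := by
  change P.act g (P.act h (f (P.act h⁻¹ p))) = P.act (g * h) (f (P.act (g * h)⁻¹ (P.act g p)))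
  have h1 : P.act (g * h)⁻¹ (P.act g p) = P.act h⁻¹ p := by
    have h2 := AddMonoid.End.map_inv_apply P.act g⁻¹ p
    rw [inv_inv] at h2
    rw [mul_inv_rev, map_mul]
    exact congrArg (P.act h⁻¹) h2
  rw [h1, map_mul]; rfl

end Coind
end OfRMorita
end EquivSheaf

end

noncomputable section
namespace EquivSheaf

section OfRMorita
variable {H : Type u} [Group H] {R : Type u} [CommRing R] {τ : H →* RingAut R}
  {A' A : RAlg τ} {P : RBimod A' A} {F : RMod A ⥤ RMod A'}

section Coind
variable [Finite H] [Module.Finite R A.carrier] (T : RTensorFunctor P F)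

/-- One summand of the pairing given by the translates of an endomorphism. -/
def translateTerm (f : P.carrier →ₗ[A'.carrier] P.carrier) (h : H) :
    P.carrier →+ A.carrier →+ (F.obj A.self.coind).carrier :=
  AddMonoidHom.mk' (fun p => AddMonoidHom.mk'
      (fun x => (T.pair A.self.coind).toFun
        (P.translate f h (MulOpposite.op x • p)) (deltaFun A h 1))
      (fun x y => by
        rw [MulOpposite.op_add, add_smul, map_add, map_add, AddMonoidHom.add_apply]))
    (fun p p' => AddMonoidHom.ext fun x => by
      change (T.pair A.self.coind).toFun
        (P.translate f h (MulOpposite.op x • (p + p'))) _ = _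
      rw [smul_add, map_add, map_add, AddMonoidHom.add_apply]; rfl)

/-- The sum of the pairings given by the translates of an endomorphism. -/
def translateSum [Fintype H] (f : P.carrier →ₗ[A'.carrier] P.carrier) :
    P.carrier →+ A.carrier →+ (F.obj A.self.coind).carrier :=
  ∑ h, translateTerm T f h

lemma translateSum_apply [Fintype H] (f : P.carrier →ₗ[A'.carrier] P.carrier) (p : P.carrier)
    (x : A.carrier) : translateSum T f p x = ∑ h, (T.pair A.self.coind).toFun
        (P.translate f h (MulOpposite.op x • p)) (deltaFun A h 1) := by
  rw [translateSum, AddMonoidHom.finsetSum_apply, AddMonoidHom.finsetSum_apply]; rfl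

lemma translateSum_act [Fintype H] (f : P.carrier →ₗ[A'.carrier] P.carrier) (g : H)
    (p : P.carrier) (x : A.carrier) :
    (F.obj A.self.coind).act g (translateSum T f p x) =
      translateSum T f (P.act g p) (A.act g x) := by
  rw [translateSum_apply, translateSum_apply, map_sum]
  refine Eq.trans ?_ (Equiv.sum_comp (Equiv.mulLeft g) _)
  refine Finset.sum_congr rfl fun h _ => ?_
  refine ((T.pair A.self.coind).map_act g _ _).trans ?_
  rw [act_deltaFun, map_one, P.act_translate, P.act_rsmul]; rfl

lemma translateSum_lsmul [Fintype H] (f : P.carrier →ₗ[A'.carrier] P.carrier) (a : A'.carrier)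
    (p : P.carrier) (x : A.carrier) :
    translateSum T f (a • p) x = a • translateSum T f p x := by
  rw [translateSum_apply, translateSum_apply, Finset.smul_sum]
  refine Finset.sum_congr rfl fun h _ => ?_
  rw [← smul_comm a, map_smul, (T.pair A.self.coind).map_lsmul]

lemma translateSum_rsmul [Fintype H] (f : P.carrier →ₗ[A'.carrier] P.carrier) (a : A.carrier)
    (p : P.carrier) (x : A.carrier) :
    translateSum T f (MulOpposite.op a • p) x = translateSum T f p (a * x) := by
  rw [translateSum_apply, translateSum_apply]
  refine Finset.sum_congr rfl fun h _ => ?_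
  rw [MulOpposite.op_mul, mul_smul]

/-- The pairing given by the translates of an endomorphism. -/
def translatePair [Fintype H] (f : P.carrier →ₗ[A'.carrier] P.carrier) :
    RBalancedMap P A.self (F.obj A.self.coind) where
  toFun := translateSum T f
  map_lsmul := translateSum_lsmul T f
  balanced := translateSum_rsmul T f
  map_act := translateSum_act T f

/-- The balanced map given by the right action on values of functions. -/
def evalPair (P : RBimod A' A) : RBalancedMap P A.self.coind P.left.coind where
  toFun := AddMonoidHom.mk' (fun p => AddMonoidHom.mk'
      (fun φ : H → A.carrier => (fun h => MulOpposite.op (φ h) • p : H → P.carrier))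
      (fun (φ ψ : H → A.carrier) => funext fun h => by
        change MulOpposite.op (φ h + ψ h) • p = _
        rw [MulOpposite.op_add, add_smul]; rfl))
    (fun p p' => AddMonoidHom.ext fun φ => funext fun h => smul_add _ p p')
  map_lsmul a p φ := funext fun (h : H) =>
    (smul_comm a (MulOpposite.op ((show H → A.carrier from φ) h)) p).symm
  balanced a p φ := funext fun (h : H) =>
    (mul_smul (MulOpposite.op ((show H → A.carrier from φ) h)) (MulOpposite.op a) p).symm
  map_act g p φ := funext fun (h : H) =>
    P.act_rsmul g p ((show H → A.carrier from φ) (g⁻¹ * h))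

lemma RTensorFunctor.exists_smul_eq (T : RTensorFunctor P F) [F.Full]
    (f : P.carrier →ₗ[A'.carrier] P.carrier) : ∃ a : A.carrier, ∀ p, f p = MulOpposite.op a • p := by
  classical
  have := Fintype.ofFinite H
  obtain ⟨Θ, hΘ, -⟩ := T.universal A.self (F.obj A.self.coind) (translatePair T f)
  obtain ⟨u, rfl⟩ := F.map_surjective Θ
  obtain ⟨W, hW, -⟩ := T.universal A.self.coind P.left.coind (evalPair P)
  let E : (F.obj A.self.coind).carrier →+ P.carrier :=
    (Pi.evalAddMonoidHom (fun _ : H => P.carrier) 1).comp W.hom.toAddMonoidHom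
  have hE : ∀ (p : P.carrier) (φ : A.self.coind.carrier),
      E ((T.pair A.self.coind).toFun p φ) =
        MulOpposite.op ((show H → A.carrier from φ) 1) • p := fun p φ => congrFun (hW p φ) 1
  let φ : A.self.coind.carrier := u.hom (1 : A.carrier)
  refine ⟨(show H → A.carrier from φ) 1, fun p => ?_⟩
  have h1 : (T.pair A.self.coind).toFun p φ = translateSum T f p (1 : A.carrier) :=
    (T.natural u p _).symm.trans (hΘ p _)
  rw [← hE, h1, translateSum_apply, map_sum, Finset.sum_eq_single 1]
  · refine Eq.symm ((hE _ _).trans ?_)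
    change MulOpposite.op ((Pi.single 1 1 : H → A.carrier) 1) • P.act 1 (f (P.act 1⁻¹ _)) = f p
    rw [Pi.single_eq_same, MulOpposite.op_one, one_smul, one_smul, inv_one, map_one]; rfl
  · intro h _ hh
    refine (hE _ _).trans ?_
    change MulOpposite.op ((Pi.single h 1 : H → A.carrier) 1) • _ = _
    rw [Pi.single_eq_of_ne hh.symm, MulOpposite.op_zero, zero_smul]
  · exact fun h => absurd (Finset.mem_univ _) h

end Coind

/-- The trace ideal of a bimodule. -/
def RBimod.traceIdeal (P : RBimod A' A) : Submodule A'.carrier A'.carrier :=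
  ⨆ q : P.carrier →ₗ[A'.carrier] A'.carrier, LinearMap.range q

/-- The translate of a linear form on a bimodule. -/
def RBimod.translateForm (P : RBimod A' A) (h : H) (q : P.carrier →ₗ[A'.carrier] A'.carrier) :
    P.carrier →ₗ[A'.carrier] A'.carrier where
  toFun p := A'.act h (q (P.act h⁻¹ p))
  map_add' p p' := by rw [map_add, map_add, map_add]
  map_smul' a p := by
    rw [P.act_lsmul, map_smul, smul_eq_mul, map_mul, A'.act_act_inv]; rfl

lemma RBimod.act_mem_traceIdeal (P : RBimod A' A) (h : H) {a : A'.carrier}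
    (ha : a ∈ P.traceIdeal) : A'.act h a ∈ P.traceIdeal := by
  induction ha using Submodule.iSup_induction' with
  | mem q x hx =>
    obtain ⟨p, rfl⟩ := hx
    refine Submodule.mem_iSup_of_mem (P.translateForm h q) ⟨P.act h p, ?_⟩
    change A'.act h (q (P.act h⁻¹ (P.act h p))) = _
    have := AddMonoid.End.map_inv_apply P.act h⁻¹ p
    rw [inv_inv] at this
    rw [this]
  | zero => rw [map_zero]; exact zero_mem _
  | add x y _ _ hx hy => rw [map_add]; exact add_mem hx hy

/-- The action on the quotient of an algebra by the trace ideal. -/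
def RBimod.traceQuotientAct (P : RBimod A' A) (h : H) :
    A'.carrier ⧸ P.traceIdeal →ₛₗ[(A'.act h : A'.carrier →+* A'.carrier)]
      A'.carrier ⧸ P.traceIdeal :=
  P.traceIdeal.mapQ P.traceIdeal
    { toFun := A'.act h
      map_add' := map_add (A'.act h)
      map_smul' := map_mul (A'.act h) }
    (fun _ ha => P.act_mem_traceIdeal h ha)

lemma RBimod.traceQuotientAct_mk (P : RBimod A' A) (h : H) (a : A'.carrier) :
    P.traceQuotientAct h (P.traceIdeal.mkQ a) = P.traceIdeal.mkQ (A'.act h a) := rfl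

lemma RBimod.traceQuotientAct_one (P : RBimod A' A) (x : A'.carrier ⧸ P.traceIdeal) :
    P.traceQuotientAct 1 x = x := by
  obtain ⟨a, rfl⟩ := P.traceIdeal.mkQ_surjective x
  rw [P.traceQuotientAct_mk, map_one]; rfl

lemma RBimod.traceQuotientAct_mul (P : RBimod A' A) (g h : H) (x : A'.carrier ⧸ P.traceIdeal) :
    P.traceQuotientAct (g * h) x = P.traceQuotientAct g (P.traceQuotientAct h x) := by
  obtain ⟨a, rfl⟩ := P.traceIdeal.mkQ_surjective x
  rw [P.traceQuotientAct_mk, P.traceQuotientAct_mk, P.traceQuotientAct_mk, map_mul]; rfl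

/-- The action on the quotient of an algebra by the trace ideal, as a homomorphism. -/
def RBimod.traceQuotientHom (P : RBimod A' A) :
    H →* AddMonoid.End (A'.carrier ⧸ P.traceIdeal) where
  toFun h := AddMonoidHom.mk' (P.traceQuotientAct h) (map_add (P.traceQuotientAct h))
  map_one' := AddMonoidHom.ext fun x => P.traceQuotientAct_one x
  map_mul' g h := AddMonoidHom.ext fun x => P.traceQuotientAct_mul g h x

lemma RBimod.traceQuotientHom_smul (P : RBimod A' A) (h : H) (a : A'.carrier)
    (x : A'.carrier ⧸ P.traceIdeal) :
    P.traceQuotientHom h (a • x) = A'.act h a • P.traceQuotientHom h x :=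
  map_smulₛₗ (P.traceQuotientAct h) a x

variable [Module.Finite R A'.carrier]

lemma RBimod.finite_traceQuotient (P : RBimod A' A) :
    Module.Finite R (A'.carrier ⧸ P.traceIdeal) :=
  Module.Finite.of_surjective (P.traceIdeal.mkQ.restrictScalars R) P.traceIdeal.mkQ_surjective

/-- The quotient of an algebra by the trace ideal. -/
def RBimod.traceQuotient (P : RBimod A' A) : RMod A' :=
  haveI := P.finite_traceQuotient
  { carrier := A'.carrier ⧸ P.traceIdeal
    act := P.traceQuotientHom
    act_smul := P.traceQuotientHom_smul }

/-- The projection to the quotient by the trace ideal. -/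
def RBimod.traceMk (P : RBimod A' A) : A'.self ⟶ P.traceQuotient :=
  RMod.Hom.mk P.traceIdeal.mkQ (fun _ _ => rfl)

lemma RTensorFunctor.one_mem_traceIdeal (T : RTensorFunctor P F) [F.EssSurj] :
    (1 : A'.carrier) ∈ P.traceIdeal := by
  let i := F.objObjPreimageIso A'.self
  let z : F.obj (F.objPreimage A'.self) ⟶ P.traceQuotient :=
    RMod.Hom.mk 0 (fun h m => (map_zero (P.traceQuotient.act h)).symm)
  have h1 : i.hom ≫ P.traceMk = z := T.hom_ext fun p m => by
    refine (Submodule.Quotient.mk_eq_zero P.traceIdeal).mpr ?_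
    refine Submodule.mem_iSup_of_mem
      ({ toFun := fun p => i.hom.hom ((T.pair _).toFun p m)
         map_add' := fun p p' => by rw [map_add, AddMonoidHom.add_apply, map_add]; rfl
         map_smul' := fun a p => by
          rw [(T.pair _).map_lsmul, map_smul]; rfl } : P.carrier →ₗ[A'.carrier] A'.carrier)
      ⟨p, rfl⟩
  have h2 : P.traceMk = i.inv ≫ z := by rw [← h1, Iso.inv_hom_id_assoc]
  refine (Submodule.Quotient.mk_eq_zero P.traceIdeal).mp ?_
  exact congrArg (fun φ : A'.self ⟶ P.traceQuotient => φ.hom (1 : A'.carrier)) h2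

lemma RTensorFunctor.exists_sum_eq_one (T : RTensorFunctor P F) [F.EssSurj] :
    ∃ (n : ℕ) (p : Fin n → P.carrier) (q : Fin n → P.carrier →ₗ[A'.carrier] A'.carrier),
      ∑ i, q i (p i) = 1 := by
  have key : ∀ a ∈ P.traceIdeal, ∃ (n : ℕ) (p : Fin n → P.carrier)
      (q : Fin n → P.carrier →ₗ[A'.carrier] A'.carrier), ∑ i, q i (p i) = a := fun a ha => by
    induction ha using Submodule.iSup_induction' with
    | mem q x hx =>
      obtain ⟨p, rfl⟩ := hx
      exact ⟨1, fun _ => p, fun _ => q, by simp⟩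
    | zero => exact ⟨0, Fin.elim0, Fin.elim0, rfl⟩
    | add x y _ _ hx hy =>
      obtain ⟨n, p, q, rfl⟩ := hx
      obtain ⟨n', p', q', rfl⟩ := hy
      exact ⟨n + n', Fin.append p p', Fin.append q q', by simp [Fin.sum_univ_add]⟩
  exact key 1 T.one_mem_traceIdeal

end OfRMorita
end EquivSheaf

end

noncomputable section
namespace EquivSheaf

section CtxOfRMorita
variable {H : Type u} [Group H] {R : Type u} [CommRing R] {τ : H →* RingAut R}
  {A' A : RAlg τ} {P : RBimod A' A}

/-- Linear forms on a bimodule, as a left module. -/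
@[reducible] def RBimod.moduleForm (P : RBimod A' A) :
    Module A.carrier (P.carrier →ₗ[A'.carrier] A'.carrier) where
  smul a q :=
    { toFun := fun p => q (MulOpposite.op a • p)
      map_add' := fun p p' => by rw [smul_add, map_add]
      map_smul' := fun b p => by rw [← smul_comm b, map_smul]; rfl }
  one_smul q := LinearMap.ext fun p => congrArg q (one_smul _ p)
  mul_smul a b q := LinearMap.ext fun p => congrArg q (mul_smul (MulOpposite.op b) (MulOpposite.op a) p)
  smul_zero a := rfl
  smul_add a q q' := rfl
  add_smul a b q := LinearMap.ext fun p =>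
    (congrArg q (add_smul (MulOpposite.op a) (MulOpposite.op b) p)).trans (map_add q _ _)
  zero_smul q := LinearMap.ext fun p => (congrArg q (zero_smul _ p)).trans (map_zero q)

/-- The action of the group on linear forms on a bimodule. -/
def RBimod.actForm (P : RBimod A' A) : H →* AddMonoid.End (P.carrier →ₗ[A'.carrier] A'.carrier) where
  toFun h := AddMonoidHom.mk' (P.translateForm h) fun q q' => LinearMap.ext fun p =>
    map_add (A'.act h) _ _
  map_one' := AddMonoidHom.ext fun q => LinearMap.ext fun p => by
    change A'.act 1 (q (P.act 1⁻¹ p)) = q p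
    rw [inv_one, map_one, map_one]; rfl
  map_mul' g h := AddMonoidHom.ext fun q => LinearMap.ext fun p => by
    change A'.act (g * h) (q (P.act (g * h)⁻¹ p)) = A'.act g (A'.act h (q (P.act h⁻¹ (P.act g⁻¹ p))))
    rw [map_mul, mul_inv_rev, map_mul]; rfl

lemma RBimod.actForm_act (P : RBimod A' A) (h : H) (q : P.carrier →ₗ[A'.carrier] A'.carrier)
    (p : P.carrier) : P.actForm h q (P.act h p) = A'.act h (q p) := by
  change A'.act h (q (P.act h⁻¹ (P.act h p))) = _
  have := AddMonoid.End.map_inv_apply P.act h⁻¹ p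
  rw [inv_inv] at this
  rw [this]

/-- The right multiplication by an element of the algebra of values of linear forms. -/
def RBimod.formMul (P : RBimod A' A) :
    (P.carrier →ₗ[A'.carrier] A'.carrier) →+ A'.carrier →+ (P.carrier →ₗ[A'.carrier] A'.carrier) :=
  AddMonoidHom.mk' (fun q => AddMonoidHom.mk' (fun b =>
      { toFun := fun p => q p * b
        map_add' := fun p p' => by rw [map_add, add_mul]
        map_smul' := fun a p => by rw [map_smul, smul_eq_mul, mul_assoc]; rfl })
      (fun b b' => LinearMap.ext fun p => mul_add _ _ _))
    (fun q q' => AddMonoidHom.ext fun b => LinearMap.ext fun p => add_mul _ _ _)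

/-- The right multiplication on a bimodule. -/
def RBimod.rightMul (P : RBimod A' A) : P.carrier →+ A.carrier →+ P.carrier :=
  AddMonoidHom.mk' (fun p => AddMonoidHom.mk' (fun a => MulOpposite.op a • p)
      (fun a b => by rw [MulOpposite.op_add, add_smul]))
    (fun p p' => AddMonoidHom.ext fun a => smul_add _ p p')

/-- The rank one endomorphism given by a linear form and an element. -/
def RBimod.rankOne (P : RBimod A' A) (q : P.carrier →ₗ[A'.carrier] A'.carrier) (p : P.carrier) :
    P.carrier →ₗ[A'.carrier] P.carrier where
  toFun p' := q p' • p
  map_add' p' p'' := by rw [map_add, add_smul]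
  map_smul' a p' := by rw [map_smul, smul_eq_mul, mul_smul]; rfl

lemma RBimod.op_smul_ext
    (hun : ∀ a : A.carrier, (∀ p : P.carrier, MulOpposite.op a • p = 0) → a = 0) {a b : A.carrier}
    (h : ∀ p : P.carrier, MulOpposite.op a • p = MulOpposite.op b • p) : a = b :=
  sub_eq_zero.mp (hun _ fun p => by rw [MulOpposite.op_sub, sub_smul, h, sub_self])

section
variable (hex : ∀ f : P.carrier →ₗ[A'.carrier] P.carrier, ∃ a : A.carrier,
    ∀ p, f p = MulOpposite.op a • p)
  (hun : ∀ a : A.carrier, (∀ p : P.carrier, MulOpposite.op a • p = 0) → a = 0)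

/-- The scalar by which a rank one endomorphism acts. -/
def RBimod.coeff (q : P.carrier →ₗ[A'.carrier] A'.carrier) (p : P.carrier) : A.carrier :=
  (hex (P.rankOne q p)).choose

lemma RBimod.op_coeff (q : P.carrier →ₗ[A'.carrier] A'.carrier) (p p' : P.carrier) :
    MulOpposite.op (RBimod.coeff hex q p) • p' = q p' • p :=
  ((hex (P.rankOne q p)).choose_spec p').symm

/-- The scalars by which the rank one endomorphisms act, as a pairing. -/
def RBimod.coeffHom : (P.carrier →ₗ[A'.carrier] A'.carrier) →+ P.carrier →+ A.carrier :=
  AddMonoidHom.mk' (fun q => AddMonoidHom.mk' (RBimod.coeff hex q) (fun p p' =>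
      RBimod.op_smul_ext hun fun x => by
        rw [MulOpposite.op_add, add_smul, RBimod.op_coeff, RBimod.op_coeff, RBimod.op_coeff,
          smul_add]))
    (fun q q' => AddMonoidHom.ext fun p => RBimod.op_smul_ext hun fun x => by
      change MulOpposite.op (RBimod.coeff hex (q + q') p) • x =
        MulOpposite.op (RBimod.coeff hex q p + RBimod.coeff hex q' p) • x
      rw [MulOpposite.op_add, add_smul, RBimod.op_coeff, RBimod.op_coeff, RBimod.op_coeff]
      exact add_smul (q x) (q' x) p)

lemma RBimod.op_coeffHom (q : P.carrier →ₗ[A'.carrier] A'.carrier) (p p' : P.carrier) :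
    MulOpposite.op (RBimod.coeffHom hex hun q p) • p' = q p' • p :=
  RBimod.op_coeff hex q p p'

/-- A progenerator bimodule with the expected endomorphisms defines a Morita context. -/
def RBimod.moritaCtx [Module.Finite A'.carrier P.carrier] [Module.Projective A'.carrier P.carrier]
    (htr : ∃ (n : ℕ) (p : Fin n → P.carrier) (q : Fin n → P.carrier →ₗ[A'.carrier] A'.carrier),
      ∑ i, q i (p i) = 1) : MoritaCtx A' A :=
  letI := P.moduleForm
  have hs : ∀ (a : A.carrier) (q : P.carrier →ₗ[A'.carrier] A'.carrier) p,
    (a • q) p = q (MulOpposite.op a • p) := fun _ _ _ => rfl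
  have hr : ∀ p a, P.rightMul p a = MulOpposite.op a • p := fun _ _ => rfl
  have hf : ∀ q b p, P.formMul q b p = q p * b := fun _ _ _ => rfl
  { P := P.carrier
    Q := P.carrier →ₗ[A'.carrier] A'.carrier
    pr := P.rightMul
    qr := P.formMul
    pr_one := fun p => one_smul _ p
    qr_one := fun q => LinearMap.ext fun p => mul_one _
    pr_mul := fun p a b => mul_smul (MulOpposite.op b) (MulOpposite.op a) p
    qr_mul := fun q a b => LinearMap.ext fun p => (mul_assoc _ _ _).symm
    pr_smul := fun a p b => (smul_comm a (MulOpposite.op b) p).symm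
    qr_smul := fun a q b => rfl
    pr_base := fun p r => by
      rw [hr, ← MulOpposite.algebraMap_apply, algebraMap_smul, algebraMap_smul]
    qr_base := fun q r => LinearMap.ext fun p => by
      rw [hf, hs, ← MulOpposite.algebraMap_apply, algebraMap_smul,
        ← algebraMap_smul A'.carrier r p, map_smul, smul_eq_mul, Algebra.commutes]
    pq := AddMonoidHom.flip (LinearMap.toAddMonoidHom' : _ →+ _)
    qp := RBimod.coeffHom hex hun
    pq_smul := fun a p q => map_smul q a p
    qp_smul := fun a q p => RBimod.op_smul_ext hun fun x => by
      rw [MulOpposite.op_mul, mul_smul, RBimod.op_coeffHom, RBimod.op_coeffHom, hs]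
    pq_qr := fun p q a => rfl
    qp_pr := fun q p a => RBimod.op_smul_ext hun fun x => by
      rw [MulOpposite.op_mul, mul_smul, RBimod.op_coeffHom, RBimod.op_coeffHom, hr, smul_comm]
    pq_bal := fun p a q => rfl
    qp_bal := fun q a p => RBimod.op_smul_ext hun fun x => by
      rw [RBimod.op_coeffHom, RBimod.op_coeffHom, hf, mul_smul]
    pq_assoc := fun p q p' => (RBimod.op_coeffHom hex hun q p' p).symm
    qp_assoc := fun q p q' => LinearMap.ext fun x => by
      rw [hs, RBimod.op_coeffHom, map_smul]; rfl
    exists_pq := htr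
    exists_qp := by
      obtain ⟨n, q, v, h⟩ := exists_dual_basis A'.carrier P.carrier
      refine ⟨n, q, v, RBimod.op_smul_ext hun fun x => ?_⟩
      rw [Finset.op_sum, Finset.sum_smul, MulOpposite.op_one, one_smul]
      refine Eq.trans (Finset.sum_congr rfl fun i _ => ?_) (h x)
      exact RBimod.op_coeffHom hex hun _ _ _
    actP := P.act
    actQ := P.actForm
    actP_smul := P.act_lsmul
    actQ_smul := fun g a q => LinearMap.ext fun x => by
      change A'.act g (q (MulOpposite.op a • P.act g⁻¹ x)) =
        A'.act g (q (P.act g⁻¹ (MulOpposite.op (A.act g a) • x)))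
      rw [P.act_rsmul, A.act_inv_act]
    actP_pr := fun g p a => P.act_rsmul g p a
    actQ_qr := fun g q a => LinearMap.ext fun x => map_mul (A'.act g) _ _
    act_pq := fun g p q => (P.actForm_act g q p).symm
    act_qp := fun g q p => RBimod.op_smul_ext hun fun x => by
      rw [RBimod.op_coeffHom, ← AddMonoid.End.map_inv_apply P.act g x, ← P.act_rsmul,
        RBimod.op_coeffHom, P.actForm_act, P.act_lsmul] }

end

/-- Morita equivalent algebras are related by a Morita context. -/
theorem RMorita.nonempty_moritaCtx [Finite H] [Module.Finite R A.carrier]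
    [Module.Finite R A'.carrier] [IsSemisimpleRing A'.carrier] (h : RMorita A A') :
    Nonempty (MoritaCtx A' A) := by
  obtain ⟨P, F, ⟨T⟩, hF⟩ := h
  have := Module.Finite.of_restrictScalars_finite R A'.carrier P.carrier
  have := Module.projective_of_isSemisimpleRing A'.carrier P.carrier
  exact ⟨RBimod.moritaCtx T.exists_smul_eq (fun a => T.eq_zero_of_smul) T.exists_sum_eq_one⟩

end CtxOfRMorita
end EquivSheaf

end

noncomputable section
namespace EquivSheaf

section Unit
variable {H : Type u} [Group H] {R : Type u} [CommRing R] {τ : H →* RingAut R} {X : Scheme.{u}}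
  {ρ : H →* Aut X} {f : X ⟶ Spec (.of R)} (hf : IsEquivariant τ ρ f)

instance : Module.Finite R (RAlg.unit τ).carrier := inferInstanceAs (Module.Finite R R)

instance : Module.Projective R (RAlg.unit τ).carrier := inferInstanceAs (Module.Projective R R)

/-- The functor forgetting the module structure over a sheaf of algebras. -/
def EqCohAlg.forgetAlg (B : EqAlg ρ) : EqCohAlg B ⥤ EqCoh ρ where
  obj M := { toEqMod := M.toEqMod, coherent := M.coherent }
  map f := ⟨f.hom, f.map_act⟩

lemma EqCohAlg.op_unit (M : EqCohAlg (pullEqAlg hf (RAlg.unit τ))) (r : R) :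
    M.op r = zmul f M.mod r := EqCohAlg.op_algebraMap hf M r

theorem forgetAlg_unit_isEquivalence :
    (EqCohAlg.forgetAlg (pullEqAlg hf (RAlg.unit τ))).IsEquivalence where
  faithful := ⟨fun e => EqCohAlg.Hom.ext (congrArg EqCoh.Hom.hom e)⟩
  full := ⟨fun {M N} φ => ⟨EqCohAlg.homOfOp hf (show M.mod ⟶ N.mod from φ.hom) (fun a U m => by
      refine (congrArg (fun x => (show M.mod ⟶ N.mod from φ.hom).app U
        (Scheme.Modules.Hom.app x U m)) (EqCohAlg.op_unit hf M a)).trans ?_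
      refine Eq.trans ?_ (congrArg (fun x => Scheme.Modules.Hom.app x U
        ((show M.mod ⟶ N.mod from φ.hom).app U m)) (EqCohAlg.op_unit hf N a)).symm
      exact Scheme.Modules.Hom.app_smul (show M.mod ⟶ N.mod from φ.hom) _ _) φ.map_act, rfl⟩⟩
  essSurj := ⟨fun E => ⟨EqCohAlg.ofOp hf E.toEqMod E.coherent (zmulHom f E.mod) (fun _ => rfl)
    (fun h r U m => (E.act_osmul h U _ m).trans
      (congrArg (· • E.act h U m) (actO_baseHom hf h U r))), ⟨Iso.refl _⟩⟩⟩

end Unit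
end EquivSheaf

end

noncomputable section
namespace EquivSheaf

section MainProof
variable {k : Type u} [Field k] [CharZero k] {G H : Type u} [Group G] [Finite G] [Group H]
  {π : G →* H} (hπ : Function.Surjective π) {X : Scheme.{u}} {s : X ⟶ Spec (.of k)} {ρ : H →* Aut X}
  (hs : IsOver ρ s)

instance isAffineHom_irrStr : IsAffineHom (irrStr k π) :=
  inferInstanceAs (IsAffineHom (Spec.map _))

instance isAffineHom_pullback_snd_irrStr : IsAffineHom (Limits.pullback.snd (irrStr k π) s) :=
  isAffineHom_isStableUnderBaseChange.of_isPullback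
    (IsPullback.of_hasPullback (irrStr k π) s) isAffineHom_irrStr

section
variable {V : Type u} [AddCommGroup V] [Module k V] [FiniteDimensional k V]
  {σ : Representation k G V} [IsAzumaya (ZN k π) (endAlgZ hπ σ).carrier]

/-- Direct image of equivariant modules over `End_N(V)ᵒᵖ` from `Irr(N) × X` to `X`. -/
def prodPush : EqCohAlg (pullEqAlg (irrProj_equivariant hπ hs) (endAlgZ hπ σ)) ⥤
    EqCohAlg (calA hπ hs σ) :=
  pushEq (p := Limits.pullback.snd (irrStr k π) s) hs.isEquivariant
    (irrProj_equivariant hπ hs) (fun h => prodMap_snd _ _ ((irr_isOver hπ).inv h) (hs.inv h))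
    (B := endAlg hπ σ) (A := endAlgZ hπ σ) (RingEquiv.refl (EndN π σ)ᵐᵒᵖ)
    (fun c => congrArg MulOpposite.op (centerToEndN_algebraMap c).symm) (fun _ _ => rfl)
    (IsPullback.of_hasPullback (irrStr k π) s).flip

instance prodPush_isEquivalence : (prodPush (σ := σ) hπ hs).IsEquivalence :=
  pushEq_isEquivalence _ _ _ _ _ _ _

/-- Sheaves equivariant for the extension as modules over the pulled back algebra
`End_N(V)ᵒᵖ` on `Irr(N) × X`. -/
def cohGEquivalence (hσ : IsNGenerator π σ) :
    CohG π ρ ≌ EqCohAlg (pullEqAlg (irrProj_equivariant hπ hs) (endAlgZ hπ σ)) :=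
  (psiG hπ σ hσ hs).asEquivalence.trans (prodPush hπ hs).asEquivalence.symm

end

theorem isCanonicalClass_rightRegular :
    IsCanonicalClass hπ (RBr.mk ⟨endAlgZ hπ (rightRegular k G),
      (isNGenerator_rightRegular k G π).isAzumaya hπ⟩) := by
  refine ⟨⟨G → k, inferInstance, inferInstance, inferInstance, rightRegular k G,
    isNGenerator_rightRegular k G π⟩, fun V _ _ _ σ hσ => ⟨hσ.isAzumaya hπ, ?_⟩⟩
  have h₁ := hσ.isAzumaya hπ
  have h₂ := (isNGenerator_rightRegular k G π).isAzumaya hπ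
  exact Quot.sound (genCtx hπ hσ (isNGenerator_rightRegular k G π)).rMorita

variable {R : Type u} [CommRing R] [IsSemisimpleRing R] {τ : H →* RingAut R} {Y : Scheme.{u}}
    {ρ' : H →* Aut Y} {f : Y ⟶ Spec (.of R)} (hf : IsEquivariant τ ρ' f)

theorem RAz.isAzumaya_pull (A : RAz τ) : (A.pull hf).toSheafAlg.IsAzumaya :=
  haveI := A.2
  isAzumaya_pullAlg f A.1.carrier

/-- The pullback of Brauer classes along an equivariant morphism to an affine scheme. -/
def RBr.pull [Finite H] : RBr τ → BrH ρ' :=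
  Quot.lift (fun A => BrH.mk ⟨A.pull hf, A.isAzumaya_pull hf⟩) fun A A' h => Quot.sound <| by
    have := A.2
    have := A'.2
    have : IsSemisimpleRing A'.1.carrier := isSemisimpleRing_of_isAzumaya (R := R)
    obtain ⟨c⟩ := RMorita.nonempty_moritaCtx h
    exact c.morita hf

/-- The category of modules of an equivariant Azumaya algebra depends only on the Brauer class. -/
theorem BrH.nonempty_equivalence {B B' : AzAlg ρ'} (h : BrH.mk B = BrH.mk B') :
    Nonempty (EqCohAlg B.1 ≌ EqCohAlg B'.1) := by
  have key : ∀ C C' : AzAlg ρ', Morita C.1 C'.1 →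
      Nonempty (EqCohAlg B.1 ≌ EqCohAlg C.1) = Nonempty (EqCohAlg B.1 ≌ EqCohAlg C'.1) := by
    rintro C C' ⟨P, F, -, hF⟩
    exact propext ⟨fun ⟨e⟩ => ⟨e.trans F.asEquivalence⟩, fun ⟨e⟩ => ⟨e.trans F.asEquivalence.symm⟩⟩
  exact (congrArg (Quot.lift (fun C : AzAlg ρ' => Nonempty (EqCohAlg B.1 ≌ EqCohAlg C.1)) key)
    h).mp ⟨.refl⟩

end MainProof
end EquivSheaf
end

open EquivSheaf

theorem mainTheorem7 {k : Type u} [Field k] [CharZero k] {G H : Type u} [Group G] [Finite G]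
    [Group H] (π : G →* H) (hπ : Function.Surjective π) :
    ∃ θ : RBr (centerAct k hπ), IsCanonicalClass hπ θ ∧
      ∀ (X : Scheme.{u}) (s : X ⟶ Spec (.of k)) [LocallyOfFiniteType s] [QuasiCompact s]
        (ρ : H →* Aut X) (hs : IsOver ρ s),
        (∀ (V : Type u) [AddCommGroup V] [Module k V] [FiniteDimensional k V]
          (σ : Representation k G V), IsNGenerator π σ →
          ∃ (E : EqCohAlg (calA hπ hs σ) ≌ CohG π ρ)
            (E₀ : CohAlg (calA hπ hs σ).toSheafAlg ≌ CohN π ρ),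
            Nonempty (IsTensorG hπ hs σ E.functor) ∧
            Nonempty (IsTensorN hπ hs σ E₀.functor) ∧
            Nonempty (E.functor ⋙ forgetGN π ρ ≅
              EqCohAlg.forgetAct (calA hπ hs σ) ⋙ E₀.functor)) ∧
        (∃ η : BrH (irrProdAct hπ hs),
          (∀ A : RAz (centerAct k hπ), RBr.mk A = θ →
            ∃ hA : (A.pull (irrProj_equivariant hπ hs)).toSheafAlg.IsAzumaya,
              BrH.mk ⟨A.pull (irrProj_equivariant hπ hs), hA⟩ = η) ∧
          ∀ B : AzAlg (irrProdAct hπ hs), BrH.mk B = η →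
            Nonempty (CohG π ρ ≌ EqCohAlg B.1)) ∧
        (θ = 0 → Nonempty (CohG π ρ ≌ EqCoh (irrProdAct hπ hs))) := by
  have : Finite H := Finite.of_surjective π hπ
  have hσ := isNGenerator_rightRegular k G π
  refine ⟨_, isCanonicalClass_rightRegular hπ, fun X s _ _ ρ hs => ?_⟩
  have hA := hσ.isAzumaya hπ
  have hB : ∀ B : AzAlg (irrProdAct hπ hs), BrH.mk B = RBr.pull (irrProj_equivariant hπ hs)
      (RBr.mk ⟨endAlgZ hπ (rightRegular k G), hσ.isAzumaya hπ⟩) →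
        Nonempty (CohG π ρ ≌ EqCohAlg B.1) := fun B h => by
    obtain ⟨e⟩ := BrH.nonempty_equivalence h
    exact ⟨(cohGEquivalence hπ hs hσ).trans e.symm⟩
  refine ⟨fun V _ _ _ σ hσ => exists_generator_equivalence hπ σ hs hσ,
    ⟨RBr.pull (irrProj_equivariant hπ hs) _, fun A hA => ⟨A.isAzumaya_pull _,
      congrArg (RBr.pull (irrProj_equivariant hπ hs)) hA⟩, hB⟩, fun h => ?_⟩
  have := forgetAlg_unit_isEquivalence (irrProj_equivariant hπ hs)
  obtain ⟨e⟩ := hB ⟨pullEqAlg (irrProj_equivariant hπ hs) (RAlg.unit _),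
    RAz.isAzumaya_pull (irrProj_equivariant hπ hs) ⟨RAlg.unit _, IsAzumaya.id _⟩⟩
    (congrArg (RBr.pull (irrProj_equivariant hπ hs)) h.symm)
  exact ⟨e.trans (EqCohAlg.forgetAlg _).asEquivalence⟩
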